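/- For every integer $n \ge 0$ and every $C_1 \in (0,\infty)$ there is a constant $C_2 = C_2(C_1,n) < \infty$ with the following property. Let $X$ be a complex manifold of complex dimension $n$, let $p \in X$, let $T > 0$, and let $\omega(t)$, $t \in [0,T]$, be a smooth solution on $X \times [0,T]$ of the Kähler–Ricci flow $\frac{\partial \omega}{\partial t} = -\mathrm{Ric}(\omega)$ through Kähler metrics, whose time slices need not be complete. Let $r > 0$, and let $B_0(p,\rho)$ denote the open metric ball of radius $\rho$ around $p$ with respect to $\omega(0)$. Suppose that $B_0(p,r)$ has compact closure in $X$, that at time zero $$|\mathrm{Rm}| \le C_1 r^{-2} \quad\text{and}\quad |\nabla \mathrm{Rm}| \le C_1 r^{-3} \quad \text{on } B_0(p,r),$$ and that for all $t \in [0,T]$ $$C_1^{-1}\,\omega(0) \le \omega(t) \le C_1\,\omega(0) \quad \text{on } B_0(p,r).$$ Then $|\mathrm{Rm}(x,t)| \le C_2\, r^{-2}$ for all $x \in B_0(p, \tfrac14 r)$ and all $t \in [0,T]$. (Here $|\mathrm{Rm}(x,t)|$ is the norm of the curvature tensor of $\omega(t)$, measured with $\omega(t)$. The constant $C_2$ depends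 neither on $T$ nor on $r$.) -/

import Mathlib

open Set
open scoped Manifold ContDiff ComplexConjugate

noncomputable section

/-- The model space `ℂⁿ` of an `n`-dimensional complex manifold. -/
abbrev CSpace (n : ℕ) : Type := EuclideanSpace ℂ (Fin n)

/-! ### Local formulas in holomorphic coordinates -/

section Local

variable {n : ℕ}

/-- `∂f/∂zᵢ = (∂f/∂xᵢ - √-1 ∂f/∂yᵢ) / 2`. -/
def dz (i : Fin n) (f : CSpace n → ℂ) (z : CSpace n) : ℂ :=
  (fderiv ℝ f z (EuclideanSpace.single i 1)
    - Complex.I * fderiv ℝ f z (EuclideanSpace.single i Complex.I)) / 2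

/-- `∂f/∂z̄ᵢ = (∂f/∂xᵢ + √-1 ∂f/∂yᵢ) / 2`. -/
def dzbar (i : Fin n) (f : CSpace n → ℂ) (z : CSpace n) : ℂ :=
  (fderiv ℝ f z (EuclideanSpace.single i 1)
    + Complex.I * fderiv ℝ f z (EuclideanSpace.single i Complex.I)) / 2

/-- The Christoffel symbol `Γᵖₘᵢ = g^{q̄p} ∂ₘ g_{iq̄}` of a Kähler metric with components
`G z i j = g_{ij̄}(z)`. The inverse metric is `g^{q̄p} = (G z)⁻¹ q p`. -/
def christoffel (G : CSpace n → Matrix (Fin n) (Fin n) ℂ) (p m i : Fin n) (z : CSpace n) : ℂ :=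
  ∑ q, (G z)⁻¹ q p * dz m (fun w => G w i q) z

/-- The curvature `R_{ij̄kl̄} = -∂ᵢ∂_{j̄} g_{kl̄} + g^{q̄p} ∂ᵢ g_{kq̄} ∂_{j̄} g_{pl̄}`. -/
def curvature (G : CSpace n → Matrix (Fin n) (Fin n) ℂ) (i j k l : Fin n) (z : CSpace n) : ℂ :=
  - dz i (fun w => dzbar j (fun y => G y k l) w) z
    + ∑ p, ∑ q, (G z)⁻¹ q p * dz i (fun w => G w k q) z * dzbar j (fun w => G w p l) z

/-- The Ricci curvature `R_{ij̄} = g^{l̄k} R_{ij̄kl̄}`. -/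
def ricci (G : CSpace n → Matrix (Fin n) (Fin n) ℂ) (i j : Fin n) (z : CSpace n) : ℂ :=
  ∑ k, ∑ l, (G z)⁻¹ l k * curvature G i j k l z

/-- The covariant derivative
`∇ₘ R_{ij̄kl̄} = ∂ₘ R_{ij̄kl̄} - Γᵖₘᵢ R_{pj̄kl̄} - Γᵖₘₖ R_{ij̄pl̄}`. -/
def covCurvature (G : CSpace n → Matrix (Fin n) (Fin n) ℂ) (m i j k l : Fin n)
    (z : CSpace n) : ℂ :=
  dz m (curvature G i j k l) z
    - ∑ p, christoffel G p m i z * curvature G p j k l z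
    - ∑ p, christoffel G p m k z * curvature G i j p l z

/-- `|Rm|² = g^{āi} g^{j̄b} g^{c̄k} g^{l̄d} R_{ij̄kl̄} conj(R_{ab̄cd̄})`. -/
def curvatureNormSq (G : CSpace n → Matrix (Fin n) (Fin n) ℂ) (z : CSpace n) : ℝ :=
  (∑ i, ∑ j, ∑ k, ∑ l, ∑ a, ∑ b, ∑ c, ∑ d,
    (G z)⁻¹ a i * (G z)⁻¹ j b * (G z)⁻¹ c k * (G z)⁻¹ l d *
      curvature G i j k l z * conj (curvature G a b c d z)).re

/-- `|∇Rm|² = g^{ēm} g^{āi} g^{j̄b} g^{c̄k} g^{l̄d} ∇ₘR_{ij̄kl̄} conj(∇ₑR_{ab̄cd̄})`, where `∇` is the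
`(1,0)`-part of the covariant derivative. Since `Rm` is a real tensor, the `(0,1)`-part is the
conjugate of the `(1,0)`-part and has the same norm. -/
def covCurvatureNormSq (G : CSpace n → Matrix (Fin n) (Fin n) ℂ) (z : CSpace n) : ℝ :=
  (∑ m, ∑ i, ∑ j, ∑ k, ∑ l, ∑ e, ∑ a, ∑ b, ∑ c, ∑ d,
    (G z)⁻¹ e m * (G z)⁻¹ a i * (G z)⁻¹ j b * (G z)⁻¹ c k * (G z)⁻¹ l d *
      covCurvature G m i j k l z * conj (covCurvature G e a b c d z)).re

end Local

/-! ### Hermitian metrics on a complex manifold -/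

/-- A (not necessarily continuous) Hermitian metric on a complex manifold `X`, complex linear in
the first and conjugate linear in the second variable. Its fundamental form is
`ω = √-1 g_{ij̄} dzⁱ ∧ dz̄ʲ` with `g_{ij̄} = form (∂/∂zⁱ) (∂/∂zʲ)`. -/
structure HermitianMetric (n : ℕ) (X : Type*) [TopologicalSpace X] [ChartedSpace (CSpace n) X] where
  form : ∀ x : X, TangentSpace 𝓘(ℂ, CSpace n) x →ₗ[ℂ] TangentSpace 𝓘(ℂ, CSpace n) x →ₗ⋆[ℂ] ℂ
  conj_symm : ∀ x v w, conj (form x v w) = form x w v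
  pos : ∀ x v, v ≠ 0 → 0 < (form x v v).re

namespace HermitianMetric

variable {n : ℕ} {X : Type*} [TopologicalSpace X] [ChartedSpace (CSpace n) X]

/-- The components `g_{ij̄}(z)` of a Hermitian metric in the preferred holomorphic chart at `x₀`;
meaningful for `z` in the target of that chart. -/
def coord (g : HermitianMetric n X) (x₀ : X) (z : CSpace n) : Matrix (Fin n) (Fin n) ℂ :=
  Matrix.of fun i j =>
    let e := chartAt (CSpace n) x₀
    let D := mfderiv 𝓘(ℂ, CSpace n) 𝓘(ℂ, CSpace n) e.symm z
    g.form (e.symm z) (D (EuclideanSpace.single i (1 : ℂ) : CSpace n))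
      (D (EuclideanSpace.single j (1 : ℂ) : CSpace n))

/-- The Kähler condition `dω = 0`, which in holomorphic coordinates reads
`∂ᵢ g_{jk̄} = ∂ⱼ g_{ik̄}`. -/
def IsKahler (g : HermitianMetric n X) : Prop :=
  ∀ x₀ : X, ∀ z ∈ (chartAt (CSpace n) x₀).target, ∀ i j k,
    dz i (fun w => g.coord x₀ w j k) z = dz j (fun w => g.coord x₀ w i k) z

/-- The length of tangent vectors for the underlying Riemannian metric `2 Re g_{ij̄} dzⁱ ⊗ dz̄ʲ`
(the one for which `ω(u, v) = ⟨Ju, v⟩`). -/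
@[reducible] def tangentENorm (g : HermitianMetric n X) (x : X) : ENorm (TangentSpace 𝓘(ℝ, CSpace n) x) where
  enorm := fun v : CSpace n => ENNReal.ofReal (Real.sqrt (2 * (g.form x v v).re))

/-- The Riemannian distance of the metric: the infimum of the lengths of `C¹` paths (`∞` between
points that cannot be joined). -/
def edist (g : HermitianMetric n X) (x y : X) : ENNReal :=
  letI := g.tangentENorm
  Manifold.riemannianEDist 𝓘(ℝ, CSpace n) x y

/-- The open metric ball `B(p, r)`. -/
def ball (g : HermitianMetric n X) (p : X) (r : ℝ) : Set X :=
  {x | g.edist p x < ENNReal.ofReal r}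

/-- `|Rm|` at `x`. -/
def normRm (g : HermitianMetric n X) (x : X) : ℝ :=
  Real.sqrt (curvatureNormSq (g.coord x) (chartAt (CSpace n) x x))

/-- `|∇Rm|` at `x`. -/
def normCovRm (g : HermitianMetric n X) (x : X) : ℝ :=
  Real.sqrt (covCurvatureNormSq (g.coord x) (chartAt (CSpace n) x x))

end HermitianMetric

/-- `g` restricted to the time interval `[0, T]` is a smooth Kähler-Ricci flow `∂ω/∂t = -Ric(ω)` on
`X`. No completeness of the time slices is required. -/
structure IsKahlerRicciFlow {n : ℕ} {X : Type*} [TopologicalSpace X] [ChartedSpace (CSpace n) X]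
    (g : ℝ → HermitianMetric n X) (T : ℝ) : Prop where
  smooth : ∀ (x₀ : X) (i j : Fin n),
    ContDiffOn ℝ ∞ (fun q : ℝ × CSpace n => (g q.1).coord x₀ q.2 i j)
      (Icc 0 T ×ˢ (chartAt (CSpace n) x₀).target)
  kahler : ∀ t ∈ Icc 0 T, (g t).IsKahler
  flow : ∀ t ∈ Icc 0 T, ∀ x₀ : X, ∀ z ∈ (chartAt (CSpace n) x₀).target, ∀ i j,
    HasDerivWithinAt (fun s => (g s).coord x₀ z i j) (-ricci ((g t).coord x₀) i j z) (Icc 0 T) t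

end

/-! Write `g` for the evolving metric, `g₀` for the initial one, `Γ` and `Γ₀` for their Chern
connections, and put `s = |Γ - Γ₀|²`, `τ = tr_g g₀`, `ρ = |Rm|²`. Parabolic scaling reduces to `r =
1`. Where `g` and `g₀` are comparable and `Rm₀`, `∇Rm₀` are bounded, the flow gives `(∂ₜ - Δ) τ ≤ C
- c s`, `(∂ₜ - Δ) s ≤ C (1 + s) - |∇(Γ - Γ₀)|²`, `(∂ₜ - Δ) ρ ≤ C ρ^{3/2} - |∇Rm|²`, and `ρ ≤ 2 |∇(Γ
- Γ₀)|² + C`, because `∂̄(Γ - Γ₀)` is the difference of the curvatures. Hence `s (K + τ)` and, once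
`s` is bounded, `ρ (K + s)` satisfy `(∂ₜ - Δ) Q ≤ -c Q² + D` for suitable `K`
(`exists_connTest_bound`, `exists_curvTest_bound`). The sink `-c Q²` absorbs the derivatives of a
cutoff function, so an interior bound of `Q` follows that does not depend on `T`. At time zero the
first function vanishes and the second is bounded by the hypothesis on `Rm₀`. The bound of `s` on
balls of radius `1/2` thus leads to the bound of `ρ` on balls of radius `1/4`.

The evolution inequalities are pointwise. They are derived in a commutative algebra with derivations
`∂ᵢ`, `∂_{ī}`, `∂ₜ`, realised by germs of smooth functions on space-time, in holomorphic coordinates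
in which `g` is the identity to first order at one point and one time. Such coordinates exist
because the metric is Kähler (`exists_normal_coordinates`), and `HolomorphicChange` transfers the
results to arbitrary charts.

The cutoff requires a substitute for the squared `g₀`-distance that has smooth upper barriers with
controlled complex Hessian, although the manifold is not complete. Geodesics are avoided. A chain
consists of `N` short steps in finitely many charts around the compact closure of the ball, and its
cost is the sum of the slightly weighted squared lengths of the steps. If `D` is the least cost of a
chain from `o` to `x`, then `N D` plays the role of the squared distance. When the end point moves
along a holomorphic map, the earlier points are dragged along by an approximate parallel transport,
with speeds that decrease linearly towards `o`. The cost of the moving chain is a smooth upper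
barrier for `D`. Its complex Hessian involves only the curvature of `g₀` and a term `12 / N`, up to
errors that disappear for large `N` (`hasLevi`, `exists_step`, `hasBarrier`). The constants of the
charts therefore do not enter the final bound.

Chains are compact, so `(θ / N - D)² Q` attains its maximum over times and chains with `D ≤ θ / N`.
At an interior maximum the barrier replaces `D`, and the second derivative test combined with the
sink gives a quadratic inequality for the maximum (`exists_maximum_principle`). -/

noncomputable section

/-! ### Commutative algebras with Wirtinger derivations -/

section DMap

variable {A B : Type*} [CommRing A] [Algebra ℂ A] {m n : Type*} [Fintype m] [Fintype n]
  [DecidableEq m] [DecidableEq n]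

/-- Entrywise application of a derivation to a matrix. -/
def dmap (δ : Derivation ℂ A A) (M : Matrix n m A) : Matrix n m A := M.map δ

omit [Fintype m] [Fintype n] [DecidableEq m] [DecidableEq n] in
@[simp] theorem dmap_apply (δ : Derivation ℂ A A) (M : Matrix n m A) (i : n) (j : m) :
    dmap δ M i j = δ (M i j) := rfl

theorem dmap_mul (δ : Derivation ℂ A A) (M N : Matrix n n A) :
    dmap δ (M * N) = dmap δ M * N + M * dmap δ N := by
  ext i j
  simp only [dmap_apply, Matrix.mul_apply, Matrix.add_apply, map_sum, Derivation.leibniz,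
    smul_eq_mul, Finset.sum_add_distrib]
  rw [add_comm]
  congr 1
  exact Finset.sum_congr rfl fun _ _ => mul_comm _ _

theorem dmap_add (δ : Derivation ℂ A A) (M N : Matrix n n A) :
    dmap δ (M + N) = dmap δ M + dmap δ N := by ext; simp

theorem dmap_neg (δ : Derivation ℂ A A) (M : Matrix n n A) :
    dmap δ (-M) = -dmap δ M := by ext; simp

theorem dmap_one (δ : Derivation ℂ A A) : dmap δ (1 : Matrix n n A) = 0 := by
  ext i j
  by_cases h : i = j <;> simp [Matrix.one_apply, h]

theorem dmap_sum {ι : Type*} (s : Finset ι) (δ : Derivation ℂ A A) (M : ι → Matrix n n A) :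
    dmap δ (∑ i ∈ s, M i) = ∑ i ∈ s, dmap δ (M i) := by
  ext; simp [Matrix.sum_apply]

theorem dmap_smul (δ : Derivation ℂ A A) (a : A) (M : Matrix n n A) :
    dmap δ (a • M) = δ a • M + a • dmap δ M := by
  ext i j
  simp [Derivation.leibniz, add_comm, mul_comm]

theorem dmap_comm {δ ε : Derivation ℂ A A} (h : ∀ a, δ (ε a) = ε (δ a)) (M : Matrix n n A) :
    dmap δ (dmap ε M) = dmap ε (dmap δ M) := by
  ext i j; simp [h]

end DMap

/-- A commutative algebra with the derivations `∂ᵢ`, `∂_{ī}`, a conjugation and an evaluation. -/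
structure Wirtinger (n : ℕ) (A : Type*) [CommRing A] [Algebra ℂ A] where
  d : Fin n → Derivation ℂ A A
  db : Fin n → Derivation ℂ A A
  cj : A →+* A
  ev : A →+* ℂ
  d_d : ∀ i j a, d i (d j a) = d j (d i a)
  d_db : ∀ i j a, d i (db j a) = db j (d i a)
  db_db : ∀ i j a, db i (db j a) = db j (db i a)
  d_cj : ∀ i a, d i (cj a) = cj (db i a)
  db_cj : ∀ i a, db i (cj a) = cj (d i a)
  cj_cj : ∀ a, cj (cj a) = a
  ev_cj : ∀ a, ev (cj a) = starRingEnd ℂ (ev a)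
  ev_algebraMap : ∀ c, ev (algebraMap ℂ A c) = c

/-- A `Wirtinger` structure with a time derivative. -/
structure TimeWirtinger (n : ℕ) (A : Type*) [CommRing A] [Algebra ℂ A] extends Wirtinger n A where
  t : Derivation ℂ A A
  t_d : ∀ i a, t (d i a) = d i (t a)
  t_db : ∀ i a, t (db i a) = db i (t a)
  t_cj : ∀ a, t (cj a) = cj (t a)

namespace Wirtinger

variable {n : ℕ} {A : Type*} [CommRing A] [Algebra ℂ A] (W : Wirtinger n A)

/-- The curvature matrix `(R_{ij̄kl̄})_{kl}` of a metric `G` with inverse `H`. -/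
def curv (G H : Matrix (Fin n) (Fin n) A) (i j : Fin n) : Matrix (Fin n) (Fin n) A :=
  -dmap (W.d i) (dmap (W.db j) G) + dmap (W.d i) G * H * dmap (W.db j) G

/-- The connection matrix `(Γᵖₘₖ)_{kp}`. -/
def conn (G H : Matrix (Fin n) (Fin n) A) (m : Fin n) : Matrix (Fin n) (Fin n) A :=
  dmap (W.d m) G * H

/-- The matrix `(∇ₘR_{ij̄kl̄})_{kl}`. -/
def covCurv (G H : Matrix (Fin n) (Fin n) A) (m i j : Fin n) : Matrix (Fin n) (Fin n) A :=
  dmap (W.d m) (W.curv G H i j) - ∑ p, W.conn G H m i p • W.curv G H p j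
    - W.conn G H m * W.curv G H i j

end Wirtinger

namespace TimeWirtinger

variable {n : ℕ} {A : Type*} [CommRing A] [Algebra ℂ A] (W : TimeWirtinger n A)

/-- The flat heat operator at the base point. -/
def ell (a : A) : ℂ := W.ev (W.t a) - ∑ p, W.ev (W.d p (W.db p a))

/-- Evaluation of matrices. -/
def evM : Matrix (Fin n) (Fin n) A →+* Matrix (Fin n) (Fin n) ℂ := W.ev.mapMatrix

@[simp] theorem evM_apply (M : Matrix (Fin n) (Fin n) A) (i j : Fin n) :
    W.evM M i j = W.ev (M i j) := rfl

/-- The flat heat operator on matrices. -/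
def ellM (M : Matrix (Fin n) (Fin n) A) : Matrix (Fin n) (Fin n) ℂ :=
  W.evM (dmap W.t M) - ∑ p, W.evM (dmap (W.d p) (dmap (W.db p) M))

@[simp] theorem ellM_apply (M : Matrix (Fin n) (Fin n) A) (i j : Fin n) :
    W.ellM M i j = W.ell (M i j) := by
  simp [ellM, ell, Matrix.sum_apply]

theorem ell_mul (a b : A) : W.ell (a * b) = W.ev a * W.ell b + W.ell a * W.ev b
    - ∑ p, (W.ev (W.d p a) * W.ev (W.db p b) + W.ev (W.db p a) * W.ev (W.d p b)) := by
  have h : ∀ p, W.ev (W.d p (W.db p (a * b))) = W.ev a * W.ev (W.d p (W.db p b))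
      + W.ev (W.d p (W.db p a)) * W.ev b
      + (W.ev (W.d p a) * W.ev (W.db p b) + W.ev (W.db p a) * W.ev (W.d p b)) := by
    intro p
    simp only [Derivation.leibniz, smul_eq_mul, map_add, map_mul]
    ring
  simp only [ell, h, Finset.sum_add_distrib, ← Finset.mul_sum, ← Finset.sum_mul]
  simp only [Derivation.leibniz, smul_eq_mul, map_add, map_mul]
  ring

theorem ell_add (a b : A) : W.ell (a + b) = W.ell a + W.ell b := by
  simp only [ell, map_add, Finset.sum_add_distrib]; ring

theorem ell_sub (a b : A) : W.ell (a - b) = W.ell a - W.ell b := by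
  simp only [ell, map_sub, Finset.sum_sub_distrib]; ring

theorem ell_sum {ι : Type*} (s : Finset ι) (f : ι → A) :
    W.ell (∑ i ∈ s, f i) = ∑ i ∈ s, W.ell (f i) := by
  simp only [ell, map_sum, Finset.sum_sub_distrib]
  rw [Finset.sum_comm]

theorem ell_algebraMap (c : ℂ) : W.ell (algebraMap ℂ A c) = 0 := by
  simp [ell]

/-- The operator is real: conjugation exchanges `∂_p` and `∂_{p̄}`, and these commute. -/
theorem ell_cj (a : A) : W.ell (W.cj a) = starRingEnd ℂ (W.ell a) := by
  simp only [ell, W.t_cj, W.db_cj, W.d_cj, W.ev_cj, map_sub, map_sum]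
  congr 1
  exact Finset.sum_congr rfl fun p _ => by rw [W.d_db]

theorem ellM_add (M N : Matrix (Fin n) (Fin n) A) : W.ellM (M + N) = W.ellM M + W.ellM N := by
  ext; simp [ell_add]

theorem ellM_neg (M : Matrix (Fin n) (Fin n) A) : W.ellM (-M) = - W.ellM M := by
  simp [ellM, dmap_neg, neg_add_eq_sub]

theorem ellM_mul (M N : Matrix (Fin n) (Fin n) A) :
    W.ellM (M * N) = W.evM M * W.ellM N + W.ellM M * W.evM N
      - ∑ p, (W.evM (dmap (W.d p) M) * W.evM (dmap (W.db p) N)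
        + W.evM (dmap (W.db p) M) * W.evM (dmap (W.d p) N)) := by
  have h : ∀ p, W.evM (dmap (W.d p) (dmap (W.db p) (M * N))) =
      W.evM M * W.evM (dmap (W.d p) (dmap (W.db p) N))
      + W.evM (dmap (W.d p) (dmap (W.db p) M)) * W.evM N
      + (W.evM (dmap (W.d p) M) * W.evM (dmap (W.db p) N)
        + W.evM (dmap (W.db p) M) * W.evM (dmap (W.d p) N)) := by
    intro p
    simp only [dmap_mul, dmap_add, map_add, map_mul]
    abel
  simp only [ellM, h, Finset.sum_add_distrib, ← Finset.mul_sum, ← Finset.sum_mul]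
  simp only [dmap_mul, map_add, map_mul]
  noncomm_ring

/-- A solution of Kähler–Ricci flow, in coordinates that are normal at the base point at the
base time. -/
structure IsNormalFlow (G H : Matrix (Fin n) (Fin n) A) : Prop where
  GH : G * H = 1
  HG : H * G = 1
  ev_one : W.evM G = 1
  ev_d : ∀ p, W.evM (dmap (W.d p) G) = 0
  ev_db : ∀ p, W.evM (dmap (W.db p) G) = 0
  -- The Ricci tensor is traced over the first pair of indices here, whereas `ricci` traces the last
  -- pair. The two agree by `Wirtinger.curv_symm`, and in this form `∂ₜ G` is a combination of
  -- curvature matrices, so that the rules of matrix calculus apply.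
  flow : dmap W.t G = -∑ a, ∑ b, H b a • W.curv G H a b

namespace IsNormalFlow

variable {W} {G H : Matrix (Fin n) (Fin n) A} (h : W.IsNormalFlow G H)
include h

theorem ev_inv : W.evM H = 1 := by
  have := congrArg W.evM h.GH
  simpa [h.ev_one] using this

theorem ev_dmap_inv (δ : Derivation ℂ A A) (hδ : W.evM (dmap δ G) = 0) :
    W.evM (dmap δ H) = 0 := by
  have := congrArg (fun M => W.evM (dmap δ M)) h.GH
  simpa [dmap_mul, dmap_one, h.ev_one, hδ] using this

theorem ev_d_inv (p : Fin n) : W.evM (dmap (W.d p) H) = 0 := h.ev_dmap_inv _ (h.ev_d p)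

theorem ev_db_inv (p : Fin n) : W.evM (dmap (W.db p) H) = 0 := h.ev_dmap_inv _ (h.ev_db p)

theorem ev_curv (i j : Fin n) :
    W.evM (W.curv G H i j) = -W.evM (dmap (W.d i) (dmap (W.db j) G)) := by
  simp [Wirtinger.curv, h.ev_d]

theorem ev_inv_smul_sum (X : Fin n → Fin n → Matrix (Fin n) (Fin n) A) :
    W.evM (∑ a, ∑ b, H b a • X a b) = ∑ a, W.evM (X a a) := by
  have h1 := h.ev_inv
  have h2 : ∀ a b, W.evM (H b a • X a b) = (1 : Matrix (Fin n) (Fin n) ℂ) b a • W.evM (X a b) := by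
    intro a b
    ext i j
    simp [← h1]
  simp [map_sum, h2, Matrix.one_apply]

/-- Two derivatives of `G H = 1`; the mixed terms contain a first derivative of the metric and
vanish at the base point. -/
theorem ev_dd_inv (δ ε : Derivation ℂ A A) (hδ : W.evM (dmap δ G) = 0) (hε : W.evM (dmap ε G) = 0) :
    W.evM (dmap δ (dmap ε H)) = -W.evM (dmap δ (dmap ε G)) := by
  have := congrArg (fun M => W.evM (dmap δ (dmap ε M))) h.GH
  simp only [dmap_mul, dmap_one, dmap_add, map_add, map_mul, h.ev_one, hδ, hε, h.ev_inv,
    h.ev_dmap_inv _ hδ, mul_one, one_mul, mul_zero, zero_mul, add_zero, zero_add] at this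
  rw [eq_neg_iff_add_eq_zero, add_comm, this]
  ext; simp

/-- In normal coordinates the curvature is `-∂∂̄G` at the base point, so `-Ric` is the flat
Laplacian of `G` there and the flow reads as the flat heat equation. -/
theorem ellM_metric : W.ellM G = 0 := by
  rw [TimeWirtinger.ellM, h.flow, map_neg, h.ev_inv_smul_sum]
  simp [h.ev_curv]

theorem ellM_inv : W.ellM H = 0 := by
  have := congrArg W.ellM h.GH
  rw [W.ellM_mul, h.ellM_metric] at this
  simp only [h.ev_one, h.ev_d, h.ev_db, one_mul, zero_mul, add_zero, Finset.sum_const_zero,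
    sub_zero] at this
  rw [this]
  ext i j
  by_cases h : i = j <;> simp [Matrix.one_apply, h, ell]

/-- First derivatives of the flow equation at the base point. -/
theorem ev_dmap_t (δ : Derivation ℂ A A) (hδ : W.evM (dmap δ G) = 0) :
    W.evM (dmap δ (dmap W.t G)) = ∑ p, W.evM (dmap δ (dmap (W.d p) (dmap (W.db p) G))) := by
  rw [h.flow]
  simp only [dmap_neg, dmap_sum, dmap_smul, Finset.sum_add_distrib, map_neg, map_add]
  rw [h.ev_inv_smul_sum]
  have h0 : W.evM (∑ a, ∑ b, δ (H b a) • W.curv G H a b) = 0 := by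
    have h1 := h.ev_dmap_inv δ hδ
    simp only [map_sum]
    refine Finset.sum_eq_zero fun a _ => Finset.sum_eq_zero fun b _ => ?_
    ext i j
    have := congrFun (congrFun h1 b) a
    simp only [evM_apply, dmap_apply, Matrix.zero_apply] at this
    simp [this]
  rw [h0, zero_add, ← Finset.sum_neg_distrib]
  refine Finset.sum_congr rfl fun p _ => ?_
  simp [Wirtinger.curv, dmap_add, dmap_neg, dmap_mul, h.ev_d, h.ev_db, h.ev_d_inv, h.ev_db_inv]

/-- The cancellation of `ellM_metric` survives one more derivative, since each term in the
derivative of the quadratic part of the curvature still contains a vanishing first derivative of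
`G`. -/
theorem ellM_d_metric (m : Fin n) : W.ellM (dmap (W.d m) G) = 0 := by
  rw [TimeWirtinger.ellM, dmap_comm (W.t_d m), h.ev_dmap_t _ (h.ev_d m), sub_eq_zero]
  refine Finset.sum_congr rfl fun p _ => ?_
  rw [dmap_comm (W.d_d m p), dmap_comm (W.d_db m p)]

/-- Consequently the evolution of `Γ - Γ₀` receives contributions from the background connection
only. -/
theorem ellM_conn (m : Fin n) : W.ellM (W.conn G H m) = 0 := by
  rw [Wirtinger.conn, W.ellM_mul, h.ellM_d_metric, h.ev_d]
  simp [h.ev_d_inv, h.ev_db_inv]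

/-- The evolution equation of the curvature. -/
theorem ellM_curv (i j : Fin n) : W.ellM (W.curv G H i j) =
    ∑ a, ∑ b, W.ev (W.curv G H i j b a) • W.evM (W.curv G H a b)
      + ∑ p, (W.evM (W.curv G H p j) * W.evM (W.curv G H i p)
        - W.evM (W.curv G H i p) * W.evM (W.curv G H p j)) := by
  -- The time derivative of the leading part of the curvature, from two spatial derivatives of the
  -- flow equation. The Hessian of the inverse metric and the quadratic part of the curvature
  -- produce the terms that are quadratic in second derivatives of `G`.
  have hX : W.evM (dmap (W.d i) (dmap (W.db j) (dmap W.t G))) =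
      -∑ a, ∑ b, W.ev (W.curv G H i j b a) • W.evM (W.curv G H a b)
      + ∑ p, (W.evM (dmap (W.d i) (dmap (W.db j) (dmap (W.d p) (dmap (W.db p) G))))
        - W.evM (dmap (W.d i) (dmap (W.d p) G)) * W.evM (dmap (W.db j) (dmap (W.db p) G))
        - W.evM (W.curv G H p j) * W.evM (W.curv G H i p)) := by
    rw [h.flow]
    simp only [dmap_neg, dmap_sum, dmap_smul, dmap_add, Finset.sum_add_distrib, map_neg, map_add]
    rw [h.ev_inv_smul_sum]
    have hz : ∀ δ : Derivation ℂ A A, W.evM (dmap δ G) = 0 →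
        ∀ X : Fin n → Fin n → Matrix (Fin n) (Fin n) A,
          W.evM (∑ a, ∑ b, δ (H b a) • X a b) = 0 := by
      intro δ hδ X
      have h1 := h.ev_dmap_inv δ hδ
      simp only [map_sum]
      refine Finset.sum_eq_zero fun a _ => Finset.sum_eq_zero fun b _ => ?_
      ext k l
      have := congrFun (congrFun h1 b) a
      simp only [evM_apply, dmap_apply, Matrix.zero_apply] at this
      simp [this]
    rw [hz _ (h.ev_d i), hz _ (h.ev_db j)]
    have h1 : W.evM (∑ a, ∑ b, (W.d i) ((W.db j) (H b a)) • W.curv G H a b) =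
        ∑ a, ∑ b, W.ev (W.curv G H i j b a) • W.evM (W.curv G H a b) := by
      simp only [map_sum]
      refine Finset.sum_congr rfl fun a _ => Finset.sum_congr rfl fun b _ => ?_
      ext k l
      have h2 := h.ev_dd_inv _ _ (h.ev_d i) (h.ev_db j)
      rw [← h.ev_curv] at h2
      have := congrFun (congrFun h2 b) a
      simp only [evM_apply, dmap_apply] at this
      simp [this]
    rw [h1, add_zero, zero_add, neg_add, ← Finset.sum_neg_distrib (s := Finset.univ) (f := fun a => W.evM _)]
    congr 1
    refine Finset.sum_congr rfl fun p _ => ?_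
    rw [h.ev_curv, h.ev_curv]
    simp only [Wirtinger.curv, dmap_add, dmap_neg, dmap_mul, map_add, map_neg, map_mul, h.ev_d,
      h.ev_db, h.ev_inv, h.ev_d_inv, h.ev_db_inv, mul_zero, zero_mul, add_zero, zero_add, mul_one]
    rw [dmap_comm (fun a => (W.d_db p j a).symm) G]
    noncomm_ring
  -- Both factors vanish at the base point, so only the cross terms of the product rule remain.
  have hY : W.ellM (dmap (W.d i) G * H * dmap (W.db j) G) =
      -∑ p, (W.evM (dmap (W.d i) (dmap (W.d p) G)) * W.evM (dmap (W.db j) (dmap (W.db p) G))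
        + W.evM (W.curv G H i p) * W.evM (W.curv G H p j)) := by
    have h1 : W.ellM (dmap (W.d i) G * H) = 0 := h.ellM_conn i
    rw [W.ellM_mul, h1, map_mul, h.ev_d, h.ev_db]
    simp only [dmap_mul, map_add, map_mul, h.ev_inv, h.ev_d_inv, h.ev_db_inv, h.ev_curv, h.ev_d,
      mul_zero, zero_mul, add_zero, zero_add, mul_one, zero_sub]
    congr 1
    refine Finset.sum_congr rfl fun p _ => ?_
    rw [dmap_comm (W.d_d p i), dmap_comm (W.db_db p j),
      dmap_comm (fun a => (W.d_db i p a).symm)]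
    noncomm_ring
  rw [Wirtinger.curv, W.ellM_add, W.ellM_neg, hY, TimeWirtinger.ellM,
    dmap_comm (W.t_d i), dmap_comm (W.t_db j), hX]
  -- Since all derivations commute, the fourth derivatives of `G` from the time derivative and from
  -- the Laplacian cancel. So do the products of `∂ᵢ∂ₚG` and `∂_{j̄}∂_{p̄}G`, which are not
  -- tensorial; what is left is quadratic in the curvature.
  have h4 : ∀ p, dmap (W.d p) (dmap (W.db p) (dmap (W.d i) (dmap (W.db j) G))) =
      dmap (W.d i) (dmap (W.db j) (dmap (W.d p) (dmap (W.db p) G))) := by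
    intro p
    ext k l
    simp only [dmap_apply]
    rw [← W.d_db i p, W.d_d p i, W.db_db p j, W.d_db p j]
  simp only [h4, Finset.sum_sub_distrib, Finset.sum_add_distrib]
  simp only [Wirtinger.curv]
  abel

end IsNormalFlow

end TimeWirtinger
end

/-! ### Evolution of weighted squared norms -/

noncomputable section

/-- A weighted Hermitian square `∑ w_{κκ'} T_κ c(T_κ')`. -/
def hermSq {A κ : Type*} [CommRing A] [Fintype κ] (c : A →+* A) (w : κ → κ → A) (T : κ → A) : A :=
  ∑ x, ∑ y, w x y * (T x * c (T y))

/-- A weighted Hermitian square with respect to the conjugation. -/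
def Wirtinger.wsq {n : ℕ} {A κ : Type*} [CommRing A] [Algebra ℂ A] [Fintype κ] (W : Wirtinger n A)
    (w : κ → κ → A) (T : κ → A) : A := hermSq W.cj w T

namespace TimeWirtinger

variable {n : ℕ} {A : Type*} [CommRing A] [Algebra ℂ A] (W : TimeWirtinger n A)

/-- Elements whose first derivatives and heat operator vanish at the base point. -/
structure IsFlat (a : A) : Prop where
  ev_d : ∀ p, W.ev (W.d p a) = 0
  ev_db : ∀ p, W.ev (W.db p a) = 0
  ell_eq : W.ell a = 0

-- The weights of tensor norms are products of entries of the metric and its inverse, and they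
-- inherit this property from their factors.
variable {W} in
theorem IsFlat.mul {a b : A} (ha : W.IsFlat a) (hb : W.IsFlat b) : W.IsFlat (a * b) where
  ev_d p := by simp [Derivation.leibniz, ha.ev_d, hb.ev_d]
  ev_db p := by simp [Derivation.leibniz, ha.ev_db, hb.ev_db]
  ell_eq := by simp [W.ell_mul, ha.ev_d, hb.ev_d, ha.ev_db, hb.ev_db, ha.ell_eq, hb.ell_eq]

/-- The squared norm of the gradient at the base point. -/
def gradSq (a : A) : ℝ := ∑ p, (‖W.ev (W.d p a)‖ ^ 2 + ‖W.ev (W.db p a)‖ ^ 2)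

theorem gradSq_nonneg (a : A) : 0 ≤ W.gradSq a :=
  Finset.sum_nonneg fun _ _ => by positivity

/-- The gradient term of the product rule is recorded as an error `x`, controlled by Cauchy–Schwarz
over all `∂ₚ` and `∂_{p̄}`. The test functions below are chosen so that this error can be absorbed.
-/
theorem re_ell_mul_le (a b : A) (ha : (W.ev a).im = 0) (hb : (W.ev b).im = 0) :
    ∃ x : ℝ, (W.ell (a * b)).re = (W.ev a).re * (W.ell b).re + (W.ell a).re * (W.ev b).re + x ∧
      x ^ 2 ≤ W.gradSq a * W.gradSq b := by
  refine ⟨-(∑ p, (W.ev (W.d p a) * W.ev (W.db p b) + W.ev (W.db p a) * W.ev (W.d p b))).re, ?_, ?_⟩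
  · rw [W.ell_mul, Complex.sub_re, Complex.add_re, Complex.mul_re, Complex.mul_re, ha, hb]
    ring
  · set z := ∑ p, (W.ev (W.d p a) * W.ev (W.db p b) + W.ev (W.db p a) * W.ev (W.d p b))
    have h1 : ‖z‖ ≤ ∑ p, (‖W.ev (W.d p a)‖ * ‖W.ev (W.db p b)‖
        + ‖W.ev (W.db p a)‖ * ‖W.ev (W.d p b)‖) := by
      refine (norm_sum_le _ _).trans (Finset.sum_le_sum fun p _ => ?_)
      refine (norm_add_le _ _).trans (le_of_eq ?_)
      rw [norm_mul, norm_mul]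
    have h2 := Finset.sum_mul_sq_le_sq_mul_sq (Finset.univ : Finset (Fin n × Fin 2))
      (fun q => ![‖W.ev (W.d q.1 a)‖, ‖W.ev (W.db q.1 a)‖] q.2)
      (fun q => ![‖W.ev (W.db q.1 b)‖, ‖W.ev (W.d q.1 b)‖] q.2)
    simp only [Fintype.sum_prod_type, Fin.sum_univ_two, Matrix.cons_val_zero,
      Matrix.cons_val_one] at h2
    have h3 : W.gradSq b = ∑ p, (‖W.ev (W.db p b)‖ ^ 2 + ‖W.ev (W.d p b)‖ ^ 2) :=
      Finset.sum_congr rfl fun p _ => add_comm _ _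
    rw [h3]
    refine le_trans ?_ h2
    rw [neg_sq, ← sq_abs]
    exact pow_le_pow_left₀ (abs_nonneg _) ((Complex.abs_re_le_norm z).trans h1) 2

section WeightedSquare

variable {κ : Type*} [Fintype κ] [DecidableEq κ]

variable (w : κ → κ → A) (T : κ → A)

variable (hw : ∀ x y, W.IsFlat (w x y)) (hw1 : ∀ x y, W.ev (w x y) = if x = y then 1 else 0)
include hw1

theorem ev_wsq : W.ev (W.wsq w T) = ((∑ x, ‖W.ev (T x)‖ ^ 2 : ℝ) : ℂ) := by
  simp only [Wirtinger.wsq, hermSq, map_sum, map_mul, hw1, ite_mul, one_mul, zero_mul, Finset.sum_ite_eq,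
    Finset.mem_univ, if_true, W.ev_cj, Complex.mul_conj, Complex.ofReal_sum,
    Complex.normSq_eq_norm_sq]

include hw

theorem ev_d_wsq (p : Fin n) : W.ev (W.d p (W.wsq w T)) =
    ∑ x, (W.ev (T x) * starRingEnd ℂ (W.ev (W.db p (T x)))
      + starRingEnd ℂ (W.ev (T x)) * W.ev (W.d p (T x))) := by
  simp only [Wirtinger.wsq, hermSq, map_sum, Derivation.leibniz, smul_eq_mul, map_add, map_mul, hw1,
    (hw _ _).ev_d, ite_mul, one_mul, zero_mul, mul_zero, add_zero, Finset.sum_ite_eq,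
    Finset.mem_univ, if_true, W.ev_cj, W.d_cj]

theorem ev_db_wsq (p : Fin n) : W.ev (W.db p (W.wsq w T)) =
    ∑ x, (W.ev (T x) * starRingEnd ℂ (W.ev (W.d p (T x)))
      + starRingEnd ℂ (W.ev (T x)) * W.ev (W.db p (T x))) := by
  simp only [Wirtinger.wsq, hermSq, map_sum, Derivation.leibniz, smul_eq_mul, map_add, map_mul, hw1,
    (hw _ _).ev_db, ite_mul, one_mul, zero_mul, mul_zero, add_zero, Finset.sum_ite_eq,
    Finset.mem_univ, if_true, W.ev_cj, W.db_cj]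

/-- A Bochner formula. The weights are the Kronecker delta and have no first derivatives and no heat
operator at the base point, so the square behaves like a sum of `|T x|²`, whose cross terms give the
full negative gradient. -/
theorem re_ell_wsq : (W.ell (W.wsq w T)).re =
    2 * ∑ x, (starRingEnd ℂ (W.ev (T x)) * W.ell (T x)).re - ∑ x, W.gradSq (T x) := by
  have h1 : W.ell (W.wsq w T) = ∑ x, W.ell (T x * W.cj (T x)) := by
    simp only [Wirtinger.wsq, hermSq, W.ell_sum]
    refine Finset.sum_congr rfl fun x _ => ?_
    have : ∀ y, W.ell (w x y * (T x * W.cj (T y))) =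
        if x = y then W.ell (T x * W.cj (T y)) else 0 := by
      intro y
      rw [W.ell_mul, (hw x y).ell_eq, hw1]
      simp [(hw x y).ev_d, (hw x y).ev_db]
    simp [this]
  rw [h1, Complex.re_sum, Finset.mul_sum, ← Finset.sum_sub_distrib]
  refine Finset.sum_congr rfl fun x _ => ?_
  have h2 : ∀ p, (W.ev (W.d p (T x)) * W.ev (W.db p (W.cj (T x)))
      + W.ev (W.db p (T x)) * W.ev (W.d p (W.cj (T x)))) =
      ((‖W.ev (W.d p (T x))‖ ^ 2 + ‖W.ev (W.db p (T x))‖ ^ 2 : ℝ) : ℂ) := by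
    intro p
    rw [W.d_cj, W.db_cj, W.ev_cj, W.ev_cj, Complex.mul_conj, Complex.mul_conj]
    simp [Complex.normSq_eq_norm_sq]
  rw [W.ell_mul, W.ell_cj, W.ev_cj, Finset.sum_congr rfl fun p _ => h2 p, ← Complex.ofReal_sum,
    Complex.sub_re, Complex.ofReal_re, gradSq]
  simp only [Complex.add_re, Complex.mul_re, Complex.conj_re, Complex.conj_im]
  ring

/-- Kato's inequality `|∇|T|²|² ≤ 4 |T|² |∇T|²`, by Cauchy–Schwarz. It bounds the cross terms in
products with squared norms. -/
theorem gradSq_wsq_le : W.gradSq (W.wsq w T) ≤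
    4 * (∑ x, ‖W.ev (T x)‖ ^ 2) * ∑ x, W.gradSq (T x) := by
  have key : ∀ a b : κ → ℂ, ‖∑ x, (W.ev (T x) * starRingEnd ℂ (a x)
      + starRingEnd ℂ (W.ev (T x)) * b x)‖ ^ 2 ≤
      2 * (∑ x, ‖W.ev (T x)‖ ^ 2) * ∑ x, (‖a x‖ ^ 2 + ‖b x‖ ^ 2) := by
    intro a b
    have h1 : ‖∑ x, (W.ev (T x) * starRingEnd ℂ (a x)
      + starRingEnd ℂ (W.ev (T x)) * b x)‖ ≤ ∑ x, ‖W.ev (T x)‖ * (‖a x‖ + ‖b x‖) := by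
      refine (norm_sum_le _ _).trans (Finset.sum_le_sum fun x _ => ?_)
      refine (norm_add_le _ _).trans (le_of_eq ?_)
      rw [norm_mul, norm_mul, RCLike.norm_conj, RCLike.norm_conj]; ring
    have h2 := Finset.sum_mul_sq_le_sq_mul_sq Finset.univ (fun x => ‖W.ev (T x)‖)
      (fun x => ‖a x‖ + ‖b x‖)
    have h3 : ∑ x, (‖a x‖ + ‖b x‖) ^ 2 ≤ ∑ x, 2 * (‖a x‖ ^ 2 + ‖b x‖ ^ 2) :=
      Finset.sum_le_sum fun x _ => by nlinarith [sq_nonneg (‖a x‖ - ‖b x‖)]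
    rw [← Finset.mul_sum] at h3
    have h4 : 0 ≤ ∑ x, ‖W.ev (T x)‖ ^ 2 := Finset.sum_nonneg fun _ _ => by positivity
    calc _ ≤ (∑ x, ‖W.ev (T x)‖ * (‖a x‖ + ‖b x‖)) ^ 2 := pow_le_pow_left₀ (norm_nonneg _) h1 2
      _ ≤ _ := h2
      _ ≤ _ := mul_le_mul_of_nonneg_left h3 h4
      _ = _ := by ring
  have h5 : ∀ p, ‖W.ev (W.d p (W.wsq w T))‖ ^ 2 + ‖W.ev (W.db p (W.wsq w T))‖ ^ 2 ≤
      4 * (∑ x, ‖W.ev (T x)‖ ^ 2) *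
        ∑ x, (‖W.ev (W.d p (T x))‖ ^ 2 + ‖W.ev (W.db p (T x))‖ ^ 2) := by
    intro p
    rw [W.ev_d_wsq w T hw hw1, W.ev_db_wsq w T hw hw1]
    have h6 := key (fun x => W.ev (W.db p (T x))) (fun x => W.ev (W.d p (T x)))
    have h7 := key (fun x => W.ev (W.d p (T x))) (fun x => W.ev (W.db p (T x)))
    have h8 : ∑ x, (‖W.ev (W.db p (T x))‖ ^ 2 + ‖W.ev (W.d p (T x))‖ ^ 2) =
      ∑ x, (‖W.ev (W.d p (T x))‖ ^ 2 + ‖W.ev (W.db p (T x))‖ ^ 2) :=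
      Finset.sum_congr rfl fun _ _ => add_comm _ _
    rw [h8] at h6
    linarith
  calc _ ≤ _ := Finset.sum_le_sum fun p _ => h5 p
    _ = _ := by
      rw [← Finset.mul_sum, Finset.sum_comm]; rfl

end WeightedSquare

end TimeWirtinger
end

/-! ### Norms of the curvature and of the connection difference; evolution of `|Rm|²` -/

noncomputable section

/-- Index set of a tensor with three indices. -/
abbrev Idx3 (n : ℕ) : Type := Fin n × (Fin n × Fin n)

/-- Index set of a tensor with four indices. -/
abbrev Idx4 (n : ℕ) : Type := (Fin n × Fin n) × (Fin n × Fin n)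

/-- Weights of the norm of a tensor with indices `ₘ,ᵢ,ᵏ`. -/
def weight3 {n : ℕ} {A : Type*} [CommRing A] (G H : Matrix (Fin n) (Fin n) A) (x y : Idx3 n) : A :=
  H y.1 x.1 * (H y.2.1 x.2.1 * G x.2.2 y.2.2)

/-- Weights of the norm of a tensor with indices `ᵢ,j̄,ₖ,l̄`. -/
def weight4 {n : ℕ} {A : Type*} [CommRing A] (H : Matrix (Fin n) (Fin n) A) (x y : Idx4 n) : A :=
  H y.1.1 x.1.1 * H x.1.2 y.1.2 * (H y.2.1 x.2.1 * H x.2.2 y.2.2)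

/-- Entrywise bounds of products of matrices. -/
theorem norm_mul_entry_le {n : ℕ} {M N : Matrix (Fin n) (Fin n) ℂ} {a b : ℝ} (ha : 0 ≤ a)
    (hM : ∀ i j, ‖M i j‖ ≤ a) (hN : ∀ i j, ‖N i j‖ ≤ b) (i j : Fin n) :
    ‖(M * N) i j‖ ≤ n * (a * b) := by
  rw [Matrix.mul_apply]
  refine (norm_sum_le _ _).trans ?_
  calc _ ≤ ∑ _k : Fin n, a * b := Finset.sum_le_sum fun k _ => by
        rw [norm_mul]; exact mul_le_mul (hM i k) (hN k j) (norm_nonneg _) ha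
    _ = _ := by simp

namespace Wirtinger

variable {n : ℕ} {A : Type*} [CommRing A] [Algebra ℂ A] (W : Wirtinger n A)

/-- The curvature of a Chern connection is `-∂̄Γ`. Applied to both metrics this makes the curvature
visible in the gradient of `Γ - Γ₀`; applied to `g₀` alone it computes the Laplacian of `Γ₀`. -/
theorem dmap_db_conn {G H : Matrix (Fin n) (Fin n) A} (GH : G * H = 1) (HG : H * G = 1)
    (m p : Fin n) : dmap (W.db p) (W.conn G H m) = -(W.curv G H m p * H) := by
  have h1 : dmap (W.db p) H = -(H * dmap (W.db p) G * H) := by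
    have h := congrArg (dmap (W.db p)) GH
    rw [dmap_mul, dmap_one] at h
    have h2 : H * (dmap (W.db p) G * H + G * dmap (W.db p) H) = 0 := by rw [h, mul_zero]
    rw [mul_add, ← mul_assoc H G, HG, one_mul] at h2
    rw [eq_neg_iff_add_eq_zero, add_comm, mul_assoc]; exact h2
  rw [conn, dmap_mul, h1, curv, dmap_comm (fun a => (W.d_db m p a).symm)]
  noncomm_ring

theorem dmap_d_eq_conn_mul {G H : Matrix (Fin n) (Fin n) A} (HG : H * G = 1) (m : Fin n) :
    dmap (W.d m) G = W.conn G H m * G := by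
  rw [conn, mul_assoc, HG, mul_one]

/-- Replaces a coordinate derivative of the curvature by the covariant one, at the cost of terms
that are linear in the connection and in the curvature. -/
theorem dmap_d_curv_mul {G H : Matrix (Fin n) (Fin n) A} (GH : G * H = 1) (HG : H * G = 1)
    (m p q : Fin n) : dmap (W.d q) (W.curv G H m p * H) =
      (W.covCurv G H q m p + ∑ r, W.conn G H q m r • W.curv G H r p
        + W.conn G H q * W.curv G H m p) * H - W.curv G H m p * (H * W.conn G H q) := by
  have h1 : dmap (W.d q) H = -(H * dmap (W.d q) G * H) := by
    have h := congrArg (dmap (W.d q)) GH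
    rw [dmap_mul, dmap_one] at h
    have h2 : H * (dmap (W.d q) G * H + G * dmap (W.d q) H) = 0 := by rw [h, mul_zero]
    rw [mul_add, ← mul_assoc H G, HG, one_mul] at h2
    rw [eq_neg_iff_add_eq_zero, add_comm, mul_assoc]; exact h2
  have h6 : (W.covCurv G H q m p + ∑ r, W.conn G H q m r • W.curv G H r p
        + W.conn G H q * W.curv G H m p) = dmap (W.d q) (W.curv G H m p) := by
    rw [covCurv]; abel
  rw [dmap_mul, h1, h6, conn]
  noncomm_ring

/-- `|Rm|²`. -/
def rmSq (G H : Matrix (Fin n) (Fin n) A) : A :=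
  W.wsq (weight4 H) fun x => W.curv G H x.1.1 x.1.2 x.2.1 x.2.2

/-- The difference of two Chern connections. -/
def connDiff (G H G₀ H₀ : Matrix (Fin n) (Fin n) A) (x : Idx3 n) : A :=
  (W.conn G H x.1 - W.conn G₀ H₀ x.1) x.2.1 x.2.2

/-- `|Γ - Γ₀|²`. -/
def connDiffSq (G H G₀ H₀ : Matrix (Fin n) (Fin n) A) : A :=
  W.wsq (weight3 G H) (W.connDiff G H G₀ H₀)

/-- `tr_g g₀`. -/
def relTrace (H G₀ : Matrix (Fin n) (Fin n) A) : A := ∑ i, ∑ j, H j i * G₀ i j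

end Wirtinger

namespace TimeWirtinger

open Wirtinger

variable {n : ℕ} {A : Type*} [CommRing A] [Algebra ℂ A] {W : TimeWirtinger n A}

namespace IsNormalFlow

variable {G H : Matrix (Fin n) (Fin n) A} (h : W.IsNormalFlow G H)
include h

theorem flat_metric (i j : Fin n) : W.IsFlat (G i j) where
  ev_d p := congrFun (congrFun (h.ev_d p) i) j
  ev_db p := congrFun (congrFun (h.ev_db p) i) j
  ell_eq := by rw [← ellM_apply, h.ellM_metric]; rfl

theorem flat_inv (i j : Fin n) : W.IsFlat (H i j) where
  ev_d p := congrFun (congrFun (h.ev_d_inv p) i) j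
  ev_db p := congrFun (congrFun (h.ev_db_inv p) i) j
  ell_eq := by rw [← ellM_apply, h.ellM_inv]; rfl

theorem ev_metric_apply (i j : Fin n) : W.ev (G i j) = if i = j then 1 else 0 := by
  rw [← evM_apply, h.ev_one, Matrix.one_apply]

theorem ev_inv_apply (i j : Fin n) : W.ev (H i j) = if i = j then 1 else 0 := by
  rw [← evM_apply, h.ev_inv, Matrix.one_apply]

theorem flat_weight3 (x y : Idx3 n) : W.IsFlat (weight3 G H x y) :=
  (h.flat_inv _ _).mul ((h.flat_inv _ _).mul (h.flat_metric _ _))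

theorem ev_weight3 (x y : Idx3 n) : W.ev (weight3 G H x y) = if x = y then 1 else 0 := by
  obtain ⟨x1, x2, x3⟩ := x
  obtain ⟨y1, y2, y3⟩ := y
  simp only [weight3, map_mul, h.ev_inv_apply, h.ev_metric_apply, Prod.mk.injEq]
  split_ifs <;> simp_all

theorem flat_weight4 (x y : Idx4 n) : W.IsFlat (weight4 H x y) :=
  ((h.flat_inv _ _).mul (h.flat_inv _ _)).mul ((h.flat_inv _ _).mul (h.flat_inv _ _))

theorem ev_weight4 (x y : Idx4 n) : W.ev (weight4 H x y) = if x = y then 1 else 0 := by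
  obtain ⟨⟨x1, x2⟩, x3, x4⟩ := x
  obtain ⟨⟨y1, y2⟩, y3, y4⟩ := y
  simp only [weight4, map_mul, h.ev_inv_apply, Prod.mk.injEq]
  by_cases e1 : y1 = x1
  · by_cases e2 : x2 = y2
    · by_cases e3 : y3 = x3
      · simp [e1, e2, e3]
      · simp [e3, Ne.symm e3]
    · simp [e2]
  · simp [e1, Ne.symm e1]

/-- `|Rm|²` at the base point. -/
theorem ev_rmSq : W.ev (W.rmSq G H) =
    ((∑ x : Idx4 n, ‖W.ev (W.curv G H x.1.1 x.1.2 x.2.1 x.2.2)‖ ^ 2 : ℝ) : ℂ) :=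
  W.ev_wsq _ _ h.ev_weight4

theorem norm_ev_curv_le (i j k l : Fin n) :
    ‖W.ev (W.curv G H i j k l)‖ ≤ Real.sqrt (W.ev (W.rmSq G H)).re := by
  refine Real.le_sqrt_of_sq_le ?_
  rw [h.ev_rmSq, Complex.ofReal_re]
  have hx := Finset.mem_univ (((i, j), (k, l)) : Idx4 n)
  have := Finset.single_le_sum
    (f := fun x : Idx4 n => ‖W.ev (W.curv G H x.1.1 x.1.2 x.2.1 x.2.2)‖ ^ 2)
    (fun _ _ => sq_nonneg _) hx
  simpa only using this

/-- By `ellM_curv` the left side is quadratic in the curvature: `n²` products of entries, and `2 n`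
matrix products whose entries have `n` terms each. -/
theorem norm_ell_curv_le (i j k l : Fin n) : ‖W.ell (W.curv G H i j k l)‖ ≤
    3 * n ^ 2 * (W.ev (W.rmSq G H)).re := by
  set ρ := (W.ev (W.rmSq G H)).re with hρ
  have hρ0 : 0 ≤ ρ := by
    rw [hρ, h.ev_rmSq, Complex.ofReal_re]; positivity
  have hs : Real.sqrt ρ * Real.sqrt ρ = ρ := Real.mul_self_sqrt hρ0
  have hb := fun i j k l => h.norm_ev_curv_le i j k l
  rw [← hρ] at hb
  have hm : ∀ a b c d : Fin n, ‖(W.evM (W.curv G H a b) * W.evM (W.curv G H c d)) k l‖ ≤ n * ρ := by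
    intro a b c d
    rw [← hs]
    exact norm_mul_entry_le (Real.sqrt_nonneg _) (fun i j => hb a b i j) (fun i j => hb c d i j) k l
  rw [← ellM_apply, h.ellM_curv, Matrix.add_apply, Matrix.sum_apply, Matrix.sum_apply]
  have h1 : ‖∑ a, (∑ b, W.ev (W.curv G H i j b a) • W.evM (W.curv G H a b)) k l‖ ≤ n ^ 2 * ρ := by
    calc _ ≤ ∑ _a : Fin n, ∑ _b : Fin n, ρ := by
          refine (norm_sum_le _ _).trans (Finset.sum_le_sum fun a _ => ?_)
          rw [Matrix.sum_apply]
          refine (norm_sum_le _ _).trans (Finset.sum_le_sum fun b _ => ?_)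
          rw [Matrix.smul_apply, smul_eq_mul, norm_mul, ← hs]
          exact mul_le_mul (hb _ _ _ _) (hb _ _ _ _) (norm_nonneg _) (Real.sqrt_nonneg _)
      _ = _ := by simp; ring
  have h2 : ‖∑ p, (W.evM (W.curv G H p j) * W.evM (W.curv G H i p)
        - W.evM (W.curv G H i p) * W.evM (W.curv G H p j)) k l‖ ≤ 2 * n ^ 2 * ρ := by
    calc _ ≤ ∑ _p : Fin n, (n * ρ + n * ρ) := by
          refine (norm_sum_le _ _).trans (Finset.sum_le_sum fun p _ => ?_)
          rw [Matrix.sub_apply]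
          exact (norm_sub_le _ _).trans (add_le_add (hm _ _ _ _) (hm _ _ _ _))
      _ = _ := by simp; ring
  calc _ ≤ _ := norm_add_le _ _
    _ ≤ _ := add_le_add h1 h2
    _ = _ := by ring

/-- The evolution inequality of `|Rm|²`. -/
theorem re_ell_rmSq_le : (W.ell (W.rmSq G H)).re ≤
    6 * n ^ 6 * (W.ev (W.rmSq G H)).re * Real.sqrt (W.ev (W.rmSq G H)).re
      - ∑ x : Idx4 n, W.gradSq (W.curv G H x.1.1 x.1.2 x.2.1 x.2.2) := by
  have h0 := W.re_ell_wsq (weight4 H) (fun x : Idx4 n => W.curv G H x.1.1 x.1.2 x.2.1 x.2.2)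
    h.flat_weight4 h.ev_weight4
  rw [rmSq, h0, ← rmSq]
  refine sub_le_sub_right ?_ _
  set ρ := (W.ev (W.rmSq G H)).re with hρ
  have hρ0 : 0 ≤ ρ := by
    rw [hρ, h.ev_rmSq, Complex.ofReal_re]; positivity
  -- There are `n⁴` components, which together with the factors `2` and `3 n²` make `6 n⁶`.
  calc _ ≤ 2 * ∑ _x : Idx4 n, Real.sqrt ρ * (3 * n ^ 2 * ρ) := by
        refine mul_le_mul_of_nonneg_left (Finset.sum_le_sum fun x _ => ?_) (by norm_num)
        refine (Complex.re_le_norm _).trans ?_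
        rw [norm_mul, RCLike.norm_conj]
        exact mul_le_mul (h.norm_ev_curv_le _ _ _ _) (h.norm_ell_curv_le _ _ _ _) (norm_nonneg _)
          (Real.sqrt_nonneg _)
    _ = _ := by
        simp only [Finset.sum_const, Finset.card_univ, Fintype.card_prod, Fintype.card_fin,
          nsmul_eq_mul, Nat.cast_mul]
        ring

end IsNormalFlow

/-- A time-independent Hermitian metric with bounds at the base point. -/
structure IsBackground (W : TimeWirtinger n A) (G₀ H₀ : Matrix (Fin n) (Fin n) A) (B : ℝ) :
    Prop where
  GH : G₀ * H₀ = 1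
  HG : H₀ * G₀ = 1
  herm : ∀ i j, W.cj (G₀ i j) = G₀ j i
  static : dmap W.t G₀ = 0
  pos : 1 ≤ B
  metric_le : ∀ i j, ‖W.ev (G₀ i j)‖ ≤ B
  inv_le : ∀ i j, ‖W.ev (H₀ i j)‖ ≤ B
  curv_le : ∀ i j k l, ‖W.ev (W.curv G₀ H₀ i j k l)‖ ≤ B
  covCurv_le : ∀ m i j k l, ‖W.ev (W.covCurv G₀ H₀ m i j k l)‖ ≤ B
  coercive : ∀ v : Fin n → ℂ, B⁻¹ * ∑ i, ‖v i‖ ^ 2 ≤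
    (∑ i, ∑ j, v i * W.ev (G₀ i j) * starRingEnd ℂ (v j)).re

end TimeWirtinger
end

/-! ### Evolution of `tr_g g₀` and of `|Γ - Γ₀|²` -/

noncomputable section

namespace TimeWirtinger

open Wirtinger

variable {n : ℕ} {A : Type*} [CommRing A] [Algebra ℂ A] {W : TimeWirtinger n A}

namespace IsNormalFlow

variable {G H G₀ H₀ : Matrix (Fin n) (Fin n) A} {B : ℝ}
  (h : W.IsNormalFlow G H) (hb : W.IsBackground G₀ H₀ B)
include h

theorem ev_connDiffSq : W.ev (W.connDiffSq G H G₀ H₀) =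
    ((∑ x : Idx3 n, ‖W.ev (W.connDiff G H G₀ H₀ x)‖ ^ 2 : ℝ) : ℂ) :=
  W.ev_wsq _ _ h.ev_weight3

theorem connDiffSq_nonneg : 0 ≤ (W.ev (W.connDiffSq G H G₀ H₀)).re := by
  rw [h.ev_connDiffSq, Complex.ofReal_re]; positivity

theorem rmSq_nonneg : 0 ≤ (W.ev (W.rmSq G H)).re := by
  rw [h.ev_rmSq, Complex.ofReal_re]; positivity

theorem ev_conn (m : Fin n) : W.evM (W.conn G H m) = 0 := by
  simp [Wirtinger.conn, h.ev_d]

/-- In normal coordinates `Γ` vanishes at the base point, so bounds on `Γ - Γ₀` are bounds on the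
coefficients of `Γ₀`. -/
theorem ev_connDiff (x : Idx3 n) :
    W.ev (W.connDiff G H G₀ H₀ x) = -W.ev (W.conn G₀ H₀ x.1 x.2.1 x.2.2) := by
  have := congrFun (congrFun (h.ev_conn x.1) x.2.1) x.2.2
  simp only [evM_apply, Matrix.zero_apply] at this
  simp [connDiff, this]

theorem sum_norm_conn_sq : ∑ m, ∑ i, ∑ k, ‖W.ev (W.conn G₀ H₀ m i k)‖ ^ 2 =
    (W.ev (W.connDiffSq G H G₀ H₀)).re := by
  rw [h.ev_connDiffSq, Complex.ofReal_re]
  simp only [h.ev_connDiff, norm_neg, Fintype.sum_prod_type]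

theorem norm_ev_conn_le (m i k : Fin n) :
    ‖W.ev (W.conn G₀ H₀ m i k)‖ ≤ Real.sqrt (W.ev (W.connDiffSq G H G₀ H₀)).re := by
  refine Real.le_sqrt_of_sq_le ?_
  rw [← h.sum_norm_conn_sq]
  calc _ ≤ ∑ k, ‖W.ev (W.conn G₀ H₀ m i k)‖ ^ 2 :=
        Finset.single_le_sum (f := fun k => ‖W.ev (W.conn G₀ H₀ m i k)‖ ^ 2)
          (fun _ _ => sq_nonneg _) (Finset.mem_univ k)
    _ ≤ ∑ i, ∑ k, ‖W.ev (W.conn G₀ H₀ m i k)‖ ^ 2 :=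
        Finset.single_le_sum (f := fun i => ∑ k, ‖W.ev (W.conn G₀ H₀ m i k)‖ ^ 2)
          (fun _ _ => Finset.sum_nonneg fun _ _ => sq_nonneg _) (Finset.mem_univ i)
    _ ≤ _ := Finset.single_le_sum (f := fun m => ∑ i, ∑ k, ‖W.ev (W.conn G₀ H₀ m i k)‖ ^ 2)
          (fun _ _ => Finset.sum_nonneg fun _ _ => Finset.sum_nonneg fun _ _ => sq_nonneg _)
          (Finset.mem_univ m)

theorem ev_relTrace : W.ev (relTrace H G₀) = ∑ i, W.ev (G₀ i i) := by
  simp [relTrace, h.ev_inv_apply]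

theorem ev_d_relTrace (p : Fin n) : W.ev (W.d p (relTrace H G₀)) = ∑ i, W.ev (W.d p (G₀ i i)) := by
  simp [relTrace, h.ev_inv_apply, Derivation.leibniz, (h.flat_inv _ _).ev_d]

theorem ev_db_relTrace (p : Fin n) :
    W.ev (W.db p (relTrace H G₀)) = ∑ i, W.ev (W.db p (G₀ i i)) := by
  simp [relTrace, h.ev_inv_apply, Derivation.leibniz, (h.flat_inv _ _).ev_db]

theorem ell_relTrace : W.ell (relTrace H G₀) = ∑ i, W.ell (G₀ i i) := by
  simp only [relTrace, W.ell_sum]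
  refine Finset.sum_congr rfl fun i _ => ?_
  have : ∀ j, W.ell (H j i * G₀ i j) = if j = i then W.ell (G₀ i j) else 0 := by
    intro j
    rw [W.ell_mul, (h.flat_inv j i).ell_eq, h.ev_inv_apply]
    simp [(h.flat_inv j i).ev_d, (h.flat_inv j i).ev_db]
  simp [this]

include hb

theorem ev_relTrace_im : (W.ev (relTrace H G₀)).im = 0 := by
  rw [h.ev_relTrace, Complex.im_sum]
  refine Finset.sum_eq_zero fun i _ => ?_
  rw [← Complex.conj_eq_iff_im, ← W.ev_cj, hb.herm]

theorem relTrace_nonneg : 0 ≤ (W.ev (relTrace H G₀)).re := by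
  rw [h.ev_relTrace, Complex.re_sum]
  refine Finset.sum_nonneg fun i _ => ?_
  have := hb.coercive (Pi.single i 1)
  have h1 : (∑ a, ∑ j, (Pi.single i 1 : Fin n → ℂ) a * W.ev (G₀ a j) *
      starRingEnd ℂ ((Pi.single i 1 : Fin n → ℂ) j)) = W.ev (G₀ i i) := by
    simp [Pi.single_apply, ite_mul, mul_ite]
  rw [h1] at this
  refine le_trans ?_ this
  have := hb.pos
  positivity

theorem relTrace_le : (W.ev (relTrace H G₀)).re ≤ n * B := by
  rw [h.ev_relTrace, Complex.re_sum]
  calc _ ≤ ∑ _i : Fin n, B := Finset.sum_le_sum fun i _ =>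
        (Complex.re_le_norm _).trans (hb.metric_le i i)
    _ = _ := by simp

/-- Since `g₀` is static and the weights are flat, only `-∂_p∂_{p̄} g₀` remains. It equals `Rm₀`
minus the term `Γ₀ g₀ Γ₀*`, and the latter is coercive. This yields the negative multiple of `|Γ -
Γ₀|²` on which the first test function rests. -/
theorem re_ell_relTrace_le : (W.ell (relTrace H G₀)).re ≤
    n ^ 2 * B - B⁻¹ * (W.ev (W.connDiffSq G H G₀ H₀)).re := by
  have h1 : ∀ p i, W.ev (W.d p (W.db p (G₀ i i))) = -W.ev (W.curv G₀ H₀ p p i i) +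
      ∑ k, ∑ l, W.ev (W.conn G₀ H₀ p i k) * W.ev (G₀ k l) *
        starRingEnd ℂ (W.ev (W.conn G₀ H₀ p i l)) := by
    intro p i
    have e1 : W.d p (W.db p (G₀ i i)) = -W.curv G₀ H₀ p p i i +
        (W.conn G₀ H₀ p * dmap (W.db p) G₀) i i := by
      simp [Wirtinger.curv, Wirtinger.conn]
    have e2 : ∀ k, W.db p (G₀ k i) = ∑ l, W.cj (W.conn G₀ H₀ p i l) * G₀ k l := by
      intro k
      rw [← hb.herm i k, W.db_cj, ← dmap_apply, W.dmap_d_eq_conn_mul hb.HG, Matrix.mul_apply,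
        map_sum]
      simp only [map_mul, hb.herm]
    rw [e1, map_add, map_neg, Matrix.mul_apply]
    simp only [dmap_apply, e2, map_sum, map_mul, W.ev_cj, Finset.mul_sum]
    congr 1
    exact Finset.sum_congr rfl fun k _ => Finset.sum_congr rfl fun l _ => by ring
  have h2 : ∀ i, W.ell (G₀ i i) = -∑ p, W.ev (W.d p (W.db p (G₀ i i))) := by
    intro i
    have := congrFun (congrFun hb.static i) i
    simp only [dmap_apply, Matrix.zero_apply] at this
    simp [ell, this]
  rw [h.ell_relTrace, ← h.sum_norm_conn_sq]
  simp only [h2, h1, Complex.re_sum, Complex.neg_re, Complex.add_re, neg_add_rev, neg_neg,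
    Finset.sum_add_distrib, ← Finset.sum_neg_distrib]
  rw [Finset.mul_sum, add_comm, sub_eq_add_neg, ← Finset.sum_neg_distrib]
  refine add_le_add ?_ ?_
  · calc _ ≤ ∑ _i : Fin n, ∑ _p : Fin n, B := Finset.sum_le_sum fun i _ =>
          Finset.sum_le_sum fun p _ => (Complex.re_le_norm _).trans (hb.curv_le p p i i)
      _ = _ := by simp; ring
  · rw [Finset.sum_comm]
    refine Finset.sum_le_sum fun p _ => ?_
    rw [Finset.mul_sum, ← Finset.sum_neg_distrib]
    refine Finset.sum_le_sum fun i _ => ?_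
    have := hb.coercive (fun k => W.ev (W.conn G₀ H₀ p i k))
    simp only [Complex.re_sum] at this
    simp only [Finset.sum_neg_distrib]
    linarith

/-- The derivative `∂g₀ = Γ₀ g₀` is linear in `Γ₀`, which is `Γ₀ - Γ` at the base point. -/
theorem gradSq_relTrace_le : W.gradSq (relTrace H G₀) ≤
    2 * n ^ 4 * B ^ 2 * n * (W.ev (W.connDiffSq G H G₀ H₀)).re := by
  set s := (W.ev (W.connDiffSq G H G₀ H₀)).re with hs
  have hs0 : 0 ≤ s := h.connDiffSq_nonneg
  have h1 : ∀ p i, ‖W.ev (W.d p (G₀ i i))‖ ≤ n * (Real.sqrt s * B) := by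
    intro p i
    have : W.ev (W.d p (G₀ i i)) = (W.evM (W.conn G₀ H₀ p) * W.evM G₀) i i := by
      rw [← map_mul, ← W.dmap_d_eq_conn_mul hb.HG]; rfl
    rw [this]
    exact norm_mul_entry_le (Real.sqrt_nonneg _) (fun i k => h.norm_ev_conn_le p i k)
      (fun i k => hb.metric_le i k) i i
  have h2 : ∀ p i, ‖W.ev (W.db p (G₀ i i))‖ ≤ n * (Real.sqrt s * B) := by
    intro p i
    rw [← hb.herm i i, W.db_cj, W.ev_cj, RCLike.norm_conj]
    exact h1 p i
  have h3 : ∀ a : Fin n → ℂ, (∀ i, ‖a i‖ ≤ n * (Real.sqrt s * B)) →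
      ‖∑ i, a i‖ ^ 2 ≤ n ^ 4 * B ^ 2 * s := by
    intro a ha
    have : ‖∑ i, a i‖ ≤ n * (n * (Real.sqrt s * B)) := by
      refine (norm_sum_le _ _).trans ((Finset.sum_le_sum fun i _ => ha i).trans ?_)
      simp
    calc _ ≤ _ := pow_le_pow_left₀ (norm_nonneg _) this 2
      _ = n ^ 4 * B ^ 2 * (Real.sqrt s * Real.sqrt s) := by ring
      _ = _ := by rw [Real.mul_self_sqrt hs0]
  calc W.gradSq (relTrace H G₀) ≤ ∑ _p : Fin n, (n ^ 4 * B ^ 2 * s + n ^ 4 * B ^ 2 * s) := by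
        refine Finset.sum_le_sum fun p _ => ?_
        rw [h.ev_d_relTrace, h.ev_db_relTrace]
        exact add_le_add (h3 _ fun i => h1 p i) (h3 _ fun i => h2 p i)
    _ = _ := by simp; ring

/-- The heat operator annihilates `Γ` at the base point and `Γ₀` is static, so what remains is the
Laplacian of `Γ₀`. By `∂̄Γ₀ = -Rm₀ H₀` this is a derivative of `Rm₀`, that is, `∇Rm₀` together with
terms linear in `Γ₀`. Only here is the bound on `∇Rm₀` needed. -/
theorem norm_ell_connDiff_le (x : Idx3 n) : ‖W.ell (W.connDiff G H G₀ H₀ x)‖ ≤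
    6 * n ^ 3 * B ^ 2 * (1 + Real.sqrt (W.ev (W.connDiffSq G H G₀ H₀)).re) := by
  obtain ⟨m, i, k⟩ := x
  set s := (W.ev (W.connDiffSq G H G₀ H₀)).re with hs
  set γ := Real.sqrt s with hγ
  have hγ0 : 0 ≤ γ := Real.sqrt_nonneg _
  have hB := hb.pos
  have hn : (1 : ℝ) ≤ n := by exact_mod_cast Nat.one_le_of_lt i.pos
  have hconn : ∀ m i k, ‖W.evM (W.conn G₀ H₀ m) i k‖ ≤ γ := fun m i k => h.norm_ev_conn_le m i k
  have hcurv : ∀ a b i k, ‖W.evM (W.curv G₀ H₀ a b) i k‖ ≤ B := fun a b i k => hb.curv_le a b i k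
  have h1 : W.ell (W.connDiff G H G₀ H₀ (m, i, k)) =
      -(W.ell (W.conn G₀ H₀ m i k)) := by
    rw [connDiff, Matrix.sub_apply, W.ell_sub, ← ellM_apply, h.ellM_conn]; simp
  have hst : W.t (W.conn G₀ H₀ m i k) = 0 := by
    have e1 : dmap W.t H₀ = 0 := by
      have e := congrArg (dmap W.t) hb.GH
      rw [dmap_mul, dmap_one, hb.static, zero_mul, zero_add] at e
      have e' : H₀ * (G₀ * dmap W.t H₀) = 0 := by rw [e, mul_zero]
      rwa [← mul_assoc, hb.HG, one_mul] at e'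
    have e2 : dmap W.t (W.conn G₀ H₀ m) = 0 := by
      rw [Wirtinger.conn, dmap_mul, e1, dmap_comm (W.t_d m), hb.static]
      ext a b; simp [Matrix.mul_apply]
    exact congrFun (congrFun e2 i) k
  have h2 : W.ell (W.conn G₀ H₀ m i k) =
      ∑ p, W.ev (dmap (W.d p) (W.curv G₀ H₀ m p * H₀) i k) := by
    rw [ell, hst, map_zero, zero_sub, ← Finset.sum_neg_distrib]
    refine Finset.sum_congr rfl fun p _ => ?_
    have e := congrFun (congrFun (W.dmap_db_conn hb.GH hb.HG m p) i) k
    rw [dmap_apply] at e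
    rw [e, Matrix.neg_apply, map_neg, map_neg, neg_neg, dmap_apply]
  have h3 : ∀ p, ‖W.ev (dmap (W.d p) (W.curv G₀ H₀ m p * H₀) i k)‖ ≤
      6 * n ^ 2 * B ^ 2 * (1 + γ) := by
    intro p
    rw [W.dmap_d_curv_mul hb.GH hb.HG, ← evM_apply, map_sub, map_mul, map_add, map_add, map_mul,
      map_mul, map_mul]
    have b1 : ∀ a c, ‖W.evM (∑ r, W.conn G₀ H₀ p m r • W.curv G₀ H₀ r p) a c‖ ≤ n * (γ * B) := by
      intro a c
      rw [evM_apply, Matrix.sum_apply, map_sum]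
      refine (norm_sum_le _ _).trans ?_
      calc _ ≤ ∑ _r : Fin n, γ * B := Finset.sum_le_sum fun r _ => by
            rw [Matrix.smul_apply, smul_eq_mul, map_mul, norm_mul]
            exact mul_le_mul (hconn p m r) (hcurv _ _ _ _) (norm_nonneg _) hγ0
        _ = _ := by simp
    have b2 : ∀ a c, ‖(W.evM (W.conn G₀ H₀ p) * W.evM (W.curv G₀ H₀ m p)) a c‖ ≤ n * (γ * B) :=
      norm_mul_entry_le hγ0 (hconn p) (hcurv m p)
    have b3 : ∀ a c, ‖(W.evM (W.covCurv G₀ H₀ p m p) +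
        W.evM (∑ r, W.conn G₀ H₀ p m r • W.curv G₀ H₀ r p) +
        W.evM (W.conn G₀ H₀ p) * W.evM (W.curv G₀ H₀ m p)) a c‖ ≤
        B + n * (γ * B) + n * (γ * B) := by
      intro a c
      refine (norm_add_le _ _).trans (add_le_add ((norm_add_le _ _).trans (add_le_add ?_ (b1 a c)))
        (b2 a c))
      exact hb.covCurv_le _ _ _ _ _
    have b4 := norm_mul_entry_le (by positivity) b3 (fun a c => hb.inv_le a c) i k
    have b5 : ∀ a c, ‖(W.evM H₀ * W.evM (W.conn G₀ H₀ p)) a c‖ ≤ n * (B * γ) :=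
      norm_mul_entry_le (by linarith) (fun a c => hb.inv_le a c) (hconn p)
    have b6 := norm_mul_entry_le (by linarith) (hcurv m p) b5 i k
    refine (norm_sub_le _ _).trans ((add_le_add b4 b6).trans ?_)
    have c1 : n * ((B + n * (γ * B) + n * (γ * B)) * B) + n * (B * (n * (B * γ))) =
      n * B ^ 2 + 3 * n ^ 2 * B ^ 2 * γ := by ring
    have c2 : (n : ℝ) * B ^ 2 ≤ n ^ 2 * B ^ 2 := by
      have : (n : ℝ) ≤ n ^ 2 := by nlinarith
      gcongr
    rw [c1]
    have c3 : 0 ≤ (n : ℝ) ^ 2 * B ^ 2 := by positivity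
    have c4 : 0 ≤ (n : ℝ) ^ 2 * B ^ 2 * γ := by positivity
    linarith
  rw [h1, norm_neg, h2]
  calc _ ≤ ∑ _p : Fin n, 6 * (n : ℝ) ^ 2 * B ^ 2 * (1 + γ) :=
        (norm_sum_le _ _).trans (Finset.sum_le_sum fun p _ => h3 p)
    _ = _ := by simp; ring

/-- The evolution inequality of `|Γ - Γ₀|²`. -/
theorem re_ell_connDiffSq_le : (W.ell (W.connDiffSq G H G₀ H₀)).re ≤
    24 * n ^ 6 * B ^ 2 * (1 + (W.ev (W.connDiffSq G H G₀ H₀)).re)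
      - ∑ x, W.gradSq (W.connDiff G H G₀ H₀ x) := by
  have h0 := W.re_ell_wsq (weight3 G H) (W.connDiff G H G₀ H₀) h.flat_weight3 h.ev_weight3
  rw [connDiffSq, h0, ← connDiffSq]
  refine sub_le_sub_right ?_ _
  set s := (W.ev (W.connDiffSq G H G₀ H₀)).re with hs
  have hs0 : 0 ≤ s := h.connDiffSq_nonneg
  have hγ : Real.sqrt s * Real.sqrt s = s := Real.mul_self_sqrt hs0
  have hγ1 : Real.sqrt s * (1 + Real.sqrt s) ≤ 2 * (1 + s) := by
    nlinarith [sq_nonneg (Real.sqrt s - 1), Real.sqrt_nonneg s]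
  calc _ ≤ 2 * ∑ _x : Idx3 n, Real.sqrt s * (6 * n ^ 3 * B ^ 2 * (1 + Real.sqrt s)) := by
        refine mul_le_mul_of_nonneg_left (Finset.sum_le_sum fun x _ => ?_) (by norm_num)
        refine (Complex.re_le_norm _).trans ?_
        rw [norm_mul, RCLike.norm_conj]
        refine mul_le_mul ?_ (h.norm_ell_connDiff_le hb x) (norm_nonneg _) (Real.sqrt_nonneg _)
        rw [h.ev_connDiff, norm_neg]
        exact h.norm_ev_conn_le _ _ _
    _ = 12 * n ^ 6 * B ^ 2 * (Real.sqrt s * (1 + Real.sqrt s)) := by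
        simp only [Finset.sum_const, Finset.card_univ, Fintype.card_prod, Fintype.card_fin,
          nsmul_eq_mul, Nat.cast_mul]
        ring
    _ ≤ 12 * n ^ 6 * B ^ 2 * (2 * (1 + s)) := by gcongr
    _ = _ := by ring

/-- At the base point `∂̄(Γ - Γ₀)` equals `-Rm` up to a bounded background term. Thus the negative
gradient in the evolution of `|Γ - Γ₀|²` supplies a negative multiple of `|Rm|²`, which dominates
the cubic reaction term of the curvature after multiplication with `|Rm|²`. -/
theorem rmSq_le_sum_gradSq : (W.ev (W.rmSq G H)).re ≤
    2 * ∑ x, W.gradSq (W.connDiff G H G₀ H₀ x) + 2 * n ^ 6 * B ^ 4 := by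
  have hB := hb.pos
  have h1 : ∀ m p i k, W.ev (W.db p (W.connDiff G H G₀ H₀ (m, i, k))) =
      -W.ev (W.curv G H m p i k) + (W.evM (W.curv G₀ H₀ m p) * W.evM H₀) i k := by
    intro m p i k
    have e1 := congrFun (congrFun (W.dmap_db_conn h.GH h.HG m p) i) k
    have e2 := congrFun (congrFun (W.dmap_db_conn hb.GH hb.HG m p) i) k
    rw [dmap_apply] at e1 e2
    rw [connDiff, Matrix.sub_apply, map_sub, e1, e2, ← map_mul, map_sub]
    have e3 : W.ev ((W.curv G H m p * H) i k) = W.ev (W.curv G H m p i k) := by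
      rw [← evM_apply, map_mul, h.ev_inv, mul_one, evM_apply]
    rw [Matrix.neg_apply, Matrix.neg_apply, map_neg, map_neg, e3, evM_apply]
    ring
  have h2 : ∀ m p i k, ‖W.ev (W.curv G H m p i k)‖ ^ 2 ≤
      2 * ‖W.ev (W.db p (W.connDiff G H G₀ H₀ (m, i, k)))‖ ^ 2 + 2 * n ^ 2 * B ^ 4 := by
    intro m p i k
    set y := (W.evM (W.curv G₀ H₀ m p) * W.evM H₀) i k with hy
    have e1 : ‖y‖ ≤ n * (B * B) :=
      norm_mul_entry_le (by linarith) (fun a c => hb.curv_le m p a c) (fun a c => hb.inv_le a c) i k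
    have e2 : W.ev (W.curv G H m p i k) = y - W.ev (W.db p (W.connDiff G H G₀ H₀ (m, i, k))) := by
      rw [h1]; ring
    have e3 : ‖y‖ ^ 2 ≤ n ^ 2 * B ^ 4 := by
      calc _ ≤ _ := pow_le_pow_left₀ (norm_nonneg _) e1 2
        _ = _ := by ring
    rw [e2]
    have e4 := norm_sub_le y (W.ev (W.db p (W.connDiff G H G₀ H₀ (m, i, k))))
    have e5 := pow_le_pow_left₀ (norm_nonneg _) e4 2
    nlinarith [sq_nonneg (‖y‖ - ‖W.ev (W.db p (W.connDiff G H G₀ H₀ (m, i, k)))‖)]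
  rw [h.ev_rmSq, Complex.ofReal_re]
  have h3 : ∑ m, ∑ p, ∑ i, ∑ k, ‖W.ev (W.db p (W.connDiff G H G₀ H₀ (m, i, k)))‖ ^ 2 ≤
      ∑ x, W.gradSq (W.connDiff G H G₀ H₀ x) := by
    simp only [Fintype.sum_prod_type]
    refine Finset.sum_le_sum fun m _ => ?_
    rw [Finset.sum_comm]
    refine Finset.sum_le_sum fun i _ => ?_
    rw [Finset.sum_comm]
    refine Finset.sum_le_sum fun k _ => Finset.sum_le_sum fun p _ => ?_
    have : 0 ≤ ‖W.ev (W.d p (W.connDiff G H G₀ H₀ (m, i, k)))‖ ^ 2 := sq_nonneg _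
    linarith
  calc _ ≤ ∑ m, ∑ p, ∑ i, ∑ k,
        (2 * ‖W.ev (W.db p (W.connDiff G H G₀ H₀ (m, i, k)))‖ ^ 2 + 2 * n ^ 2 * B ^ 4) := by
        simp only [Fintype.sum_prod_type]
        exact Finset.sum_le_sum fun m _ => Finset.sum_le_sum fun p _ =>
          Finset.sum_le_sum fun i _ => Finset.sum_le_sum fun k _ => h2 m p i k
    _ = 2 * ∑ m, ∑ p, ∑ i, ∑ k, ‖W.ev (W.db p (W.connDiff G H G₀ H₀ (m, i, k)))‖ ^ 2
        + 2 * n ^ 6 * B ^ 4 := by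
        simp only [Finset.sum_add_distrib, ← Finset.mul_sum]
        simp
        ring
    _ ≤ _ := by linarith

end IsNormalFlow

end TimeWirtinger
end

/-! ### Test functions with a quadratic sink -/

noncomputable section

/-- The left side is the heat operator of `s (K + τ)`. The cross term satisfies `x ≤ (c/2) s² +
(2e/c) D`; its first part uses half of the sink `-c s²`, and `K = 2e/c + 1` lets `-D (K + τ)` absorb
its second part. The terms linear in `s` use another quarter of the sink, and `τ ≤ N` converts the
rest into the square of `s (K + τ)`. -/
theorem connDiff_barrier {N a b c e K s τ D ls lτ x : ℝ} (ha : 0 ≤ a) (hc : 0 < c)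
    (he : 0 ≤ e) (hK : K = 2 * e / c + 1) (hs : 0 ≤ s) (hτ0 : 0 ≤ τ)
    (hτ : τ ≤ N) (hD : 0 ≤ D) (hls : ls ≤ a * (1 + s) - D) (hlτ : lτ ≤ b - c * s)
    (hx : x ^ 2 ≤ 4 * s * D * (e * s)) :
    s * lτ + ls * (K + τ) + x ≤ -(c / 4 / (K + N) ^ 2) * (s * (K + τ)) ^ 2
      + ((b + a * (K + N)) ^ 2 / c + a * (K + N)) := by
  have hq : 0 ≤ 2 * e / c := by positivity
  have hK1 : 1 ≤ K := by linarith
  have hx1 : x ≤ c / 2 * s ^ 2 + 2 * e / c * D := by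
    refine le_of_sq_le_sq ?_ (by positivity)
    have : 2 * e / c * (c / 2) = e := by field_simp
    have h2 : (c / 2 * s ^ 2 + 2 * e / c * D) ^ 2 =
      (c / 2 * s ^ 2 - 2 * e / c * D) ^ 2 + 4 * (2 * e / c * (c / 2)) * s ^ 2 * D := by ring
    rw [h2, this]
    nlinarith [sq_nonneg (c / 2 * s ^ 2 - 2 * e / c * D)]
  have h1 : s * lτ ≤ s * (b - c * s) := mul_le_mul_of_nonneg_left hlτ hs
  have h2 : ls * (K + τ) ≤ (a * (1 + s) - D) * (K + τ) :=
    mul_le_mul_of_nonneg_right hls (by linarith)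
  have h3 : a * (1 + s) * (K + τ) ≤ a * (1 + s) * (K + N) := by gcongr
  have h4 : 2 * e / c * D ≤ D * (K + τ) := by nlinarith
  have h5 : -(c / 4 / (K + N) ^ 2) * (s * (K + τ)) ^ 2 ≥ -(c / 4) * s ^ 2 := by
    have hKN : 0 < K + N := by linarith
    have h6 : (s * (K + τ)) ^ 2 ≤ (s * (K + N)) ^ 2 := by gcongr
    have h7 : c / 4 / (K + N) ^ 2 * (s * (K + N)) ^ 2 = c / 4 * s ^ 2 := by field_simp
    have h8 : 0 ≤ c / 4 / (K + N) ^ 2 := by positivity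
    nlinarith [mul_le_mul_of_nonneg_left h6 h8]
  have h6 : (b + a * (K + N)) * s ≤ c / 4 * s ^ 2 + (b + a * (K + N)) ^ 2 / c := by
    have : (b + a * (K + N)) ^ 2 / c + c / 4 * s ^ 2 - (b + a * (K + N)) * s =
      (b + a * (K + N) - c / 2 * s) ^ 2 / c := by field_simp; ring
    have h9 : 0 ≤ (b + a * (K + N) - c / 2 * s) ^ 2 / c := by positivity
    linarith
  nlinarith

/-- The left side is the heat operator of `ρ (K + s)`. The cross term satisfies `x ≤ ρ D / 2 + 8 S
E`, and `K = 8 S + 1` absorbs its second part into `-E (K + s)`. The remaining `-ρ D / 2` is at most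
`-ρ²/4 + e ρ / 4`. The term of order `ρ^{3/2}` costs `ρ²/16` and the linear terms cost `ρ²/8`, so
`-ρ²/16` survives. -/
theorem curvature_barrier {a b e K S ρ s D E lρ ls x : ℝ} (ha : 0 ≤ a) (hb : 0 ≤ b) (he : 0 ≤ e)
    (hK : K = 8 * S + 1) (hs : 0 ≤ s) (hsS : s ≤ S) (hρ : 0 ≤ ρ) (hD : 0 ≤ D) (hE : 0 ≤ E)
    (hlρ : lρ ≤ a * ρ * Real.sqrt ρ - E) (hls : ls ≤ b - D) (hρD : ρ ≤ 2 * D + e)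
    (hx : x ^ 2 ≤ 4 * ρ * E * (4 * s * D)) :
    ρ * ls + lρ * (K + s) + x ≤ -(1 / 16 / (K + S) ^ 2) * (ρ * (K + s)) ^ 2
      + 2 * (b + e / 4 + 4 * (a * (K + S)) ^ 2) ^ 2 := by
  have hS : 0 ≤ S := hs.trans hsS
  obtain ⟨y, hy⟩ : ∃ y, y = Real.sqrt ρ := ⟨_, rfl⟩
  rw [← hy] at hlρ
  have hy0 : 0 ≤ y := hy ▸ Real.sqrt_nonneg _
  have hy2 : y ^ 2 = ρ := hy ▸ Real.sq_sqrt hρ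
  have hx1 : x ≤ 1 / 2 * ρ * D + 8 * S * E := by
    refine le_of_sq_le_sq ?_ (by positivity)
    have h1 : 4 * ρ * E * (4 * s * D) ≤ 4 * ρ * E * (4 * S * D) := by gcongr
    have h2 : (1 / 2 * ρ * D + 8 * S * E) ^ 2 = (1 / 2 * ρ * D - 8 * S * E) ^ 2
      + 4 * ρ * E * (4 * S * D) := by ring
    linarith [sq_nonneg (1 / 2 * ρ * D - 8 * S * E)]
  have h1 : ρ * ls ≤ ρ * (b - D) := mul_le_mul_of_nonneg_left hls hρ
  have h2 : lρ * (K + s) ≤ (a * ρ * y - E) * (K + s) :=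
    mul_le_mul_of_nonneg_right hlρ (by linarith)
  have h3 : a * ρ * y * (K + s) ≤ a * ρ * y * (K + S) := by gcongr
  have h4 : 8 * S * E ≤ E * (K + s) := by
    have := mul_le_mul_of_nonneg_right (by linarith : 8 * S ≤ K + s) hE
    linarith
  have h5 : -(1 / 16 / (K + S) ^ 2) * (ρ * (K + s)) ^ 2 ≥ -(1 / 16) * ρ ^ 2 := by
    have hKN : 0 < K + S := by linarith
    have h6 : (ρ * (K + s)) ^ 2 ≤ (ρ * (K + S)) ^ 2 := by
      have : 0 ≤ K + s := by linarith
      gcongr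
    have h7 : 1 / 16 / (K + S) ^ 2 * (ρ * (K + S)) ^ 2 = 1 / 16 * ρ ^ 2 := by field_simp
    have h8 : 0 ≤ 1 / 16 / (K + S) ^ 2 := by positivity
    have h9 := mul_le_mul_of_nonneg_left h6 h8
    rw [h7] at h9
    linarith
  have h6 : a * ρ * y * (K + S) ≤ 1 / 16 * ρ ^ 2 + 4 * (a * (K + S)) ^ 2 * ρ := by
    have h7 : (a * (K + S)) * y ≤ y ^ 2 / 16 + 4 * (a * (K + S)) ^ 2 := by
      nlinarith [sq_nonneg (y / 4 - 2 * (a * (K + S)))]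
    rw [hy2] at h7
    have h8 := mul_le_mul_of_nonneg_left h7 hρ
    have h9 : ρ * (a * (K + S) * y) = a * ρ * y * (K + S) := by ring
    linarith
  have h7 : ρ * D ≥ ρ * (ρ - e) / 2 := by
    have := mul_le_mul_of_nonneg_left hρD hρ
    linarith
  obtain ⟨m, hm⟩ : ∃ m, m = b + e / 4 + 4 * (a * (K + S)) ^ 2 := ⟨_, rfl⟩
  rw [← hm]
  have h8 : m * ρ ≤ ρ ^ 2 / 8 + 2 * m ^ 2 := by
    linarith [sq_nonneg (ρ - 4 * m), (by ring : (ρ - 4 * m) ^ 2 = ρ ^ 2 - 8 * (m * ρ) + 16 * m ^ 2)]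
  have h9 : m * ρ = b * ρ + e / 4 * ρ + 4 * (a * (K + S)) ^ 2 * ρ := by rw [hm]; ring
  have e1 : ρ * (b - D) = b * ρ - ρ * D := by ring
  have e2 : (a * ρ * y - E) * (K + s) = a * ρ * y * (K + s) - E * (K + s) := by ring
  have e3 : ρ * (ρ - e) / 2 = ρ ^ 2 / 2 - e / 2 * ρ := by ring
  linarith

namespace TimeWirtinger

open Wirtinger

variable {n : ℕ} {A : Type} [CommRing A] [Algebra ℂ A]

/-- The test function `|Γ - Γ₀|² (K + tr_g g₀)`. -/
def connTest (W : TimeWirtinger n A) (K : ℝ) (G H G₀ H₀ : Matrix (Fin n) (Fin n) A) : A :=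
  W.connDiffSq G H G₀ H₀ * (algebraMap ℂ A K + relTrace H G₀)

/-- The test function `|Rm|² (K + |Γ - Γ₀|²)`. -/
def curvTest (W : TimeWirtinger n A) (K : ℝ) (G H G₀ H₀ : Matrix (Fin n) (Fin n) A) : A :=
  W.rmSq G H * (algebraMap ℂ A K + W.connDiffSq G H G₀ H₀)

theorem gradSq_algebraMap_add (W : TimeWirtinger n A) (c : ℂ) (a : A) :
    W.gradSq (algebraMap ℂ A c + a) = W.gradSq a := by
  simp [gradSq]

/-- The constants are chosen before the algebra: they depend on `n` and `B` only and serve at all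
points and times of all flows. -/
theorem exists_connTest_bound (n : ℕ) {B : ℝ} (hB : 1 ≤ B) : ∃ K c C : ℝ, 1 ≤ K ∧ 0 < c ∧ 0 ≤ C ∧
    ∀ (A : Type) [CommRing A] [Algebra ℂ A] (W : TimeWirtinger n A)
      (G H G₀ H₀ : Matrix (Fin n) (Fin n) A), W.IsNormalFlow G H → W.IsBackground G₀ H₀ B →
      (W.ell (W.connTest K G H G₀ H₀)).re ≤ -c * (W.ev (W.connTest K G H G₀ H₀)).re ^ 2 + C := by
  set a : ℝ := 24 * n ^ 6 * B ^ 2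
  set e : ℝ := 2 * n ^ 4 * B ^ 2 * n
  set K : ℝ := 2 * e / B⁻¹ + 1 with hK
  have hB0 : 0 < B := by linarith
  have ha : 0 ≤ a := by positivity
  have he : 0 ≤ e := by positivity
  have hK1 : 1 ≤ K := by
    have : 0 ≤ 2 * e / B⁻¹ := by positivity
    linarith
  refine ⟨K, B⁻¹ / 4 / (K + n * B) ^ 2,
    (n ^ 2 * B + a * (K + n * B)) ^ 2 / B⁻¹ + a * (K + n * B), hK1, ?_, ?_, ?_⟩
  · have : 0 < K + n * B := by positivity
    positivity
  · have : 0 ≤ K + n * B := by positivity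
    positivity
  · intro A _ _ W G H G₀ H₀ h hb
    have him : (W.ev (W.connDiffSq G H G₀ H₀)).im = 0 := by rw [h.ev_connDiffSq]; exact Complex.ofReal_im _
    have him2 := h.ev_relTrace_im hb
    obtain ⟨x, hx, hx2⟩ := W.re_ell_mul_le (W.connDiffSq G H G₀ H₀)
      (algebraMap ℂ A K + relTrace H G₀) him (by rw [map_add, W.ev_algebraMap]; simp [him2])
    rw [W.ell_add, W.ell_algebraMap, zero_add, map_add, W.ev_algebraMap, Complex.add_re,
      Complex.ofReal_re] at hx
    rw [gradSq_algebraMap_add] at hx2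
    have hev : (W.ev (W.connTest K G H G₀ H₀)).re =
        (W.ev (W.connDiffSq G H G₀ H₀)).re * (K + (W.ev (relTrace H G₀)).re) := by
      rw [connTest, map_mul, map_add, W.ev_algebraMap, Complex.mul_re, him]; simp
    rw [hev, connTest, hx]
    have hD : 0 ≤ ∑ x, W.gradSq (W.connDiff G H G₀ H₀ x) :=
      Finset.sum_nonneg fun _ _ => W.gradSq_nonneg _
    have hg : W.gradSq (W.connDiffSq G H G₀ H₀) ≤ 4 * (W.ev (W.connDiffSq G H G₀ H₀)).re *
        ∑ x, W.gradSq (W.connDiff G H G₀ H₀ x) := by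
      have := W.gradSq_wsq_le (weight3 G H) (W.connDiff G H G₀ H₀) h.flat_weight3 h.ev_weight3
      rwa [h.ev_connDiffSq, Complex.ofReal_re]
    refine connDiff_barrier ha (by positivity) he hK h.connDiffSq_nonneg (h.relTrace_nonneg hb)
      (h.relTrace_le hb) hD (h.re_ell_connDiffSq_le hb) (h.re_ell_relTrace_le hb)
      (hx2.trans (mul_le_mul hg (h.gradSq_relTrace_le hb) (W.gradSq_nonneg _) ?_))
    have := h.connDiffSq_nonneg (G₀ := G₀) (H₀ := H₀)
    positivity

theorem exists_curvTest_bound (n : ℕ) {B S : ℝ} (hB : 1 ≤ B) (hS : 0 ≤ S) :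
    ∃ K c C : ℝ, 1 ≤ K ∧ 0 < c ∧ 0 ≤ C ∧
    ∀ (A : Type) [CommRing A] [Algebra ℂ A] (W : TimeWirtinger n A)
      (G H G₀ H₀ : Matrix (Fin n) (Fin n) A), W.IsNormalFlow G H → W.IsBackground G₀ H₀ B →
      (W.ev (W.connDiffSq G H G₀ H₀)).re ≤ S →
      (W.ell (W.curvTest K G H G₀ H₀)).re ≤ -c * (W.ev (W.curvTest K G H G₀ H₀)).re ^ 2 + C := by
  set a : ℝ := 6 * n ^ 6
  set b : ℝ := 24 * n ^ 6 * B ^ 2 * (1 + S)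
  set e : ℝ := 2 * n ^ 6 * B ^ 4
  set K : ℝ := 8 * S + 1 with hK
  have hB0 : 0 < B := by linarith
  refine ⟨K, 1 / 16 / (K + S) ^ 2, 2 * (b + e / 4 + 4 * (a * (K + S)) ^ 2) ^ 2, by linarith,
    by positivity, by positivity, ?_⟩
  intro A _ _ W G H G₀ H₀ h hb hsS
  have him : (W.ev (W.connDiffSq G H G₀ H₀)).im = 0 := by rw [h.ev_connDiffSq]; exact Complex.ofReal_im _
  have him2 : (W.ev (W.rmSq G H)).im = 0 := by rw [h.ev_rmSq]; exact Complex.ofReal_im _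
  obtain ⟨x, hx, hx2⟩ := W.re_ell_mul_le (W.rmSq G H)
    (algebraMap ℂ A K + W.connDiffSq G H G₀ H₀) him2
    (by rw [map_add, W.ev_algebraMap]; simp [him])
  rw [W.ell_add, W.ell_algebraMap, zero_add, map_add, W.ev_algebraMap, Complex.add_re,
    Complex.ofReal_re] at hx
  rw [gradSq_algebraMap_add] at hx2
  have hev : (W.ev (W.curvTest K G H G₀ H₀)).re =
      (W.ev (W.rmSq G H)).re * (K + (W.ev (W.connDiffSq G H G₀ H₀)).re) := by
    rw [curvTest, map_mul, map_add, W.ev_algebraMap, Complex.mul_re, him2]; simp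
  rw [hev, curvTest, hx]
  have hD : 0 ≤ ∑ x, W.gradSq (W.connDiff G H G₀ H₀ x) :=
    Finset.sum_nonneg fun _ _ => W.gradSq_nonneg _
  have hE : 0 ≤ ∑ x : Idx4 n, W.gradSq (W.curv G H x.1.1 x.1.2 x.2.1 x.2.2) :=
    Finset.sum_nonneg fun _ _ => W.gradSq_nonneg _
  have hs0 := h.connDiffSq_nonneg (G₀ := G₀) (H₀ := H₀)
  have hρ0 := h.rmSq_nonneg
  have hg : W.gradSq (W.connDiffSq G H G₀ H₀) ≤ 4 * (W.ev (W.connDiffSq G H G₀ H₀)).re *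
      ∑ x, W.gradSq (W.connDiff G H G₀ H₀ x) := by
    have := W.gradSq_wsq_le (weight3 G H) (W.connDiff G H G₀ H₀) h.flat_weight3 h.ev_weight3
    rwa [h.ev_connDiffSq, Complex.ofReal_re]
  have hg2 : W.gradSq (W.rmSq G H) ≤ 4 * (W.ev (W.rmSq G H)).re *
      ∑ x : Idx4 n, W.gradSq (W.curv G H x.1.1 x.1.2 x.2.1 x.2.2) := by
    have := W.gradSq_wsq_le (weight4 H) (fun x : Idx4 n => W.curv G H x.1.1 x.1.2 x.2.1 x.2.2)
      h.flat_weight4 h.ev_weight4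
    rwa [h.ev_rmSq, Complex.ofReal_re]
  refine curvature_barrier (by positivity) (by positivity) (by positivity) hK hs0 hsS hρ0 hD hE
    h.re_ell_rmSq_le ((h.re_ell_connDiffSq_le hb).trans ?_) (h.rmSq_le_sum_gradSq hb)
    (hx2.trans (mul_le_mul hg2 hg (W.gradSq_nonneg _) (by positivity)))
  refine sub_le_sub_right ?_ _
  exact mul_le_mul_of_nonneg_left (by linarith) (by positivity)

end TimeWirtinger
end

/-! ### Tensors under holomorphic changes of coordinates -/

noncomputable section

open Kronecker

section HermSq

variable {A κ : Type*} [CommRing A] [Fintype κ]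

/-- Weighted Hermitian squares under linear changes. -/
theorem hermSq_mulVec (c : A →+* A) (w w' J : Matrix κ κ A) (hJ : J.transpose * w' * J.map c = w)
    (T : κ → A) : hermSq c w' (J.mulVec T) = hermSq c w T := by
  have h1 : ∀ (w : Matrix κ κ A) (T : κ → A), hermSq c w T = T ⬝ᵥ w.mulVec (c ∘ T) := by
    intro w T
    simp only [hermSq, dotProduct, Matrix.mulVec, Finset.mul_sum, Function.comp]
    exact Finset.sum_congr rfl fun x _ => Finset.sum_congr rfl fun y _ => by ring
  have h2 : c ∘ (J.mulVec T) = (J.map c).mulVec (c ∘ T) := by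
    ext x
    simp [Matrix.mulVec, dotProduct]
  rw [h1, h1, h2, ← hJ, Matrix.mulVec_mulVec, ← Matrix.mulVec_mulVec, ← Matrix.mulVec_mulVec,
    ← Matrix.mulVec_mulVec, Matrix.dotProduct_mulVec T, Matrix.vecMul_transpose]

end HermSq

section Weights

variable {n : ℕ} {A : Type*} [CommRing A] (c : A →+* A)

/-- Weights of the norm of a tensor with indices `ₘ,ᵢ,j̄,ₖ,l̄`. -/
def weight5 (H : Matrix (Fin n) (Fin n) A) : Matrix (Fin n × Idx4 n) (Fin n × Idx4 n) A :=
  H.transpose ⊗ₖ Matrix.of (weight4 H)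

/-- The change of tensors with indices `ᵢ,j̄,ₖ,l̄`. -/
def change4 (J : Matrix (Fin n) (Fin n) A) : Matrix (Idx4 n) (Idx4 n) A :=
  (J ⊗ₖ J.map c) ⊗ₖ (J ⊗ₖ J.map c)

/-- The change of tensors with indices `ₘ,ᵢ,j̄,ₖ,l̄`. -/
def change5 (J : Matrix (Fin n) (Fin n) A) : Matrix (Fin n × Idx4 n) (Fin n × Idx4 n) A :=
  J ⊗ₖ change4 c J

/-- The change of tensors with indices `ₘ,ᵢ,ᵏ`. -/
def change3 (J K : Matrix (Fin n) (Fin n) A) : Matrix (Idx3 n) (Idx3 n) A :=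
  J ⊗ₖ (J ⊗ₖ K.transpose)

variable {c} (hc : ∀ a, c (c a) = a)

theorem slot_eq {J H H' : Matrix (Fin n) (Fin n) A} (h : (J.map c).transpose * H' * J = H) :
    J.transpose * H'.transpose * J.map c = H.transpose := by
  rw [← h]
  simp [Matrix.transpose_mul, mul_assoc]

-- The weights form a Kronecker product with one factor per index, so invariance can be checked one
-- slot at a time.
include hc in
theorem weight4_change {J H H' : Matrix (Fin n) (Fin n) A}
    (h : (J.map c).transpose * H' * J = H) :
    (change4 c J).transpose * Matrix.of (weight4 H') * (change4 c J).map c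
      = Matrix.of (weight4 H) := by
  have hcc : (J.map c).map c = J := by ext; simp [hc]
  have hk : ∀ {m : Type} (M N : Matrix m m A), (M ⊗ₖ N).map c = M.map c ⊗ₖ N.map c := by
    intro m M N; ext; simp
  have ht : ∀ {m m' : Type} (M : Matrix m m A) (N : Matrix m' m' A),
      (M ⊗ₖ N).transpose = M.transpose ⊗ₖ N.transpose := by
    intros; rfl
  change (change4 c J).transpose * ((H'.transpose ⊗ₖ H') ⊗ₖ (H'.transpose ⊗ₖ H')) *
    (change4 c J).map c = (H.transpose ⊗ₖ H) ⊗ₖ (H.transpose ⊗ₖ H)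
  rw [change4, hk, hk, ht, ht, hcc]
  simp only [← Matrix.mul_kronecker_mul]
  rw [slot_eq h, h]

include hc in
theorem weight5_change {J H H' : Matrix (Fin n) (Fin n) A}
    (h : (J.map c).transpose * H' * J = H) :
    (change5 c J).transpose * weight5 H' * (change5 c J).map c = weight5 H := by
  have hk : (change5 c J).map c = J.map c ⊗ₖ (change4 c J).map c := by ext; simp [change5]
  have ht : (change5 c J).transpose = J.transpose ⊗ₖ (change4 c J).transpose := rfl
  rw [hk, ht, weight5, weight5, ← Matrix.mul_kronecker_mul, ← Matrix.mul_kronecker_mul,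
    weight4_change hc h, slot_eq h]

theorem weight3_change {J K G G' H H' : Matrix (Fin n) (Fin n) A}
    (h : (J.map c).transpose * H' * J = H) (h' : K * G' * (K.map c).transpose = G) :
    (change3 J K).transpose * Matrix.of (weight3 G' H') * (change3 J K).map c
      = Matrix.of (weight3 G H) := by
  have hk : (change3 J K).map c = J.map c ⊗ₖ (J.map c ⊗ₖ (K.map c).transpose) := by
    ext; simp [change3]
  have ht : (change3 J K).transpose = J.transpose ⊗ₖ (J.transpose ⊗ₖ K) := rfl
  change (change3 J K).transpose * (H'.transpose ⊗ₖ (H'.transpose ⊗ₖ G')) *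
    (change3 J K).map c = H.transpose ⊗ₖ (H.transpose ⊗ₖ G)
  rw [hk, ht]
  simp only [← Matrix.mul_kronecker_mul]
  rw [slot_eq h, h']

end Weights

theorem sum_reorder {ι M : Type*} [Fintype ι] [AddCommMonoid M] (f : ι → ι → ι → ι → M) :
    ∑ p, ∑ e, ∑ b, ∑ c, f p e b c = ∑ b, ∑ c, ∑ e, ∑ p, f p e b c := by
  calc _ = ∑ p, ∑ b, ∑ c, ∑ e, f p e b c := Finset.sum_congr rfl fun p _ =>
        Finset.sum_comm.trans (Finset.sum_congr rfl fun b _ => Finset.sum_comm)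
    _ = _ := Finset.sum_comm.trans (Finset.sum_congr rfl fun b _ =>
        Finset.sum_comm.trans (Finset.sum_congr rfl fun c _ => Finset.sum_comm))

theorem sum_rotate {ι M : Type*} [Fintype ι] [AddCommMonoid M] (f : ι → ι → ι → ι → M) :
    ∑ d, ∑ a, ∑ b, ∑ c, f d a b c = ∑ a, ∑ b, ∑ c, ∑ d, f d a b c :=
  Finset.sum_comm.trans (Finset.sum_congr rfl fun _ _ =>
    Finset.sum_comm.trans (Finset.sum_congr rfl fun _ _ => Finset.sum_comm))

/-- `|∇Rm|²`. -/
def Wirtinger.covCurvSq {n : ℕ} {A : Type*} [CommRing A] [Algebra ℂ A] (W : Wirtinger n A)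
    (G H : Matrix (Fin n) (Fin n) A) : A :=
  W.wsq (weight5 H) fun x => W.covCurv G H x.1 x.2.1.1 x.2.1.2 x.2.2.1 x.2.2.2

theorem Wirtinger.relTrace_eq_trace {n : ℕ} {R : Type*} [CommRing R]
    (H G₀ : Matrix (Fin n) (Fin n) R) : Wirtinger.relTrace H G₀ = (H * G₀).trace := by
  simp only [Wirtinger.relTrace, Matrix.trace, Matrix.diag, Matrix.mul_apply]
  exact Finset.sum_comm

/-- A holomorphic change of coordinates, with Jacobian `J` and inverse Jacobian `K`. -/
structure HolomorphicChange {n : ℕ} {A B : Type*} [CommRing A] [Algebra ℂ A] [CommRing B]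
    [Algebra ℂ B] (W : Wirtinger n A) (V : Wirtinger n B) (φ : A →+* B)
    (J K : Matrix (Fin n) (Fin n) B) : Prop where
  JK : J * K = 1
  KJ : K * J = 1
  d_map : ∀ i a, V.d i (φ a) = ∑ c, J i c * φ (W.d c a)
  db_map : ∀ i a, V.db i (φ a) = ∑ c, V.cj (J i c) * φ (W.db c a)
  db_jac : ∀ m i c, V.db m (J i c) = 0
  cj_map : ∀ a, V.cj (φ a) = φ (W.cj a)

namespace HolomorphicChange

variable {n : ℕ} {A B : Type*} [CommRing A] [Algebra ℂ A] [CommRing B]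
    [Algebra ℂ B] {W : Wirtinger n A} {V : Wirtinger n B} {φ : A →+* B}
    {J K : Matrix (Fin n) (Fin n) B} (h : HolomorphicChange W V φ J K)

/-- The conjugate transpose. -/
def _root_.Wirtinger.adj (V : Wirtinger n B) (J : Matrix (Fin n) (Fin n) B) :
    Matrix (Fin n) (Fin n) B := (J.map V.cj).transpose

theorem _root_.Wirtinger.adj_mul (V : Wirtinger n B) (J K : Matrix (Fin n) (Fin n) B) :
    V.adj (J * K) = V.adj K * V.adj J := by
  simp [Wirtinger.adj, Matrix.map_mul]

theorem _root_.Wirtinger.adj_one (V : Wirtinger n B) :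
    V.adj (1 : Matrix (Fin n) (Fin n) B) = 1 := by
  simp [Wirtinger.adj]

include h

theorem adj_KJ : V.adj J * V.adj K = 1 := by rw [← V.adj_mul, h.KJ, V.adj_one]

theorem dmap_d_map (i : Fin n) (M : Matrix (Fin n) (Fin n) A) :
    dmap (V.d i) (φ.mapMatrix M) = ∑ c, J i c • φ.mapMatrix (dmap (W.d c) M) := by
  ext a b
  simp [h.d_map, Matrix.sum_apply]

theorem dmap_db_map (i : Fin n) (M : Matrix (Fin n) (Fin n) A) :
    dmap (V.db i) (φ.mapMatrix M) = ∑ c, V.cj (J i c) • φ.mapMatrix (dmap (W.db c) M) := by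
  ext a b
  simp [h.db_map, Matrix.sum_apply]

theorem dmap_db_jac (i : Fin n) : dmap (V.db i) J = 0 := by
  ext a b; simp [h.db_jac]

theorem dmap_d_adj (i : Fin n) : dmap (V.d i) (V.adj J) = 0 := by
  ext a b; simp [Wirtinger.adj, V.d_cj, h.db_jac]

theorem d_cj_jac (i a b : Fin n) : V.d i (V.cj (J a b)) = 0 := by
  simp [V.d_cj, h.db_jac]

theorem inv_mul_inv {G H : Matrix (Fin n) (Fin n) A} (GH : G * H = 1) :
    (J * φ.mapMatrix G * V.adj J) * (V.adj K * φ.mapMatrix H * K) = 1 := by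
  have e : φ.mapMatrix G * φ.mapMatrix H = 1 := by rw [← map_mul, GH, map_one]
  calc _ = J * (φ.mapMatrix G * (V.adj J * V.adj K) * φ.mapMatrix H) * K := by noncomm_ring
    _ = 1 := by rw [h.adj_KJ, mul_one, e, mul_one, h.JK]

/-- Tensoriality rests on `∂̄J = 0`: derivatives of the Jacobian enter only as `∂J` and `∂̄J*`, and
all terms that contain one of them cancel between the second-order and the quadratic part of the
curvature. -/
theorem curv_eq {G H : Matrix (Fin n) (Fin n) A} (HG : H * G = 1) (i j : Fin n) :
    V.curv (J * φ.mapMatrix G * V.adj J) (V.adj K * φ.mapMatrix H * K) i j =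
      J * (∑ c, ∑ e, (J i c * V.cj (J j e)) • φ.mapMatrix (W.curv G H c e)) * V.adj J := by
  have hJ := h.dmap_db_jac j
  set X := ∑ c, J i c • φ.mapMatrix (dmap (W.d c) G) with hX
  set Y := ∑ e, V.cj (J j e) • φ.mapMatrix (dmap (W.db e) G) with hY
  set Z := ∑ c, ∑ e, (J i c * V.cj (J j e)) • φ.mapMatrix (dmap (W.d c) (dmap (W.db e) G)) with hZ
  have hYd : dmap (V.d i) Y = Z := by
    rw [hY, dmap_sum]
    simp only [dmap_smul, h.d_cj_jac, zero_smul, zero_add, h.dmap_d_map, Finset.smul_sum, smul_smul]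
    rw [Finset.sum_comm]
    exact Finset.sum_congr rfl fun c _ => Finset.sum_congr rfl fun e _ => by rw [mul_comm]
  have hsum : (∑ c, ∑ e, (J i c * V.cj (J j e)) • φ.mapMatrix (W.curv G H c e)) =
      -Z + X * φ.mapMatrix H * Y := by
    simp only [Wirtinger.curv, map_add, map_neg, map_mul, smul_add, Finset.sum_add_distrib,
      smul_neg, Finset.sum_neg_distrib]
    congr 1
    rw [hX, hY]
    simp only [Finset.sum_mul, Finset.mul_sum, smul_mul_assoc, mul_smul_comm]
    rw [Finset.sum_comm]
    refine Finset.sum_congr rfl fun e _ => ?_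
    rw [Finset.smul_sum]
    exact Finset.sum_congr rfl fun c _ => by rw [smul_smul, mul_comm]
  have e1 : φ.mapMatrix H * φ.mapMatrix G = 1 := by rw [← map_mul, HG, map_one]
  have e2 : φ.mapMatrix G * φ.mapMatrix H = 1 := mul_eq_one_comm.mp e1
  have e3 : dmap (V.d i) (dmap (V.db j) (V.adj J)) = 0 := by
    rw [dmap_comm (V.d_db i j), h.dmap_d_adj]
    ext; simp
  rw [hsum, Wirtinger.curv]
  simp only [dmap_mul, dmap_add, hJ, h.dmap_d_map, h.dmap_db_map, ← hX, ← hY, zero_mul, zero_add,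
    h.dmap_d_adj, mul_zero, add_zero, hYd, e3]
  set Q := dmap (V.db j) (V.adj J)
  set P := dmap (V.d i) J
  have e4 : (P * φ.mapMatrix G + J * X) * V.adj J * (V.adj K * φ.mapMatrix H * K) *
      (J * Y * V.adj J + J * φ.mapMatrix G * Q) =
      (P * φ.mapMatrix G + J * X) * φ.mapMatrix H * (Y * V.adj J + φ.mapMatrix G * Q) := by
    calc _ = (P * φ.mapMatrix G + J * X) * (V.adj J * V.adj K) * φ.mapMatrix H * (K * J) *
          (Y * V.adj J + φ.mapMatrix G * Q) := by noncomm_ring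
      _ = _ := by rw [h.adj_KJ, h.KJ, mul_one, mul_one]
  have e5 : (P * φ.mapMatrix G + J * X) * φ.mapMatrix H * (Y * V.adj J + φ.mapMatrix G * Q) =
      P * (φ.mapMatrix G * φ.mapMatrix H) * Y * V.adj J
      + P * (φ.mapMatrix G * φ.mapMatrix H) * φ.mapMatrix G * Q
      + J * X * φ.mapMatrix H * Y * V.adj J + J * X * (φ.mapMatrix H * φ.mapMatrix G) * Q := by
    noncomm_ring
  rw [e4, e5, e1, e2]
  noncomm_ring

/-- The inhomogeneous term `(∂J) K` does not involve the metric. It therefore drops out of the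
difference of two connections, and a suitable choice of `J` makes a given connection vanish at a
point. -/
theorem conn_eq {G H : Matrix (Fin n) (Fin n) A} (GH : G * H = 1) (i : Fin n) :
    V.conn (J * φ.mapMatrix G * V.adj J) (V.adj K * φ.mapMatrix H * K) i =
      dmap (V.d i) J * K + J * (∑ c, J i c • φ.mapMatrix (W.conn G H c)) * K := by
  have e1 : φ.mapMatrix G * φ.mapMatrix H = 1 := by rw [← map_mul, GH, map_one]
  set X := ∑ c, J i c • φ.mapMatrix (dmap (W.d c) G) with hX
  have hsum : (∑ c, J i c • φ.mapMatrix (W.conn G H c)) = X * φ.mapMatrix H := by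
    simp only [Wirtinger.conn, map_mul, hX, Finset.sum_mul, smul_mul_assoc]
  rw [hsum, Wirtinger.conn]
  simp only [dmap_mul, h.dmap_d_map, h.dmap_d_adj, ← hX, mul_zero, add_zero]
  calc _ = dmap (V.d i) J * (φ.mapMatrix G * (V.adj J * V.adj K) * φ.mapMatrix H) * K
        + J * X * (V.adj J * V.adj K) * φ.mapMatrix H * K := by noncomm_ring
    _ = _ := by
      rw [h.adj_KJ, mul_one, mul_one, e1]
      noncomm_ring

/-- The derivatives of the Jacobian in `∂ₘR` are compensated by the inhomogeneous parts of the two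
connection terms. -/
theorem covCurv_eq {G H : Matrix (Fin n) (Fin n) A} (GH : G * H = 1) (HG : H * G = 1)
    (m i j : Fin n) :
    V.covCurv (J * φ.mapMatrix G * V.adj J) (V.adj K * φ.mapMatrix H * K) m i j =
      J * (∑ b, ∑ c, ∑ e, (J m b * (J i c * V.cj (J j e))) • φ.mapMatrix (W.covCurv G H b c e))
        * V.adj J := by
  set G' := J * φ.mapMatrix G * V.adj J with hG'
  set H' := V.adj K * φ.mapMatrix H * K with hH'
  set T : Fin n → Matrix (Fin n) (Fin n) B := fun i =>
    ∑ c, ∑ e, (J i c * V.cj (J j e)) • φ.mapMatrix (W.curv G H c e) with hT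
  set Γ := ∑ b, J m b • φ.mapMatrix (W.conn G H b) with hΓ
  set P := dmap (V.d m) J with hP
  have hcurv : ∀ i, V.curv G' H' i j = J * T i * V.adj J := fun i => h.curv_eq HG i j
  have hconn : V.conn G' H' m = P * K + J * Γ * K := h.conn_eq GH m
  have h1 : dmap (V.d m) (J * T i * V.adj J) =
      P * T i * V.adj J + J * dmap (V.d m) (T i) * V.adj J := by
    simp only [dmap_mul, h.dmap_d_adj, mul_zero, add_zero]
    noncomm_ring
  have h2 : dmap (V.d m) (T i) =
      (∑ c, ∑ e, (P i c * V.cj (J j e)) • φ.mapMatrix (W.curv G H c e)) +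
      ∑ b, ∑ c, ∑ e, (J m b * (J i c * V.cj (J j e))) •
        φ.mapMatrix (dmap (W.d b) (W.curv G H c e)) := by
    simp only [hT, dmap_sum, dmap_smul, Derivation.leibniz, h.d_cj_jac, smul_zero, zero_add,
      h.dmap_d_map, Finset.sum_add_distrib, smul_eq_mul, Finset.smul_sum, smul_smul, mul_zero]
    congr 1
    · exact Finset.sum_congr rfl fun c _ => Finset.sum_congr rfl fun e _ => by
        rw [mul_comm, hP, dmap_apply]
    · symm
      rw [Finset.sum_comm]
      refine Finset.sum_congr rfl fun c _ => ?_
      rw [Finset.sum_comm]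
      exact Finset.sum_congr rfl fun e _ => Finset.sum_congr rfl fun b _ => by rw [mul_comm]
  have h3 : V.conn G' H' m * (J * T i * V.adj J) = P * T i * V.adj J + J * Γ * T i * V.adj J := by
    rw [hconn]
    calc _ = P * (K * J) * T i * V.adj J + J * Γ * (K * J) * T i * V.adj J := by noncomm_ring
      _ = _ := by rw [h.KJ, mul_one, mul_one]
  have hcJ : V.conn G' H' m * J = P + J * Γ := by
    rw [hconn]
    calc _ = P * (K * J) + J * Γ * (K * J) := by noncomm_ring
      _ = _ := by rw [h.KJ, mul_one, mul_one]
  have h4 : ∑ p, V.conn G' H' m i p • (J * T p * V.adj J) =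
      J * ((∑ c, ∑ e, (P i c * V.cj (J j e)) • φ.mapMatrix (W.curv G H c e)) +
        ∑ c, ∑ e, ((J * Γ) i c * V.cj (J j e)) • φ.mapMatrix (W.curv G H c e)) * V.adj J := by
    have e1 : ∑ p, V.conn G' H' m i p • T p =
        ∑ c, ∑ e, ((P + J * Γ) i c * V.cj (J j e)) • φ.mapMatrix (W.curv G H c e) := by
      rw [← hcJ]
      simp only [hT, Finset.smul_sum, smul_smul, Matrix.mul_apply, Finset.sum_mul, Finset.sum_smul]
      rw [Finset.sum_comm]
      refine Finset.sum_congr rfl fun c _ => ?_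
      rw [Finset.sum_comm]
      exact Finset.sum_congr rfl fun e _ => Finset.sum_congr rfl fun p _ => by rw [mul_assoc]
    have e2 : ∑ p, V.conn G' H' m i p • (J * T p * V.adj J) =
        J * (∑ p, V.conn G' H' m i p • T p) * V.adj J := by
      simp only [Finset.mul_sum, Finset.sum_mul, smul_mul_assoc, mul_smul_comm]
    rw [e2, e1]
    simp only [Matrix.add_apply, add_mul, add_smul, Finset.sum_add_distrib]
  have h5 : (∑ b, ∑ c, ∑ e, (J m b * (J i c * V.cj (J j e))) •
      φ.mapMatrix (W.covCurv G H b c e)) =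
      (∑ b, ∑ c, ∑ e, (J m b * (J i c * V.cj (J j e))) •
        φ.mapMatrix (dmap (W.d b) (W.curv G H c e)))
      - (∑ c, ∑ e, ((J * Γ) i c * V.cj (J j e)) • φ.mapMatrix (W.curv G H c e)) - Γ * T i := by
    have e1 : (∑ c, ∑ e, ((J * Γ) i c * V.cj (J j e)) • φ.mapMatrix (W.curv G H c e)) =
        ∑ b, ∑ c, ∑ e, (J m b * (J i c * V.cj (J j e))) •
          φ.mapMatrix (∑ p, W.conn G H b c p • W.curv G H p e) := by
      have e3 : ∀ p, (J * Γ) i p = ∑ b, ∑ c, J m b * J i c * φ (W.conn G H b c p) := by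
        intro p
        rw [Finset.sum_comm]
        simp only [hΓ, Matrix.mul_apply, Matrix.sum_apply, Matrix.smul_apply, Finset.mul_sum,
          smul_eq_mul, RingHom.mapMatrix_apply, Matrix.map_apply]
        exact Finset.sum_congr rfl fun c _ => Finset.sum_congr rfl fun b _ => by ring
      have e4 : ∀ b c e, φ.mapMatrix (∑ p, W.conn G H b c p • W.curv G H p e) =
          ∑ p, φ (W.conn G H b c p) • φ.mapMatrix (W.curv G H p e) := by
        intro b c e
        rw [map_sum]
        refine Finset.sum_congr rfl fun p _ => ?_
        ext; simp
      simp only [e3, e4, Finset.sum_mul, Finset.sum_smul, Finset.smul_sum, smul_smul]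
      rw [sum_reorder]
      exact Finset.sum_congr rfl fun b _ => Finset.sum_congr rfl fun c _ =>
        Finset.sum_congr rfl fun e _ => Finset.sum_congr rfl fun p _ => by
          congr 1; ring
    have e2 : Γ * T i = ∑ b, ∑ c, ∑ e, (J m b * (J i c * V.cj (J j e))) •
          φ.mapMatrix (W.conn G H b * W.curv G H c e) := by
      rw [hΓ, Finset.sum_mul]
      refine Finset.sum_congr rfl fun b _ => ?_
      simp only [hT, Finset.mul_sum]
      refine Finset.sum_congr rfl fun c _ => Finset.sum_congr rfl fun e _ => ?_
      rw [smul_mul_smul_comm, map_mul]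
    rw [e1, e2]
    simp only [← Finset.sum_sub_distrib, ← smul_sub]
    simp only [Wirtinger.covCurv, map_sub]
  rw [Wirtinger.covCurv]
  simp only [hcurv]
  rw [h1, h2, h3, h4, h5]
  noncomm_ring

/-- The components and the weights transform by the same matrix `change4`, so `hermSq_mulVec`
applies. -/
theorem rmSq_eq {G H : Matrix (Fin n) (Fin n) A} (HG : H * G = 1) :
    V.rmSq (J * φ.mapMatrix G * V.adj J) (V.adj K * φ.mapMatrix H * K) = φ (W.rmSq G H) := by
  have h1 : (fun x : Idx4 n => V.curv (J * φ.mapMatrix G * V.adj J) (V.adj K * φ.mapMatrix H * K)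
      x.1.1 x.1.2 x.2.1 x.2.2) = (change4 V.cj J).mulVec
        (fun x => φ (W.curv G H x.1.1 x.1.2 x.2.1 x.2.2)) := by
    ext ⟨⟨i, j⟩, k, l⟩
    simp only [h.curv_eq HG, Matrix.mulVec, dotProduct, Fintype.sum_prod_type, change4,
      Matrix.kroneckerMap_apply, Matrix.map_apply]
    simp only [Matrix.mul_apply, Matrix.sum_apply, Wirtinger.adj, Matrix.transpose_apply,
      Matrix.map_apply, Finset.sum_mul, Finset.mul_sum, Matrix.smul_apply, smul_eq_mul,
      RingHom.mapMatrix_apply]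
    rw [sum_rotate]
    exact Finset.sum_congr rfl fun a _ => Finset.sum_congr rfl fun b _ =>
      Finset.sum_congr rfl fun c _ => Finset.sum_congr rfl fun d _ => by ring
  have h2 : (V.adj J) * (V.adj K * φ.mapMatrix H * K) * J = φ.mapMatrix H := by
    calc _ = (V.adj J * V.adj K) * φ.mapMatrix H * (K * J) := by noncomm_ring
      _ = _ := by rw [h.adj_KJ, h.KJ, one_mul, mul_one]
  have h3 := hermSq_mulVec V.cj _ _ _ (weight4_change V.cj_cj h2)
    (fun x => φ (W.curv G H x.1.1 x.1.2 x.2.1 x.2.2))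
  rw [Wirtinger.rmSq, Wirtinger.wsq, h1]
  refine h3.trans ?_
  simp [hermSq, Wirtinger.rmSq, Wirtinger.wsq, weight4, h.cj_map]

theorem covCurvSq_eq {G H : Matrix (Fin n) (Fin n) A} (GH : G * H = 1) (HG : H * G = 1) :
    V.covCurvSq (J * φ.mapMatrix G * V.adj J) (V.adj K * φ.mapMatrix H * K) =
      φ (W.covCurvSq G H) := by
  have h1 : (fun x : Fin n × Idx4 n => V.covCurv (J * φ.mapMatrix G * V.adj J)
      (V.adj K * φ.mapMatrix H * K) x.1 x.2.1.1 x.2.1.2 x.2.2.1 x.2.2.2) =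
      (change5 V.cj J).mulVec
        (fun x => φ (W.covCurv G H x.1 x.2.1.1 x.2.1.2 x.2.2.1 x.2.2.2)) := by
    ext ⟨m, ⟨i, j⟩, k, l⟩
    simp only [h.covCurv_eq GH HG, Matrix.mulVec, dotProduct, Fintype.sum_prod_type, change5,
      change4, Matrix.kroneckerMap_apply, Matrix.map_apply]
    simp only [Matrix.mul_apply, Matrix.sum_apply, Wirtinger.adj, Matrix.transpose_apply,
      Matrix.map_apply, Finset.sum_mul, Finset.mul_sum, Matrix.smul_apply, smul_eq_mul,
      RingHom.mapMatrix_apply]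
    calc _ = ∑ d, ∑ e, ∑ a, ∑ b, ∑ c, (J m e * J i a * V.cj (J j b) * J k c * V.cj (J l d) *
          φ (W.covCurv G H e a b c d)) := by
          refine Finset.sum_congr rfl fun d _ => ?_
          exact Finset.sum_congr rfl fun e _ => Finset.sum_congr rfl fun a _ =>
            Finset.sum_congr rfl fun b _ => Finset.sum_congr rfl fun c _ => by ring
      _ = _ := by
          rw [Finset.sum_comm]
          refine Finset.sum_congr rfl fun e _ => ?_
          rw [sum_rotate]
          exact Finset.sum_congr rfl fun a _ => Finset.sum_congr rfl fun b _ =>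
            Finset.sum_congr rfl fun c _ => Finset.sum_congr rfl fun d _ => by ring
  have h2 : (V.adj J) * (V.adj K * φ.mapMatrix H * K) * J = φ.mapMatrix H := by
    calc _ = (V.adj J * V.adj K) * φ.mapMatrix H * (K * J) := by noncomm_ring
      _ = _ := by rw [h.adj_KJ, h.KJ, one_mul, mul_one]
  have h3 := hermSq_mulVec V.cj _ _ _ (weight5_change V.cj_cj h2)
    (fun x => φ (W.covCurv G H x.1 x.2.1.1 x.2.1.2 x.2.2.1 x.2.2.2))
  unfold Wirtinger.covCurvSq Wirtinger.wsq
  rw [h1]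
  refine h3.trans ?_
  simp [hermSq, Wirtinger.covCurvSq, Wirtinger.wsq, weight4, weight5, h.cj_map]

theorem connDiffSq_eq {G H G₀ H₀ : Matrix (Fin n) (Fin n) A} (GH : G * H = 1)
    (GH₀ : G₀ * H₀ = 1) :
    V.connDiffSq (J * φ.mapMatrix G * V.adj J) (V.adj K * φ.mapMatrix H * K)
      (J * φ.mapMatrix G₀ * V.adj J) (V.adj K * φ.mapMatrix H₀ * K) =
      φ (W.connDiffSq G H G₀ H₀) := by
  have h1 : V.connDiff (J * φ.mapMatrix G * V.adj J) (V.adj K * φ.mapMatrix H * K)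
      (J * φ.mapMatrix G₀ * V.adj J) (V.adj K * φ.mapMatrix H₀ * K) =
      (change3 J K).mulVec (fun x => φ (W.connDiff G H G₀ H₀ x)) := by
    ext ⟨m, i, k⟩
    have e : ∀ c, φ.mapMatrix (W.conn G H c) - φ.mapMatrix (W.conn G₀ H₀ c) =
        φ.mapMatrix (W.conn G H c - W.conn G₀ H₀ c) := fun c => (map_sub _ _ _).symm
    rw [Wirtinger.connDiff, h.conn_eq GH, h.conn_eq GH₀, add_sub_add_left_eq_sub, ← sub_mul,
      ← mul_sub, ← Finset.sum_sub_distrib]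
    simp only [← smul_sub, e]
    simp only [Matrix.mulVec, dotProduct, Fintype.sum_prod_type, change3,
      Matrix.kroneckerMap_apply, Matrix.transpose_apply]
    simp only [Matrix.mul_apply, Matrix.sum_apply, Finset.sum_mul, Finset.mul_sum,
      Matrix.smul_apply, smul_eq_mul, RingHom.mapMatrix_apply, Matrix.map_apply,
      Wirtinger.connDiff]
    refine (Finset.sum_comm.trans (Finset.sum_congr rfl fun _ _ => Finset.sum_comm)).trans ?_
    exact Finset.sum_congr rfl fun a _ => Finset.sum_congr rfl fun b _ =>
      Finset.sum_congr rfl fun c _ => by ring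
  have h2 : (V.adj J) * (V.adj K * φ.mapMatrix H * K) * J = φ.mapMatrix H := by
    calc _ = (V.adj J * V.adj K) * φ.mapMatrix H * (K * J) := by noncomm_ring
      _ = _ := by rw [h.adj_KJ, h.KJ, one_mul, mul_one]
  have h4 : K * (J * φ.mapMatrix G * V.adj J) * V.adj K = φ.mapMatrix G := by
    calc _ = (K * J) * φ.mapMatrix G * (V.adj J * V.adj K) := by noncomm_ring
      _ = _ := by rw [h.adj_KJ, h.KJ, one_mul, mul_one]
  have h3 := hermSq_mulVec V.cj _ _ _ (weight3_change h2 h4) (fun x => φ (W.connDiff G H G₀ H₀ x))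
  rw [Wirtinger.connDiffSq, Wirtinger.wsq, h1]
  refine h3.trans ?_
  simp [hermSq, Wirtinger.connDiffSq, Wirtinger.wsq, weight3, h.cj_map]

theorem relTrace_eq {G₀ H : Matrix (Fin n) (Fin n) A} :
    Wirtinger.relTrace (V.adj K * φ.mapMatrix H * K) (J * φ.mapMatrix G₀ * V.adj J) =
      φ (Wirtinger.relTrace H G₀) := by
  have h1 : (V.adj K * φ.mapMatrix H * K) * (J * φ.mapMatrix G₀ * V.adj J) =
      V.adj K * (φ.mapMatrix (H * G₀) * V.adj J) := by
    calc _ = V.adj K * φ.mapMatrix H * (K * J) * φ.mapMatrix G₀ * V.adj J := by noncomm_ring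
      _ = _ := by rw [h.KJ, map_mul]; noncomm_ring
  rw [Wirtinger.relTrace_eq_trace, Wirtinger.relTrace_eq_trace, h1, Matrix.trace_mul_comm, mul_assoc, h.adj_KJ, mul_one, RingHom.mapMatrix_apply,
    Matrix.trace, Matrix.trace, map_sum]
  rfl

end HolomorphicChange
end

noncomputable section

open Filter Topology

/-! ### Germs of smooth functions -/

section SmoothGerm

variable {V : Type*} [NormedAddCommGroup V] [NormedSpace ℝ V]

/-- The ring of germs at `p` of smooth complex functions. -/
def SmoothGerm (p : V) : Subring (Germ (𝓝 p) ℂ) where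
  carrier := {g | ∃ f : V → ℂ, ContDiffAt ℝ ∞ f p ∧ (f : Germ (𝓝 p) ℂ) = g}
  mul_mem' := by
    rintro _ _ ⟨f, hf, rfl⟩ ⟨g, hg, rfl⟩
    exact ⟨f * g, hf.mul hg, rfl⟩
  one_mem' := ⟨1, contDiffAt_const, rfl⟩
  add_mem' := by
    rintro _ _ ⟨f, hf, rfl⟩ ⟨g, hg, rfl⟩
    exact ⟨f + g, hf.add hg, rfl⟩
  zero_mem' := ⟨0, contDiffAt_const, rfl⟩
  neg_mem' := by
    rintro _ ⟨f, hf, rfl⟩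
    exact ⟨-f, hf.neg, rfl⟩

namespace SmoothGerm

variable {p : V}

/-- The germ of a smooth function. -/
def mk (f : V → ℂ) (hf : ContDiffAt ℝ ∞ f p) : SmoothGerm p := ⟨(f : Germ (𝓝 p) ℂ), f, hf, rfl⟩

theorem exists_rep (a : SmoothGerm p) : ∃ f hf, a = mk f hf := by
  obtain ⟨_, f, hf, rfl⟩ := a
  exact ⟨f, hf, rfl⟩

theorem mk_eq_mk {f g : V → ℂ} {hf : ContDiffAt ℝ ∞ f p} {hg : ContDiffAt ℝ ∞ g p} :
    mk f hf = mk g hg ↔ f =ᶠ[𝓝 p] g := by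
  exact ⟨fun h => Germ.coe_eq.mp (congrArg Subtype.val h), fun h => Subtype.ext (Germ.coe_eq.mpr h)⟩

theorem mk_add {f g : V → ℂ} (hf : ContDiffAt ℝ ∞ f p) (hg : ContDiffAt ℝ ∞ g p) :
    mk f hf + mk g hg = mk (fun x => f x + g x) (hf.add hg) := rfl

theorem mk_sum {ι : Type*} (s : Finset ι) {f : ι → V → ℂ} (hf : ∀ i, ContDiffAt ℝ ∞ (f i) p) :
    ∑ i ∈ s, mk (f i) (hf i) =
      mk (fun x => ∑ i ∈ s, f i x) (ContDiffAt.sum fun i _ => hf i) := by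
  classical
  induction s using Finset.induction_on with
  | empty => simp only [Finset.sum_empty]; rfl
  | insert i s hi ih =>
    rw [Finset.sum_insert hi, ih, mk_add, mk_eq_mk]
    exact Eventually.of_forall fun x => by simp [Finset.sum_insert hi]

/-- Constants. -/
def constHom (p : V) : ℂ →+* SmoothGerm p where
  toFun c := mk (fun _ => c) contDiffAt_const
  map_one' := rfl
  map_mul' _ _ := rfl
  map_zero' := rfl
  map_add' _ _ := rfl

instance : Algebra ℂ (SmoothGerm p) := (constHom p).toAlgebra

theorem smul_eq (c : ℂ) {f : V → ℂ} (hf : ContDiffAt ℝ ∞ f p) :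
    c • mk f hf = mk (fun x => c * f x) (contDiffAt_const.mul hf) := rfl

/-- Evaluation at the base point. -/
def eval (p : V) : SmoothGerm p →+* ℂ := (Germ.valueRingHom).comp (SmoothGerm p).subtype

theorem contDiffAt_conj {f : V → ℂ} (hf : ContDiffAt ℝ ∞ f p) :
    ContDiffAt ℝ ∞ (fun x => starRingEnd ℂ (f x)) p :=
  Complex.conjCLE.contDiff.contDiffAt.comp p hf

/-- Complex conjugation of germs. -/
def conjHom (p : V) : SmoothGerm p →+* SmoothGerm p where
  toFun a := ⟨Germ.map (starRingEnd ℂ) a.1, by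
    obtain ⟨_, f, hf, rfl⟩ := a
    exact ⟨_, contDiffAt_conj hf, rfl⟩⟩
  map_one' := by
    apply Subtype.ext
    change ((fun _ : V => starRingEnd ℂ 1 : V → ℂ) : Germ (𝓝 p) ℂ) = ((fun _ => 1 : V → ℂ) : Germ (𝓝 p) ℂ)
    simp
  map_mul' a b := by
    obtain ⟨f, hf, rfl⟩ := exists_rep a
    obtain ⟨g, hg, rfl⟩ := exists_rep b
    exact mk_eq_mk (hf := contDiffAt_conj (hf.mul hg))
      (hg := (contDiffAt_conj hf).mul (contDiffAt_conj hg)) |>.mpr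
      (Eventually.of_forall fun x => map_mul _ _ _)
  map_zero' := by
    apply Subtype.ext
    change ((fun _ : V => starRingEnd ℂ 0 : V → ℂ) : Germ (𝓝 p) ℂ) = ((fun _ => 0 : V → ℂ) : Germ (𝓝 p) ℂ)
    simp
  map_add' a b := by
    obtain ⟨f, hf, rfl⟩ := exists_rep a
    obtain ⟨g, hg, rfl⟩ := exists_rep b
    exact mk_eq_mk (hf := contDiffAt_conj (hf.add hg))
      (hg := (contDiffAt_conj hf).add (contDiffAt_conj hg)) |>.mpr
      (Eventually.of_forall fun x => map_add _ _ _)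

theorem conjHom_mk {f : V → ℂ} (hf : ContDiffAt ℝ ∞ f p) :
    conjHom p (mk f hf) = mk (fun x => starRingEnd ℂ (f x)) (contDiffAt_conj hf) := rfl

theorem contDiffAt_fderiv_apply {f : V → ℂ} (hf : ContDiffAt ℝ ∞ f p) (v : V) :
    ContDiffAt ℝ ∞ (fun x => fderiv ℝ f x v) p :=
  (hf.fderiv_right (m := ∞) (by simp)).clm_apply contDiffAt_const

/-- Directional derivatives of germs of functions. -/
def derivGerm (p v : V) : Germ (𝓝 p) ℂ → Germ (𝓝 p) ℂ :=
  Germ.map' (fun f x => fderiv ℝ f x v) fun _ _ h => h.fderiv.fun_comp fun L : V →L[ℝ] ℂ => L v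

theorem eventually_differentiableAt {f : V → ℂ} (hf : ContDiffAt ℝ ∞ f p) :
    ∀ᶠ x in 𝓝 p, DifferentiableAt ℝ f x := by
  have h1 : ContDiffAt ℝ 1 f p := hf.of_le (by exact_mod_cast le_top)
  filter_upwards [h1.eventually (by simp)] with x hx
  exact hx.differentiableAt (by simp)

/-- Directional derivatives as derivations. -/
def deriv (p v : V) : Derivation ℂ (SmoothGerm p) (SmoothGerm p) :=
  Derivation.mk'
    { toFun := fun a => ⟨derivGerm p v a.1, by
        obtain ⟨_, f, hf, rfl⟩ := a
        exact ⟨_, contDiffAt_fderiv_apply hf v, rfl⟩⟩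
      map_add' := fun a b => by
        obtain ⟨f, hf, rfl⟩ := exists_rep a
        obtain ⟨g, hg, rfl⟩ := exists_rep b
        refine mk_eq_mk (hf := contDiffAt_fderiv_apply (hf.add hg) v)
          (hg := (contDiffAt_fderiv_apply hf v).add (contDiffAt_fderiv_apply hg v)) |>.mpr ?_
        filter_upwards [eventually_differentiableAt hf, eventually_differentiableAt hg] with x h1 h2
        rw [fderiv_fun_add h1 h2]; rfl
      map_smul' := fun c a => by
        obtain ⟨f, hf, rfl⟩ := exists_rep a
        refine mk_eq_mk (hf := contDiffAt_fderiv_apply (contDiffAt_const.mul hf) v)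
          (hg := contDiffAt_const.mul (contDiffAt_fderiv_apply hf v)) |>.mpr ?_
        filter_upwards [eventually_differentiableAt hf] with x h1
        rw [fderiv_const_mul h1 c]; rfl }
    fun a b => by
      obtain ⟨f, hf, rfl⟩ := exists_rep a
      obtain ⟨g, hg, rfl⟩ := exists_rep b
      refine mk_eq_mk (hf := contDiffAt_fderiv_apply (hf.mul hg) v)
          (hg := (hf.mul (contDiffAt_fderiv_apply hg v)).add
            (hg.mul (contDiffAt_fderiv_apply hf v))) |>.mpr ?_
      filter_upwards [eventually_differentiableAt hf, eventually_differentiableAt hg] with x h1 h2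
      rw [fderiv_fun_mul h1 h2]; rfl

theorem deriv_mk (v : V) {f : V → ℂ} (hf : ContDiffAt ℝ ∞ f p) :
    deriv p v (mk f hf) = mk (fun x => fderiv ℝ f x v) (contDiffAt_fderiv_apply hf v) := rfl

theorem deriv_comm (v w : V) (a : SmoothGerm p) :
    deriv p v (deriv p w a) = deriv p w (deriv p v a) := by
  obtain ⟨f, hf, rfl⟩ := exists_rep a
  rw [deriv_mk, deriv_mk, deriv_mk, deriv_mk, mk_eq_mk]
  have h2 : ContDiffAt ℝ 2 f p := hf.of_le (WithTop.coe_le_coe.mpr le_top)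
  filter_upwards [h2.eventually (by simp)] with x hx
  have hs := hx.isSymmSndFDerivAt (by simp)
  have hd : DifferentiableAt ℝ (fderiv ℝ f) x :=
    (hx.fderiv_right (m := 1) (by norm_num)).differentiableAt (by simp)
  have key : ∀ a b : V, fderiv ℝ (fun y => fderiv ℝ f y a) x b = fderiv ℝ (fderiv ℝ f) x b a := by
    intro a b
    have := (hd.hasFDerivAt.clm_apply (hasFDerivAt_const a x)).fderiv
    rw [this]; simp
  rw [key, key]
  exact hs v w

theorem deriv_conj (v : V) (a : SmoothGerm p) :
    deriv p v (conjHom p a) = conjHom p (deriv p v a) := by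
  obtain ⟨f, hf, rfl⟩ := exists_rep a
  rw [conjHom_mk, deriv_mk, deriv_mk, conjHom_mk, mk_eq_mk]
  filter_upwards [eventually_differentiableAt hf] with x h1
  have : HasFDerivAt (fun y => starRingEnd ℂ (f y))
      ((Complex.conjCLE : ℂ →L[ℝ] ℂ).comp (fderiv ℝ f x)) x :=
    (Complex.conjCLE.hasFDerivAt).comp x h1.hasFDerivAt
  rw [this.fderiv]; rfl

theorem conjHom_smul (c : ℂ) (a : SmoothGerm p) :
    conjHom p (c • a) = starRingEnd ℂ c • conjHom p a := by
  obtain ⟨f, hf, rfl⟩ := exists_rep a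
  rw [smul_eq, conjHom_mk, conjHom_mk, smul_eq, mk_eq_mk]
  exact Eventually.of_forall fun x => map_mul _ _ _

/-- The Wirtinger derivations `∂ᵢ = (∂_{eᵢ} - √-1 ∂_{fᵢ}) / 2`. -/
def wirtinger {n : ℕ} (p : V) (e f : Fin n → V) : Wirtinger n (SmoothGerm p) where
  d i := (2⁻¹ : ℂ) • (deriv p (e i) - Complex.I • deriv p (f i))
  db i := (2⁻¹ : ℂ) • (deriv p (e i) + Complex.I • deriv p (f i))
  cj := conjHom p
  ev := eval p
  d_d i j a := by
    simp only [Derivation.smul_apply, Derivation.sub_apply, map_smul, map_sub, Derivation.map_smul]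
    rw [deriv_comm (e i), deriv_comm (e i), deriv_comm (f i), deriv_comm (f i)]
    module
  d_db i j a := by
    simp only [Derivation.smul_apply, Derivation.sub_apply, Derivation.add_apply, map_sub, map_add,
      Derivation.map_smul]
    rw [deriv_comm (e i), deriv_comm (e i), deriv_comm (f i), deriv_comm (f i)]
    module
  db_db i j a := by
    simp only [Derivation.smul_apply, Derivation.add_apply, map_add, Derivation.map_smul]
    rw [deriv_comm (e i), deriv_comm (e i), deriv_comm (f i), deriv_comm (f i)]
    module
  d_cj i a := by
    simp only [Derivation.smul_apply, Derivation.sub_apply, Derivation.add_apply, deriv_conj,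
      conjHom_smul, map_add, Complex.conj_I, neg_smul, map_inv₀, map_ofNat]
    rw [sub_eq_add_neg]
  db_cj i a := by
    simp only [Derivation.smul_apply, Derivation.sub_apply, Derivation.add_apply, deriv_conj,
      conjHom_smul, map_sub, Complex.conj_I, neg_smul, map_inv₀, map_ofNat]
    rw [sub_neg_eq_add]
  cj_cj a := by
    obtain ⟨f, hf, rfl⟩ := exists_rep a
    rw [conjHom_mk, conjHom_mk, mk_eq_mk]
    exact Eventually.of_forall fun x => Complex.conj_conj _
  ev_cj a := by
    obtain ⟨f, hf, rfl⟩ := exists_rep a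
    rfl
  ev_algebraMap c := rfl

/-- Wirtinger derivations together with a time derivative. -/
def timeWirtinger {n : ℕ} (p : V) (e f : Fin n → V) (τ : V) : TimeWirtinger n (SmoothGerm p) where
  toWirtinger := wirtinger p e f
  t := deriv p τ
  t_d i a := by
    simp only [wirtinger, Derivation.smul_apply, Derivation.sub_apply, Derivation.map_smul, map_sub]
    rw [deriv_comm τ, deriv_comm τ]
  t_db i a := by
    simp only [wirtinger, Derivation.smul_apply, Derivation.add_apply, Derivation.map_smul, map_add]
    rw [deriv_comm τ, deriv_comm τ]
  t_cj a := deriv_conj τ a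

end SmoothGerm

end SmoothGerm
end

noncomputable section

open Filter Topology

/-! ### Germs of time-dependent functions on `ℂⁿ` -/

section SpaceTime

variable {n : ℕ}

/-- The Wirtinger and time derivations of germs on space-time. -/
def stw (q : ℝ × CSpace n) : TimeWirtinger n (SmoothGerm q) :=
  SmoothGerm.timeWirtinger q (fun i => (0, EuclideanSpace.single i 1))
    (fun i => (0, EuclideanSpace.single i Complex.I)) (1, 0)

/-- `a` is the germ of `F`. -/
def IsRep {q : ℝ × CSpace n} (a : SmoothGerm q) (F : ℝ → CSpace n → ℂ) : Prop :=
  a.1 = ((fun x : ℝ × CSpace n => F x.1 x.2 : ℝ × CSpace n → ℂ) : Germ (𝓝 q) ℂ)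

variable {q : ℝ × CSpace n} {a b : SmoothGerm q} {F F' : ℝ → CSpace n → ℂ}

theorem isRep_mk (h : ContDiffAt ℝ ∞ (fun x : ℝ × CSpace n => F x.1 x.2) q) :
    IsRep (SmoothGerm.mk _ h) F := rfl

namespace IsRep

theorem contDiffAt (h : IsRep a F) : ContDiffAt ℝ ∞ (fun x : ℝ × CSpace n => F x.1 x.2) q := by
  obtain ⟨f, hf, rfl⟩ := SmoothGerm.exists_rep a
  exact hf.congr_of_eventuallyEq (Germ.coe_eq.mp h).symm

theorem eq_mk (h : IsRep a F) : a = SmoothGerm.mk _ h.contDiffAt := Subtype.ext h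

theorem eval_eq (h : IsRep a F) : (stw q).ev a = F q.1 q.2 := by
  rw [h.eq_mk]; rfl

theorem eq_of_eventuallyEq (h : IsRep a F) (h' : IsRep b F')
    (hF : ∀ᶠ x in 𝓝 q, F x.1 x.2 = F' x.1 x.2) : a = b := by
  rw [h.eq_mk, h'.eq_mk, SmoothGerm.mk_eq_mk]; exact hF

theorem congr (h : IsRep a F) (hF : ∀ᶠ x in 𝓝 q, F x.1 x.2 = F' x.1 x.2) : IsRep a F' :=
  Eq.trans h (Germ.coe_eq.mpr hF)

theorem add (h : IsRep a F) (h' : IsRep b F') : IsRep (a + b) fun t z => F t z + F' t z := by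
  rw [h.eq_mk, h'.eq_mk]; rfl

theorem sub (h : IsRep a F) (h' : IsRep b F') : IsRep (a - b) fun t z => F t z - F' t z := by
  rw [h.eq_mk, h'.eq_mk]; rfl

theorem neg (h : IsRep a F) : IsRep (-a) fun t z => -F t z := by
  rw [h.eq_mk]; rfl

theorem mul (h : IsRep a F) (h' : IsRep b F') : IsRep (a * b) fun t z => F t z * F' t z := by
  rw [h.eq_mk, h'.eq_mk]; rfl

theorem sum {ι : Type*} {s : Finset ι} {a : ι → SmoothGerm q} {F : ι → ℝ → CSpace n → ℂ}
    (h : ∀ i, IsRep (a i) (F i)) : IsRep (∑ i ∈ s, a i) fun t z => ∑ i ∈ s, F i t z := by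
  rw [Finset.sum_congr rfl fun i _ => (h i).eq_mk, SmoothGerm.mk_sum]; rfl

theorem const (c : ℂ) : IsRep (algebraMap ℂ (SmoothGerm q) c) fun _ _ => c := rfl

theorem cj (h : IsRep a F) : IsRep ((stw q).cj a) fun t z => conj (F t z) := by
  rw [h.eq_mk]; rfl

theorem t (h : IsRep a F) :
    IsRep ((stw q).t a) fun t z => fderiv ℝ (fun x : ℝ × CSpace n => F x.1 x.2) (t, z) (1, 0) := by
  rw [h.eq_mk]; rfl

/-- The local formulas differentiate a time slice, the derivations of `stw` differentiate on
space-time. The two agree near the base point, hence also as germs that may be differentiated again.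
-/
theorem eventually_slice (h : IsRep a F) : ∀ᶠ x in 𝓝 q, ∀ v,
    fderiv ℝ (F x.1) x.2 v = fderiv ℝ (fun x : ℝ × CSpace n => F x.1 x.2) x (0, v) := by
  filter_upwards [SmoothGerm.eventually_differentiableAt h.contDiffAt] with x hx v
  have h1 : HasFDerivAt (fun z : CSpace n => (x.1, z)) (ContinuousLinearMap.inr ℝ ℝ (CSpace n)) x.2 :=
    hasFDerivAt_prodMk_right x.1 x.2
  have h2 : HasFDerivAt (F x.1) _ x.2 := HasFDerivAt.comp (g := fun x : ℝ × CSpace n => F x.1 x.2)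
    x.2 (f := fun z => (x.1, z)) hx.hasFDerivAt h1
  rw [h2.fderiv]; rfl

theorem d (h : IsRep a F) (i : Fin n) : IsRep ((stw q).d i a) fun t z => dz i (F t) z := by
  have h1 : IsRep ((stw q).d i a) fun t z =>
      2⁻¹ * (fderiv ℝ (fun x : ℝ × CSpace n => F x.1 x.2) (t, z) (0, EuclideanSpace.single i 1)
      - Complex.I * fderiv ℝ (fun x : ℝ × CSpace n => F x.1 x.2) (t, z)
        (0, EuclideanSpace.single i Complex.I)) := by
    rw [h.eq_mk]; rfl
  refine h1.congr ?_
  filter_upwards [h.eventually_slice] with x hx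
  rw [dz, hx, hx]; ring

theorem db (h : IsRep a F) (i : Fin n) : IsRep ((stw q).db i a) fun t z => dzbar i (F t) z := by
  have h1 : IsRep ((stw q).db i a) fun t z =>
      2⁻¹ * (fderiv ℝ (fun x : ℝ × CSpace n => F x.1 x.2) (t, z) (0, EuclideanSpace.single i 1)
      + Complex.I * fderiv ℝ (fun x : ℝ × CSpace n => F x.1 x.2) (t, z)
        (0, EuclideanSpace.single i Complex.I)) := by
    rw [h.eq_mk]; rfl
  refine h1.congr ?_
  filter_upwards [h.eventually_slice] with x hx
  rw [dzbar, hx, hx]; ring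

end IsRep

/-- The matrix germ `M` is the germ of the family `G`. -/
def IsRepM (M : Matrix (Fin n) (Fin n) (SmoothGerm q))
    (G : ℝ → CSpace n → Matrix (Fin n) (Fin n) ℂ) : Prop :=
  ∀ i j, IsRep (M i j) fun t z => G t z i j

variable {M N : Matrix (Fin n) (Fin n) (SmoothGerm q)}
  {G G' : ℝ → CSpace n → Matrix (Fin n) (Fin n) ℂ}

theorem IsRepM.mul (h : IsRepM M G) (h' : IsRepM N G') :
    IsRepM (M * N) fun t z => G t z * G' t z := fun i j => by
  simp only [Matrix.mul_apply]
  exact IsRep.sum fun k => (h i k).mul (h' k j)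

theorem IsRepM.eq_of_eventuallyEq (h : IsRepM M G) (h' : IsRepM N G')
    (hG : ∀ᶠ x in 𝓝 q, G x.1 x.2 = G' x.1 x.2) : M = N := by
  ext1 i j
  exact (h i j).eq_of_eventuallyEq (h' i j) (hG.mono fun x hx => by rw [hx])

theorem IsRepM.congr (h : IsRepM M G) (hG : ∀ᶠ x in 𝓝 q, G x.1 x.2 = G' x.1 x.2) : IsRepM M G' :=
  fun i j => (h i j).congr (hG.mono fun x hx => by rw [hx])

theorem IsRepM.one : IsRepM (1 : Matrix (Fin n) (Fin n) (SmoothGerm q)) fun _ _ => 1 := by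
  intro i j
  by_cases h : i = j
  · subst h; simp only [Matrix.one_apply_eq]; rfl
  · simp only [Matrix.one_apply_ne h]; rfl

section Curvature

variable (h : IsRepM M G) (h' : IsRepM N fun t z => (G t z)⁻¹)
include h h'

theorem IsRepM.conn (m i p : Fin n) :
    IsRep ((stw q).conn M N m i p) fun t z => christoffel (G t) p m i z := by
  have : IsRep (∑ r, N r p * (stw q).d m (M i r))
      fun t z => christoffel (G t) p m i z :=
    IsRep.sum fun r => (h' r p).mul ((h i r).d m)
  convert this using 1
  simp only [Wirtinger.conn, Matrix.mul_apply, dmap_apply]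
  exact Finset.sum_congr rfl fun r _ => mul_comm _ _

theorem IsRepM.curv (i j k l : Fin n) :
    IsRep ((stw q).curv M N i j k l) fun t z => curvature (G t) i j k l z := by
  have : IsRep (-(stw q).d i ((stw q).db j (M k l)) +
      ∑ p, ∑ r, N r p * (stw q).d i (M k r) * (stw q).db j (M p l))
      fun t z => curvature (G t) i j k l z :=
    (((h k l).db j).d i).neg.add (IsRep.sum fun p => IsRep.sum fun r =>
      ((h' r p).mul ((h k r).d i)).mul ((h p l).db j))
  convert this using 1
  simp only [Wirtinger.curv, Matrix.add_apply, Matrix.neg_apply, Matrix.mul_apply, dmap_apply,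
    Finset.sum_mul]
  congr 1
  exact Finset.sum_congr rfl fun p _ => Finset.sum_congr rfl fun r _ => by ring

theorem IsRepM.covCurv (m i j k l : Fin n) :
    IsRep ((stw q).covCurv M N m i j k l) fun t z => covCurvature (G t) m i j k l z := by
  have : IsRep ((stw q).d m ((stw q).curv M N i j k l)
      - ∑ p, (stw q).conn M N m i p * (stw q).curv M N p j k l
      - ∑ p, (stw q).conn M N m k p * (stw q).curv M N i j p l)
      fun t z => covCurvature (G t) m i j k l z :=
    (((h.curv h' i j k l).d m).sub (IsRep.sum fun p => (h.conn h' m i p).mul (h.curv h' p j k l))).sub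
      (IsRep.sum fun p => (h.conn h' m k p).mul (h.curv h' i j p l))
  convert this using 1
  simp only [Wirtinger.covCurv, Matrix.sub_apply, Matrix.sum_apply, Matrix.smul_apply,
    Matrix.mul_apply, dmap_apply, smul_eq_mul]

end Curvature

/-! ### Pointwise test functions -/

/-- `|Rm|²` as a complex number. -/
def rmSqAt (G : CSpace n → Matrix (Fin n) (Fin n) ℂ) (z : CSpace n) : ℂ :=
  hermSq (starRingEnd ℂ) (weight4 (G z)⁻¹) fun x => curvature G x.1.1 x.1.2 x.2.1 x.2.2 z

/-- `|∇Rm|²` as a complex number. -/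
def covCurvSqAt (G : CSpace n → Matrix (Fin n) (Fin n) ℂ) (z : CSpace n) : ℂ :=
  hermSq (starRingEnd ℂ) (weight5 (G z)⁻¹)
    fun x => covCurvature G x.1 x.2.1.1 x.2.1.2 x.2.2.1 x.2.2.2 z

/-- `|Γ - Γ₀|²` as a complex number. -/
def connDiffSqAt (G G₀ : CSpace n → Matrix (Fin n) (Fin n) ℂ) (z : CSpace n) : ℂ :=
  hermSq (starRingEnd ℂ) (weight3 (G z) (G z)⁻¹)
    fun x => christoffel G x.2.2 x.1 x.2.1 z - christoffel G₀ x.2.2 x.1 x.2.1 z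

/-- `|Γ - Γ₀|² (K + tr_g g₀)`. -/
def connTestAt (K : ℝ) (G G₀ : CSpace n → Matrix (Fin n) (Fin n) ℂ) (z : CSpace n) : ℂ :=
  connDiffSqAt G G₀ z * (K + Wirtinger.relTrace (G z)⁻¹ (G₀ z))

/-- `|Rm|² (K + |Γ - Γ₀|²)`. -/
def curvTestAt (K : ℝ) (G G₀ : CSpace n → Matrix (Fin n) (Fin n) ℂ) (z : CSpace n) : ℂ :=
  rmSqAt G z * (K + connDiffSqAt G G₀ z)

theorem curvatureNormSq_eq (G : CSpace n → Matrix (Fin n) (Fin n) ℂ) (z : CSpace n) :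
    curvatureNormSq G z = (rmSqAt G z).re := by
  simp only [curvatureNormSq, rmSqAt, hermSq, Fintype.sum_prod_type]
  refine congrArg Complex.re ?_
  refine Finset.sum_congr rfl fun i _ => Finset.sum_congr rfl fun j _ =>
    Finset.sum_congr rfl fun k _ => Finset.sum_congr rfl fun l _ => Finset.sum_congr rfl fun a _ =>
    Finset.sum_congr rfl fun b _ => Finset.sum_congr rfl fun c _ => Finset.sum_congr rfl fun d _ => ?_
  change _ = (G z)⁻¹ a i * (G z)⁻¹ j b * ((G z)⁻¹ c k * (G z)⁻¹ l d) *
    (curvature G i j k l z * conj (curvature G a b c d z))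
  ring

theorem covCurvatureNormSq_eq (G : CSpace n → Matrix (Fin n) (Fin n) ℂ) (z : CSpace n) :
    covCurvatureNormSq G z = (covCurvSqAt G z).re := by
  simp only [covCurvatureNormSq, covCurvSqAt, hermSq, Fintype.sum_prod_type]
  refine congrArg Complex.re ?_
  refine Finset.sum_congr rfl fun m _ => Finset.sum_congr rfl fun i _ =>
    Finset.sum_congr rfl fun j _ => Finset.sum_congr rfl fun k _ => Finset.sum_congr rfl fun l _ =>
    Finset.sum_congr rfl fun e _ => Finset.sum_congr rfl fun a _ => Finset.sum_congr rfl fun b _ =>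
    Finset.sum_congr rfl fun c _ => Finset.sum_congr rfl fun d _ => ?_
  change _ = (G z)⁻¹ e m * ((G z)⁻¹ a i * (G z)⁻¹ j b * ((G z)⁻¹ c k * (G z)⁻¹ l d)) *
    (covCurvature G m i j k l z * conj (covCurvature G e a b c d z))
  ring

theorem IsRep.hermSq {κ : Type*} [Fintype κ] {w : κ → κ → SmoothGerm q} {T : κ → SmoothGerm q}
    {w' : ℝ → CSpace n → κ → κ → ℂ} {T' : ℝ → CSpace n → κ → ℂ}
    (hw : ∀ x y, IsRep (w x y) fun t z => w' t z x y) (hT : ∀ x, IsRep (T x) fun t z => T' t z x) :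
    IsRep (hermSq (stw q).cj w T) fun t z => _root_.hermSq (starRingEnd ℂ) (w' t z) (T' t z) :=
  IsRep.sum fun x => IsRep.sum fun y => (hw x y).mul ((hT x).mul (hT y).cj)

section Tests

variable {M₀ N₀ : Matrix (Fin n) (Fin n) (SmoothGerm q)}
  {G₀ : ℝ → CSpace n → Matrix (Fin n) (Fin n) ℂ}
variable (h : IsRepM M G) (h' : IsRepM N fun t z => (G t z)⁻¹)
include h h'

theorem IsRepM.rmSq : IsRep ((stw q).rmSq M N) fun t z => rmSqAt (G t) z :=
  IsRep.hermSq (w' := fun t z => weight4 (G t z)⁻¹)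
    (fun x y => ((h' _ _).mul (h' _ _)).mul ((h' _ _).mul (h' _ _)))
    fun x => h.curv h' _ _ _ _

theorem IsRepM.covCurvSq : IsRep ((stw q).covCurvSq M N) fun t z => covCurvSqAt (G t) z :=
  IsRep.hermSq (w' := fun t z => weight5 (G t z)⁻¹)
    (fun x y => (h' _ _).mul (((h' _ _).mul (h' _ _)).mul ((h' _ _).mul (h' _ _))))
    fun x => h.covCurv h' _ _ _ _ _

variable (h₀ : IsRepM M₀ G₀) (h₀' : IsRepM N₀ fun t z => (G₀ t z)⁻¹)
include h₀ h₀'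

theorem IsRepM.connDiffSq :
    IsRep ((stw q).connDiffSq M N M₀ N₀) fun t z => connDiffSqAt (G t) (G₀ t) z :=
  IsRep.hermSq (w' := fun t z => weight3 (G t z) (G t z)⁻¹)
    (fun x y => (h' _ _).mul ((h' _ _).mul (h _ _)))
    fun x => (h.conn h' _ _ _).sub (h₀.conn h₀' _ _ _)

omit h h₀' in
theorem IsRepM.relTrace :
    IsRep (Wirtinger.relTrace N M₀) fun t z => Wirtinger.relTrace (G t z)⁻¹ (G₀ t z) :=
  IsRep.sum fun i => IsRep.sum fun j => (h' j i).mul (h₀ i j)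

theorem IsRepM.connTest (K : ℝ) :
    IsRep ((stw q).connTest K M N M₀ N₀) fun t z => connTestAt K (G t) (G₀ t) z :=
  (h.connDiffSq h' h₀ h₀').mul ((IsRep.const _).add (IsRepM.relTrace h' h₀))

theorem IsRepM.curvTest (K : ℝ) :
    IsRep ((stw q).curvTest K M N M₀ N₀) fun t z => curvTestAt K (G t) (G₀ t) z :=
  (h.rmSq h').mul ((IsRep.const _).add (h.connDiffSq h' h₀ h₀'))

end Tests

end SpaceTime
end

noncomputable section

open Filter Topology

/-! ### Smoothness of inverse matrices -/

section MatrixSmooth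

variable {n : ℕ} {E : Type*} [NormedAddCommGroup E] [NormedSpace ℝ E]
  {M : E → Matrix (Fin n) (Fin n) ℂ} {s : Set E} {x : E}

theorem contDiffWithinAt_det (h : ∀ i j, ContDiffWithinAt ℝ ∞ (fun y => M y i j) s x) :
    ContDiffWithinAt ℝ ∞ (fun y => (M y).det) s x := by
  simp only [Matrix.det_apply]
  exact ContDiffWithinAt.sum fun σ _ => (contDiffWithinAt_prod fun i _ => h _ _).const_smul _

/-- Cramer's rule. Smoothness within a set is needed because the time interval is closed. -/
theorem contDiffWithinAt_inv_apply (h : ∀ i j, ContDiffWithinAt ℝ ∞ (fun y => M y i j) s x)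
    (hx : (M x).det ≠ 0) (i j : Fin n) : ContDiffWithinAt ℝ ∞ (fun y => (M y)⁻¹ i j) s x := by
  simp only [Matrix.inv_def, Ring.inverse_eq_inv', Matrix.smul_apply, smul_eq_mul]
  refine ((contDiffWithinAt_det h).inv hx).mul ?_
  simp only [Matrix.adjugate_apply]
  refine contDiffWithinAt_det fun a b => ?_
  by_cases hab : a = j
  · subst hab; simp only [Matrix.updateRow_self]; exact contDiffWithinAt_const
  · simp only [Matrix.updateRow_ne hab]; exact h a b

end MatrixSmooth

section Pullback

variable {n : ℕ}

/-- A germ of matrices that is invertible at the base point has an inverse. -/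
theorem IsRepM.exists_inv {q : ℝ × CSpace n} {M : Matrix (Fin n) (Fin n) (SmoothGerm q)}
    {G : ℝ → CSpace n → Matrix (Fin n) (Fin n) ℂ} (h : IsRepM M G) (hG : (G q.1 q.2).det ≠ 0) :
    ∃ N : Matrix (Fin n) (Fin n) (SmoothGerm q), IsRepM N (fun t z => (G t z)⁻¹) ∧
      M * N = 1 ∧ N * M = 1 := by
  have h1 : ∀ i j, ContDiffAt ℝ ∞ (fun x : ℝ × CSpace n => G x.1 x.2 i j) q :=
    fun i j => (h i j).contDiffAt
  have h2 : ∀ i j, ContDiffAt ℝ ∞ (fun x : ℝ × CSpace n => (G x.1 x.2)⁻¹ i j) q := fun i j =>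
    (contDiffWithinAt_inv_apply (M := fun x : ℝ × CSpace n => G x.1 x.2) (s := univ)
      (fun i j => (h1 i j).contDiffWithinAt) hG i j).contDiffAt univ_mem
  have h3 : ContinuousAt (fun x : ℝ × CSpace n => (G x.1 x.2).det) q :=
    ((contDiffWithinAt_det (M := fun x : ℝ × CSpace n => G x.1 x.2) (s := univ)
      (fun i j => (h1 i j).contDiffWithinAt)).contDiffAt univ_mem).continuousAt
  have h4 : ∀ᶠ x in 𝓝 q, (G x.1 x.2).det ≠ 0 := h3.eventually_ne hG
  have hN : IsRepM (Matrix.of fun i j => SmoothGerm.mk _ (h2 i j)) (fun t z => (G t z)⁻¹) :=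
    fun i j => isRep_mk (F := fun t z => (G t z)⁻¹ i j) (h2 i j)
  have h5 : M * (Matrix.of fun i j => SmoothGerm.mk _ (h2 i j)) = 1 :=
    (h.mul hN).eq_of_eventuallyEq IsRepM.one
      (h4.mono fun x hx => Matrix.mul_nonsing_inv _ (isUnit_iff_ne_zero.mpr hx))
  exact ⟨_, hN, h5, mul_eq_one_comm.mp h5⟩

/-- Smooth families of matrices as matrices of germs. -/
theorem exists_isRepM {q : ℝ × CSpace n} {G : ℝ → CSpace n → Matrix (Fin n) (Fin n) ℂ}
    (h : ∀ i j, ContDiffAt ℝ ∞ (fun x : ℝ × CSpace n => G x.1 x.2 i j) q) :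
    ∃ M : Matrix (Fin n) (Fin n) (SmoothGerm q), IsRepM M G :=
  ⟨Matrix.of fun i j => SmoothGerm.mk _ (h i j), fun i j => isRep_mk (F := fun t z => G t z i j) (h i j)⟩

variable {t₀ : ℝ} {z₀ : CSpace n} {τ : CSpace n → CSpace n}

theorem tendsto_prodMap (hτ : ContDiffAt ℝ ∞ τ z₀) :
    Tendsto (fun x : ℝ × CSpace n => (x.1, τ x.2)) (𝓝 (t₀, z₀)) (𝓝 (t₀, τ z₀)) := by
  have h : ContinuousAt (fun x : ℝ × CSpace n => (x.1, τ x.2)) (t₀, z₀) :=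
    continuousAt_fst.prodMk
      (ContinuousAt.comp (f := fun x : ℝ × CSpace n => x.2) (g := τ) hτ.continuousAt continuousAt_snd)
  exact h

theorem contDiffAt_pull (hτ : ContDiffAt ℝ ∞ τ z₀) {f : ℝ × CSpace n → ℂ}
    (hf : ContDiffAt ℝ ∞ f (t₀, τ z₀)) :
    ContDiffAt ℝ ∞ (fun x : ℝ × CSpace n => f (x.1, τ x.2)) (t₀, z₀) :=
  ContDiffAt.comp (f := fun x : ℝ × CSpace n => (x.1, τ x.2)) (t₀, z₀) hf
    (contDiffAt_fst.prodMk (ContDiffAt.comp (f := fun x : ℝ × CSpace n => x.2) (g := τ)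
      (t₀, z₀) hτ contDiffAt_snd))

/-- Pullback of germs by `id × τ`. -/
def pull (t₀ : ℝ) (hτ : ContDiffAt ℝ ∞ τ z₀) :
    SmoothGerm ((t₀, τ z₀) : ℝ × CSpace n) →+* SmoothGerm ((t₀, z₀) : ℝ × CSpace n) where
  toFun a := ⟨Germ.compTendsto a.1 _ (tendsto_prodMap hτ), by
    obtain ⟨_, f, hf, rfl⟩ := a
    exact ⟨_, contDiffAt_pull hτ hf, rfl⟩⟩
  map_one' := rfl
  map_mul' a b := by
    obtain ⟨f, hf, rfl⟩ := SmoothGerm.exists_rep a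
    obtain ⟨g, hg, rfl⟩ := SmoothGerm.exists_rep b
    rfl
  map_zero' := rfl
  map_add' a b := by
    obtain ⟨f, hf, rfl⟩ := SmoothGerm.exists_rep a
    obtain ⟨g, hg, rfl⟩ := SmoothGerm.exists_rep b
    rfl

theorem IsRep.pull {a : SmoothGerm ((t₀, τ z₀) : ℝ × CSpace n)} {F : ℝ → CSpace n → ℂ}
    (h : IsRep a F) (hτ : ContDiffAt ℝ ∞ τ z₀) : IsRep (pull t₀ hτ a) fun t z => F t (τ z) := by
  rw [h.eq_mk]; rfl

theorem IsRepM.pull {M : Matrix (Fin n) (Fin n) (SmoothGerm ((t₀, τ z₀) : ℝ × CSpace n))}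
    {G : ℝ → CSpace n → Matrix (Fin n) (Fin n) ℂ}
    (h : IsRepM M G) (hτ : ContDiffAt ℝ ∞ τ z₀) :
    IsRepM ((_root_.pull t₀ hτ).mapMatrix M) fun t z => G t (τ z) := fun i j => (h i j).pull hτ

theorem exists_isRep {q : ℝ × CSpace n} (a : SmoothGerm q) : ∃ F, IsRep a F := by
  obtain ⟨f, hf, rfl⟩ := SmoothGerm.exists_rep a
  exact ⟨fun t z => f (t, z), rfl⟩

/-- The Jacobian matrix of a holomorphic map. -/
def jac (τ : CSpace n → CSpace n) (z : CSpace n) : Matrix (Fin n) (Fin n) ℂ :=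
  Matrix.of fun i c => fderiv ℂ τ z (EuclideanSpace.single i 1) c

theorem fderiv_apply_eq_sum (L : CSpace n →L[ℝ] ℂ) (A : CSpace n →L[ℂ] CSpace n) (i : Fin n) :
    (L (A (EuclideanSpace.single i 1)) - Complex.I * L (A (EuclideanSpace.single i Complex.I))) / 2 =
      ∑ c, A (EuclideanSpace.single i 1) c * ((L (EuclideanSpace.single c 1) -
        Complex.I * L (EuclideanSpace.single c Complex.I)) / 2) ∧
    (L (A (EuclideanSpace.single i 1)) + Complex.I * L (A (EuclideanSpace.single i Complex.I))) / 2 =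
      ∑ c, conj (A (EuclideanSpace.single i 1) c) * ((L (EuclideanSpace.single c 1) +
        Complex.I * L (EuclideanSpace.single c Complex.I)) / 2) := by
  have h1 : ∀ v : CSpace n, L v = ∑ c, (((v c).re : ℂ) * L (EuclideanSpace.single c 1) +
      ((v c).im : ℂ) * L (EuclideanSpace.single c Complex.I)) := by
    intro v
    have e : v = ∑ c, ((v c).re • (EuclideanSpace.single c 1 : CSpace n) +
        (v c).im • (EuclideanSpace.single c Complex.I : CSpace n)) := by
      ext k
      simp only [PiLp.add_apply, WithLp.ofLp_sum, Finset.sum_apply, PiLp.smul_apply,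
        PiLp.single_apply, WithLp.ofLp_add, WithLp.ofLp_smul, Pi.add_apply, Pi.smul_apply]
      rw [Finset.sum_eq_single k]
      · simp [Complex.re_add_im]
      · intro b _ hb; simp [hb.symm]
      · simp
    conv_lhs => rw [e]
    simp only [map_sum, map_add, map_smul, Complex.real_smul]
  have h2 : A (EuclideanSpace.single i Complex.I) = Complex.I • A (EuclideanSpace.single i 1) := by
    rw [← map_smul]; congr 1; ext k; by_cases hk : k = i <;> simp [hk]
  rw [h2, h1 (A _), h1 (Complex.I • _)]
  simp only [PiLp.smul_apply, smul_eq_mul, Complex.mul_re, Complex.I_re, Complex.I_im, zero_mul,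
    one_mul, zero_sub, Complex.mul_im, zero_add, add_zero, Finset.mul_sum, ← Finset.sum_sub_distrib,
    ← Finset.sum_add_distrib, Finset.sum_div]
  constructor
  · refine Finset.sum_congr rfl fun c _ => ?_
    conv_rhs => rw [← Complex.re_add_im (A (EuclideanSpace.single i 1) c)]
    push_cast
    linear_combination (-((A (EuclideanSpace.single i 1) c).im : ℂ) *
      L (EuclideanSpace.single c Complex.I) / 2) * (-Complex.I_sq)
  · refine Finset.sum_congr rfl fun c _ => ?_
    conv_rhs => rw [← Complex.re_add_im (A (EuclideanSpace.single i 1) c)]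
    push_cast
    simp only [map_add, map_mul, Complex.conj_ofReal, Complex.conj_I]
    linear_combination (-((A (EuclideanSpace.single i 1) c).im : ℂ) *
      L (EuclideanSpace.single c Complex.I) / 2) * (-Complex.I_sq)

/-- Since the derivative of `τ` is complex linear, the chain rule does not mix `∂` and `∂̄`. -/
theorem eventually_dz_comp {f : CSpace n → ℂ} (hτ : AnalyticAt ℂ τ z₀)
    (hf : DifferentiableAt ℝ f (τ z₀)) (i : Fin n) :
    dz i (fun z => f (τ z)) z₀ = ∑ c, jac τ z₀ i c * dz c f (τ z₀) ∧
    dzbar i (fun z => f (τ z)) z₀ = ∑ c, conj (jac τ z₀ i c) * dzbar c f (τ z₀) := by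
  have h1 : HasFDerivAt τ ((fderiv ℂ τ z₀).restrictScalars ℝ) z₀ :=
    hτ.differentiableAt.hasFDerivAt.restrictScalars ℝ
  have h2 : fderiv ℝ (fun z => f (τ z)) z₀ =
      (fderiv ℝ f (τ z₀)).comp ((fderiv ℂ τ z₀).restrictScalars ℝ) :=
    (hf.hasFDerivAt.comp z₀ h1).fderiv
  rw [dz, dzbar, h2]
  exact fderiv_apply_eq_sum (fderiv ℝ f (τ z₀)) (fderiv ℂ τ z₀) i

theorem eventually_slice_differentiable {q : ℝ × CSpace n} {a : SmoothGerm q} {F : ℝ → CSpace n → ℂ}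
    (h : IsRep a F) : ∀ᶠ x in 𝓝 q, DifferentiableAt ℝ (F x.1) x.2 := by
  filter_upwards [SmoothGerm.eventually_differentiableAt h.contDiffAt] with x hx
  exact DifferentiableAt.comp (g := fun x : ℝ × CSpace n => F x.1 x.2) x.2 (f := fun z => (x.1, z))
    hx (hasFDerivAt_prodMk_right (𝕜 := ℝ) x.1 x.2).differentiableAt

theorem analyticAt_jac (hτ : AnalyticAt ℂ τ z₀) (i c : Fin n) :
    AnalyticAt ℂ (fun z => jac τ z i c) z₀ :=
  (((EuclideanSpace.proj c : CSpace n →L[ℂ] ℂ).comp (ContinuousLinearMap.apply ℂ (CSpace n)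
    (EuclideanSpace.single i (1 : ℂ) : CSpace n))).analyticAt _).comp hτ.fderiv

theorem contDiffAt_jac (hτ : AnalyticAt ℂ τ z₀) (i c : Fin n) :
    ContDiffAt ℝ ∞ (fun z => jac τ z i c) z₀ :=
  ((analyticAt_jac hτ i c).contDiffAt (n := ∞)).restrict_scalars ℝ

theorem dzbar_eq_zero {f : CSpace n → ℂ} {z : CSpace n} (hf : DifferentiableAt ℂ f z) (i : Fin n) :
    dzbar i f z = 0 := by
  have h1 : fderiv ℝ f z = (fderiv ℂ f z).restrictScalars ℝ :=
    (hf.hasFDerivAt.restrictScalars ℝ).fderiv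
  have h2 : (EuclideanSpace.single i Complex.I : CSpace n) =
      Complex.I • EuclideanSpace.single i 1 := by
    ext k; by_cases hk : k = i <;> simp [hk]
  rw [dzbar, h1, h2]
  simp only [ContinuousLinearMap.coe_restrictScalars', map_smul, smul_eq_mul]
  linear_combination (fderiv ℂ f z (EuclideanSpace.single i 1) / 2) * Complex.I_sq

theorem dz_eq_fderiv {f : CSpace n → ℂ} {z : CSpace n} (hf : DifferentiableAt ℂ f z) (i : Fin n) :
    dz i f z = fderiv ℂ f z (EuclideanSpace.single i 1) := by
  have h1 : fderiv ℝ f z = (fderiv ℂ f z).restrictScalars ℝ :=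
    (hf.hasFDerivAt.restrictScalars ℝ).fderiv
  have h2 : (EuclideanSpace.single i Complex.I : CSpace n) =
      Complex.I • EuclideanSpace.single i 1 := by
    ext k; by_cases hk : k = i <;> simp [hk]
  rw [dz, h1, h2]
  simp only [ContinuousLinearMap.coe_restrictScalars', map_smul, smul_eq_mul]
  linear_combination (-fderiv ℂ f z (EuclideanSpace.single i 1) / 2) * Complex.I_sq

/-- Holomorphic functions have holomorphic germs. -/
theorem IsRep.db_eq_zero {q : ℝ × CSpace n} {a : SmoothGerm q} {f : CSpace n → ℂ}
    (h : IsRep a fun _ z => f z) (hf : AnalyticAt ℂ f q.2) (i : Fin n) : (stw q).db i a = 0 := by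
  refine (h.db i).eq_of_eventuallyEq (F' := fun _ _ => 0) rfl ?_
  filter_upwards [continuousAt_snd.eventually hf.eventually_analyticAt] with x hx
  exact dzbar_eq_zero hx.differentiableAt i

theorem IsRep.t_eq_zero {q : ℝ × CSpace n} {a : SmoothGerm q} {f : CSpace n → ℂ}
    (h : IsRep a fun _ z => f z) : (stw q).t a = 0 := by
  refine h.t.eq_of_eventuallyEq (F' := fun _ _ => 0) rfl ?_
  filter_upwards [SmoothGerm.eventually_differentiableAt h.contDiffAt] with x hx
  have h1 : HasFDerivAt (fun s : ℝ => (s, x.2)) (ContinuousLinearMap.inl ℝ ℝ (CSpace n)) x.1 :=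
    hasFDerivAt_prodMk_left x.1 x.2
  have h2 := (HasFDerivAt.comp (g := fun x : ℝ × CSpace n => f x.2) x.1 (f := fun s => (s, x.2))
    hx.hasFDerivAt h1).fderiv
  have h3 : fderiv ℝ ((fun x : ℝ × CSpace n => f x.2) ∘ fun s : ℝ => (s, x.2)) x.1 = 0 := by
    change fderiv ℝ (fun _ : ℝ => f x.2) x.1 = 0
    simp
  rw [h3] at h2
  exact (DFunLike.congr_fun h2 (1 : ℝ)).symm

/-- The Jacobian as a matrix of germs. -/
theorem exists_isRepM_jac (t₀ : ℝ) (hτ : AnalyticAt ℂ τ z₀) :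
    ∃ J : Matrix (Fin n) (Fin n) (SmoothGerm ((t₀, z₀) : ℝ × CSpace n)),
      IsRepM J fun _ z => jac τ z :=
  exists_isRepM fun i c => ContDiffAt.comp (f := fun x : ℝ × CSpace n => x.2) (t₀, z₀)
    (contDiffAt_jac hτ i c) contDiffAt_snd

section Rules

variable (hτ : AnalyticAt ℂ τ z₀) {J : Matrix (Fin n) (Fin n) (SmoothGerm ((t₀, z₀) : ℝ × CSpace n))}
  (hJ : IsRepM J fun _ z => jac τ z)

theorem contDiffAt_real (hτ : AnalyticAt ℂ τ z₀) : ContDiffAt ℝ ∞ τ z₀ :=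
  (hτ.contDiffAt (n := ∞)).restrict_scalars ℝ

include hJ

theorem d_pull (i : Fin n) (a : SmoothGerm ((t₀, τ z₀) : ℝ × CSpace n)) :
    (stw (t₀, z₀)).d i (pull t₀ (contDiffAt_real hτ) a) =
      ∑ c, J i c * pull t₀ (contDiffAt_real hτ) ((stw (t₀, τ z₀)).d c a) := by
  obtain ⟨F, hF⟩ := exists_isRep a
  refine ((hF.pull (contDiffAt_real hτ)).d i).eq_of_eventuallyEq
    (IsRep.sum fun c => (hJ i c).mul ((hF.d c).pull (contDiffAt_real hτ))) ?_
  filter_upwards [(tendsto_prodMap (contDiffAt_real hτ)).eventually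
    (eventually_slice_differentiable hF),
    continuousAt_snd.eventually hτ.eventually_analyticAt] with x h1 h2
  exact (eventually_dz_comp h2 h1 i).1

theorem db_pull (i : Fin n) (a : SmoothGerm ((t₀, τ z₀) : ℝ × CSpace n)) :
    (stw (t₀, z₀)).db i (pull t₀ (contDiffAt_real hτ) a) =
      ∑ c, (stw (t₀, z₀)).cj (J i c) * pull t₀ (contDiffAt_real hτ) ((stw (t₀, τ z₀)).db c a) := by
  obtain ⟨F, hF⟩ := exists_isRep a
  refine ((hF.pull (contDiffAt_real hτ)).db i).eq_of_eventuallyEq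
    (IsRep.sum fun c => (hJ i c).cj.mul ((hF.db c).pull (contDiffAt_real hτ))) ?_
  filter_upwards [(tendsto_prodMap (contDiffAt_real hτ)).eventually
    (eventually_slice_differentiable hF),
    continuousAt_snd.eventually hτ.eventually_analyticAt] with x h1 h2
  exact (eventually_dz_comp h2 h1 i).2

omit hJ in
theorem t_pull (a : SmoothGerm ((t₀, τ z₀) : ℝ × CSpace n)) :
    (stw (t₀, z₀)).t (pull t₀ (contDiffAt_real hτ) a) =
      pull t₀ (contDiffAt_real hτ) ((stw (t₀, τ z₀)).t a) := by
  obtain ⟨F, hF⟩ := exists_isRep a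
  refine (hF.pull (contDiffAt_real hτ)).t.eq_of_eventuallyEq (hF.t.pull (contDiffAt_real hτ)) ?_
  filter_upwards [(tendsto_prodMap (contDiffAt_real hτ)).eventually
    (SmoothGerm.eventually_differentiableAt hF.contDiffAt),
    continuousAt_snd.eventually hτ.eventually_analyticAt] with x h1 h2
  have h3 : HasFDerivAt (fun x : ℝ × CSpace n => (x.1, τ x.2)) _ x :=
    HasFDerivAt.prodMk hasFDerivAt_fst
      (HasFDerivAt.comp (f := fun x : ℝ × CSpace n => x.2) (g := τ) x
        (h2.differentiableAt.hasFDerivAt.restrictScalars ℝ) hasFDerivAt_snd)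
  have h4 := (HasFDerivAt.comp (g := fun x : ℝ × CSpace n => F x.1 x.2)
    (f := fun x : ℝ × CSpace n => (x.1, τ x.2)) x h1.hasFDerivAt h3).fderiv
  have h5 : fderiv ℝ (fun x : ℝ × CSpace n => F x.1 (τ x.2)) (x.1, x.2) = _ := h4
  rw [h5]
  simp

omit hJ in
theorem cj_pull (a : SmoothGerm ((t₀, τ z₀) : ℝ × CSpace n)) :
    (stw (t₀, z₀)).cj (pull t₀ (contDiffAt_real hτ) a) =
      pull t₀ (contDiffAt_real hτ) ((stw (t₀, τ z₀)).cj a) := by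
  obtain ⟨F, hF⟩ := exists_isRep a
  exact (hF.pull (contDiffAt_real hτ)).cj.eq_of_eventuallyEq (hF.cj.pull (contDiffAt_real hτ))
    (Eventually.of_forall fun _ => rfl)

omit hJ in
theorem ev_pull (a : SmoothGerm ((t₀, τ z₀) : ℝ × CSpace n)) :
    (stw (t₀, z₀)).ev (pull t₀ (contDiffAt_real hτ) a) = (stw (t₀, τ z₀)).ev a := by
  obtain ⟨F, hF⟩ := exists_isRep a
  rw [(hF.pull (contDiffAt_real hτ)).eval_eq, hF.eval_eq]

include hτ in
theorem holomorphicChange_pull (hdet : (jac τ z₀).det ≠ 0) :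
    ∃ K, IsRepM K (fun _ z => (jac τ z)⁻¹) ∧
      HolomorphicChange (stw (t₀, τ z₀)).toWirtinger (stw (t₀, z₀)).toWirtinger
        (pull t₀ (contDiffAt_real hτ)) J K := by
  obtain ⟨K, hK, h1, h2⟩ := hJ.exists_inv hdet
  exact ⟨K, hK, h1, h2, d_pull hτ hJ, db_pull hτ hJ,
    fun m i c => (hJ i c).db_eq_zero (analyticAt_jac hτ i c) m, cj_pull hτ⟩

end Rules

end Pullback
end

noncomputable section

open Filter Topology

/-! ### Hermitian forms -/

section Forms

open scoped ComplexOrder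

variable {n : ℕ}

/-- The sesquilinear form `∑ vᵢ Pᵢⱼ conj wⱼ`. -/
def sf (P : Matrix (Fin n) (Fin n) ℂ) (v w : Fin n → ℂ) : ℂ := ∑ i, ∑ j, v i * P i j * conj (w j)

/-- The quadratic form `∑ vᵢ Pᵢⱼ conj vⱼ`. -/
def qf (P : Matrix (Fin n) (Fin n) ℂ) (v : Fin n → ℂ) : ℝ := (sf P v v).re

theorem sf_eq (P : Matrix (Fin n) (Fin n) ℂ) (v w : Fin n → ℂ) :
    sf P v w = v ⬝ᵥ P.mulVec (star w) := by
  simp only [sf, dotProduct, Matrix.mulVec, Finset.mul_sum, mul_assoc]; rfl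

theorem sf_change (P J : Matrix (Fin n) (Fin n) ℂ) (v w : Fin n → ℂ) :
    sf (J * P * J.conjTranspose) v w = sf P (Matrix.vecMul v J) (Matrix.vecMul w J) := by
  rw [sf_eq, sf_eq, ← Matrix.mulVec_mulVec, ← Matrix.mulVec_mulVec, Matrix.dotProduct_mulVec v,
    Matrix.star_vecMul]

theorem qf_change (P J : Matrix (Fin n) (Fin n) ℂ) (v : Fin n → ℂ) :
    qf (J * P * J.conjTranspose) v = qf P (Matrix.vecMul v J) := by
  rw [qf, sf_change, qf]

theorem qf_one (v : Fin n → ℂ) : qf 1 v = ∑ i, ‖v i‖ ^ 2 := by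
  simp only [qf, sf, Matrix.one_apply, mul_ite, mul_one, mul_zero, ite_mul, zero_mul,
    Finset.sum_ite_eq, Finset.mem_univ, if_true, Complex.re_sum]
  refine Finset.sum_congr rfl fun i _ => ?_
  rw [Complex.mul_conj, Complex.ofReal_re, Complex.normSq_eq_norm_sq]

theorem qf_single (P : Matrix (Fin n) (Fin n) ℂ) (i : Fin n) : qf P (Pi.single i 1) = (P i i).re := by
  rw [qf, sf_eq]
  congr 1
  simp [Matrix.mulVec, dotProduct, Pi.single_apply]

theorem posDef_of_qf_pos {P : Matrix (Fin n) (Fin n) ℂ} (hP : P.IsHermitian)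
    (h : ∀ v, v ≠ 0 → 0 < qf P v) : P.PosDef := by
  refine Matrix.PosDef.of_dotProduct_mulVec_pos hP fun x hx => ?_
  have h1 := h (star x) (by simpa using hx)
  rw [qf, sf_eq, star_star] at h1
  have h2 : conj (star x ⬝ᵥ P.mulVec x) = star x ⬝ᵥ P.mulVec x := by
    have : star (star x ⬝ᵥ P.mulVec x) = star x ⬝ᵥ P.mulVec x := by
      rw [← Matrix.star_dotProduct (P.mulVec x) x, Matrix.star_mulVec, hP.eq, Matrix.dotProduct_mulVec]
    exact this
  rw [← Complex.conj_eq_iff_re.mp h2]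
  exact_mod_cast h1

-- The rows of `J` are a unitary frame for the form `P`, which reduces statements about `P` to the
-- identity matrix. The factorisation comes from a representation `P = B* B` of a positive element.
open scoped MatrixOrder Matrix.Norms.L2Operator in
theorem exists_eq_mul_conjTranspose {P : Matrix (Fin n) (Fin n) ℂ} (hP : P.PosDef) :
    ∃ J K : Matrix (Fin n) (Fin n) ℂ, J * K = 1 ∧ K * J = 1 ∧ P = K * K.conjTranspose := by
  obtain ⟨B, hB⟩ := CStarAlgebra.nonneg_iff_eq_star_mul_self.mp hP.posSemidef.nonneg
  have hdet : B.conjTranspose.det ≠ 0 := by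
    intro h0
    have := hP.det_pos
    rw [hB, Matrix.det_mul, Matrix.star_eq_conjTranspose, h0, zero_mul] at this
    exact lt_irrefl _ this
  have hu := isUnit_iff_ne_zero.mpr hdet
  exact ⟨B.conjTranspose⁻¹, B.conjTranspose, Matrix.nonsing_inv_mul _ hu,
    Matrix.mul_nonsing_inv _ hu, by rw [Matrix.conjTranspose_conjTranspose]; exact hB⟩

variable {P J K : Matrix (Fin n) (Fin n) ℂ}

theorem frame_eq_one (hJK : J * K = 1) (hP : P = K * K.conjTranspose) :
    J * P * J.conjTranspose = 1 := by
  calc J * P * J.conjTranspose = (J * K) * (J * K).conjTranspose := by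
        rw [hP, Matrix.conjTranspose_mul]; noncomm_ring
    _ = 1 := by rw [hJK]; simp

theorem frame_inv (hJK : J * K = 1) (hKJ : K * J = 1) (hP : P = K * K.conjTranspose) :
    P⁻¹ = J.conjTranspose * J := by
  refine Matrix.inv_eq_right_inv ?_
  calc P * (J.conjTranspose * J) = K * (J * K).conjTranspose * J := by
        rw [hP, Matrix.conjTranspose_mul]; noncomm_ring
    _ = 1 := by rw [hJK, Matrix.conjTranspose_one, mul_one, hKJ]

theorem qf_frame (hP : P = K * K.conjTranspose) (v : Fin n → ℂ) :
    qf P v = ∑ i, ‖Matrix.vecMul v K i‖ ^ 2 := by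
  rw [← qf_one, ← qf_change, mul_one, hP]

theorem norm_frame_sq_le {B : ℝ} (hP : P = K * K.conjTranspose)
    (h : ∀ v, qf P v ≤ B * ∑ i, ‖v i‖ ^ 2) (i j : Fin n) : ‖K i j‖ ^ 2 ≤ B := by
  have h1 := h (Pi.single i 1)
  rw [qf_frame hP] at h1
  have h2 : ∑ k, ‖(Pi.single i 1 : Fin n → ℂ) k‖ ^ 2 = 1 := by
    rw [Finset.sum_eq_single i]
    · simp
    · intro b _ hb; simp [hb]
    · simp
  rw [h2, mul_one] at h1
  refine le_trans ?_ h1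
  have := Finset.single_le_sum (f := fun j => ‖Matrix.vecMul (Pi.single i 1) K j‖ ^ 2)
    (fun _ _ => sq_nonneg _) (Finset.mem_univ j)
  simpa using this

theorem norm_coframe_sq_le {B : ℝ} (hJK : J * K = 1) (hP : P = K * K.conjTranspose)
    (h : ∀ v, ∑ i, ‖v i‖ ^ 2 ≤ B * qf P v) (i j : Fin n) : ‖J i j‖ ^ 2 ≤ B := by
  have h1 := h (J i)
  have h2 : qf P (J i) = 1 := by
    have h3 : Matrix.vecMul (Pi.single i 1) J = J i := by ext; simp
    rw [← h3, ← qf_change, frame_eq_one hJK hP, qf_single]; simp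
  rw [h2, mul_one] at h1
  exact (Finset.single_le_sum (f := fun j => ‖J i j‖ ^ 2) (fun _ _ => sq_nonneg _)
    (Finset.mem_univ j)).trans h1

theorem hermSq_weight_one (T : Idx4 n → ℂ) :
    hermSq (starRingEnd ℂ) (weight4 (1 : Matrix (Fin n) (Fin n) ℂ)) T = ((∑ x, ‖T x‖ ^ 2 : ℝ) : ℂ) := by
  have h1 : ∀ x y : Idx4 n, weight4 (1 : Matrix (Fin n) (Fin n) ℂ) x y = if x = y then 1 else 0 := by
    rintro ⟨⟨i, j⟩, k, l⟩ ⟨⟨a, b⟩, c, d⟩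
    simp only [weight4, Matrix.one_apply, Prod.mk.injEq]
    split_ifs <;> simp_all
  simp only [hermSq, h1, ite_mul, one_mul, zero_mul, Finset.sum_ite_eq, Finset.mem_univ, if_true]
  push_cast
  refine Finset.sum_congr rfl fun x _ => ?_
  rw [Complex.mul_conj, Complex.normSq_eq_norm_sq]; push_cast; rfl

theorem hermSq_weight_one' (T : Fin n × Idx4 n → ℂ) :
    hermSq (starRingEnd ℂ) (weight5 (1 : Matrix (Fin n) (Fin n) ℂ)) T =
      ((∑ x, ‖T x‖ ^ 2 : ℝ) : ℂ) := by
  have h1 : weight5 (1 : Matrix (Fin n) (Fin n) ℂ) = fun x y => if x = y then 1 else 0 := by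
    ext ⟨m, ⟨i, j⟩, k, l⟩ ⟨e, ⟨a, b⟩, c, d⟩
    simp only [weight5, weight4, Matrix.one_apply, Prod.mk.injEq, Matrix.kroneckerMap_apply,
      Matrix.transpose_apply, Matrix.of_apply]
    split_ifs <;> simp_all
  simp only [hermSq, h1, ite_mul, one_mul, zero_mul, Finset.sum_ite_eq, Finset.mem_univ, if_true]
  push_cast
  refine Finset.sum_congr rfl fun x _ => ?_
  rw [Complex.mul_conj, Complex.normSq_eq_norm_sq]; push_cast; rfl

theorem slot_frame (hJK : J * K = 1) (hKJ : K * J = 1) (hP : P = K * K.conjTranspose) :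
    (J.map (starRingEnd ℂ)).transpose * 1 * J = P⁻¹ := by
  rw [frame_inv hJK hKJ hP, mul_one]; rfl

theorem sum_norm_change4_sq (hJK : J * K = 1) (hKJ : K * J = 1) (hP : P = K * K.conjTranspose)
    (T : Idx4 n → ℂ) : ∑ x, ‖(change4 (starRingEnd ℂ) J).mulVec T x‖ ^ 2 =
      (hermSq (starRingEnd ℂ) (weight4 P⁻¹) T).re := by
  have h1 := hermSq_mulVec (starRingEnd ℂ) _ _ _
    (weight4_change (c := starRingEnd ℂ) Complex.conj_conj (slot_frame hJK hKJ hP)) T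
  have h2 := congrArg Complex.re h1
  change (hermSq (starRingEnd ℂ) (weight4 1) _).re = _ at h2
  rw [hermSq_weight_one, Complex.ofReal_re] at h2
  exact h2

theorem sum_norm_change5_sq (hJK : J * K = 1) (hKJ : K * J = 1) (hP : P = K * K.conjTranspose)
    (T : Fin n × Idx4 n → ℂ) : ∑ x, ‖(change5 (starRingEnd ℂ) J).mulVec T x‖ ^ 2 =
      (hermSq (starRingEnd ℂ) (weight5 P⁻¹) T).re := by
  have h1 := hermSq_mulVec (starRingEnd ℂ) _ _ _
    (weight5_change (c := starRingEnd ℂ) Complex.conj_conj (slot_frame hJK hKJ hP)) T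
  have h2 := congrArg Complex.re h1
  rw [hermSq_weight_one', Complex.ofReal_re] at h2
  exact h2

open Kronecker in
theorem change4_mul (hKJ : K * J = 1) :
    change4 (starRingEnd ℂ) K * change4 (starRingEnd ℂ) J = 1 := by
  have h1 : K.map (starRingEnd ℂ) * J.map (starRingEnd ℂ) = 1 := by
    rw [← Matrix.map_mul, hKJ, Matrix.map_one _ (map_zero _) (map_one _)]
  simp only [change4, ← Matrix.mul_kronecker_mul, hKJ, h1, Matrix.one_kronecker_one]

open Kronecker in
theorem change5_mul (hKJ : K * J = 1) :
    change5 (starRingEnd ℂ) K * change5 (starRingEnd ℂ) J = 1 := by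
  simp only [change5, ← Matrix.mul_kronecker_mul, hKJ, change4_mul hKJ, Matrix.one_kronecker_one]

theorem norm_le_of_change {κ : Type*} [Fintype κ] [DecidableEq κ] {A B : Matrix κ κ ℂ} {T : κ → ℂ}
    (hAB : A * B = 1) {a R : ℝ} (hA : ∀ x y, ‖A x y‖ ≤ a) (hR : 0 ≤ R)
    (hT : ∑ x, ‖B.mulVec T x‖ ^ 2 ≤ R ^ 2) (x : κ) : ‖T x‖ ≤ Fintype.card κ * (a * R) := by
  have h1 : T = A.mulVec (B.mulVec T) := by rw [Matrix.mulVec_mulVec, hAB, Matrix.one_mulVec]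
  have h2 : ∀ y, ‖B.mulVec T y‖ ≤ R := fun y => by
    refine abs_le_of_sq_le_sq' ?_ hR |>.2
    exact (Finset.single_le_sum (f := fun x => ‖B.mulVec T x‖ ^ 2) (fun _ _ => sq_nonneg _)
      (Finset.mem_univ y)).trans hT
  rw [h1]
  calc ‖A.mulVec (B.mulVec T) x‖ ≤ ∑ y, ‖A x y * B.mulVec T y‖ := norm_sum_le _ _
    _ ≤ ∑ _y : κ, a * R := Finset.sum_le_sum fun y _ => by
        rw [norm_mul]
        exact mul_le_mul (hA x y) (h2 y) (norm_nonneg _) ((norm_nonneg _).trans (hA x y))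
    _ = _ := by simp

theorem norm_change4_le {b : ℝ} (hK : ∀ i j, ‖K i j‖ ≤ b) (x y : Idx4 n) :
    ‖change4 (starRingEnd ℂ) K x y‖ ≤ b ^ 4 := by
  obtain ⟨⟨i, j⟩, k, l⟩ := x
  obtain ⟨⟨a, e⟩, c, d⟩ := y
  have hb : 0 ≤ b := (norm_nonneg _).trans (hK i a)
  simp only [change4, Matrix.kroneckerMap_apply, Matrix.map_apply, norm_mul, RCLike.norm_conj]
  calc _ ≤ (b * b) * (b * b) := by gcongr <;> apply hK
    _ = _ := by ring

theorem norm_change5_le {b : ℝ} (hK : ∀ i j, ‖K i j‖ ≤ b) (x y : Fin n × Idx4 n) :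
    ‖change5 (starRingEnd ℂ) K x y‖ ≤ b ^ 5 := by
  have hb : 0 ≤ b := (norm_nonneg _).trans (hK x.1 y.1)
  rw [change5, Matrix.kroneckerMap_apply, norm_mul]
  calc _ ≤ b * b ^ 4 := mul_le_mul (hK _ _) (norm_change4_le hK _ _) (norm_nonneg _) hb
    _ = _ := by ring

/-- Components of the curvature are controlled by its norm. -/
theorem norm_curvature_form_le (hP : P.PosDef) (T : Idx4 n → ℂ) {R : ℝ} (hR : 0 ≤ R)
    (hT : (hermSq (starRingEnd ℂ) (weight4 P⁻¹) T).re ≤ R ^ 2) (u v : Fin n → ℂ) :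
    ‖∑ x : Idx4 n, T x * (u x.1.1 * conj (u x.1.2) * (v x.2.1 * conj (v x.2.2)))‖ ≤
      R * (n ^ 2 * (qf P u * qf P v)) := by
  obtain ⟨J, K, hJK, hKJ, hPK⟩ := exists_eq_mul_conjTranspose hP
  set T' := (change4 (starRingEnd ℂ) J).mulVec T with hT'
  have h1 : T = (change4 (starRingEnd ℂ) K).mulVec T' := by
    rw [hT', Matrix.mulVec_mulVec, change4_mul hKJ, Matrix.one_mulVec]
  have h2 : ∀ y, ‖T' y‖ ≤ R := fun y => by
    refine abs_le_of_sq_le_sq' ?_ hR |>.2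
    refine (Finset.single_le_sum (f := fun x => ‖T' x‖ ^ 2) (fun _ _ => sq_nonneg _)
      (Finset.mem_univ y)).trans ?_
    rw [hT', sum_norm_change4_sq hJK hKJ hPK]; exact hT
  set u' := Matrix.vecMul u K
  set v' := Matrix.vecMul v K
  have h3 : ∀ w : Fin n → ℂ, ∀ a, conj (Matrix.vecMul w K a) = ∑ i, conj (w i) * conj (K i a) := by
    intro w a; simp [Matrix.vecMul, dotProduct]
  have h4 : ∑ x : Idx4 n, T x * (u x.1.1 * conj (u x.1.2) * (v x.2.1 * conj (v x.2.2))) =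
      ∑ y : Idx4 n, T' y * (u' y.1.1 * conj (u' y.1.2) * (v' y.2.1 * conj (v' y.2.2))) := by
    have e1 : ∀ x, T x = ∑ y, change4 (starRingEnd ℂ) K x y * T' y := fun x => by
      conv_lhs => rw [h1]
      rfl
    simp only [e1, Finset.sum_mul]
    rw [Finset.sum_comm]
    refine Finset.sum_congr rfl fun y _ => ?_
    have e2 : ∀ x : Idx4 n, change4 (starRingEnd ℂ) K x y * T' y *
        (u x.1.1 * conj (u x.1.2) * (v x.2.1 * conj (v x.2.2))) =
        T' y * ((u x.1.1 * K x.1.1 y.1.1) * (conj (u x.1.2) * conj (K x.1.2 y.1.2)) *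
        ((v x.2.1 * K x.2.1 y.2.1) * (conj (v x.2.2) * conj (K x.2.2 y.2.2)))) := by
      intro x
      simp only [change4, Matrix.kroneckerMap_apply, Matrix.map_apply]
      ring
    simp only [e2, ← Finset.mul_sum]
    congr 1
    simp only [Fintype.sum_prod_type, ← Finset.mul_sum, ← Finset.sum_mul, u', v', h3]
    rfl
  have h5 : ∀ w : Fin n → ℂ, (∑ i, ‖w i‖) ^ 2 ≤ n * ∑ i, ‖w i‖ ^ 2 := fun w => by
    have := sq_sum_le_card_mul_sum_sq (s := Finset.univ) (f := fun i => ‖w i‖)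
    simpa using this
  have h6 : 0 ≤ ∑ i, ‖u' i‖ ^ 2 := Finset.sum_nonneg fun _ _ => sq_nonneg _
  rw [h4, qf_frame hPK, qf_frame hPK]
  calc _ ≤ ∑ y : Idx4 n, R * (‖u' y.1.1‖ * ‖u' y.1.2‖ * (‖v' y.2.1‖ * ‖v' y.2.2‖)) := by
        refine norm_sum_le_of_le _ fun y _ => ?_
        simp only [norm_mul, RCLike.norm_conj]
        exact mul_le_mul_of_nonneg_right (h2 y) (by positivity)
    _ = R * ((∑ i, ‖u' i‖) ^ 2 * (∑ i, ‖v' i‖) ^ 2) := by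
        simp only [← Finset.mul_sum, Fintype.sum_prod_type, ← Finset.sum_mul, sq]
    _ ≤ R * ((n * ∑ i, ‖u' i‖ ^ 2) * (n * ∑ i, ‖v' i‖ ^ 2)) := by
        gcongr <;> apply h5
    _ = _ := by ring

end Forms
end

noncomputable section

open Filter Topology

/-! ### Symmetries of the curvature -/

section Symmetry

variable {n : ℕ} {A : Type*} [CommRing A] [Algebra ℂ A]

namespace Wirtinger

variable {W : Wirtinger n A} {G H : Matrix (Fin n) (Fin n) A}

theorem db_kahler (herm : ∀ i j, W.cj (G i j) = G j i)
    (kahler : ∀ i j k, W.d i (G j k) = W.d j (G i k)) (j k l : Fin n) :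
    W.db j (G k l) = W.db l (G k j) := by
  rw [← herm l k, ← herm j k, W.db_cj, W.db_cj, kahler]

/-- The Kähler condition exchanges the two holomorphic indices, and its conjugate the two
antiholomorphic ones. This reconciles the two ways of tracing the curvature to the Ricci tensor. -/
theorem curv_symm (herm : ∀ i j, W.cj (G i j) = G j i)
    (kahler : ∀ i j k, W.d i (G j k) = W.d j (G i k)) (i j k l : Fin n) :
    W.curv G H i j k l = W.curv G H k l i j := by
  have hb := db_kahler herm kahler
  simp only [curv, Matrix.add_apply, Matrix.neg_apply, Matrix.mul_apply, dmap_apply]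
  have e1 : W.d i (W.db j (G k l)) = W.d k (W.db l (G i j)) := by
    rw [W.d_db, kahler i k, ← W.d_db, hb]
  rw [e1]
  congr 1
  refine Finset.sum_congr rfl fun p _ => ?_
  rw [hb j p l]
  congr 1
  exact Finset.sum_congr rfl fun q _ => by rw [kahler i k]

end Wirtinger

/-- The flow equation is invariant under holomorphic changes. -/
theorem HolomorphicChange.flow_eq {B : Type*} [CommRing B] [Algebra ℂ B] {W : TimeWirtinger n A}
    {V : TimeWirtinger n B} {φ : A →+* B} {J K : Matrix (Fin n) (Fin n) B}
    (h : HolomorphicChange W.toWirtinger V.toWirtinger φ J K) {G H : Matrix (Fin n) (Fin n) A}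
    (HG : H * G = 1) (ht : ∀ a, V.t (φ a) = φ (W.t a)) (hJ : ∀ i c, V.t (J i c) = 0)
    (flow : dmap W.t G = -∑ a, ∑ b, H b a • W.curv G H a b) :
    dmap V.t (J * φ.mapMatrix G * V.adj J) = -∑ a, ∑ b, (V.adj K * φ.mapMatrix H * K) b a •
      V.curv (J * φ.mapMatrix G * V.adj J) (V.adj K * φ.mapMatrix H * K) a b := by
  have h1 : dmap V.t J = 0 := by ext; simp [hJ]
  have h2 : dmap V.t (V.adj J) = 0 := by ext; simp [Wirtinger.adj, V.t_cj, hJ]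
  have h3 : dmap V.t (φ.mapMatrix G) = φ.mapMatrix (dmap W.t G) := by ext; simp [ht]
  have h4 : V.adj J * (V.adj K * φ.mapMatrix H * K) * J = φ.mapMatrix H := by
    calc _ = (V.adj J * V.adj K) * φ.mapMatrix H * (K * J) := by noncomm_ring
      _ = _ := by rw [h.adj_KJ, h.KJ, one_mul, mul_one]
  set H' := V.adj K * φ.mapMatrix H * K
  have h5 : ∀ c e, φ (H e c) = ∑ a, ∑ b, H' b a * (J a c * V.cj (J b e)) := by
    intro c e
    have := congrFun (congrFun h4 e) c
    rw [RingHom.mapMatrix_apply, Matrix.map_apply] at this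
    rw [← this]
    simp only [Matrix.mul_apply, Wirtinger.adj, Matrix.transpose_apply, Matrix.map_apply,
      Finset.sum_mul]
    exact Finset.sum_congr rfl fun a _ => Finset.sum_congr rfl fun b _ => by ring
  simp only [dmap_mul, h1, h2, h3, flow, zero_mul, mul_zero, zero_add, add_zero, h.curv_eq HG]
  have h6 : φ.mapMatrix (-∑ a, ∑ b, H b a • W.curv G H a b) =
      -∑ a, ∑ b, H' b a • ∑ c, ∑ e, (J a c * V.cj (J b e)) • φ.mapMatrix (W.curv G H c e) := by
    rw [map_neg]
    congr 1
    have e1 : ∀ c e, φ.mapMatrix (H e c • W.curv G H c e) =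
        φ (H e c) • φ.mapMatrix (W.curv G H c e) := by
      intro c e; ext; simp
    simp only [map_sum, e1, h5, Finset.sum_smul, Finset.smul_sum, smul_smul]
    exact sum_reorder (fun c e a b => (H' b a * (J a c * V.cj (J b e))) •
      φ.mapMatrix (W.curv G H c e)) |>.trans (Finset.sum_congr rfl fun a _ =>
        Finset.sum_congr rfl fun b _ => Finset.sum_comm)
  rw [h6, mul_neg, neg_mul, Finset.mul_sum, Finset.sum_mul]
  congr 1
  refine Finset.sum_congr rfl fun a _ => ?_
  rw [Finset.mul_sum, Finset.sum_mul]
  exact Finset.sum_congr rfl fun b _ => by rw [mul_smul_comm, smul_mul_assoc, ← h.curv_eq HG]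

end Symmetry

/-! ### Local Kähler metrics and flows -/

section LocalFlow

open scoped ComplexOrder

variable {n : ℕ}

/-- A Hermitian metric near a point of `ℂⁿ`. -/
structure LocalMetric (G : CSpace n → Matrix (Fin n) (Fin n) ℂ) (z₀ : CSpace n) : Prop where
  smooth : ∀ i j, ContDiffAt ℝ ∞ (fun z => G z i j) z₀
  herm : ∀ᶠ z in 𝓝 z₀, (G z).IsHermitian
  pos : ∀ v, v ≠ 0 → 0 < qf (G z₀) v

/-- A Kähler-Ricci flow near a point of space-time. -/
structure LocalFlow (G : ℝ → CSpace n → Matrix (Fin n) (Fin n) ℂ) (t₀ : ℝ) (z₀ : CSpace n) :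
    Prop where
  smooth : ∀ i j, ContDiffAt ℝ ∞ (fun x : ℝ × CSpace n => G x.1 x.2 i j) (t₀, z₀)
  herm : ∀ᶠ x in 𝓝 (t₀, z₀), (G x.1 x.2).IsHermitian
  pos : ∀ v, v ≠ 0 → 0 < qf (G t₀ z₀) v
  kahler : ∀ᶠ x in 𝓝 (t₀, z₀), ∀ i j k,
    dz i (fun w => G x.1 w j k) x.2 = dz j (fun w => G x.1 w i k) x.2
  flow : ∀ᶠ x in 𝓝 (t₀, z₀), ∀ i j,
    HasDerivAt (fun s => G s x.2 i j) (-ricci (G x.1) i j x.2) x.1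

theorem LocalMetric.det_ne {G : CSpace n → Matrix (Fin n) (Fin n) ℂ} {z₀ : CSpace n}
    (h : LocalMetric G z₀) : (G z₀).det ≠ 0 := by
  have := (posDef_of_qf_pos h.herm.self_of_nhds h.pos)
  exact isUnit_iff_ne_zero.mp ((Matrix.isUnit_iff_isUnit_det _).mp this.isUnit)

theorem LocalMetric.static {G : CSpace n → Matrix (Fin n) (Fin n) ℂ} {z₀ : CSpace n}
    (h : LocalMetric G z₀) (t₀ : ℝ) (i j : Fin n) :
    ContDiffAt ℝ ∞ (fun x : ℝ × CSpace n => G x.2 i j) (t₀, z₀) :=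
  ContDiffAt.comp (f := fun x : ℝ × CSpace n => x.2) (t₀, z₀) (h.smooth i j) contDiffAt_snd

variable {q : ℝ × CSpace n} {M N : Matrix (Fin n) (Fin n) (SmoothGerm q)}
  {G : ℝ → CSpace n → Matrix (Fin n) (Fin n) ℂ}

theorem IsRepM.herm (h : IsRepM M G) (hG : ∀ᶠ x in 𝓝 q, (G x.1 x.2).IsHermitian) (i j : Fin n) :
    (stw q).cj (M i j) = M j i :=
  (h i j).cj.eq_of_eventuallyEq (h j i) (hG.mono fun _ hx => hx.apply _ _)

theorem IsRepM.kahler (h : IsRepM M G) (hG : ∀ᶠ x in 𝓝 q, ∀ i j k,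
    dz i (fun w => G x.1 w j k) x.2 = dz j (fun w => G x.1 w i k) x.2) (i j k : Fin n) :
    (stw q).d i (M j k) = (stw q).d j (M i k) :=
  ((h j k).d i).eq_of_eventuallyEq ((h i k).d j) (hG.mono fun _ hx => hx _ _ _)

theorem IsRep.hasDerivAt {a : SmoothGerm q} {F : ℝ → CSpace n → ℂ} (h : IsRep a F) :
    ∀ᶠ x in 𝓝 q, HasDerivAt (fun s => F s x.2)
      (fderiv ℝ (fun x : ℝ × CSpace n => F x.1 x.2) x (1, 0)) x.1 := by
  filter_upwards [SmoothGerm.eventually_differentiableAt h.contDiffAt] with ⟨s, z⟩ hx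
  have h1 : HasDerivAt (fun s : ℝ => (s, z)) ((1 : ℝ), (0 : CSpace n)) s :=
    (hasDerivAt_id s).prodMk (hasDerivAt_const _ _)
  exact hx.hasFDerivAt.comp_hasDerivAt s h1

theorem IsRepM.flow (h : IsRepM M G) (h' : IsRepM N fun t z => (G t z)⁻¹)
    (hherm : ∀ᶠ x in 𝓝 q, (G x.1 x.2).IsHermitian)
    (hk : ∀ᶠ x in 𝓝 q, ∀ i j k,
      dz i (fun w => G x.1 w j k) x.2 = dz j (fun w => G x.1 w i k) x.2)
    (hG : ∀ᶠ x in 𝓝 q, ∀ i j, HasDerivAt (fun s => G s x.2 i j) (-ricci (G x.1) i j x.2) x.1) :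
    dmap (stw q).t M = -∑ a, ∑ b, N b a • (stw q).curv M N a b := by
  ext1 i j
  have h0 : IsRep (∑ k, ∑ l, N l k * (stw q).curv M N i j k l)
      fun t z => ∑ k, ∑ l, (G t z)⁻¹ l k * curvature (G t) i j k l z :=
    IsRep.sum fun k => IsRep.sum fun l => (h' l k).mul (h.curv h' i j k l)
  have h2 : (stw q).t (M i j) = -∑ k, ∑ l, N l k * (stw q).curv M N i j k l := by
    refine (h i j).t.eq_of_eventuallyEq h0.neg ?_
    filter_upwards [hG, (h i j).hasDerivAt] with ⟨s, z⟩ hx hx'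
    have e := hx'.unique (hx i j)
    exact e
  -- This symmetry turns the trace over the last pair in `ricci` into the trace over the first pair
  -- that the matrix form of the flow requires.
  have hs : ∀ k l, (stw q).curv M N i j k l = (stw q).curv M N k l i j := fun k l =>
    Wirtinger.curv_symm (W := (stw q).toWirtinger) (h.herm hherm) (h.kahler hk) i j k l
  have h3 : (-∑ a, ∑ b, N b a • (stw q).curv M N a b) i j =
      -∑ k, ∑ l, N l k * (stw q).curv M N k l i j := by
    rw [Matrix.neg_apply, Matrix.sum_apply]
    refine congrArg Neg.neg (Finset.sum_congr rfl fun a _ => ?_)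
    rw [Matrix.sum_apply]
    rfl
  rw [h3, dmap_apply, h2]
  refine congrArg Neg.neg (Finset.sum_congr rfl fun a _ => Finset.sum_congr rfl fun b _ => ?_)
  rw [hs]

theorem IsRepM.static {G₀ : CSpace n → Matrix (Fin n) (Fin n) ℂ} (h : IsRepM M fun _ z => G₀ z) :
    dmap (stw q).t M = 0 := by
  ext1 i j; exact (h i j).t_eq_zero

/-- A quadratic holomorphic map. -/
def quadMap (z₀ : CSpace n) (A : Matrix (Fin n) (Fin n) ℂ) (b : Fin n → Fin n → Fin n → ℂ)
    (ζ : CSpace n) : CSpace n :=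
  WithLp.toLp 2 fun c => z₀ c + ∑ i, ζ i * A i c + ∑ i, ∑ j, ζ i * ζ j * b i j c

section QuadMap

variable (z₀ : CSpace n) (A : Matrix (Fin n) (Fin n) ℂ) (b : Fin n → Fin n → Fin n → ℂ)

theorem quadMap_zero : quadMap z₀ A b 0 = z₀ := by
  ext c; simp [quadMap]

theorem analyticAt_quadMap (ζ : CSpace n) : AnalyticAt ℂ (quadMap z₀ A b) ζ := by
  have hp : ∀ i : Fin n, AnalyticAt ℂ (fun ζ : CSpace n => ζ i) ζ := fun i =>
    (EuclideanSpace.proj i : CSpace n →L[ℂ] ℂ).analyticAt ζ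
  have h : AnalyticAt ℂ (fun ζ : CSpace n => fun c => z₀ c + ∑ i, ζ i * A i c +
      ∑ i, ∑ j, ζ i * ζ j * b i j c) ζ := by
    refine AnalyticAt.pi fun c => ?_
    exact (analyticAt_const.add (Finset.analyticAt_fun_sum _ fun i _ =>
      (hp i).mul analyticAt_const)).add (Finset.analyticAt_fun_sum _ fun i _ =>
        Finset.analyticAt_fun_sum _ fun j _ => ((hp i).mul (hp j)).mul analyticAt_const)
  exact ((EuclideanSpace.equiv (Fin n) ℂ).symm.toContinuousLinearMap.analyticAt _).comp h

theorem jac_quadMap (ζ : CSpace n) (i c : Fin n) :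
    jac (quadMap z₀ A b) ζ i c = A i c + ∑ j, ζ j * (b i j c + b j i c) := by
  have h1 : HasFDerivAt (fun ζ : CSpace n => quadMap z₀ A b ζ c)
      ((EuclideanSpace.proj c : CSpace n →L[ℂ] ℂ).comp (fderiv ℂ (quadMap z₀ A b) ζ)) ζ :=
    (EuclideanSpace.proj c : CSpace n →L[ℂ] ℂ).hasFDerivAt.comp ζ
      (analyticAt_quadMap z₀ A b ζ).differentiableAt.hasFDerivAt
  have hp : ∀ i : Fin n, HasFDerivAt (fun ζ : CSpace n => ζ i)
      (EuclideanSpace.proj i : CSpace n →L[ℂ] ℂ) ζ := fun i =>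
    (EuclideanSpace.proj i : CSpace n →L[ℂ] ℂ).hasFDerivAt
  have h2 : HasFDerivAt (fun ζ : CSpace n => quadMap z₀ A b ζ c) _ ζ :=
    ((HasFDerivAt.fun_sum fun i _ => (hp i).mul_const (A i c)).const_add (z₀ c)).add
      (HasFDerivAt.fun_sum fun i _ => HasFDerivAt.fun_sum fun j _ =>
        ((hp i).mul (hp j)).mul_const (b i j c))
  have h3 := DFunLike.congr_fun (h1.unique h2) (EuclideanSpace.single i 1)
  have h4 : jac (quadMap z₀ A b) ζ i c = ((EuclideanSpace.proj c : CSpace n →L[ℂ] ℂ).comp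
    (fderiv ℂ (quadMap z₀ A b) ζ)) (EuclideanSpace.single i 1) := rfl
  rw [h4, h3]
  simp [mul_add, Finset.sum_add_distrib]
  rw [add_comm]
  simp [mul_comm]

theorem dz_jac_quadMap (m i c : Fin n) :
    dz m (fun ζ => jac (quadMap z₀ A b) ζ i c) 0 = b i m c + b m i c := by
  have hp : ∀ i : Fin n, HasFDerivAt (fun ζ : CSpace n => ζ i)
      (EuclideanSpace.proj i : CSpace n →L[ℂ] ℂ) 0 := fun i =>
    (EuclideanSpace.proj i : CSpace n →L[ℂ] ℂ).hasFDerivAt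
  have h2 : HasFDerivAt (fun ζ : CSpace n => A i c + ∑ j, ζ j * (b i j c + b j i c)) _ 0 :=
    (HasFDerivAt.fun_sum fun j _ => (hp j).mul_const (b i j c + b j i c)).const_add (A i c)
  simp only [jac_quadMap]
  rw [dz_eq_fderiv h2.differentiableAt, h2.fderiv]
  simp

end QuadMap

end LocalFlow
end

noncomputable section

open Filter Topology

/-! ### Normal coordinates -/

section Normal

variable {n : ℕ}

open scoped ComplexOrder

/-- The constant in the bounds of the background metric in normal coordinates. -/
def backgroundBound (n : ℕ) (C : ℝ) : ℝ :=
  C + n * (C * C) + Fintype.card (Idx4 n) * (C ^ 4 * C) + Fintype.card (Fin n × Idx4 n) * (C ^ 5 * C)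

theorem norm_mul_sum_le {A B : Matrix (Fin n) (Fin n) ℂ} {C : ℝ} (hC : 0 ≤ C)
    (hA : ∀ i j, ‖A i j‖ ≤ C) (hB : ∀ i j, ‖B i j‖ ≤ C) (i j : Fin n) :
    ‖(A * B) i j‖ ≤ n * (C * C) := by
  rw [Matrix.mul_apply]
  calc _ ≤ ∑ _k : Fin n, C * C := norm_sum_le_of_le _ fun k _ => by
        rw [norm_mul]; exact mul_le_mul (hA _ _) (hB _ _) (norm_nonneg _) hC
    _ = _ := by simp

/-- Bounds of a background metric at a point where it is comparable with the identity. -/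
theorem isBackground_of_bounds {q : ℝ × CSpace n} {M₀ N₀ : Matrix (Fin n) (Fin n) (SmoothGerm q)}
    {C : ℝ} (hC : 1 ≤ C) (hMN : M₀ * N₀ = 1) (hNM : N₀ * M₀ = 1)
    (herm : ∀ i j, (stw q).cj (M₀ i j) = M₀ j i) (static : dmap (stw q).t M₀ = 0)
    (hle : ∀ v, qf ((stw q).evM M₀) v ≤ C * ∑ i, ‖v i‖ ^ 2)
    (hge : ∀ v, ∑ i, ‖v i‖ ^ 2 ≤ C * qf ((stw q).evM M₀) v)
    (hrm : ((stw q).ev ((stw q).rmSq M₀ N₀)).re ≤ C ^ 2)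
    (hcov : ((stw q).ev ((stw q).covCurvSq M₀ N₀)).re ≤ C ^ 2) :
    (stw q).IsBackground M₀ N₀ (backgroundBound n C) := by
  set P := (stw q).evM M₀ with hP
  have hC0 : 0 ≤ C := by linarith
  have hpos : ∀ v, v ≠ 0 → 0 < qf P v := by
    intro v hv
    have h1 := hge v
    have h2 : 0 < ∑ i, ‖v i‖ ^ 2 := by
      obtain ⟨i, hi⟩ := Function.ne_iff.mp hv
      refine Finset.sum_pos' (fun _ _ => sq_nonneg _) ⟨i, Finset.mem_univ _, ?_⟩
      have : 0 < ‖v i‖ := norm_pos_iff.mpr hi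
      positivity
    by_contra hcon
    nlinarith
  have hPh : P.IsHermitian := by
    ext i j
    rw [Matrix.conjTranspose_apply, hP, TimeWirtinger.evM_apply, TimeWirtinger.evM_apply]
    exact ((stw q).ev_cj _).symm.trans (by rw [herm])
  obtain ⟨J, K, hJK, hKJ, hPK⟩ := exists_eq_mul_conjTranspose (posDef_of_qf_pos hPh hpos)
  -- Entries with square at most `C` have absolute value at most `C` because `C ≥ 1`; this avoids
  -- square roots in `backgroundBound`.
  have hCC : C ≤ C ^ 2 := by nlinarith
  have hK : ∀ i j, ‖K i j‖ ≤ C := fun i j =>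
    abs_le_of_sq_le_sq' ((norm_frame_sq_le hPK hle i j).trans hCC) hC0 |>.2
  have hJ : ∀ i j, ‖J i j‖ ≤ C := fun i j =>
    abs_le_of_sq_le_sq' ((norm_coframe_sq_le hJK hPK hge i j).trans hCC) hC0 |>.2
  have hinv : (stw q).evM N₀ = P⁻¹ := by
    refine (Matrix.inv_eq_right_inv ?_).symm
    rw [hP, ← map_mul, hMN, map_one]
  have p1 : 0 ≤ n * (C * C) := by positivity
  have p2 : 0 ≤ Fintype.card (Idx4 n) * (C ^ 4 * C) := by positivity
  have p3 : 0 ≤ Fintype.card (Fin n × Idx4 n) * (C ^ 5 * C) := by positivity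
  have hB : ∀ x, (x ≤ n * (C * C) ∨ x ≤ Fintype.card (Idx4 n) * (C ^ 4 * C) ∨
      x ≤ Fintype.card (Fin n × Idx4 n) * (C ^ 5 * C)) → x ≤ backgroundBound n C := by
    intro x hx
    unfold backgroundBound
    rcases hx with h | h | h <;> linarith
  have hBC : C ≤ backgroundBound n C := by unfold backgroundBound; linarith
  have hev : ∀ {κ : Type} [Fintype κ] (w : κ → κ → SmoothGerm q) (T : κ → SmoothGerm q),
      (stw q).ev (hermSq (stw q).cj w T) =
      hermSq (starRingEnd ℂ) (fun x y => (stw q).ev (w x y)) fun x => (stw q).ev (T x) := by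
    intro κ _ w T
    simp only [hermSq, map_sum, map_mul, (stw q).ev_cj]
  refine ⟨hMN, hNM, herm, static, by linarith, fun i j => ?_, fun i j => ?_, fun i j k l => ?_,
    fun m i j k l => ?_, fun v => ?_⟩
  · refine hB _ (Or.inl ?_)
    have h1 : (stw q).ev (M₀ i j) = (K * K.conjTranspose) i j := by rw [← hPK]; rfl
    rw [h1]
    exact norm_mul_sum_le hC0 hK (fun i j => by simpa using hK j i) i j
  · refine hB _ (Or.inl ?_)
    have h1 : (stw q).ev (N₀ i j) = (J.conjTranspose * J) i j := by
      rw [← frame_inv hJK hKJ hPK, ← hinv]; rfl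
    rw [h1]
    exact norm_mul_sum_le hC0 (fun i j => by simpa using hJ j i) hJ i j
  · refine hB _ (Or.inr (Or.inl ?_))
    have h1 := hev (weight4 N₀) fun x => (stw q).curv M₀ N₀ x.1.1 x.1.2 x.2.1 x.2.2
    have h2 : (fun x y : Idx4 n => (stw q).ev (weight4 N₀ x y)) = weight4 P⁻¹ := by
      ext x y; simp only [weight4, map_mul, ← hinv]; rfl
    rw [h2] at h1
    refine norm_le_of_change (T := fun x : Idx4 n =>
      (stw q).ev ((stw q).curv M₀ N₀ x.1.1 x.1.2 x.2.1 x.2.2)) (change4_mul hKJ)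
      (norm_change4_le hK) hC0 ?_ ((i, j), (k, l))
    rw [sum_norm_change4_sq hJK hKJ hPK, ← h1]
    exact hrm
  · refine hB _ (Or.inr (Or.inr ?_))
    have h1 := hev (weight5 N₀) fun x => (stw q).covCurv M₀ N₀ x.1 x.2.1.1 x.2.1.2 x.2.2.1 x.2.2.2
    have h2 : (fun x y : Fin n × Idx4 n => (stw q).ev (weight5 N₀ x y)) = weight5 P⁻¹ := by
      ext x y
      simp only [weight5, weight4, Matrix.kroneckerMap_apply, Matrix.transpose_apply,
        Matrix.of_apply, map_mul, ← hinv]; rfl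
    rw [h2] at h1
    refine norm_le_of_change (T := fun x : Fin n × Idx4 n =>
      (stw q).ev ((stw q).covCurv M₀ N₀ x.1 x.2.1.1 x.2.1.2 x.2.2.1 x.2.2.2)) (change5_mul hKJ)
      (norm_change5_le hK) hC0 ?_ (m, ((i, j), (k, l)))
    rw [sum_norm_change5_sq hJK hKJ hPK, ← h1]
    exact hcov
  · have h1 : (∑ i, ∑ j, v i * (stw q).ev (M₀ i j) * starRingEnd ℂ (v j)).re = qf P v := rfl
    rw [h1]
    have h2 : 0 ≤ ∑ i, ‖v i‖ ^ 2 := Finset.sum_nonneg fun _ _ => sq_nonneg _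
    have h3 : 0 < backgroundBound n C := by linarith
    have h4 := hge v
    have h5 : 0 ≤ qf P v := by
      by_contra hcon
      nlinarith
    rw [inv_mul_le_iff₀ h3]
    nlinarith

variable {t₀ : ℝ} {z₀ : CSpace n} {τ : CSpace n → CSpace n}

/-- Transformed metrics. -/
theorem IsRepM.change {M : Matrix (Fin n) (Fin n) (SmoothGerm ((t₀, τ z₀) : ℝ × CSpace n))}
    {G : ℝ → CSpace n → Matrix (Fin n) (Fin n) ℂ} (h : IsRepM M G) (hτ : AnalyticAt ℂ τ z₀)
    {J : Matrix (Fin n) (Fin n) (SmoothGerm ((t₀, z₀) : ℝ × CSpace n))}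
    (hJ : IsRepM J fun _ z => jac τ z) :
    IsRepM (J * (_root_.pull t₀ (contDiffAt_real hτ)).mapMatrix M * (stw (t₀, z₀)).adj J)
      fun t z => jac τ z * G t (τ z) * (jac τ z).conjTranspose := by
  refine (hJ.mul (h.pull (contDiffAt_real hτ))).mul (G' := fun _ z => (jac τ z).conjTranspose) ?_
  intro i j
  exact (hJ j i).cj

/-- Normal coordinates for a Kähler-Ricci flow at a point of space-time. -/
theorem exists_normal_coordinates {C : ℝ} (hC : 1 ≤ C)
    {G : ℝ → CSpace n → Matrix (Fin n) (Fin n) ℂ} {G₀ : CSpace n → Matrix (Fin n) (Fin n) ℂ}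
    (hG : LocalFlow G t₀ z₀) (hG₀ : LocalMetric G₀ z₀)
    (hle : ∀ v, qf (G₀ z₀) v ≤ C * qf (G t₀ z₀) v) (hge : ∀ v, qf (G t₀ z₀) v ≤ C * qf (G₀ z₀) v)
    (hrm : (rmSqAt G₀ z₀).re ≤ C ^ 2) (hcov : (covCurvSqAt G₀ z₀).re ≤ C ^ 2) :
    ∃ τ : CSpace n → CSpace n, AnalyticAt ℂ τ 0 ∧ τ 0 = z₀ ∧
      (∀ p, qf (G₀ z₀) (jac τ 0 p) ≤ C) ∧
      ∃ M N M₀ N₀ : Matrix (Fin n) (Fin n) (SmoothGerm ((t₀, 0) : ℝ × CSpace n)),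
        (stw (t₀, 0)).IsNormalFlow M N ∧ (stw (t₀, 0)).IsBackground M₀ N₀ (backgroundBound n C) ∧
        IsRep ((stw (t₀, 0)).rmSq M N) (fun t z => rmSqAt (G t) (τ z)) ∧
        IsRep ((stw (t₀, 0)).connDiffSq M N M₀ N₀) (fun t z => connDiffSqAt (G t) G₀ (τ z)) ∧
        (∀ K : ℝ, IsRep ((stw (t₀, 0)).connTest K M N M₀ N₀)
          (fun t z => connTestAt K (G t) G₀ (τ z))) ∧
        (∀ K : ℝ, IsRep ((stw (t₀, 0)).curvTest K M N M₀ N₀)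
          (fun t z => curvTestAt K (G t) G₀ (τ z))) := by
  have hpd := posDef_of_qf_pos hG.herm.self_of_nhds hG.pos
  obtain ⟨A, A', hAA', hA'A, hGA⟩ := exists_eq_mul_conjTranspose hpd
  have hdetG : (G t₀ z₀).det ≠ 0 :=
    isUnit_iff_ne_zero.mp ((Matrix.isUnit_iff_isUnit_det _).mp hpd.isUnit)
  -- The Jacobian of the quadratic map has derivative `b i m c + b m i c` at the origin. With the
  -- factor `-1/2` this is minus the connection in the frame `A`, so the inhomogeneous term in
  -- `conn_eq` cancels the connection at the point.
  set b : Fin n → Fin n → Fin n → ℂ := fun i m c =>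
    -2⁻¹ * ∑ d, ∑ e, A i d * A m e * christoffel (G t₀) c e d z₀ with hb
  set τ := quadMap z₀ A b with hτdef
  have hτ0 : τ 0 = z₀ := quadMap_zero _ _ _
  have hτ : AnalyticAt ℂ τ 0 := analyticAt_quadMap _ _ _ _
  have hjac0 : jac τ 0 = A := by ext i c; simp [hτdef, jac_quadMap]
  -- Here the Kähler condition enters: without the symmetry of the Christoffel symbols a holomorphic
  -- change of coordinates could remove only their symmetric part.
  have hb_symm : ∀ i m c, b i m c = b m i c := by
    intro i m c
    have hs : ∀ e d, christoffel (G t₀) c e d z₀ = christoffel (G t₀) c d e z₀ := fun e d =>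
      Finset.sum_congr rfl fun q _ => by rw [hG.kahler.self_of_nhds e d q]
    simp only [hb]
    rw [Finset.sum_comm]
    congr 1
    exact Finset.sum_congr rfl fun d _ => Finset.sum_congr rfl fun e _ => by rw [hs]; ring
  -- The germs live at the point `τ 0`. Replacing `z₀` by `τ 0` makes the base points agree
  -- syntactically.
  clear_value τ
  subst hτ0
  obtain ⟨M, hM⟩ := exists_isRepM hG.smooth
  obtain ⟨N, hN, hMN, hNM⟩ := hM.exists_inv hdetG
  obtain ⟨M₀, hM₀⟩ := exists_isRepM (G := fun _ => G₀) (hG₀.static t₀)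
  obtain ⟨N₀, hN₀, hMN₀, hNM₀⟩ := hM₀.exists_inv hG₀.det_ne
  obtain ⟨J, hJ⟩ := exists_isRepM_jac t₀ hτ
  have hdet : (jac τ 0).det ≠ 0 := by
    intro h0
    have := congrArg Matrix.det hAA'
    rw [Matrix.det_mul, ← hjac0, h0, zero_mul, Matrix.det_one] at this
    exact zero_ne_one this
  obtain ⟨K, hK, hch⟩ := holomorphicChange_pull hτ hJ hdet
  set φ := pull t₀ (contDiffAt_real hτ) with hφ
  set W := stw (t₀, τ 0) with hW
  set V := stw ((t₀, 0) : ℝ × CSpace n) with hV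
  have hevJ : V.evM J = A := by
    ext i c; exact (hJ i c).eval_eq.trans (congrFun (congrFun hjac0 i) c)
  have hevadj : V.evM (V.adj J) = A.conjTranspose := by
    ext i c
    rw [TimeWirtinger.evM_apply, Wirtinger.adj, Matrix.transpose_apply, Matrix.map_apply, V.ev_cj,
      ← TimeWirtinger.evM_apply, hevJ]; rfl
  have hevφ : ∀ X : Matrix (Fin n) (Fin n) (SmoothGerm ((t₀, τ 0) : ℝ × CSpace n)),
      V.evM (φ.mapMatrix X) = W.evM X := fun X => by
    ext i c; exact ev_pull hτ _
  have hevM : W.evM M = G t₀ (τ 0) := by ext i c; exact (hM i c).eval_eq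
  have hevM₀ : W.evM M₀ = G₀ (τ 0) := by ext i c; exact (hM₀ i c).eval_eq
  have hone : A * G t₀ (τ 0) * A.conjTranspose = 1 := frame_eq_one hAA' hGA
  have hherm' : ∀ i j, V.cj ((J * φ.mapMatrix M * V.adj J) i j) = (J * φ.mapMatrix M * V.adj J) j i := by
    have h1 := hM.change hτ hJ
    refine h1.herm ?_
    filter_upwards [(tendsto_prodMap (contDiffAt_real hτ)).eventually hG.herm] with x hx
    exact Matrix.isHermitian_mul_mul_conjTranspose _ hx
  have hherm₀' : ∀ i j, V.cj ((J * φ.mapMatrix M₀ * V.adj J) i j) =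
      (J * φ.mapMatrix M₀ * V.adj J) j i := by
    have h1 := hM₀.change hτ hJ
    refine h1.herm ?_
    filter_upwards [(continuous_snd.tendsto ((t₀, 0) : ℝ × CSpace n)).eventually
      ((contDiffAt_real hτ).continuousAt.eventually hG₀.herm)] with x hx
    exact Matrix.isHermitian_mul_mul_conjTranspose _ hx
  have ev_one : V.evM (J * φ.mapMatrix M * V.adj J) = 1 := by
    rw [map_mul, map_mul, hevJ, hevadj, hevφ, hevM, hone]
  have ev_conn : ∀ m, V.evM (V.conn (J * φ.mapMatrix M * V.adj J) (V.adj K * φ.mapMatrix N * K) m)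
      = 0 := by
    intro m
    rw [hch.conn_eq hMN]
    have e1 : V.evM (dmap (V.d m) J) = Matrix.of fun i c => b i m c + b m i c := by
      ext i c
      rw [TimeWirtinger.evM_apply, dmap_apply, ((hJ i c).d m).eval_eq, Matrix.of_apply, hτdef]
      exact dz_jac_quadMap _ _ _ _ _ _
    have e2 : V.evM (J * ∑ c, J m c • φ.mapMatrix (W.conn M N c)) =
        Matrix.of fun i c => -(b i m c + b m i c) := by
      ext i c
      have e3 : ∀ e, V.evM (J m e • φ.mapMatrix (W.conn M N e)) =
          Matrix.of fun d c => A m e * christoffel (G t₀) c e d (τ 0) := by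
        intro e
        ext d c
        rw [TimeWirtinger.evM_apply, Matrix.smul_apply, smul_eq_mul, map_mul, Matrix.of_apply]
        congr 1
        · exact congrFun (congrFun hevJ m) e
        · refine (ev_pull hτ _).trans ?_
          exact (hM.conn hN e d c).eval_eq
      rw [map_mul, map_sum, hevJ, Matrix.of_apply, ← hb_symm i m c]
      simp only [e3, Matrix.mul_apply, Matrix.sum_apply, Matrix.of_apply, hb, Finset.mul_sum]
      rw [← Finset.sum_add_distrib, ← Finset.sum_neg_distrib]
      refine Finset.sum_congr rfl fun d _ => ?_
      rw [← Finset.sum_add_distrib, ← Finset.sum_neg_distrib]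
      exact Finset.sum_congr rfl fun e _ => by ring
    have e4 : (Matrix.of fun i c => -(b i m c + b m i c)) =
        -(Matrix.of fun i c => b i m c + b m i c : Matrix (Fin n) (Fin n) ℂ) := rfl
    rw [map_add, map_mul, map_mul, e1, e2, e4, neg_mul, add_neg_cancel]
  have hMN' := hch.inv_mul_inv hMN
  have hNM' : (V.adj K * φ.mapMatrix N * K) * (J * φ.mapMatrix M * V.adj J) = 1 :=
    mul_eq_one_comm.mp hMN'
  have ev_d : ∀ m, V.evM (dmap (V.d m) (J * φ.mapMatrix M * V.adj J)) = 0 := by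
    intro m
    have e1 : dmap (V.d m) (J * φ.mapMatrix M * V.adj J) =
        V.conn (J * φ.mapMatrix M * V.adj J) (V.adj K * φ.mapMatrix N * K) m *
          (J * φ.mapMatrix M * V.adj J) := by
      calc _ = dmap (V.d m) (J * φ.mapMatrix M * V.adj J) *
            ((V.adj K * φ.mapMatrix N * K) * (J * φ.mapMatrix M * V.adj J)) := by
            rw [hNM', mul_one]
        _ = _ := (mul_assoc _ _ _).symm
    rw [e1, map_mul, ev_conn, zero_mul]
  have ev_db : ∀ m, V.evM (dmap (V.db m) (J * φ.mapMatrix M * V.adj J)) = 0 := by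
    intro m
    ext i j
    rw [TimeWirtinger.evM_apply, dmap_apply, ← hherm' j i, V.db_cj, V.ev_cj]
    have := congrFun (congrFun (ev_d m) j) i
    rw [TimeWirtinger.evM_apply, dmap_apply] at this
    rw [this]; simp
  have hflow := hch.flow_eq hNM (t_pull hτ) (fun i c => (hJ i c).t_eq_zero)
    (hM.flow hN hG.herm hG.kahler hG.flow)
  have hstat : dmap V.t (J * φ.mapMatrix M₀ * V.adj J) = 0 := by
    have := hM₀.change hτ hJ
    exact IsRepM.static (G₀ := fun z => jac τ z * G₀ (τ z) * (jac τ z).conjTranspose) this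
  have hP : V.evM (J * φ.mapMatrix M₀ * V.adj J) = A * G₀ (τ 0) * A.conjTranspose := by
    rw [map_mul, map_mul, hevJ, hevadj, hevφ, hevM₀]
  -- In the new frame `g(t₀)` is the identity, so the comparison with `G t₀` becomes the comparison
  -- with the Euclidean norm required by `isBackground_of_bounds`.
  have hq1 : ∀ v, qf (G t₀ (τ 0)) (Matrix.vecMul v A) = ∑ i, ‖v i‖ ^ 2 := fun v => by
    rw [← qf_change, hone, qf_one]
  refine ⟨τ, hτ, rfl, fun p => ?_, _, _, _, _, ⟨hMN', hNM', ev_one, ev_d, ev_db, hflow⟩,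
    isBackground_of_bounds hC (hch.inv_mul_inv hMN₀) (mul_eq_one_comm.mp (hch.inv_mul_inv hMN₀))
      hherm₀' hstat ?_ ?_ ?_ ?_, ?_, ?_, fun K' => ?_, fun K' => ?_⟩
  · have h1 : jac τ 0 p = Matrix.vecMul (Pi.single p 1) A := by rw [hjac0]; ext; simp
    have h2 := hle (Matrix.vecMul (Pi.single p 1) A)
    rw [hq1] at h2
    have h3 : ∑ k, ‖(Pi.single p 1 : Fin n → ℂ) k‖ ^ 2 = 1 := by
      rw [Finset.sum_eq_single p]
      · simp
      · intro b _ hb; simp [hb]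
      · simp
    rw [h1]
    rwa [h3, mul_one] at h2
  · intro v
    rw [hP, qf_change, ← hq1]
    exact hle _
  · intro v
    rw [hP, qf_change, ← hq1]
    exact hge _
  · rw [hch.rmSq_eq hNM₀]
    refine le_trans (le_of_eq ?_) hrm
    rw [hφ, ev_pull hτ, (hM₀.rmSq hN₀).eval_eq]
  · rw [hch.covCurvSq_eq hMN₀ hNM₀]
    refine le_trans (le_of_eq ?_) hcov
    rw [hφ, ev_pull hτ, (hM₀.covCurvSq hN₀).eval_eq]
  · rw [hch.rmSq_eq hNM]
    exact (hM.rmSq hN).pull (contDiffAt_real hτ)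
  · rw [hch.connDiffSq_eq hMN hMN₀]
    exact (hM.connDiffSq hN hM₀ hN₀).pull (contDiffAt_real hτ)
  · have e : V.connTest K' (J * φ.mapMatrix M * V.adj J) (V.adj K * φ.mapMatrix N * K)
        (J * φ.mapMatrix M₀ * V.adj J) (V.adj K * φ.mapMatrix N₀ * K) =
        φ (W.connTest K' M N M₀ N₀) := by
      rw [TimeWirtinger.connTest, TimeWirtinger.connTest, hch.connDiffSq_eq hMN hMN₀,
        hch.relTrace_eq, map_mul, map_add]
      rfl
    rw [e]
    exact (hM.connTest hN hM₀ hN₀ K').pull (contDiffAt_real hτ)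
  · have e : V.curvTest K' (J * φ.mapMatrix M * V.adj J) (V.adj K * φ.mapMatrix N * K)
        (J * φ.mapMatrix M₀ * V.adj J) (V.adj K * φ.mapMatrix N₀ * K) =
        φ (W.curvTest K' M N M₀ N₀) := by
      rw [TimeWirtinger.curvTest, TimeWirtinger.curvTest, hch.connDiffSq_eq hMN hMN₀,
        hch.rmSq_eq hNM, map_mul, map_add]
      rfl
    rw [e]
    exact (hM.curvTest hN hM₀ hN₀ K').pull (contDiffAt_real hτ)

end Normal
end

noncomputable section

open Filter Topology

/-! ### Differential inequalities in normal coordinates -/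

section Heat

variable {n : ℕ}

/-- The inequality `(∂ₜ - Δ) F ≤ -c F² + D` at `(t₀, 0)`, with the Laplacian in the coordinates. -/
def HeatBound (F : ℝ → CSpace n → ℂ) (t₀ c D : ℝ) : Prop :=
  ∃ d, HasDerivAt (fun s => (F s 0).re) d t₀ ∧ ContDiffAt ℝ ∞ (F t₀) 0 ∧
    d - ∑ p, (dz p (dzbar p (F t₀)) 0).re ≤ -c * (F t₀ 0).re ^ 2 + D

theorem IsRep.slice {q : ℝ × CSpace n} {a : SmoothGerm q} {F : ℝ → CSpace n → ℂ} (h : IsRep a F) :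
    ContDiffAt ℝ ∞ (F q.1) q.2 :=
  ContDiffAt.comp (g := fun x : ℝ × CSpace n => F x.1 x.2) (f := fun z => (q.1, z)) q.2
    h.contDiffAt (contDiffAt_const.prodMk contDiffAt_id)

theorem IsRep.heatBound {t₀ : ℝ} {a : SmoothGerm ((t₀, 0) : ℝ × CSpace n)} {F : ℝ → CSpace n → ℂ}
    (h : IsRep a F) {c D : ℝ} (ha : ((stw (t₀, 0)).ell a).re ≤ -c * ((stw (t₀, 0)).ev a).re ^ 2 + D) :
    HeatBound F t₀ c D := by
  refine ⟨_, (Complex.reCLM.hasFDerivAt.comp_hasDerivAt t₀ h.hasDerivAt.self_of_nhds), h.slice, ?_⟩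
  rw [TimeWirtinger.ell, h.eval_eq, h.t.eval_eq] at ha
  have h1 : ∀ p, (stw (t₀, 0)).ev ((stw (t₀, 0)).d p ((stw (t₀, 0)).db p a)) =
      dz p (dzbar p (F t₀)) 0 := fun p => ((h.db p).d p).eval_eq
  simp only [h1, Complex.sub_re, Complex.re_sum] at ha
  exact ha

/-- The pointwise hypotheses under which the differential inequalities hold. -/
structure ComparableFlow (G : ℝ → CSpace n → Matrix (Fin n) (Fin n) ℂ)
    (G₀ : CSpace n → Matrix (Fin n) (Fin n) ℂ) (C t₀ : ℝ) (z₀ : CSpace n) : Prop where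
  flow : LocalFlow G t₀ z₀
  metric : LocalMetric G₀ z₀
  le : ∀ v, qf (G₀ z₀) v ≤ C * qf (G t₀ z₀) v
  ge : ∀ v, qf (G t₀ z₀) v ≤ C * qf (G₀ z₀) v
  rm : (rmSqAt G₀ z₀).re ≤ C ^ 2
  cov : (covCurvSqAt G₀ z₀).re ≤ C ^ 2

theorem backgroundBound_ge {C : ℝ} (hC : 1 ≤ C) : 1 ≤ backgroundBound n C := by
  have : 0 ≤ C := by linarith
  have p1 : 0 ≤ n * (C * C) := by positivity
  have p2 : 0 ≤ Fintype.card (Idx4 n) * (C ^ 4 * C) := by positivity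
  have p3 : 0 ≤ Fintype.card (Fin n × Idx4 n) * (C ^ 5 * C) := by positivity
  unfold backgroundBound
  linarith

/-- As `K ≥ 1` and `tr_g g₀ ≥ 0`, the test function dominates `|Γ - Γ₀|²`. The coordinates are
unitary for the evolving metric; the bound on the Jacobian records that their frame is also bounded
for `g₀`, in terms of which the barriers are controlled. -/
theorem exists_connTest_heat (n : ℕ) {C : ℝ} (hC : 1 ≤ C) :
    ∃ K c D : ℝ, 1 ≤ K ∧ 0 < c ∧ 0 ≤ D ∧
    ∀ (G : ℝ → CSpace n → Matrix (Fin n) (Fin n) ℂ) (G₀ : CSpace n → Matrix (Fin n) (Fin n) ℂ)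
      (t₀ : ℝ) (z₀ : CSpace n), ComparableFlow G G₀ C t₀ z₀ →
      (connDiffSqAt (G t₀) G₀ z₀).re ≤ (connTestAt K (G t₀) G₀ z₀).re ∧
      ∃ τ : CSpace n → CSpace n, AnalyticAt ℂ τ 0 ∧ τ 0 = z₀ ∧ (∀ p, qf (G₀ z₀) (jac τ 0 p) ≤ C) ∧
        HeatBound (fun t z => connTestAt K (G t) G₀ (τ z)) t₀ c D := by
  obtain ⟨K, c, D, hK, hc, hD, H⟩ := TimeWirtinger.exists_connTest_bound n (backgroundBound_ge (n := n) hC)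
  refine ⟨K, c, D, hK, hc, hD, fun G G₀ t₀ z₀ h => ?_⟩
  obtain ⟨τ, hτ, rfl, hp, M, N, M₀, N₀, hflow, hback, -, h1, h2, -⟩ :=
    exists_normal_coordinates hC h.flow h.metric h.le h.ge h.rm h.cov
  refine ⟨?_, τ, hτ, rfl, hp, (h2 K).heatBound (H _ _ _ _ _ _ hflow hback)⟩
  have n1 := hflow.connDiffSq_nonneg (G₀ := M₀) (H₀ := N₀)
  have n2 := hflow.relTrace_nonneg hback
  have e3 : ((stw (t₀, 0)).ev ((stw (t₀, 0)).connTest K M N M₀ N₀)).re =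
      ((stw (t₀, 0)).ev ((stw (t₀, 0)).connDiffSq M N M₀ N₀)).re *
        (K + ((stw (t₀, 0)).ev (Wirtinger.relTrace N M₀)).re) := by
    rw [TimeWirtinger.connTest, map_mul, map_add, Wirtinger.ev_algebraMap, hflow.ev_connDiffSq,
      Complex.re_ofReal_mul, Complex.add_re, Complex.ofReal_re, Complex.ofReal_re]
  rw [h1.eval_eq, (h2 K).eval_eq] at e3
  rw [h1.eval_eq] at n1
  change (connDiffSqAt (G t₀) G₀ (τ 0)).re ≤ (connTestAt K (G t₀) G₀ (τ 0)).re
  rw [e3]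
  nlinarith

/-- Here the bound `S` of `|Γ - Γ₀|²` is an input; it is supplied by the estimate of the first test
function. -/
theorem exists_curvTest_heat (n : ℕ) {C S : ℝ} (hC : 1 ≤ C) (hS : 0 ≤ S) :
    ∃ K c D : ℝ, 1 ≤ K ∧ 0 < c ∧ 0 ≤ D ∧
    ∀ (G : ℝ → CSpace n → Matrix (Fin n) (Fin n) ℂ) (G₀ : CSpace n → Matrix (Fin n) (Fin n) ℂ)
      (t₀ : ℝ) (z₀ : CSpace n), ComparableFlow G G₀ C t₀ z₀ → (connDiffSqAt (G t₀) G₀ z₀).re ≤ S →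
      (rmSqAt (G t₀) z₀).re ≤ (curvTestAt K (G t₀) G₀ z₀).re ∧
      ∃ τ : CSpace n → CSpace n, AnalyticAt ℂ τ 0 ∧ τ 0 = z₀ ∧ (∀ p, qf (G₀ z₀) (jac τ 0 p) ≤ C) ∧
        HeatBound (fun t z => curvTestAt K (G t) G₀ (τ z)) t₀ c D := by
  obtain ⟨K, c, D, hK, hc, hD, H⟩ := TimeWirtinger.exists_curvTest_bound n (backgroundBound_ge (n := n) hC) hS
  refine ⟨K, c, D, hK, hc, hD, fun G G₀ t₀ z₀ h hle => ?_⟩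
  obtain ⟨τ, hτ, rfl, hp, M, N, M₀, N₀, hflow, hback, h0, h1, -, h2⟩ :=
    exists_normal_coordinates hC h.flow h.metric h.le h.ge h.rm h.cov
  refine ⟨?_, τ, hτ, rfl, hp,
    (h2 K).heatBound (H _ _ _ _ _ _ hflow hback (by rw [h1.eval_eq]; exact hle))⟩
  have n1 := hflow.connDiffSq_nonneg (G₀ := M₀) (H₀ := N₀)
  have n2 := hflow.rmSq_nonneg
  have e3 : ((stw (t₀, 0)).ev ((stw (t₀, 0)).curvTest K M N M₀ N₀)).re =
      ((stw (t₀, 0)).ev ((stw (t₀, 0)).rmSq M N)).re *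
        (K + ((stw (t₀, 0)).ev ((stw (t₀, 0)).connDiffSq M N M₀ N₀)).re) := by
    rw [TimeWirtinger.curvTest, map_mul, map_add, Wirtinger.ev_algebraMap, hflow.ev_rmSq,
      Complex.re_ofReal_mul, Complex.add_re, Complex.ofReal_re, Complex.ofReal_re]
  rw [h0.eval_eq, h1.eval_eq, (h2 K).eval_eq] at e3
  rw [h1.eval_eq] at n1
  rw [h0.eval_eq] at n2
  change (rmSqAt (G t₀) (τ 0)).re ≤ (curvTestAt K (G t₀) G₀ (τ 0)).re
  rw [e3]
  nlinarith

end Heat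

/-! ### Smooth families up to the boundary in time -/

section Families

variable {n : ℕ} {T : ℝ} {U : Set (CSpace n)}

/-- Smoothness on `[0, T] × U`. -/
def SmoothFam (T : ℝ) (U : Set (CSpace n)) (F : ℝ → CSpace n → ℂ) : Prop :=
  ContDiffOn ℝ ∞ (fun x : ℝ × CSpace n => F x.1 x.2) (Icc 0 T ×ˢ U)

namespace SmoothFam

variable {F F' : ℝ → CSpace n → ℂ}

theorem const (c : ℂ) : SmoothFam T U fun _ _ => c := contDiffOn_const

theorem add (h : SmoothFam T U F) (h' : SmoothFam T U F') : SmoothFam T U fun t z => F t z + F' t z :=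
  ContDiffOn.add h h'

theorem sub (h : SmoothFam T U F) (h' : SmoothFam T U F') : SmoothFam T U fun t z => F t z - F' t z :=
  ContDiffOn.sub h h'

theorem neg (h : SmoothFam T U F) : SmoothFam T U fun t z => -F t z := ContDiffOn.neg h

theorem mul (h : SmoothFam T U F) (h' : SmoothFam T U F') : SmoothFam T U fun t z => F t z * F' t z :=
  ContDiffOn.mul h h'

theorem sum {ι : Type*} {s : Finset ι} {F : ι → ℝ → CSpace n → ℂ} (h : ∀ i, SmoothFam T U (F i)) :
    SmoothFam T U fun t z => ∑ i ∈ s, F i t z := ContDiffOn.sum fun i _ => h i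

theorem cj (h : SmoothFam T U F) : SmoothFam T U fun t z => conj (F t z) :=
  Complex.conjCLE.contDiff.comp_contDiffOn h

/-- On the closed time interval only derivatives within the product set are available. They are
unique because `0 < T`, and in spatial directions they are the ordinary derivatives of the slices
because `U` is open. -/
theorem slice_fderiv (hT : 0 < T) (hU : IsOpen U) (h : SmoothFam T U F) (v : CSpace n) :
    SmoothFam T U fun t z => fderiv ℝ (F t) z v := by
  have hud : UniqueDiffOn ℝ (Icc 0 T ×ˢ U) := (uniqueDiffOn_Icc hT).prod hU.uniqueDiffOn
  have h1 : ContDiffOn ℝ ∞ (fun x => fderivWithin ℝ (fun x : ℝ × CSpace n => F x.1 x.2)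
      (Icc 0 T ×ˢ U) x (0, v)) (Icc 0 T ×ˢ U) :=
    (h.fderivWithin hud (m := ∞) (by simp)).clm_apply contDiffOn_const
  refine h1.congr fun x hx => ?_
  have h2 : HasFDerivWithinAt (fun x : ℝ × CSpace n => F x.1 x.2) _ (Icc 0 T ×ˢ U) x :=
    ((h.differentiableOn (by simp)) x hx).hasFDerivWithinAt
  have h3 : HasFDerivWithinAt (fun z : CSpace n => (x.1, z))
      (ContinuousLinearMap.inr ℝ ℝ (CSpace n)) U x.2 :=
    (hasFDerivAt_prodMk_right x.1 x.2).hasFDerivWithinAt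
  have h4 : HasFDerivWithinAt (F x.1) _ U x.2 :=
    HasFDerivWithinAt.comp (g := fun x : ℝ × CSpace n => F x.1 x.2) x.2
      (f := fun z => (x.1, z)) h2 h3 fun z hz => ⟨hx.1, hz⟩
  have h5 := (h4.hasFDerivAt (hU.mem_nhds hx.2)).fderiv
  change fderiv ℝ (F x.1) x.2 v = _
  rw [h5]
  rfl

theorem dz (hT : 0 < T) (hU : IsOpen U) (h : SmoothFam T U F) (i : Fin n) :
    SmoothFam T U fun t z => dz i (F t) z := by
  have := ((h.slice_fderiv hT hU (EuclideanSpace.single i 1)).sub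
    ((const Complex.I).mul (h.slice_fderiv hT hU (EuclideanSpace.single i Complex.I)))).mul
      (const 2⁻¹)
  exact ContDiffOn.congr this fun x _ => div_eq_mul_inv _ _

theorem dzbar (hT : 0 < T) (hU : IsOpen U) (h : SmoothFam T U F) (i : Fin n) :
    SmoothFam T U fun t z => dzbar i (F t) z := by
  have := ((h.slice_fderiv hT hU (EuclideanSpace.single i 1)).add
    ((const Complex.I).mul (h.slice_fderiv hT hU (EuclideanSpace.single i Complex.I)))).mul
      (const 2⁻¹)
  exact ContDiffOn.congr this fun x _ => div_eq_mul_inv _ _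

theorem hermSq {κ : Type*} [Fintype κ] {w : ℝ → CSpace n → κ → κ → ℂ} {T' : ℝ → CSpace n → κ → ℂ}
    (hw : ∀ x y, SmoothFam T U fun t z => w t z x y) (hT : ∀ x, SmoothFam T U fun t z => T' t z x) :
    SmoothFam T U fun t z => _root_.hermSq (starRingEnd ℂ) (w t z) (T' t z) :=
  sum fun x => sum fun y => (hw x y).mul ((hT x).mul (hT y).cj)

variable {G G₀ : ℝ → CSpace n → Matrix (Fin n) (Fin n) ℂ}

theorem inv (h : ∀ i j, SmoothFam T U fun t z => G t z i j)
    (hdet : ∀ t ∈ Icc 0 T, ∀ z ∈ U, (G t z).det ≠ 0) (i j : Fin n) :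
    SmoothFam T U fun t z => (G t z)⁻¹ i j := fun x hx =>
  contDiffWithinAt_inv_apply (M := fun x : ℝ × CSpace n => G x.1 x.2) (fun i j => h i j x hx)
    (hdet _ hx.1 _ hx.2) i j

section Tensors

variable (hT : 0 < T) (hU : IsOpen U) (h : ∀ i j, SmoothFam T U fun t z => G t z i j)
  (h' : ∀ i j, SmoothFam T U fun t z => (G t z)⁻¹ i j)
include hT hU h h'

theorem christoffel (p m i : Fin n) : SmoothFam T U fun t z => christoffel (G t) p m i z :=
  sum fun q => (h' q p).mul ((h i q).dz hT hU m)

theorem curvature (i j k l : Fin n) : SmoothFam T U fun t z => curvature (G t) i j k l z :=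
  (((h k l).dzbar hT hU j).dz hT hU i).neg.add (sum fun p => sum fun q =>
    ((h' q p).mul ((h k q).dz hT hU i)).mul ((h p l).dzbar hT hU j))

theorem rmSqAt : SmoothFam T U fun t z => rmSqAt (G t) z :=
  hermSq (w := fun t z => weight4 (G t z)⁻¹)
    (fun _ _ => ((h' _ _).mul (h' _ _)).mul ((h' _ _).mul (h' _ _)))
    fun _ => curvature hT hU h h' _ _ _ _

variable (h₀ : ∀ i j, SmoothFam T U fun t z => G₀ t z i j)
  (h₀' : ∀ i j, SmoothFam T U fun t z => (G₀ t z)⁻¹ i j)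
include h₀ h₀'

theorem connDiffSqAt : SmoothFam T U fun t z => connDiffSqAt (G t) (G₀ t) z :=
  hermSq (w := fun t z => weight3 (G t z) (G t z)⁻¹)
    (fun _ _ => (h' _ _).mul ((h' _ _).mul (h _ _)))
    fun _ => (christoffel hT hU h h' _ _ _).sub (christoffel hT hU h₀ h₀' _ _ _)

theorem connTestAt (K : ℝ) : SmoothFam T U fun t z => connTestAt K (G t) (G₀ t) z :=
  (connDiffSqAt hT hU h h' h₀ h₀').mul ((const _).add
    (sum fun i => sum fun j => (h' j i).mul (h₀ i j)))

theorem curvTestAt (K : ℝ) : SmoothFam T U fun t z => curvTestAt K (G t) (G₀ t) z :=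
  (rmSqAt hT hU h h').mul ((const _).add (connDiffSqAt hT hU h h' h₀ h₀'))

end Tensors

end SmoothFam

end Families
end

noncomputable section

open Filter Topology

/-! ### Metrics in charts -/

section Charts

variable {n : ℕ} {X : Type*} [TopologicalSpace X] [ChartedSpace (CSpace n) X]

/-- The change of charts from the chart at `b` to the chart at `a`. -/
def transition (a b : X) (z : CSpace n) : CSpace n :=
  chartAt (CSpace n) a ((chartAt (CSpace n) b).symm z)

/-- The derivative of the inverse of the chart at `a`. -/
def chartDeriv (a : X) (z : CSpace n) : CSpace n →L[ℂ] CSpace n :=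
  mfderiv 𝓘(ℂ, CSpace n) 𝓘(ℂ, CSpace n) (chartAt (CSpace n) a).symm z

/-- A Hermitian metric as a function of vectors of the model space. -/
def HermitianMetric.inner (g : HermitianMetric n X) (x : X) (v w : CSpace n) : ℂ := g.form x v w

namespace HermitianMetric

variable (g : HermitianMetric n X)

theorem inner_add_left (x : X) (u v w : CSpace n) :
    g.inner x (u + v) w = g.inner x u w + g.inner x v w :=
  (congrArg (fun f => f w) (map_add (g.form x) u v)).trans rfl

theorem inner_smul_left (x : X) (c : ℂ) (v w : CSpace n) :
    g.inner x (c • v) w = c * g.inner x v w :=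
  (congrArg (fun f => f w) (map_smul (g.form x) c v)).trans rfl

theorem conj_inner (x : X) (v w : CSpace n) : conj (g.inner x v w) = g.inner x w v :=
  g.conj_symm x v w

theorem inner_smul_right (x : X) (c : ℂ) (v w : CSpace n) :
    g.inner x v (c • w) = conj c * g.inner x v w := by
  rw [← conj_inner, inner_smul_left, map_mul, conj_inner]

theorem inner_sum_left {ι : Type*} (s : Finset ι) (x : X) (f : ι → CSpace n) (w : CSpace n) :
    g.inner x (∑ i ∈ s, f i) w = ∑ i ∈ s, g.inner x (f i) w := by
  classical
  induction s using Finset.induction_on with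
  | empty =>
    simp only [Finset.sum_empty]
    have := g.inner_smul_left x 0 0 w
    simpa using this
  | insert i s hi ih => rw [Finset.sum_insert hi, Finset.sum_insert hi, inner_add_left, ih]

theorem inner_sum_right {ι : Type*} (s : Finset ι) (x : X) (f : ι → CSpace n) (v : CSpace n) :
    g.inner x v (∑ i ∈ s, f i) = ∑ i ∈ s, g.inner x v (f i) := by
  rw [← conj_inner, inner_sum_left, map_sum]
  exact Finset.sum_congr rfl fun i _ => g.conj_inner _ _ _

theorem coord_apply (a : X) (z : CSpace n) (i j : Fin n) : g.coord a z i j =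
    g.inner ((chartAt (CSpace n) a).symm z) (chartDeriv a z (EuclideanSpace.single i 1))
      (chartDeriv a z (EuclideanSpace.single j 1)) := rfl

theorem sum_single (v : CSpace n) : ∑ i, v i • (EuclideanSpace.single i 1 : CSpace n) = v := by
  ext k
  simp [WithLp.ofLp_sum, Finset.sum_apply, Pi.single_apply]

theorem sf_coord (a : X) (z v w : CSpace n) : sf (g.coord a z) v w =
    g.inner ((chartAt (CSpace n) a).symm z) (chartDeriv a z v) (chartDeriv a z w) := by
  conv_rhs => rw [← sum_single v, ← sum_single w]
  simp only [map_sum, map_smul, inner_sum_left, inner_sum_right, inner_smul_left,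
    inner_smul_right, sf, coord_apply]
  rw [Finset.sum_comm]
  refine Finset.sum_congr rfl fun i _ => ?_
  rw [Finset.mul_sum]
  exact Finset.sum_congr rfl fun j _ => by ring

theorem isHermitian_coord (a : X) (z : CSpace n) : (g.coord a z).IsHermitian := by
  ext i j
  rw [Matrix.conjTranspose_apply, coord_apply, coord_apply]
  exact g.conj_inner _ _ _

variable [IsManifold 𝓘(ℂ, CSpace n) ω X]

theorem _root_.contMDiffAt_chart_symm {a : X} {z : CSpace n}
    (hz : z ∈ (chartAt (CSpace n) a).target) :
    ContMDiffAt 𝓘(ℂ, CSpace n) 𝓘(ℂ, CSpace n) ω (chartAt (CSpace n) a).symm z :=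
  (contMDiffOn_chart_symm (x := a) (n := ω) z hz).contMDiffAt
    ((chartAt (CSpace n) a).open_target.mem_nhds hz)

theorem _root_.contMDiffAt_chart_of_mem {a x : X} (hx : x ∈ (chartAt (CSpace n) a).source) :
    ContMDiffAt 𝓘(ℂ, CSpace n) 𝓘(ℂ, CSpace n) ω (chartAt (CSpace n) a) x :=
  (contMDiffOn_chart (x := a) (n := ω) _ hx).contMDiffAt
    ((chartAt (CSpace n) a).open_source.mem_nhds hx)

theorem _root_.analyticAt_transition {a b : X} {z : CSpace n}
    (hz : z ∈ (chartAt (CSpace n) b).target)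
    (h : (chartAt (CSpace n) b).symm z ∈ (chartAt (CSpace n) a).source) :
    AnalyticAt ℂ (transition a b) z :=
  ((contMDiffAt_chart_of_mem h).comp z (contMDiffAt_chart_symm hz)).contDiffAt.analyticAt

theorem _root_.chartDeriv_transition {a b : X} {z : CSpace n}
    (hz : z ∈ (chartAt (CSpace n) b).target)
    (h : (chartAt (CSpace n) b).symm z ∈ (chartAt (CSpace n) a).source) (v : CSpace n) :
    chartDeriv b z v = chartDeriv a (transition a b z) (fderiv ℂ (transition a b) z v) := by
  have h1 : transition a b z ∈ (chartAt (CSpace n) a).target :=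
    (chartAt (CSpace n) a).map_source h
  have h2 : MDifferentiableAt 𝓘(ℂ, CSpace n) 𝓘(ℂ, CSpace n) (chartAt (CSpace n) a).symm
      (transition a b z) := (contMDiffAt_chart_symm h1).mdifferentiableAt (by simp)
  have h3 : MDifferentiableAt 𝓘(ℂ, CSpace n) 𝓘(ℂ, CSpace n) (transition a b) z :=
    (analyticAt_transition hz h).differentiableAt.mdifferentiableAt
  have h4 : (chartAt (CSpace n) a).symm ∘ transition a b =ᶠ[𝓝 z] (chartAt (CSpace n) b).symm := by
    have hc : ContinuousAt (chartAt (CSpace n) b).symm z :=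
      (chartAt (CSpace n) b).continuousAt_symm hz
    filter_upwards [hc.eventually ((chartAt (CSpace n) a).open_source.mem_nhds h)] with w hw
    exact (chartAt (CSpace n) a).left_inv hw
  have h5 := mfderiv_comp z h2 h3
  rw [h4.mfderiv_eq, mfderiv_eq_fderiv] at h5
  exact DFunLike.congr_fun h5 v

theorem _root_.symm_transition {a b : X} {z : CSpace n}
    (h : (chartAt (CSpace n) b).symm z ∈ (chartAt (CSpace n) a).source) :
    (chartAt (CSpace n) a).symm (transition a b z) = (chartAt (CSpace n) b).symm z :=
  (chartAt (CSpace n) a).left_inv h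

theorem sf_transition {a b : X} {z : CSpace n} (hz : z ∈ (chartAt (CSpace n) b).target)
    (h : (chartAt (CSpace n) b).symm z ∈ (chartAt (CSpace n) a).source) (v w : CSpace n) :
    sf (g.coord b z) v w = sf (g.coord a (transition a b z)) (fderiv ℂ (transition a b) z v)
      (fderiv ℂ (transition a b) z w) := by
  rw [sf_coord, sf_coord, chartDeriv_transition hz h, chartDeriv_transition hz h,
    symm_transition h]

theorem _root_.fderiv_eq_vecMul_jac {τ : CSpace n → CSpace n} {z : CSpace n} (v : CSpace n)  :
    (fderiv ℂ τ z v : Fin n → ℂ) = Matrix.vecMul v (jac τ z) := by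
  ext c
  conv_lhs => rw [← sum_single v]
  simp [Matrix.vecMul, dotProduct, jac, WithLp.ofLp_sum, Finset.sum_apply]

theorem _root_.sf_single (P : Matrix (Fin n) (Fin n) ℂ) (i j : Fin n) :
    sf P (Pi.single i 1) (Pi.single j 1) = P i j := by
  rw [sf_eq]
  simp [Matrix.mulVec, dotProduct, Pi.single_apply]

theorem coord_transition {a b : X} {z : CSpace n} (hz : z ∈ (chartAt (CSpace n) b).target)
    (h : (chartAt (CSpace n) b).symm z ∈ (chartAt (CSpace n) a).source) :
    g.coord b z = jac (transition a b) z * g.coord a (transition a b z) *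
      (jac (transition a b) z).conjTranspose := by
  ext i j
  have h1 := g.sf_transition hz h (EuclideanSpace.single i 1) (EuclideanSpace.single j 1)
  rw [fderiv_eq_vecMul_jac, fderiv_eq_vecMul_jac, ← sf_change] at h1
  have h2 : ∀ i, ((EuclideanSpace.single i (1 : ℂ) : CSpace n) : Fin n → ℂ) = Pi.single i 1 :=
    fun i => rfl
  rwa [h2, h2, sf_single, sf_single] at h1

theorem _root_.fderiv_transition_comp {a b : X} {z : CSpace n}
    (hz : z ∈ (chartAt (CSpace n) b).target)
    (h : (chartAt (CSpace n) b).symm z ∈ (chartAt (CSpace n) a).source) (v : CSpace n) :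
    fderiv ℂ (transition b a) (transition a b z) (fderiv ℂ (transition a b) z v) = v := by
  have h1 : transition a b z ∈ (chartAt (CSpace n) a).target :=
    (chartAt (CSpace n) a).map_source h
  have h2 : (chartAt (CSpace n) a).symm (transition a b z) ∈ (chartAt (CSpace n) b).source := by
    rw [symm_transition h]; exact (chartAt (CSpace n) b).map_target hz
  have h3 : HasFDerivAt (transition b a ∘ transition a b) _ z :=
    (analyticAt_transition h1 h2).differentiableAt.hasFDerivAt.comp z
      (analyticAt_transition hz h).differentiableAt.hasFDerivAt
  have h4 : transition b a ∘ transition a b =ᶠ[𝓝 z] id := by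
    have hc : ContinuousAt (chartAt (CSpace n) b).symm z :=
      (chartAt (CSpace n) b).continuousAt_symm hz
    filter_upwards [hc.eventually ((chartAt (CSpace n) a).open_source.mem_nhds h),
      (chartAt (CSpace n) b).open_target.mem_nhds hz] with w hw hw'
    simp only [Function.comp, transition, id]
    rw [(chartAt (CSpace n) a).left_inv hw, (chartAt (CSpace n) b).right_inv hw']
  have h5 := (h3.congr_of_eventuallyEq h4.symm).unique (hasFDerivAt_id z)
  exact DFunLike.congr_fun h5 v

theorem _root_.det_jac_transition_ne {a b : X} {z : CSpace n}
    (hz : z ∈ (chartAt (CSpace n) b).target)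
    (h : (chartAt (CSpace n) b).symm z ∈ (chartAt (CSpace n) a).source) :
    (jac (transition a b) z).det ≠ 0 := by
  intro h0
  obtain ⟨v, hv, hv0⟩ := Matrix.exists_vecMul_eq_zero_iff.mpr h0
  have h1 := fderiv_transition_comp hz h (WithLp.toLp 2 v)
  have h2 : fderiv ℂ (transition a b) z (WithLp.toLp 2 v) = 0 := by
    ext c
    have := congrFun (fderiv_eq_vecMul_jac (τ := transition a b) (z := z) (WithLp.toLp 2 v)) c
    rw [this]
    change Matrix.vecMul v (jac (transition a b) z) c = 0
    rw [hv0]; rfl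
  rw [h2, map_zero] at h1
  apply hv
  have := congrArg (fun w : CSpace n => (w : Fin n → ℂ)) h1
  exact this.symm

theorem _root_.chartDeriv_injective {a : X} {z : CSpace n}
    (hz : z ∈ (chartAt (CSpace n) a).target) {v : CSpace n} (hv : chartDeriv a z v = 0) : v = 0 := by
  have h1 : (chartAt (CSpace n) a).symm z ∈ (chartAt (CSpace n) a).source :=
    (chartAt (CSpace n) a).map_target hz
  have h2 : MDifferentiableAt 𝓘(ℂ, CSpace n) 𝓘(ℂ, CSpace n) (chartAt (CSpace n) a)
      ((chartAt (CSpace n) a).symm z) := (contMDiffAt_chart_of_mem h1).mdifferentiableAt (by simp)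
  have h3 : MDifferentiableAt 𝓘(ℂ, CSpace n) 𝓘(ℂ, CSpace n) (chartAt (CSpace n) a).symm z :=
    (contMDiffAt_chart_symm hz).mdifferentiableAt (by simp)
  have h4 : chartAt (CSpace n) a ∘ (chartAt (CSpace n) a).symm =ᶠ[𝓝 z] id := by
    filter_upwards [(chartAt (CSpace n) a).open_target.mem_nhds hz] with w hw
    exact (chartAt (CSpace n) a).right_inv hw
  have h5 := mfderiv_comp z h2 h3
  rw [h4.mfderiv_eq, mfderiv_id] at h5
  have h6 := DFunLike.congr_fun h5 v
  have h7 : (v : CSpace n) = mfderiv 𝓘(ℂ, CSpace n) 𝓘(ℂ, CSpace n) (chartAt (CSpace n) a)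
      ((chartAt (CSpace n) a).symm z) (chartDeriv a z v) := h6
  rw [h7, hv]
  exact map_zero _

theorem qf_coord_pos {a : X} {z : CSpace n} (hz : z ∈ (chartAt (CSpace n) a).target)
    (v : Fin n → ℂ) (hv : v ≠ 0) : 0 < qf (g.coord a z) v := by
  have h1 := g.sf_coord a z (WithLp.toLp 2 v) (WithLp.toLp 2 v)
  have h2 : qf (g.coord a z) v = (sf (g.coord a z) (WithLp.toLp 2 v : CSpace n)
    (WithLp.toLp 2 v : CSpace n)).re := rfl
  rw [h2, h1]
  refine g.pos _ _ fun h0 => hv ?_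
  have := chartDeriv_injective hz h0
  exact congrArg (fun w : CSpace n => (w : Fin n → ℂ)) this

end HermitianMetric

end Charts

/-! ### Invariance of the pointwise quantities -/

section Invariance

variable {n : ℕ} {τ : CSpace n → CSpace n} {z₀ : CSpace n}
  {G G' G₀ G₀' : CSpace n → Matrix (Fin n) (Fin n) ℂ}

/-- `G'` is the pullback of `G` by the local biholomorphism `τ` near `z₀`. -/
structure IsPullback (τ : CSpace n → CSpace n) (z₀ : CSpace n)
    (G G' : CSpace n → Matrix (Fin n) (Fin n) ℂ) : Prop where
  analytic : AnalyticAt ℂ τ z₀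
  det_jac : (jac τ z₀).det ≠ 0
  smooth : ∀ i j, ContDiffAt ℝ ∞ (fun z => G z i j) (τ z₀)
  det : (G (τ z₀)).det ≠ 0
  eq : ∀ᶠ z in 𝓝 z₀, G' z = jac τ z * G (τ z) * (jac τ z).conjTranspose

theorem contDiffAt_static {f : CSpace n → ℂ} {z : CSpace n} (h : ContDiffAt ℝ ∞ f z) (t : ℝ) :
    ContDiffAt ℝ ∞ (fun x : ℝ × CSpace n => f x.2) (t, z) :=
  ContDiffAt.comp (f := fun x : ℝ × CSpace n => x.2) (t, z) h contDiffAt_snd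

/-- The germs of a pullback metric. -/
theorem IsPullback.germs (h : IsPullback τ z₀ G G')
    {J K : Matrix (Fin n) (Fin n) (SmoothGerm (((0 : ℝ), z₀) : ℝ × CSpace n))}
    (hJ : IsRepM J fun _ z => jac τ z) (hK : IsRepM K fun _ z => (jac τ z)⁻¹) :
    ∃ M N, IsRepM M (fun _ => G) ∧ IsRepM N (fun _ z => (G z)⁻¹) ∧ M * N = 1 ∧ N * M = 1 ∧
      IsRepM (J * (pull 0 (contDiffAt_real h.analytic)).mapMatrix M *
        (stw ((0 : ℝ), z₀)).adj J) (fun _ => G') ∧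
      IsRepM ((stw ((0 : ℝ), z₀)).adj K * (pull 0 (contDiffAt_real h.analytic)).mapMatrix N * K)
        (fun _ z => (G' z)⁻¹) := by
  obtain ⟨M, hM⟩ := exists_isRepM (q := ((0 : ℝ), τ z₀)) (G := fun _ => G)
    fun i j => contDiffAt_static (h.smooth i j) 0
  obtain ⟨N, hN, hMN, hNM⟩ := hM.exists_inv h.det
  have h1 : ∀ᶠ x : ℝ × CSpace n in 𝓝 ((0 : ℝ), z₀),
      G' x.2 = jac τ x.2 * G (τ x.2) * (jac τ x.2).conjTranspose :=
    (continuous_snd.tendsto ((0 : ℝ), z₀)).eventually h.eq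
  refine ⟨M, N, hM, hN, hMN, hNM, (hM.change h.analytic hJ).congr (h1.mono fun x hx => hx.symm), ?_⟩
  have h2 : IsRepM ((stw ((0 : ℝ), z₀)).adj K) fun _ z => (jac τ z)⁻¹.conjTranspose :=
    fun i j => (hK j i).cj
  refine ((h2.mul (hN.pull (contDiffAt_real h.analytic))).mul hK).congr ?_
  filter_upwards [h1] with x hx
  rw [hx, Matrix.mul_inv_rev, Matrix.mul_inv_rev, Matrix.conjTranspose_nonsing_inv, ← mul_assoc]

/-- The metrics are regarded as time-independent germs at time zero, to which the algebraic
invariance applies; evaluation at the base point gives the claim. -/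
theorem IsPullback.rmSqAt_eq (h : IsPullback τ z₀ G G') : rmSqAt G' z₀ = rmSqAt G (τ z₀) := by
  obtain ⟨J, hJ⟩ := exists_isRepM_jac 0 h.analytic
  obtain ⟨K, hK, hch⟩ := holomorphicChange_pull h.analytic hJ h.det_jac
  obtain ⟨M, N, hM, hN, hMN, hNM, hM', hN'⟩ := h.germs hJ hK
  have h1 := (hM'.rmSq hN').eval_eq
  rw [hch.rmSq_eq hNM, ev_pull h.analytic, (hM.rmSq hN).eval_eq] at h1
  exact h1.symm

theorem IsPullback.connDiffSqAt_eq (h : IsPullback τ z₀ G G') (h₀ : IsPullback τ z₀ G₀ G₀') :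
    connDiffSqAt G' G₀' z₀ = connDiffSqAt G G₀ (τ z₀) := by
  obtain ⟨J, hJ⟩ := exists_isRepM_jac 0 h.analytic
  obtain ⟨K, hK, hch⟩ := holomorphicChange_pull h.analytic hJ h.det_jac
  obtain ⟨M, N, hM, hN, hMN, hNM, hM', hN'⟩ := h.germs hJ hK
  obtain ⟨M₀, N₀, hM₀, hN₀, hMN₀, hNM₀, hM₀', hN₀'⟩ := h₀.germs hJ hK
  have h1 := (hM'.connDiffSq hN' hM₀' hN₀').eval_eq
  rw [hch.connDiffSq_eq hMN hMN₀, ev_pull h.analytic, (hM.connDiffSq hN hM₀ hN₀).eval_eq] at h1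
  exact h1.symm

theorem IsPullback.connTestAt_eq (h : IsPullback τ z₀ G G') (h₀ : IsPullback τ z₀ G₀ G₀') (K' : ℝ) :
    connTestAt K' G' G₀' z₀ = connTestAt K' G G₀ (τ z₀) := by
  obtain ⟨J, hJ⟩ := exists_isRepM_jac 0 h.analytic
  obtain ⟨K, hK, hch⟩ := holomorphicChange_pull h.analytic hJ h.det_jac
  obtain ⟨M, N, hM, hN, hMN, hNM, hM', hN'⟩ := h.germs hJ hK
  obtain ⟨M₀, N₀, hM₀, hN₀, hMN₀, hNM₀, hM₀', hN₀'⟩ := h₀.germs hJ hK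
  have h1 := (IsRepM.relTrace hN' hM₀').eval_eq
  rw [hch.relTrace_eq, ev_pull h.analytic, (IsRepM.relTrace hN hM₀).eval_eq] at h1
  rw [connTestAt, connTestAt, h.connDiffSqAt_eq h₀]
  exact congrArg (fun x => connDiffSqAt G G₀ (τ z₀) * (K' + x)) h1.symm

theorem IsPullback.curvTestAt_eq (h : IsPullback τ z₀ G G') (h₀ : IsPullback τ z₀ G₀ G₀') (K' : ℝ) :
    curvTestAt K' G' G₀' z₀ = curvTestAt K' G G₀ (τ z₀) := by
  rw [curvTestAt, curvTestAt, h.connDiffSqAt_eq h₀, h.rmSqAt_eq]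

end Invariance
end

noncomputable section

open Filter Topology

/-! ### The complex Hessian of the squared length of a moving vector -/

section Levi

variable {n : ℕ}

/-- The vector `Γ(a, b)` with components `Γⁱ_{ck} a_c b_k`. -/
def christoffelVec (G : CSpace n → Matrix (Fin n) (Fin n) ℂ) (z : CSpace n) (a b : Fin n → ℂ) :
    Fin n → ℂ := fun i => ∑ c, ∑ k, a c * b k * christoffel G i c k z

/-- The contraction `R(a, ā, b, b̄)`. -/
def curvatureForm (G : CSpace n → Matrix (Fin n) (Fin n) ℂ) (z : CSpace n) (a b : Fin n → ℂ) : ℂ :=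
  ∑ x : Idx4 n, curvature G x.1.1 x.1.2 x.2.1 x.2.2 z *
    (a x.1.1 * conj (a x.1.2) * (b x.2.1 * conj (b x.2.2)))

theorem sf_add_left (P : Matrix (Fin n) (Fin n) ℂ) (u v w : Fin n → ℂ) :
    sf P (u + v) w = sf P u w + sf P v w := by
  simp only [sf_eq, add_dotProduct]

theorem sf_add_right (P : Matrix (Fin n) (Fin n) ℂ) (u v w : Fin n → ℂ) :
    sf P u (v + w) = sf P u v + sf P u w := by
  simp only [sf_eq, star_add, Matrix.mulVec_add, dotProduct_add]

theorem sf_add_matrix (P Q : Matrix (Fin n) (Fin n) ℂ) (u v : Fin n → ℂ) :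
    sf (P + Q) u v = sf P u v + sf Q u v := by
  simp only [sf_eq, Matrix.add_mulVec, dotProduct_add]

theorem sf_vecMul_left (P C : Matrix (Fin n) (Fin n) ℂ) (u v : Fin n → ℂ) :
    sf P (Matrix.vecMul u C) v = sf (C * P) u v := by
  rw [sf_eq, sf_eq, ← Matrix.mulVec_mulVec, Matrix.dotProduct_mulVec u]

theorem conj_sf (P : Matrix (Fin n) (Fin n) ℂ) (u v : Fin n → ℂ) :
    conj (sf P u v) = sf P.conjTranspose v u := by
  simp only [sf, map_sum, map_mul, Complex.conj_conj, Matrix.conjTranspose_apply]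
  rw [Finset.sum_comm]
  exact Finset.sum_congr rfl fun i _ => Finset.sum_congr rfl fun j _ => by
    rw [← starRingEnd_apply]; ring

theorem ofReal_qf {P : Matrix (Fin n) (Fin n) ℂ} (hP : P.IsHermitian) (v : Fin n → ℂ) :
    (qf P v : ℂ) = sf P v v := by
  refine Complex.conj_eq_iff_re.mp ?_
  rw [conj_sf, hP.eq]

/-- The difference `σ - τ` is a holomorphic section of the tangent bundle along `τ`, and `h` is its
squared length. For a holomorphic section `v` of a Hermitian bundle, `∂∂̄|v|²` equals `|∇v|²` minus
the curvature applied to `v`; here `u` is the covariant derivative of `v` in the direction `p`. This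
is the second variation formula for a single short step. -/
theorem hasLevi {G : CSpace n → Matrix (Fin n) (Fin n) ℂ} {τ σ : CSpace n → CSpace n}
    (hG : LocalMetric G (τ 0)) (hτ : AnalyticAt ℂ τ 0) (hσ : AnalyticAt ℂ σ 0) (p : Fin n)
    {h : CSpace n → ℂ} (hh : ∀ ζ, h ζ = sf (G (τ ζ)) (σ ζ - τ ζ) (σ ζ - τ ζ)) {v u : Fin n → ℂ}
    (hv : v = σ 0 - τ 0)
    (hu : u = jac σ 0 p - jac τ 0 p + christoffelVec G (τ 0) (jac τ 0 p) v) :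
    ContDiffAt ℝ ∞ h 0 ∧ dz p h 0 = sf (G (τ 0)) u v ∧
      dz p (dzbar p h) 0 = -curvatureForm G (τ 0) (jac τ 0 p) v + sf (G (τ 0)) u u := by
  obtain ⟨M, hM⟩ := exists_isRepM (q := ((0 : ℝ), τ 0)) (G := fun _ => G) (hG.static 0)
  obtain ⟨N, hN, hMN, hNM⟩ := hM.exists_inv hG.det_ne
  obtain ⟨J, hJ⟩ := exists_isRepM_jac 0 hτ
  set φ := pull 0 (contDiffAt_real hτ) with hφ
  set W := stw ((0 : ℝ), τ 0) with hW
  set V := stw ((0, 0) : ℝ × CSpace n) with hV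
  have hvan : ∀ i, AnalyticAt ℂ (fun ζ => (σ ζ - τ ζ) i) 0 := fun i =>
    ((EuclideanSpace.proj i : CSpace n →L[ℂ] ℂ).analyticAt _).comp (hσ.sub hτ)
  have hvs : ∀ i, ContDiffAt ℝ ∞ (fun ζ => (σ ζ - τ ζ) i) 0 := fun i =>
    ((hvan i).contDiffAt (n := ∞)).restrict_scalars ℝ
  set x : Fin n → SmoothGerm ((0, 0) : ℝ × CSpace n) := fun i =>
    SmoothGerm.mk _ (contDiffAt_static (hvs i) 0) with hx
  have hxr : ∀ i, IsRep (x i) fun _ ζ => (σ ζ - τ ζ) i := fun i =>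
    isRep_mk (F := fun _ ζ => (σ ζ - τ ζ) i) _
  have hxdb : ∀ i, V.db p (x i) = 0 := fun i => (hxr i).db_eq_zero (hvan i) p
  have hxcj : ∀ i, V.d p (V.cj (x i)) = 0 := fun i => by rw [V.d_cj, hxdb, map_zero]
  have hxdd : ∀ i, V.d p (V.cj (V.d p (x i))) = 0 := fun i => by
    rw [V.d_cj, ← V.d_db, hxdb, map_zero, map_zero]
  have hJdb : ∀ c, V.d p (V.cj (J p c)) = 0 := fun c => by
    rw [V.d_cj, (hJ p c).db_eq_zero (analyticAt_jac hτ p c) p, map_zero]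
  have hr : IsRep (∑ i, ∑ j, x i * φ (M i j) * V.cj (x j)) fun _ ζ => h ζ := by
    refine IsRep.congr (IsRep.sum fun i => IsRep.sum fun j =>
      ((hxr i).mul ((hM i j).pull (contDiffAt_real hτ))).mul (hxr j).cj)
      (Eventually.of_forall fun y => ?_)
    exact (hh _).symm
  have hMd : ∀ i j, V.d p (φ (M i j)) = ∑ c, J p c * φ (W.d c (M i j)) := fun i j =>
    d_pull hτ hJ p (M i j)
  have hMdb : ∀ i j, V.db p (φ (M i j)) = ∑ c, V.cj (J p c) * φ (W.db c (M i j)) := fun i j =>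
    db_pull hτ hJ p (M i j)
  have hMddb : ∀ i j, V.d p (V.db p (φ (M i j))) =
      ∑ c, ∑ e, J p c * V.cj (J p e) * φ (W.d c (W.db e (M i j))) := fun i j => by
    rw [hMdb, map_sum]
    rw [Finset.sum_comm]
    refine Finset.sum_congr rfl fun e _ => ?_
    rw [Derivation.leibniz, hJdb, smul_zero, add_zero, smul_eq_mul, d_pull hτ hJ, Finset.mul_sum]
    exact Finset.sum_congr rfl fun c _ => by ring
  set P : Fin n → ℂ := jac τ 0 p with hP
  have evJ : ∀ c, V.ev (J p c) = P c := fun c => (hJ p c).eval_eq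
  have evx : ∀ i, V.ev (x i) = v i := fun i => by rw [(hxr i).eval_eq, hv]; rfl
  have evdx : ∀ i, V.ev (V.d p (x i)) = jac σ 0 p i - P i := fun i => by
    rw [((hxr i).d p).eval_eq]
    have h1 : HasFDerivAt (fun ζ => (σ ζ - τ ζ) i) _ 0 :=
      (EuclideanSpace.proj i : CSpace n →L[ℂ] ℂ).hasFDerivAt.comp (0 : CSpace n)
        (hσ.differentiableAt.hasFDerivAt.sub hτ.differentiableAt.hasFDerivAt)
    change dz p (fun ζ => (σ ζ - τ ζ) i) 0 = _
    rw [dz_eq_fderiv h1.differentiableAt, h1.fderiv]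
    rfl
  set y : Fin n → ℂ := jac σ 0 p - P with hy
  have evφ : ∀ a, V.ev (φ a) = W.ev a := fun a => ev_pull hτ a
  have evM : ∀ i j, W.ev (M i j) = G (τ 0) i j := fun i j => (hM i j).eval_eq
  set X : Matrix (Fin n) (Fin n) ℂ := Matrix.of fun i j => ∑ c, P c * dz c (fun w => G w i j) (τ 0)
    with hX
  set Y : Matrix (Fin n) (Fin n) ℂ :=
    Matrix.of fun i j => ∑ c, conj (P c) * dzbar c (fun w => G w i j) (τ 0) with hY
  set Z : Matrix (Fin n) (Fin n) ℂ := Matrix.of fun i j =>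
    ∑ c, ∑ e, P c * conj (P e) * dz c (dzbar e (fun w => G w i j)) (τ 0) with hZ
  have evX : ∀ i j, V.ev (V.d p (φ (M i j))) = X i j := fun i j => by
    rw [hMd, map_sum, hX, Matrix.of_apply]
    refine Finset.sum_congr rfl fun c _ => ?_
    rw [map_mul, evJ, evφ, ((hM i j).d c).eval_eq]
  have evY : ∀ i j, V.ev (V.db p (φ (M i j))) = Y i j := fun i j => by
    rw [hMdb, map_sum, hY, Matrix.of_apply]
    refine Finset.sum_congr rfl fun c _ => ?_
    rw [map_mul, V.ev_cj, evJ, evφ, ((hM i j).db c).eval_eq]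
  have evZ : ∀ i j, V.ev (V.d p (V.db p (φ (M i j)))) = Z i j := fun i j => by
    rw [hMddb, map_sum, hZ, Matrix.of_apply]
    refine Finset.sum_congr rfl fun c _ => ?_
    rw [map_sum]
    refine Finset.sum_congr rfl fun e _ => ?_
    rw [map_mul, map_mul, V.ev_cj, evJ, evJ, evφ, (((hM i j).db e).d c).eval_eq]
  have hherm : (G (τ 0)).IsHermitian := hG.herm.self_of_nhds
  have hhermM : ∀ i j, V.cj (φ (M i j)) = φ (M j i) := fun i j => by
    rw [cj_pull hτ]
    congr 1
    exact hM.herm ((continuous_snd.tendsto ((0 : ℝ), τ 0)).eventually hG.herm) i j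
  have hYX : Y = X.conjTranspose := by
    ext i j
    rw [Matrix.conjTranspose_apply, ← evY, ← evX, ← hhermM j i, V.db_cj, V.ev_cj]
    rfl
  -- The matrix of the connection in the direction of `∂ₚτ`. With it `u = y + v C`, and the terms
  -- quadratic in `C` complete the square of `u`; what remains of the second derivatives of `G` is
  -- the curvature.
  set C := X * (G (τ 0))⁻¹ with hC
  have hdet := isUnit_iff_ne_zero.mpr hG.det_ne
  have hCG : C * G (τ 0) = X := by rw [hC, mul_assoc, Matrix.nonsing_inv_mul _ hdet, mul_one]
  have huC : u = y + Matrix.vecMul v C := by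
    rw [hu]
    congr 1
    ext i
    simp only [christoffelVec, christoffel, Matrix.vecMul, dotProduct, hC, hX, Matrix.mul_apply,
      Matrix.of_apply, Finset.mul_sum, Finset.sum_mul]
    rw [Finset.sum_comm]
    refine Finset.sum_congr rfl fun k _ => ?_
    rw [Finset.sum_comm]
    refine Finset.sum_congr rfl fun r _ => Finset.sum_congr rfl fun c _ => ?_
    ring
  have hZR : sf Z v v = -curvatureForm G (τ 0) P v + sf (C * G (τ 0) * C.conjTranspose) v v := by
    have e1 : C * G (τ 0) * C.conjTranspose = X * (G (τ 0))⁻¹ * Y := by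
      rw [hCG, hC, Matrix.conjTranspose_mul, hYX, Matrix.conjTranspose_nonsing_inv, hherm.eq,
        ← mul_assoc]
    have e2 : ∀ k l, (∑ i, ∑ j, P i * conj (P j) * curvature G i j k l (τ 0)) =
        -Z k l + (X * (G (τ 0))⁻¹ * Y) k l := by
      intro k l
      simp only [curvature, mul_add, Finset.sum_add_distrib, hZ, Matrix.of_apply, mul_neg,
        Finset.sum_neg_distrib]
      congr 1
      simp only [hX, hY, Matrix.mul_apply, Matrix.of_apply, Finset.sum_mul, Finset.mul_sum]
      have := sum_reorder (fun i j a b => P i * conj (P j) * ((G (τ 0))⁻¹ b a *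
        dz i (fun w => G w k b) (τ 0) * dzbar j (fun w => G w a l) (τ 0)))
      rw [this]
      refine Finset.sum_congr rfl fun a _ => ?_
      rw [Finset.sum_comm]
      refine (Finset.sum_congr rfl fun j _ => ?_)
      refine Finset.sum_congr rfl fun b _ => Finset.sum_congr rfl fun i _ => ?_
      ring
    have e3 : curvatureForm G (τ 0) P v = sf (-Z + X * (G (τ 0))⁻¹ * Y) v v := by
      have e4 : ∀ k l, (-Z + X * (G (τ 0))⁻¹ * Y) k l =
          ∑ i, ∑ j, P i * conj (P j) * curvature G i j k l (τ 0) := fun k l => (e2 k l).symm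
      simp only [curvatureForm, sf, e4, Fintype.sum_prod_type, Finset.mul_sum, Finset.sum_mul]
      rw [sum_reorder]
      refine Finset.sum_congr rfl fun k _ => Finset.sum_congr rfl fun l _ => ?_
      rw [Finset.sum_comm]
      refine Finset.sum_congr rfl fun i _ => Finset.sum_congr rfl fun j _ => ?_
      ring
    have e5 : sf (-Z) v v = -sf Z v v := by
      simp only [sf_eq, Matrix.neg_mulVec, dotProduct_neg]
    rw [e1, e3, sf_add_matrix, e5]
    ring
  refine ⟨hr.slice, ?_, ?_⟩
  · have h1 : dz p h 0 = V.ev (V.d p (∑ i, ∑ j, x i * φ (M i j) * V.cj (x j))) :=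
      (hr.d p).eval_eq.symm
    have h2 : sf (G (τ 0)) u v = sf (G (τ 0)) y v + sf X v v := by
      rw [huC, sf_add_left, sf_vecMul_left, hCG]
    rw [h1, h2]
    simp only [map_sum, Derivation.leibniz, hxcj, map_zero, mul_zero, smul_zero, zero_add, smul_eq_mul, map_add, map_mul,
      evX, evx, evdx, V.ev_cj, evφ, evM, sf, ← Finset.sum_add_distrib]
    exact Finset.sum_congr rfl fun i _ => Finset.sum_congr rfl fun j _ => by
      simp only [hy, Pi.sub_apply]; ring
  · have h1 : dz p (dzbar p h) 0 =
        V.ev (V.d p (V.db p (∑ i, ∑ j, x i * φ (M i j) * V.cj (x j)))) :=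
      ((hr.db p).d p).eval_eq.symm
    have h3 : sf (G (τ 0)) y (Matrix.vecMul v C) = sf Y y v := by
      have e1 : conj (sf X v y) = sf Y y v := by rw [conj_sf, hYX]
      rw [← e1, ← hCG, ← sf_vecMul_left, conj_sf, hherm.eq]
    have h2 : -curvatureForm G (τ 0) P v + sf (G (τ 0)) u u =
        sf Y y v + sf Z v v + sf (G (τ 0)) y y + sf X v y := by
      rw [huC, sf_add_left, sf_add_right, sf_add_right, hZR, sf_change, h3,
        sf_vecMul_left _ _ v y, hCG]
      ring
    rw [h1, h2]
    simp only [map_sum, Derivation.leibniz, hxdb, map_zero, mul_zero, zero_mul, smul_zero, zero_add, add_zero, smul_eq_mul, map_add,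
      map_mul, V.db_cj, hxcj, hxdd, evX, evY, evZ, evx, evdx, V.ev_cj, evφ, evM, sf,
      ← Finset.sum_add_distrib]
    exact Finset.sum_congr rfl fun i _ => Finset.sum_congr rfl fun j _ => by
      simp only [hy, Pi.sub_apply]; ring

end Levi
end

noncomputable section

open Filter Topology

/-! ### Elementary inequalities for Hermitian forms -/

section HermitianForms

variable {n : ℕ} {P : Matrix (Fin n) (Fin n) ℂ}

open scoped ComplexOrder

theorem norm_sf_le {B : ℝ} (hB : ∀ i j, ‖P i j‖ ≤ B) (v w : Fin n → ℂ) :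
    ‖sf P v w‖ ≤ n ^ 2 * B * (‖v‖ * ‖w‖) := by
  have h : ∀ i j, ‖v i * P i j * conj (w j)‖ ≤ B * (‖v‖ * ‖w‖) := fun i j => by
    rw [norm_mul, norm_mul, RCLike.norm_conj]
    have h0 : 0 ≤ B := (norm_nonneg _).trans (hB i j)
    calc ‖v i‖ * ‖P i j‖ * ‖w j‖ ≤ ‖v‖ * B * ‖w‖ := by
          gcongr
          exacts [norm_le_pi_norm v i, hB i j, norm_le_pi_norm w j]
      _ = _ := by ring
  calc ‖sf P v w‖ ≤ ∑ i : Fin n, ∑ j : Fin n, B * (‖v‖ * ‖w‖) :=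
        norm_sum_le_of_le _ fun i _ => norm_sum_le_of_le _ fun j _ => h i j
    _ = _ := by simp; ring

theorem qf_nonneg (hP : P.PosDef) (v : Fin n → ℂ) : 0 ≤ qf P v := by
  obtain ⟨J, K, -, -, hK⟩ := exists_eq_mul_conjTranspose hP
  rw [qf_frame hK]
  positivity

theorem qf_smul (P : Matrix (Fin n) (Fin n) ℂ) (c : ℂ) (v : Fin n → ℂ) :
    qf P (c • v) = ‖c‖ ^ 2 * qf P v := by
  have h : sf P (c • v) (c • v) = ((‖c‖ ^ 2 : ℝ) : ℂ) * sf P v v := by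
    have h2 : c * conj c = ((‖c‖ ^ 2 : ℝ) : ℂ) := by
      rw [Complex.mul_conj, Complex.normSq_eq_norm_sq]
    rw [← h2]
    simp only [sf, Pi.smul_apply, smul_eq_mul, map_mul, Finset.mul_sum]
    exact Finset.sum_congr rfl fun i _ => Finset.sum_congr rfl fun j _ => by ring
  rw [qf, h, Complex.re_ofReal_mul, qf]

theorem qf_zero (P : Matrix (Fin n) (Fin n) ℂ) : qf P 0 = 0 := by simp [qf, sf]

/-- The Cauchy-Schwarz inequality. -/
theorem norm_sf_sq_le (hP : P.PosDef) (u v : Fin n → ℂ) : ‖sf P u v‖ ^ 2 ≤ qf P u * qf P v := by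
  obtain ⟨J, K, -, -, hK⟩ := exists_eq_mul_conjTranspose hP
  have h1 : sf P u v = ∑ i, Matrix.vecMul u K i * conj (Matrix.vecMul v K i) := by
    have := sf_change 1 K u v
    rw [mul_one, ← hK] at this
    rw [this]
    simp [sf, Matrix.one_apply]
  rw [h1, qf_frame hK, qf_frame hK]
  calc _ ≤ (∑ i, ‖Matrix.vecMul u K i‖ * ‖Matrix.vecMul v K i‖) ^ 2 := by
        gcongr
        refine norm_sum_le_of_le _ fun i _ => ?_
        rw [norm_mul, RCLike.norm_conj]
    _ ≤ _ := Finset.sum_mul_sq_le_sq_mul_sq _ _ _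

theorem norm_sf_le_sqrt (hP : P.PosDef) (u v : Fin n → ℂ) :
    ‖sf P u v‖ ≤ √(qf P u) * √(qf P v) := by
  rw [← Real.sqrt_mul (qf_nonneg hP u)]
  exact Real.le_sqrt_of_sq_le (norm_sf_sq_le hP u v)

theorem qf_add (hP : P.IsHermitian) (u v : Fin n → ℂ) :
    qf P (u + v) = qf P u + 2 * (sf P u v).re + qf P v := by
  have h : (sf P v u).re = (sf P u v).re := by
    rw [← Complex.conj_re, conj_sf, hP.eq]
  simp only [qf, sf_add_left, sf_add_right, Complex.add_re, h]
  ring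

theorem qf_add_le (hP : P.PosDef) (u v : Fin n → ℂ) : qf P (u + v) ≤ 2 * qf P u + 2 * qf P v := by
  rw [qf_add hP.1]
  have h1 := (Complex.re_le_norm _).trans (norm_sf_le_sqrt hP u v)
  have h2 := Real.sq_sqrt (qf_nonneg hP u)
  have h3 := Real.sq_sqrt (qf_nonneg hP v)
  nlinarith [sq_nonneg (√(qf P u) - √(qf P v))]

theorem exists_norm_sq_le_qf (hP : P.PosDef) : ∃ B : ℝ, 0 < B ∧ ∀ v, ‖v‖ ^ 2 ≤ B * qf P v := by
  obtain ⟨J, K, hJK, hKJ, hK⟩ := exists_eq_mul_conjTranspose hP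
  refine ⟨(∑ i, ∑ j, ‖J i j‖ ^ 2) + 1, by positivity, fun v => ?_⟩
  have h0 : 0 ≤ qf P v := qf_nonneg hP v
  have h1 : ∀ j, ‖v j‖ ^ 2 ≤ ((∑ i, ∑ j, ‖J i j‖ ^ 2) + 1) * qf P v := fun j => by
    have h2 : v j = ∑ i, Matrix.vecMul v K i * J i j := by
      have : Matrix.vecMul (Matrix.vecMul v K) J = v := by
        rw [Matrix.vecMul_vecMul, hKJ, Matrix.vecMul_one]
      exact (congrFun this j).symm
    calc ‖v j‖ ^ 2 ≤ (∑ i, ‖Matrix.vecMul v K i‖ * ‖J i j‖) ^ 2 := by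
          rw [h2]; gcongr
          exact norm_sum_le_of_le _ fun i _ => (norm_mul _ _).le
      _ ≤ (∑ i, ‖Matrix.vecMul v K i‖ ^ 2) * ∑ i, ‖J i j‖ ^ 2 :=
          Finset.sum_mul_sq_le_sq_mul_sq _ _ _
      _ ≤ _ := by
          rw [← qf_frame hK, mul_comm]
          gcongr
          refine le_trans (Finset.sum_le_sum fun i _ => ?_) (le_add_of_nonneg_right zero_le_one)
          exact Finset.single_le_sum (f := fun j => ‖J i j‖ ^ 2) (fun _ _ => sq_nonneg _)
            (Finset.mem_univ j)
  have h2 : ‖v‖ ≤ √(((∑ i, ∑ j, ‖J i j‖ ^ 2) + 1) * qf P v) :=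
    (pi_norm_le_iff_of_nonneg (Real.sqrt_nonneg _)).mpr fun j => Real.le_sqrt_of_sq_le (h1 j)
  exact (Real.le_sqrt (norm_nonneg _) (by positivity)).mp h2

theorem norm_christoffelVec_le {G : CSpace n → Matrix (Fin n) (Fin n) ℂ} {z : CSpace n} {B : ℝ}
    (hB : ∀ i c k, ‖christoffel G i c k z‖ ≤ B) (hB0 : 0 ≤ B) (a b : Fin n → ℂ) :
    ‖christoffelVec G z a b‖ ≤ n ^ 2 * B * (‖a‖ * ‖b‖) := by
  refine (pi_norm_le_iff_of_nonneg (by positivity)).mpr fun i => ?_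
  calc _ ≤ ∑ c : Fin n, ∑ k : Fin n, B * (‖a‖ * ‖b‖) := by
        refine norm_sum_le_of_le _ fun c _ => norm_sum_le_of_le _ fun k _ => ?_
        rw [norm_mul, norm_mul]
        calc _ ≤ ‖a‖ * ‖b‖ * B := by
              gcongr
              exacts [norm_le_pi_norm a c, norm_le_pi_norm b k, hB i c k]
          _ = _ := by ring
    _ = _ := by simp; ring

/-- For a Kähler metric, `g(Γ(w, v), w)` is the derivative of `g(w, w)` in the direction `v`. -/
theorem sf_christoffelVec {G : CSpace n → Matrix (Fin n) (Fin n) ℂ} {z : CSpace n}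
    (hG : (G z).det ≠ 0)
    (hK : ∀ i j k, dz i (fun w => G w j k) z = dz j (fun w => G w i k) z) (w v : Fin n → ℂ) :
    sf (G z) (christoffelVec G z w v) w =
      ∑ c, v c * ∑ i, ∑ j, w i * dz c (fun y => G y i j) z * conj (w j) := by
  have h1 : ∀ j, ∑ i, christoffelVec G z w v i * G z i j =
      ∑ c, ∑ k, w c * v k * dz c (fun y => G y k j) z := fun j => by
    simp only [christoffelVec, christoffel, Finset.sum_mul]
    rw [Finset.sum_comm]
    refine Finset.sum_congr rfl fun c _ => ?_
    rw [Finset.sum_comm]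
    refine Finset.sum_congr rfl fun k _ => ?_
    have h2 : ∀ q, ∑ i, (G z)⁻¹ q i * G z i j = (1 : Matrix (Fin n) (Fin n) ℂ) q j := fun q => by
      rw [← Matrix.mul_apply, Matrix.nonsing_inv_mul _ (isUnit_iff_ne_zero.mpr hG)]
    calc _ = ∑ i, ∑ q, w c * v k * dz c (fun w => G w k q) z * ((G z)⁻¹ q i * G z i j) := by
          refine Finset.sum_congr rfl fun i _ => ?_
          rw [Finset.mul_sum, Finset.sum_mul]
          exact Finset.sum_congr rfl fun q _ => by ring
      _ = ∑ q, w c * v k * dz c (fun w => G w k q) z * (1 : Matrix (Fin n) (Fin n) ℂ) q j := by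
          rw [Finset.sum_comm]
          exact Finset.sum_congr rfl fun q _ => by rw [← Finset.mul_sum, h2]
      _ = _ := by simp [Matrix.one_apply]
  rw [sf, Finset.sum_comm]
  simp only [← Finset.sum_mul, h1]
  simp only [Finset.mul_sum, Finset.sum_mul]
  rw [Finset.sum_comm]
  calc _ = ∑ i, ∑ c, ∑ j, v c * (w i * dz c (fun y => G y i j) z * conj (w j)) := by
        refine Finset.sum_congr rfl fun i _ => ?_
        rw [Finset.sum_comm]
        refine Finset.sum_congr rfl fun c _ => Finset.sum_congr rfl fun j _ => ?_
        rw [hK i c j]; ring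
    _ = _ := Finset.sum_comm

theorem fderiv_apply_eq_dz (f : CSpace n → ℂ) (z v : CSpace n) :
    fderiv ℝ f z v = ∑ c, (v c * dz c f z + conj (v c) * dzbar c f z) := by
  have h1 : v = ∑ c, ((v c).re • (EuclideanSpace.single c 1 : CSpace n) +
      (v c).im • (EuclideanSpace.single c Complex.I : CSpace n)) := by
    conv_lhs => rw [← HermitianMetric.sum_single v]
    refine Finset.sum_congr rfl fun c _ => ?_
    ext k
    by_cases hk : k = c
    · subst hk
      have := (Complex.re_add_im (v k)).symm
      simpa [mul_comm] using this
    · simp [hk]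
  conv_lhs => rw [h1]
  rw [map_sum]
  refine Finset.sum_congr rfl fun c _ => ?_
  rw [map_add, map_smul, map_smul, Complex.real_smul, Complex.real_smul, dz, dzbar]
  have h2 : conj (v c) = ((v c).re : ℂ) - (v c).im * Complex.I := by
    apply Complex.ext <;> simp
  have h3 : v c = ((v c).re : ℂ) + (v c).im * Complex.I := (Complex.re_add_im _).symm
  rw [h2]
  conv_rhs => enter [1, 1]; rw [h3]
  have h4 : Complex.I * Complex.I = -1 := Complex.I_mul_I
  linear_combination (((v c).im : ℂ) * fderiv ℝ f z (EuclideanSpace.single c Complex.I)) * h4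

end HermitianForms
end

noncomputable section

open Filter Topology

/-! ### Uniform estimates for a Kähler metric near a point -/

section LocalEstimates

variable {n : ℕ}

open scoped ComplexOrder

theorem sf_sub_matrix (P Q : Matrix (Fin n) (Fin n) ℂ) (u v : Fin n → ℂ) :
    sf (P - Q) u v = sf P u v - sf Q u v := by
  simp only [sf_eq, Matrix.sub_mulVec, dotProduct_sub]

theorem abs_qf_sub_le {P Q : Matrix (Fin n) (Fin n) ℂ} {ε : ℝ} (h : ∀ i j, ‖P i j - Q i j‖ ≤ ε)
    (w : Fin n → ℂ) : |qf P w - qf Q w| ≤ n ^ 2 * ε * ‖w‖ ^ 2 := by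
  rw [qf, qf, ← Complex.sub_re, ← sf_sub_matrix, sq ‖w‖]
  exact (Complex.abs_re_le_norm _).trans (norm_sf_le (P := P - Q) h w w)

theorem norm_ofLp_le (v : CSpace n) : ‖(v : Fin n → ℂ)‖ ≤ ‖v‖ :=
  (pi_norm_le_iff_of_nonneg (norm_nonneg _)).mpr fun i => PiLp.norm_apply_le v i

theorem norm_sq_le_ofLp (v : CSpace n) : ‖v‖ ^ 2 ≤ n * ‖(v : Fin n → ℂ)‖ ^ 2 := by
  rw [EuclideanSpace.norm_sq_eq]
  calc _ ≤ ∑ _i : Fin n, ‖(v : Fin n → ℂ)‖ ^ 2 :=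
        Finset.sum_le_sum fun i _ => by gcongr; exact norm_le_pi_norm (v : Fin n → ℂ) i
    _ = _ := by simp

/-- A locally uniform second order Taylor estimate. -/
theorem exists_taylor {E F : Type*} [NormedAddCommGroup E] [NormedSpace ℝ E]
    [NormedAddCommGroup F] [NormedSpace ℝ F] {f : E → F} {a : E} (hf : ContDiffAt ℝ ∞ f a) :
    ∃ M : ℝ, 0 ≤ M ∧ ∀ᶠ q : E × E in 𝓝 (a, a),
      ‖f q.2 - f q.1 - fderiv ℝ f q.1 (q.2 - q.1)‖ ≤ M * ‖q.2 - q.1‖ ^ 2 := by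
  have h1 : ContDiffAt ℝ 1 (fderiv ℝ f) a := hf.fderiv_right (m := 1) (by norm_cast)
  obtain ⟨K, t, ht, hK⟩ := h1.exists_lipschitzOnWith
  have h2 : ∀ᶠ z in 𝓝 a, ContDiffAt ℝ 1 f z :=
    (hf.of_le (m := 1) (by norm_cast)).eventually (by simp)
  obtain ⟨ε, hε, hball⟩ := Metric.mem_nhds_iff.mp (inter_mem ht h2)
  refine ⟨K, K.2, ?_⟩
  have hd : ∀ x ∈ Metric.ball a ε, DifferentiableAt ℝ f x := fun x hx =>
    (show ContDiffAt ℝ 1 f x from (hball hx).2).differentiableAt one_ne_zero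
  filter_upwards [prod_mem_nhds (Metric.ball_mem_nhds a hε) (Metric.ball_mem_nhds a hε)] with q hq
  have hs : segment ℝ q.1 q.2 ⊆ Metric.ball a ε := (convex_ball a ε).segment_subset hq.1 hq.2
  have h3 := (convex_segment q.1 q.2).norm_image_sub_le_of_norm_hasFDerivWithin_le'
    (f := f) (f' := fderiv ℝ f) (φ := fderiv ℝ f q.1) (C := K * ‖q.2 - q.1‖) (x := q.1) (y := q.2)
    (fun x hx => (hd x (hs hx)).hasFDerivAt.hasFDerivWithinAt)
    (fun x hx => by
      have h4 := hK.dist_le_mul x (hball (hs hx)).1 q.1 (hball hq.1).1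
      rw [dist_eq_norm, dist_eq_norm] at h4
      refine h4.trans ?_
      gcongr
      obtain ⟨s, hs, rfl⟩ := (segment_eq_image' ℝ q.1 q.2 ▸ hx :)
      simp only [add_sub_cancel_left, norm_smul, Real.norm_eq_abs, abs_of_nonneg hs.1]
      exact mul_le_of_le_one_left (norm_nonneg _) hs.2)
    (left_mem_segment ℝ _ _) (right_mem_segment ℝ _ _)
  rw [sq, ← mul_assoc]
  exact h3

/-- The estimates for a Kähler metric near two neighbouring points `z` and `z'`. -/
structure ChartEstimate (G : CSpace n → Matrix (Fin n) (Fin n) ℂ) (L : ℝ) (z z' : CSpace n) :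
    Prop where
  metric : LocalMetric G z
  le : ∀ w, qf (G z) w ≤ L * ‖w‖ ^ 2
  norm_le : ∀ w : Fin n → ℂ, ‖w‖ ^ 2 ≤ L * qf (G z) w
  christoffel : ∀ a b, ‖christoffelVec G z a b‖ ≤ L * (‖a‖ * ‖b‖)
  compare : ∀ w, qf (G z) w ≤ 2 * qf (G z') w
  -- First-order parallel transport from `z'` to `z`. The Christoffel term matches the first
  -- variation of the metric, so the error is quadratic in the distance of the points. It is this
  -- order that keeps the accumulated error along a chain proportional to the total cost.
  transport : ∀ w, qf (G z) (w + christoffelVec G z w ((z' : Fin n → ℂ) - z)) ≤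
    (1 + L * ‖(z' : Fin n → ℂ) - z‖ ^ 2) * qf (G z') w

variable {G : CSpace n → Matrix (Fin n) (Fin n) ℂ} {a : CSpace n}

theorem exists_norm_christoffelVec_le (hG : LocalMetric G a) :
    ∃ B : ℝ, 0 ≤ B ∧ ∀ᶠ z in 𝓝 a, ∀ v w, ‖christoffelVec G z v w‖ ≤ B * (‖v‖ * ‖w‖) := by
  obtain ⟨M, hM⟩ := exists_isRepM (q := ((0 : ℝ), a)) (G := fun _ => G) (hG.static 0)
  obtain ⟨N, hN, -, -⟩ := hM.exists_inv hG.det_ne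
  have h1 : ∀ i c k, ∃ B : ℝ, ∀ᶠ z in 𝓝 a, ‖christoffel G i c k z‖ ≤ B := fun i c k => by
    have h2 : ContinuousAt (fun z => ‖christoffel G i c k z‖) a :=
      (hM.conn hN c k i).slice.continuousAt.norm
    exact ⟨_, (h2.eventually_lt_const (lt_add_one _)).mono fun z hz => le_of_lt hz⟩
  choose B hB using h1
  have h3 : ∀ᶠ z in 𝓝 a, ∀ i c k, ‖christoffel G i c k z‖ ≤ B i c k := by
    simpa only [eventually_all] using hB
  refine ⟨n ^ 2 * ∑ i, ∑ c, ∑ k, |B i c k|, by positivity, h3.mono fun z hz v w => ?_⟩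
  refine norm_christoffelVec_le (fun i c k => (hz i c k).trans ((le_abs_self _).trans ?_))
    (by positivity) v w
  calc |B i c k| ≤ ∑ k, |B i c k| :=
        Finset.single_le_sum (f := fun k => |B i c k|) (fun _ _ => abs_nonneg _) (Finset.mem_univ k)
    _ ≤ ∑ c, ∑ k, |B i c k| :=
        Finset.single_le_sum (f := fun c => ∑ k, |B i c k|)
          (fun _ _ => Finset.sum_nonneg fun _ _ => abs_nonneg _) (Finset.mem_univ c)
    _ ≤ _ := Finset.single_le_sum (f := fun i => ∑ c, ∑ k, |B i c k|)
          (fun _ _ => Finset.sum_nonneg fun _ _ => Finset.sum_nonneg fun _ _ => abs_nonneg _)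
          (Finset.mem_univ i)

/-- The first variation of a Kähler metric along a vector is given by the Christoffel symbols. -/
theorem sum_fderiv_eq {z : CSpace n} (hG : (G z).det ≠ 0)
    (hH : ∀ᶠ y in 𝓝 z, (G y).IsHermitian)
    (hK : ∀ i j k, dz i (fun w => G w j k) z = dz j (fun w => G w i k) z) (w : Fin n → ℂ)
    (v : CSpace n) :
    (∑ i, ∑ j, w i * fderiv ℝ (fun y => G y i j) z v * conj (w j)).re =
      2 * (sf (G z) (christoffelVec G z w v) w).re := by
  set S := ∑ c, v c * ∑ i, ∑ j, w i * dz c (fun y => G y i j) z * conj (w j) with hS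
  have h0 : ∀ c i j, dzbar c (fun y => G y i j) z = conj (dz c (fun y => G y j i) z) := fun c i j => by
    have h1 : (fun y => G y i j) =ᶠ[𝓝 z] fun y => Complex.conjCLE (G y j i) :=
      hH.mono fun y hy => (hy.apply i j).symm
    have h2 : fderiv ℝ (fun y => G y i j) z =
        (Complex.conjCLE : ℂ →L[ℝ] ℂ).comp (fderiv ℝ (fun y => G y j i) z) := by
      rw [h1.fderiv_eq]
      exact Complex.conjCLE.comp_fderiv
    rw [dzbar, dz, h2]
    simp [Complex.conj_ofNat]
  have h1 : ∑ i, ∑ j, w i * fderiv ℝ (fun y => G y i j) z v * conj (w j) = S + conj S := by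
    have h2 : conj S = ∑ c, conj (v c) * ∑ i, ∑ j, w i * dzbar c (fun y => G y i j) z * conj (w j) := by
      simp only [hS, map_sum, map_mul, h0, Complex.conj_conj]
      refine Finset.sum_congr rfl fun c _ => ?_
      rw [Finset.sum_comm]
      congr 1
      exact Finset.sum_congr rfl fun i _ => Finset.sum_congr rfl fun j _ => by ring
    rw [h2, hS, ← Finset.sum_add_distrib]
    simp only [fderiv_apply_eq_dz, Finset.mul_sum, Finset.sum_mul]
    calc _ = ∑ i, ∑ c, ∑ j, w i * (v c * dz c (fun y => G y i j) z +
          conj (v c) * dzbar c (fun y => G y i j) z) * conj (w j) :=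
          Finset.sum_congr rfl fun i _ => Finset.sum_comm
      _ = ∑ c, ∑ i, ∑ j, w i * (v c * dz c (fun y => G y i j) z +
          conj (v c) * dzbar c (fun y => G y i j) z) * conj (w j) := Finset.sum_comm
      _ = _ := by
          refine Finset.sum_congr rfl fun c _ => ?_
          simp only [← Finset.sum_add_distrib]
          exact Finset.sum_congr rfl fun i _ => Finset.sum_congr rfl fun j _ => by ring
  rw [h1, sf_christoffelVec hG hK]
  simp [← hS]
  ring

/-- Taylor expansion of `G` between the two points has the first-order term `2 Re g(Γ(w, v), w)` by
`sum_fderiv_eq`, which is also the mixed term of the square of `w + Γ(w, v)`. The remainders are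
quadratic in `v`, uniformly near the diagonal. -/
theorem exists_chartEstimate (hG : LocalMetric G a)
    (hsm : ∀ᶠ z in 𝓝 a, ∀ i j, ContDiffAt ℝ ∞ (fun z => G z i j) z)
    (hK : ∀ᶠ z in 𝓝 a, ∀ i j k, dz i (fun w => G w j k) z = dz j (fun w => G w i k) z) :
    ∃ L : ℝ, 1 ≤ L ∧ ∀ᶠ q : CSpace n × CSpace n in 𝓝 (a, a), ChartEstimate G L q.1 q.2 := by
  obtain ⟨b, hb, hb'⟩ := exists_norm_sq_le_qf (posDef_of_qf_pos hG.herm.self_of_nhds hG.pos)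
  obtain ⟨Γ, hΓ, hΓ'⟩ := exists_norm_christoffelVec_le hG
  have ht : ∃ M : ℝ, 0 ≤ M ∧ ∀ᶠ q : CSpace n × CSpace n in 𝓝 (a, a), ∀ i j,
      ‖G q.2 i j - G q.1 i j - fderiv ℝ (fun z => G z i j) q.1 (q.2 - q.1)‖ ≤
        M * ‖(q.2 : Fin n → ℂ) - q.1‖ ^ 2 := by
    choose M hM0 hM using fun i j => exists_taylor (hG.smooth i j)
    refine ⟨(∑ i, ∑ j, M i j) * n, mul_nonneg (Finset.sum_nonneg fun i _ =>
      Finset.sum_nonneg fun j _ => hM0 i j) (Nat.cast_nonneg n), ?_⟩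
    have h1 : ∀ᶠ q : CSpace n × CSpace n in 𝓝 (a, a), ∀ i j,
        ‖G q.2 i j - G q.1 i j - fderiv ℝ (fun z => G z i j) q.1 (q.2 - q.1)‖ ≤
          M i j * ‖q.2 - q.1‖ ^ 2 := by
      simpa only [eventually_all] using hM
    filter_upwards [h1] with q hq i j
    refine (hq i j).trans ?_
    have h2 : M i j ≤ ∑ i, ∑ j, M i j :=
      (Finset.single_le_sum (f := fun j => M i j) (fun _ _ => hM0 _ _) (Finset.mem_univ j)).trans
        (Finset.single_le_sum (f := fun i => ∑ j, M i j)
          (fun _ _ => Finset.sum_nonneg fun _ _ => hM0 _ _) (Finset.mem_univ i))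
    rw [mul_assoc]
    exact mul_le_mul h2 (norm_sq_le_ofLp (q.2 - q.1)) (sq_nonneg _)
      ((hM0 i j).trans h2)
  obtain ⟨M, hM0, hM⟩ := ht
  -- Chosen so that nearby forms differ from that at `a` by at most a quarter of it. Two of them are
  -- then comparable with factor `(5/4) / (3/4) ≤ 2`. The summand `1` covers `n = 0`.
  set ε : ℝ := (4 * b * (n ^ 2 + 1))⁻¹ with hε
  have hε0 : 0 < ε := by positivity
  have hcont : ∀ᶠ z in 𝓝 a, ∀ i j, ‖G z i j - G a i j‖ ≤ ε := by
    simp only [eventually_all]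
    intro i j
    have h1 := (hG.smooth i j).continuousAt
    filter_upwards [h1 (Metric.closedBall_mem_nhds _ hε0)] with z hz
    simpa [dist_eq_norm] using hz
  have hεb : n ^ 2 * ε ≤ (4 * b)⁻¹ := by
    rw [hε, mul_inv, ← mul_assoc, mul_comm ((n : ℝ) ^ 2), mul_assoc]
    refine mul_le_of_le_one_right (by positivity) ?_
    rw [← div_eq_mul_inv]
    exact div_le_one_of_le₀ (by linarith) (by positivity)
  have hqf : ∀ᶠ z in 𝓝 a, ∀ w, |qf (G z) w - qf (G a) w| ≤ qf (G a) w / 4 := by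
    filter_upwards [hcont] with z hz w
    refine (abs_qf_sub_le hz w).trans ?_
    calc _ ≤ (4 * b)⁻¹ * (b * qf (G a) w) :=
          mul_le_mul hεb (hb' w) (sq_nonneg _) (by positivity)
      _ = _ := by field_simp
  obtain ⟨B, hB0, hB⟩ : ∃ B : ℝ, 0 ≤ B ∧ ∀ w, qf (G a) w ≤ B * ‖w‖ ^ 2 := by
    refine ⟨n ^ 2 * ∑ i, ∑ j, ‖G a i j‖, by positivity, fun w => ?_⟩
    refine (Complex.re_le_norm _).trans ((norm_sf_le (B := ∑ i, ∑ j, ‖G a i j‖)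
      (fun i j => ?_) w w).trans_eq (by ring))
    exact (Finset.single_le_sum (f := fun j => ‖G a i j‖) (fun _ _ => norm_nonneg _)
      (Finset.mem_univ j)).trans (Finset.single_le_sum (f := fun i => ∑ j, ‖G a i j‖)
          (fun _ _ => Finset.sum_nonneg fun _ _ => norm_nonneg _) (Finset.mem_univ i))
  have hq0 : ∀ w, 0 ≤ qf (G a) w := qf_nonneg (posDef_of_qf_pos hG.herm.self_of_nhds hG.pos)
  -- A single constant for all the estimates: each of them uses one summand.
  set L : ℝ := 1 + 2 * B + 2 * b + Γ + 2 * b * (n ^ 2 * M + 2 * B * Γ ^ 2) with hL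
  have hLM : 2 * b * (n ^ 2 * M + 2 * B * Γ ^ 2) ≤ L := by
    have : 0 ≤ 1 + 2 * B + 2 * b + Γ := by positivity
    linarith
  have hX : 0 ≤ 2 * b * (n ^ 2 * M + 2 * B * Γ ^ 2) := by positivity
  refine ⟨L, by linarith, ?_⟩
  have hfst : Tendsto Prod.fst (𝓝 ((a, a) : CSpace n × CSpace n)) (𝓝 a) := continuousAt_fst
  have hsnd : Tendsto Prod.snd (𝓝 ((a, a) : CSpace n × CSpace n)) (𝓝 a) := continuousAt_snd
  filter_upwards [hM, hfst.eventually hqf, hsnd.eventually hqf, hfst.eventually hΓ',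
    hfst.eventually hK, hfst.eventually hsm, hfst.eventually hG.herm.eventually_nhds] with
    ⟨z, z'⟩ hT h1 h2 h3 h4 h5 h6
  simp only at hT h1 h2 h3 h4 h5 h6
  have hlow : ∀ w, ‖w‖ ^ 2 ≤ 2 * b * qf (G z) w := fun w => by
    have := abs_le.mp (h1 w); nlinarith [hb' w, hq0 w]
  have hlow' : ∀ w, ‖w‖ ^ 2 ≤ 2 * b * qf (G z') w := fun w => by
    have := abs_le.mp (h2 w); nlinarith [hb' w, hq0 w]
  have hmet : LocalMetric G z := ⟨h5, h6, fun v hv => by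
    have := abs_le.mp (h1 v); linarith [hG.pos v hv]⟩
  have hup : ∀ w, qf (G z) w ≤ 2 * B * ‖w‖ ^ 2 := fun w => by
    have := abs_le.mp (h1 w); linarith [hB w, hq0 w]
  refine ⟨hmet, fun w => (hup w).trans ?_, fun w => (hlow w).trans ?_, fun v w => (h3 v w).trans ?_,
    fun w => ?_, fun w => ?_⟩
  · gcongr; linarith
  · gcongr
    · have := abs_le.mp (h1 w); linarith [hq0 w]
    · linarith
  · gcongr; linarith
  · have := abs_le.mp (h1 w); have := abs_le.mp (h2 w); linarith [hq0 w]
  · set v : Fin n → ℂ := (z' : Fin n → ℂ) - z with hv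
    have e1 := sum_fderiv_eq hmet.det_ne h6 h4 w (z' - z)
    have hvv : ((z' - z : CSpace n) : Fin n → ℂ) = v := rfl
    rw [hvv] at e1
    set R : Matrix (Fin n) (Fin n) ℂ := Matrix.of fun i j =>
      G z' i j - G z i j - fderiv ℝ (fun z => G z i j) z (z' - z) with hR
    have e2 : (sf R w w).re = qf (G z') w - qf (G z) w -
        2 * (sf (G z) (christoffelVec G z w v) w).re := by
      rw [← e1, qf, qf, ← Complex.sub_re, ← Complex.sub_re]
      simp only [sf, hR, Matrix.of_apply, ← Finset.sum_sub_distrib]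
      congr 1
      exact Finset.sum_congr rfl fun i _ => Finset.sum_congr rfl fun j _ => by ring
    have e3 : |(sf R w w).re| ≤ n ^ 2 * (M * ‖v‖ ^ 2) * (‖w‖ * ‖w‖) :=
      (Complex.abs_re_le_norm _).trans (norm_sf_le (P := R) hT w w)
    have e4 : qf (G z) (w + christoffelVec G z w v) = qf (G z) w +
        2 * (sf (G z) (christoffelVec G z w v) w).re + qf (G z) (christoffelVec G z w v) := by
      rw [add_comm w, qf_add h6.self_of_nhds]; ring
    have e5 : qf (G z) (christoffelVec G z w v) ≤ 2 * B * (Γ * (‖w‖ * ‖v‖)) ^ 2 := by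
      refine (hup _).trans ?_
      gcongr
      exact h3 w v
    have e6 : 0 ≤ qf (G z') w := by have := abs_le.mp (h2 w); linarith [hq0 w]
    calc _ ≤ qf (G z') w + (n ^ 2 * M + 2 * B * Γ ^ 2) * ‖v‖ ^ 2 * ‖w‖ ^ 2 := by
          rw [e4]; have := abs_le.mp e3; nlinarith
      _ ≤ qf (G z') w + (n ^ 2 * M + 2 * B * Γ ^ 2) * ‖v‖ ^ 2 * (2 * b * qf (G z') w) := by
          gcongr; exact hlow' w
      _ = (1 + 2 * b * (n ^ 2 * M + 2 * B * Γ ^ 2) * ‖v‖ ^ 2) * qf (G z') w := by ring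
      _ ≤ _ := by gcongr

end LocalEstimates
end

noncomputable section

open Filter Topology

/-! ### One step of a broken geodesic -/

section Step

variable {n : ℕ}

open scoped ComplexOrder

theorem dzbar_eq_conj_dz {f g : CSpace n → ℂ} {z : CSpace n} (h : f =ᶠ[𝓝 z] fun y => conj (g y))
    (c : Fin n) : dzbar c f z = conj (dz c g z) := by
  have h2 : fderiv ℝ f z = (Complex.conjCLE : ℂ →L[ℝ] ℂ).comp (fderiv ℝ g z) := by
    rw [h.fderiv_eq]
    exact Complex.conjCLE.comp_fderiv
  rw [dzbar, dz, h2]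
  simp [Complex.conj_ofNat]

theorem dzbar_ofReal {f : CSpace n → ℝ} {z : CSpace n} (c : Fin n) :
    dzbar c (fun y => (f y : ℂ)) z = conj (dz c (fun y => (f y : ℂ)) z) :=
  dzbar_eq_conj_dz (Eventually.of_forall fun y => (Complex.conj_ofReal _).symm) c

theorem dz_mul {f g : CSpace n → ℂ} {z : CSpace n} (hf : ContDiffAt ℝ ∞ f z)
    (hg : ContDiffAt ℝ ∞ g z) (p : Fin n) :
    dz p (fun y => f y * g y) z = f z * dz p g z + g z * dz p f z := by
  have h1 : IsRep (SmoothGerm.mk _ (contDiffAt_static hf 0)) fun _ z => f z :=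
    isRep_mk (F := fun _ z => f z) _
  have h2 : IsRep (SmoothGerm.mk _ (contDiffAt_static hg 0)) fun _ z => g z :=
    isRep_mk (F := fun _ z => g z) _
  have h := ((h1.mul h2).d p).eval_eq
  rw [Derivation.leibniz, smul_eq_mul, smul_eq_mul, map_add, map_mul, map_mul, h1.eval_eq,
    h2.eval_eq, (h1.d p).eval_eq, (h2.d p).eval_eq] at h
  exact h.symm

theorem dz_dzbar_mul {f g : CSpace n → ℂ} {z : CSpace n} (hf : ContDiffAt ℝ ∞ f z)
    (hg : ContDiffAt ℝ ∞ g z) (p : Fin n) :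
    dz p (dzbar p fun y => f y * g y) z = f z * dz p (dzbar p g) z + dz p f z * dzbar p g z +
      dz p g z * dzbar p f z + g z * dz p (dzbar p f) z := by
  have h1 : IsRep (SmoothGerm.mk _ (contDiffAt_static hf 0)) fun _ z => f z :=
    isRep_mk (F := fun _ z => f z) _
  have h2 : IsRep (SmoothGerm.mk _ (contDiffAt_static hg 0)) fun _ z => g z :=
    isRep_mk (F := fun _ z => g z) _
  have h := (((h1.mul h2).db p).d p).eval_eq
  simp only [Derivation.leibniz, smul_eq_mul, map_add, map_mul, h1.eval_eq,
    h2.eval_eq, (h1.d p).eval_eq, (h2.d p).eval_eq, (h1.db p).eval_eq, (h2.db p).eval_eq,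
    ((h1.db p).d p).eval_eq, ((h2.db p).d p).eval_eq] at h
  rw [← h]
  ring

theorem dz_add {f g : CSpace n → ℂ} {z : CSpace n} (hf : DifferentiableAt ℝ f z)
    (hg : DifferentiableAt ℝ g z) (p : Fin n) :
    dz p (fun y => f y + g y) z = dz p f z + dz p g z := by
  have : fderiv ℝ (fun y => f y + g y) z = fderiv ℝ f z + fderiv ℝ g z := fderiv_add hf hg
  simp only [dz, this, add_apply]
  ring

theorem dz_dzbar_add {f g : CSpace n → ℂ} {z : CSpace n} (hf : ContDiffAt ℝ ∞ f z)
    (hg : ContDiffAt ℝ ∞ g z) (p : Fin n) :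
    dz p (dzbar p fun y => f y + g y) z = dz p (dzbar p f) z + dz p (dzbar p g) z := by
  have h1 : IsRep (SmoothGerm.mk _ (contDiffAt_static hf 0)) fun _ z => f z :=
    isRep_mk (F := fun _ z => f z) _
  have h2 : IsRep (SmoothGerm.mk _ (contDiffAt_static hg 0)) fun _ z => g z :=
    isRep_mk (F := fun _ z => g z) _
  have h := (((h1.add h2).db p).d p).eval_eq
  simp only [map_add, ((h1.db p).d p).eval_eq, ((h2.db p).d p).eval_eq] at h
  exact h.symm

theorem dz_const (c : ℂ) (z : CSpace n) (p : Fin n) : dz p (fun _ => c) z = 0 := by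
  simp [dz]

theorem dzbar_const (c : ℂ) (z : CSpace n) (p : Fin n) : dzbar p (fun _ => c) z = 0 := by
  simp [dzbar]

theorem jac_const (e : CSpace n) (p : Fin n) : jac (fun _ => e) 0 p = 0 := by
  ext c; simp [jac]

theorem christoffelVec_zero_left (G : CSpace n → Matrix (Fin n) (Fin n) ℂ) (z : CSpace n)
    (b : Fin n → ℂ) : christoffelVec G z 0 b = 0 := by
  ext i; simp [christoffelVec]

theorem christoffelVec_smul_left (G : CSpace n → Matrix (Fin n) (Fin n) ℂ) (z : CSpace n) (c : ℂ)
    (a b : Fin n → ℂ) : christoffelVec G z (c • a) b = c • christoffelVec G z a b := by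
  ext i
  simp only [christoffelVec, Pi.smul_apply, smul_eq_mul, Finset.mul_sum]
  exact Finset.sum_congr rfl fun _ _ => Finset.sum_congr rfl fun _ _ => by ring

theorem christoffelVec_add_left (G : CSpace n → Matrix (Fin n) (Fin n) ℂ) (z : CSpace n)
    (a a' b : Fin n → ℂ) :
    christoffelVec G z (a + a') b = christoffelVec G z a b + christoffelVec G z a' b := by
  ext i
  simp only [christoffelVec, Pi.add_apply, ← Finset.sum_add_distrib]
  exact Finset.sum_congr rfl fun _ _ => Finset.sum_congr rfl fun _ _ => by ring

theorem localMetric_one (z : CSpace n) : LocalMetric (fun _ => (1 : Matrix (Fin n) (Fin n) ℂ)) z where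
  smooth _ _ := contDiffAt_const
  herm := Eventually.of_forall fun _ => Matrix.isHermitian_one
  pos v hv := by
    rw [qf_one]
    obtain ⟨i, hi⟩ := Function.ne_iff.mp hv
    exact Finset.sum_pos' (fun _ _ => sq_nonneg _) ⟨i, Finset.mem_univ _, by
      have : 0 < ‖v i‖ := norm_pos_iff.mpr hi
      positivity⟩

theorem qf_one_le (w : Fin n → ℂ) : qf 1 w ≤ n * ‖w‖ ^ 2 := by
  rw [qf_one]
  calc _ ≤ ∑ _i : Fin n, ‖w‖ ^ 2 := Finset.sum_le_sum fun i _ => by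
        gcongr; exact norm_le_pi_norm w i
    _ = _ := by simp

/-- The derivatives of the squared distance to a fixed point along a holomorphic map. -/
theorem levi_sq_dist {τ : CSpace n → CSpace n} (hτ : AnalyticAt ℂ τ 0) (e : CSpace n) (p : Fin n) :
    ContDiffAt ℝ ∞ (fun ζ => (qf 1 (τ ζ - e) : ℂ)) 0 ∧
      dz p (fun ζ => (qf 1 (τ ζ - e) : ℂ)) 0 =
        sf 1 (jac τ 0 p) (τ 0 - e) ∧
      dz p (dzbar p fun ζ => (qf 1 (τ ζ - e) : ℂ)) 0 = qf 1 (jac τ 0 p) := by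
  have h := hasLevi (G := fun _ => 1) (τ := fun _ => e) (σ := τ) (localMetric_one e)
    analyticAt_const hτ p (h := fun ζ => (qf 1 (τ ζ - e) : ℂ))
    (fun ζ => ofReal_qf Matrix.isHermitian_one _) (v := (τ 0 : Fin n → ℂ) - e) (u := jac τ 0 p) rfl
    (by rw [jac_const, christoffelVec_zero_left]; simp)
  refine ⟨h.1, h.2.1, ?_⟩
  rw [h.2.2, jac_const, ofReal_qf Matrix.isHermitian_one]
  simp [curvatureForm]

/-- The cost of a step from `z` to `z'`. -/
def stepCost (G : CSpace n → Matrix (Fin n) (Fin n) ℂ) (κ : ℝ) (e z z' : CSpace n) : ℝ :=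
  (1 + κ * qf 1 (z - e)) * qf (G z) (z' - z)

/-- The affine map with prescribed value and holomorphic derivatives at the origin. -/
theorem exists_affine (z : CSpace n) (P : Fin n → Fin n → ℂ) (s : ℂ) : ∃ τ : CSpace n → CSpace n,
    AnalyticAt ℂ τ 0 ∧ τ 0 = z ∧ (s = 0 → ∀ ζ, τ ζ = z) ∧ ∀ p, jac τ 0 p = s • P p := by
  set A : CSpace n →L[ℂ] CSpace n := ∑ i, (EuclideanSpace.proj i : CSpace n →L[ℂ] ℂ).smulRight
    (WithLp.toLp 2 (P i)) with hA
  have h1 : HasFDerivAt (fun ζ => z + s • A ζ) (s • A) 0 := (A.hasFDerivAt.const_smul s).const_add z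
  refine ⟨fun ζ => z + s • A ζ, analyticAt_const.add ((s • A).analyticAt 0),
    by simp, fun h ζ => by simp [h], fun p => ?_⟩
  ext c
  rw [jac, Matrix.of_apply, h1.fderiv]
  have h2 : A (EuclideanSpace.single p 1) = WithLp.toLp 2 (P p) := by
    simp [hA, sum_apply, Pi.single_apply, ite_smul]
  rw [smul_apply, h2]
  rfl

theorem norm_curvatureForm_le {G : CSpace n → Matrix (Fin n) (Fin n) ℂ} {z : CSpace n}
    (hG : LocalMetric G z) {C : ℝ} (hC : 0 ≤ C) (hRm : (rmSqAt G z).re ≤ C ^ 2) (a b : Fin n → ℂ) :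
    ‖curvatureForm G z a b‖ ≤ C * n ^ 2 * (qf (G z) a * qf (G z) b) := by
  rw [mul_assoc]
  exact norm_curvature_form_le (posDef_of_qf_pos hG.herm.self_of_nhds hG.pos) _ hC hRm a b

/-- The derivatives of the weight in the step cost along a holomorphic map. -/
theorem levi_weight {τ : CSpace n → CSpace n} (hτ : AnalyticAt ℂ τ 0) (e : CSpace n) (κ : ℝ)
    (p : Fin n) :
    ContDiffAt ℝ ∞ (fun ζ => ((1 + κ * qf 1 (τ ζ - e) : ℝ) : ℂ)) 0 ∧
      dz p (fun ζ => ((1 + κ * qf 1 (τ ζ - e) : ℝ) : ℂ)) 0 = κ * sf 1 (jac τ 0 p) (τ 0 - e) ∧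
      dz p (dzbar p fun ζ => ((1 + κ * qf 1 (τ ζ - e) : ℝ) : ℂ)) 0 = κ * qf 1 (jac τ 0 p) := by
  obtain ⟨h1, h2, h3⟩ := levi_sq_dist hτ e p
  have h4 : ContDiffAt ℝ ∞ (fun ζ => (κ : ℂ) * (qf 1 (τ ζ - e) : ℂ)) 0 := contDiffAt_const.mul h1
  have h5 : (fun ζ => ((1 + κ * qf 1 (τ ζ - e) : ℝ) : ℂ)) =
      fun ζ => 1 + (κ : ℂ) * (qf 1 (τ ζ - e) : ℂ) := by ext; push_cast; rfl
  have h6 : ∀ z : CSpace n, dzbar p (fun _ : CSpace n => (1 : ℂ)) z = 0 := fun z => dzbar_const 1 z p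
  have h7 : dz p (dzbar p fun _ : CSpace n => (κ : ℂ)) 0 = 0 := by
    have : dzbar p (fun _ : CSpace n => (κ : ℂ)) = fun _ => 0 := funext fun z => dzbar_const _ z p
    rw [this, dz_const]
  have h8 : dz p (dzbar p fun _ : CSpace n => (1 : ℂ)) 0 = 0 := by
    have : dzbar p (fun _ : CSpace n => (1 : ℂ)) = fun _ => 0 := funext fun z => dzbar_const _ z p
    rw [this, dz_const]
  rw [h5]
  refine ⟨contDiffAt_const.add h4, ?_, ?_⟩
  · rw [dz_add (differentiableAt_const _) (h4.differentiableAt (by simp)), dz_const,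
      dz_mul contDiffAt_const h1, dz_const, h2]
    ring
  · rw [dz_dzbar_add contDiffAt_const h4, h8, dz_dzbar_mul contDiffAt_const h1, h7, dz_const,
      dzbar_const, h3]
    ring

-- The end point of a step moves along `σ`, and its starting point is dragged along by `s` times the
-- approximate parallel transport of the velocity of `σ`. The relative velocity is then `(1 - s)`
-- times that velocity up to second order in the length of the step. So the Hessian of the squared
-- length consists of a term of size `(1 - s)²`, a curvature term of size `c`, and errors that
-- `hsmall` bounds by `c`. Only the curvature bound `C` survives in the constants, not the chart
-- constant `L`.
set_option maxHeartbeats 1000000 in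
theorem exists_step {G : CSpace n → Matrix (Fin n) (Fin n) ℂ} {L C κ s c : ℝ} {z z' e : CSpace n}
    (hherm : ∀ z, (G z).IsHermitian) (hE : ChartEstimate G L z z') (hE' : (G z').PosDef) (hL : 1 ≤ L) (hC : 0 ≤ C)
    (hRm : (rmSqAt G z).re ≤ C ^ 2)
    {σ : CSpace n → CSpace n} (hσ : AnalyticAt ℂ σ 0) (hσ0 : σ 0 = z') (hκ : 0 ≤ κ)
    (hκ1 : κ * qf 1 (z - e) ≤ 1) (hκ2 : 2 * n * L * κ ≤ 1) (hs : 0 ≤ s) (hs1 : s ≤ 1)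
    (hc : c = qf (G z) (z' - z)) (hsmall : 4 * L ^ 8 * c ≤ 1) :
    ∃ τ : CSpace n → CSpace n, AnalyticAt ℂ τ 0 ∧ τ 0 = z ∧ (s = 0 → ∀ ζ, τ ζ = z) ∧
      ContDiffAt ℝ ∞ (fun ζ => (stepCost G κ e (τ ζ) (σ ζ) : ℂ)) 0 ∧
      (∀ p, qf (G z) (jac τ 0 p) ≤ s ^ 2 * (1 + L ^ 2 * c) * qf (G z') (jac σ 0 p)) ∧
      (∀ p, (dz p (dzbar p fun ζ => (stepCost G κ e (τ ζ) (σ ζ) : ℂ)) 0).re ≤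
        (12 * (1 - s) ^ 2 + (4 * C * n ^ 2 + 5) * c) * qf (G z') (jac σ 0 p)) ∧
      ∀ p, ‖dz p (fun ζ => (stepCost G κ e (τ ζ) (σ ζ) : ℂ)) 0‖ ≤
        (4 * (1 - s) * √c + 4 * c) * √(qf (G z') (jac σ 0 p)) := by
  set v : Fin n → ℂ := z' - z with hv
  set w : Fin n → Fin n → ℂ := fun p => jac σ 0 p with hw
  have hP : (G z).PosDef := posDef_of_qf_pos hE.metric.herm.self_of_nhds hE.metric.pos
  obtain ⟨τ, hτ, hτ0, hτs, hτj⟩ := exists_affine z (fun p => w p + christoffelVec G z (w p) v) s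
  have hc0 : 0 ≤ c := hc ▸ qf_nonneg hP _
  have hvc : ‖v‖ ^ 2 ≤ L * c := hc ▸ hE.norm_le v
  have hLc : L ^ 2 * c ≤ 1 := by
    have : L ^ 2 ≤ L ^ 8 := pow_le_pow_right₀ hL (by norm_num)
    nlinarith
  have hω0 : ∀ p, 0 ≤ qf (G z') (w p) := fun p => qf_nonneg hE' _
  have hPp : ∀ p, qf (G z) (w p + christoffelVec G z (w p) v) ≤ (1 + L ^ 2 * c) * qf (G z') (w p) :=
    fun p => (hE.transport (w p)).trans (by
      gcongr ?_ * _
      · exact hω0 p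
      · nlinarith)
  have hns : ‖(s : ℂ)‖ ^ 2 = s ^ 2 := by rw [Complex.norm_real, Real.norm_eq_abs, sq_abs]
  have hJ : ∀ p, qf (G z) (jac τ 0 p) ≤ s ^ 2 * (1 + L ^ 2 * c) * qf (G z') (w p) := fun p => by
    rw [hτj, qf_smul, hns, mul_assoc]
    exact mul_le_mul_of_nonneg_left (hPp p) (sq_nonneg _)
  have hJ2 : ∀ p, qf (G z) (jac τ 0 p) ≤ 2 * qf (G z') (w p) := fun p => (hJ p).trans (by
    have := hω0 p
    gcongr
    nlinarith [mul_nonneg (sq_nonneg L) hc0, pow_le_one₀ hs hs1 (n := 2), sq_nonneg s])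
  set u : Fin n → Fin n → ℂ := fun p => w p - jac τ 0 p + christoffelVec G z (jac τ 0 p) v with hu
  -- The terms with a single Christoffel symbol cancel; the iterated one is quadratic in `v` and is
  -- absorbed by `hsmall`.
  have hu' : ∀ p, u p = ((1 - s : ℝ) : ℂ) • w p +
      (s : ℂ) • christoffelVec G z (christoffelVec G z (w p) v) v := fun p => by
    simp only [hu, hτj, christoffelVec_smul_left, christoffelVec_add_left, Complex.ofReal_sub,
      Complex.ofReal_one]
    module
  have hqu : ∀ p, qf (G z) (u p) ≤ (4 * (1 - s) ^ 2 + c) * qf (G z') (w p) := fun p => by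
    have h1 : ‖christoffelVec G z (christoffelVec G z (w p) v) v‖ ≤ L ^ 2 * ‖w p‖ * ‖v‖ ^ 2 := by
      refine (hE.christoffel _ _).trans ?_
      have := hE.christoffel (w p) v
      calc L * (‖christoffelVec G z (w p) v‖ * ‖v‖) ≤ L * (L * (‖w p‖ * ‖v‖) * ‖v‖) := by gcongr
        _ = _ := by ring
    have h2 : ‖w p‖ ^ 2 ≤ L * (2 * qf (G z') (w p)) := (hE.norm_le _).trans (by
      have := hE.compare (w p); gcongr)
    have h3 : qf (G z) (christoffelVec G z (christoffelVec G z (w p) v) v) ≤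
        c / 2 * qf (G z') (w p) := by
      calc _ ≤ L * (L ^ 2 * ‖w p‖ * ‖v‖ ^ 2) ^ 2 := (hE.le _).trans (by gcongr)
        _ = L ^ 5 * ‖w p‖ ^ 2 * (‖v‖ ^ 2) ^ 2 := by ring
        _ ≤ L ^ 5 * (L * (2 * qf (G z') (w p))) * (L * c) ^ 2 := by
            have := hω0 p
            gcongr
        _ = (4 * L ^ 8 * c) * (c / 2 * qf (G z') (w p)) := by ring
        _ ≤ _ := mul_le_of_le_one_left (mul_nonneg (by linarith) (hω0 p)) hsmall
    have h4 := hE.compare (w p)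
    rw [hu']
    refine (qf_add_le hP _ _).trans ?_
    rw [qf_smul, qf_smul, hns, Complex.norm_real, Real.norm_eq_abs, sq_abs]
    have h5 : s ^ 2 ≤ 1 := pow_le_one₀ hs hs1
    have h6 : s ^ 2 * qf (G z) (christoffelVec G z (christoffelVec G z (w p) v) v) ≤
        c / 2 * qf (G z') (w p) := (mul_le_of_le_one_left (qf_nonneg hP _) h5).trans h3
    have h7 : (1 - s) ^ 2 * qf (G z) (w p) ≤ (1 - s) ^ 2 * (2 * qf (G z') (w p)) := by gcongr
    linarith
  set H : CSpace n → ℂ := fun ζ => (qf (G (τ ζ)) (σ ζ - τ ζ) : ℂ) with hHdef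
  set F : CSpace n → ℂ := fun ζ => ((1 + κ * qf 1 (τ ζ - e) : ℝ) : ℂ) with hFdef
  have hFH : (fun ζ => (stepCost G κ e (τ ζ) (σ ζ) : ℂ)) = fun ζ => F ζ * H ζ := by
    ext ζ; simp only [stepCost, hFdef, hHdef]; push_cast; rfl
  have hH := fun p => hasLevi (G := G) (τ := τ) (σ := σ) (hτ0 ▸ hE.metric) hτ hσ p (h := H)
    (fun ζ => ofReal_qf (hherm _) _) (v := v) (u := u p) (by rw [hτ0, hσ0]) (by rw [hτ0])
  have hF : ∀ p, ContDiffAt ℝ ∞ F 0 ∧ dz p F 0 = κ * sf 1 (jac τ 0 p) (τ 0 - e) ∧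
      dz p (dzbar p F) 0 = κ * qf 1 (jac τ 0 p) := levi_weight hτ e κ
  rw [hτ0] at hF hH
  have hF0 : F 0 = ((1 + κ * qf 1 (z - e) : ℝ) : ℂ) := by simp only [hFdef, hτ0]
  have hH0 : H 0 = (c : ℂ) := by simp only [hHdef, hτ0, hσ0, hc, hv]
  have hψ0 : 0 ≤ qf 1 (z - e) := qf_nonneg Matrix.PosDef.one _
  have hq1 : ∀ p, κ * qf 1 (jac τ 0 p) ≤ qf (G z') (w p) := fun p => by
    have h1 : ‖jac τ 0 p‖ ^ 2 ≤ L * (2 * qf (G z') (w p)) := (hE.norm_le _).trans (by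
      have := hJ2 p; gcongr)
    calc κ * qf 1 (jac τ 0 p) ≤ κ * (n * (L * (2 * qf (G z') (w p)))) := by
          gcongr; exact (qf_one_le _).trans (by gcongr)
      _ = (2 * n * L * κ) * qf (G z') (w p) := by ring
      _ ≤ _ := mul_le_of_le_one_left (hω0 p) hκ2
  have hcurv : ∀ p, ‖curvatureForm G z (jac τ 0 p) v‖ ≤ C * n ^ 2 * (2 * qf (G z') (w p) * c) :=
    fun p => (norm_curvatureForm_le hE.metric hC hRm _ _).trans (by
      have := hJ2 p
      rw [← hc]
      gcongr)
  have hHpp : ∀ p, (dz p (dzbar p H) 0).re ≤ C * n ^ 2 * (2 * qf (G z') (w p) * c) + qf (G z) (u p) :=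
    fun p => by
      rw [(hH p).2.2, Complex.add_re, Complex.neg_re]
      have h1 := abs_le.mp ((Complex.abs_re_le_norm _).trans (hcurv p))
      have h2 : (sf (G z) (u p) (u p)).re = qf (G z) (u p) := rfl
      linarith
  have hHp : ∀ p, ‖dz p H 0‖ ≤ √(qf (G z) (u p)) * √c := fun p => by
    rw [(hH p).2.1, hc]; exact norm_sf_le_sqrt hP _ _
  have hFp : ∀ p, ‖dz p F 0‖ ≤ √(qf (G z') (w p)) := fun p => by
    rw [(hF p).2.1, norm_mul, Complex.norm_real, Real.norm_eq_abs, abs_of_nonneg hκ]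
    refine Real.le_sqrt_of_sq_le ?_
    calc _ = κ ^ 2 * ‖sf 1 (jac τ 0 p) (z - e)‖ ^ 2 := by ring
      _ ≤ κ ^ 2 * (qf 1 (jac τ 0 p) * qf 1 (z - e)) := by
          gcongr; exact norm_sf_sq_le Matrix.PosDef.one _ _
      _ = (κ * qf 1 (jac τ 0 p)) * (κ * qf 1 (z - e)) := by ring
      _ ≤ _ := mul_le_of_le_one_right (mul_nonneg hκ (qf_nonneg Matrix.PosDef.one _)) hκ1 |>.trans
          (hq1 p)
  have hsq : ∀ p, √(qf (G z) (u p)) ≤ (2 * (1 - s) + √c) * √(qf (G z') (w p)) := fun p => by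
    refine (Real.sqrt_le_sqrt (hqu p)).trans ?_
    rw [Real.sqrt_mul (by positivity)]
    gcongr
    refine Real.sqrt_le_iff.mpr ⟨by have := Real.sqrt_nonneg c; linarith, ?_⟩
    nlinarith [Real.sq_sqrt hc0, Real.sqrt_nonneg c, mul_nonneg (sub_nonneg.mpr hs1) (Real.sqrt_nonneg c)]
  refine ⟨τ, hτ, hτ0, fun h => hτs (by rw [h, Complex.ofReal_zero]), ?_, hJ, fun p => ?_, fun p => ?_⟩
  · rw [hFH]
    rcases isEmpty_or_nonempty (Fin n) with hn | ⟨⟨p⟩⟩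
    · exact contDiffAt_const.congr_of_eventuallyEq (Eventually.of_forall fun ζ =>
        congrArg (fun ζ => F ζ * H ζ) (Subsingleton.elim ζ 0))
    · exact (hF p).1.mul (hH p).1
  · rw [hFH, dz_dzbar_mul (hF p).1 (hH p).1, hF0, hH0]
    have e1 : dzbar p F 0 = conj (dz p F 0) := dzbar_ofReal p
    have e2 : dzbar p H 0 = conj (dz p H 0) := dzbar_ofReal p
    have e3 : dz p F 0 * dzbar p H 0 + dz p H 0 * dzbar p F 0 =
        ((2 * (dz p F 0 * conj (dz p H 0)).re : ℝ) : ℂ) := by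
      rw [e1, e2]
      have := Complex.add_conj (dz p F 0 * conj (dz p H 0))
      rw [map_mul, Complex.conj_conj, mul_comm (conj (dz p F 0))] at this
      rw [this]
    have e4 : (dz p F 0 * conj (dz p H 0)).re ≤ √(qf (G z') (w p)) * (√(qf (G z) (u p)) * √c) := by
      refine (Complex.re_le_norm _).trans ?_
      rw [norm_mul, RCLike.norm_conj]
      exact mul_le_mul (hFp p) (hHp p) (norm_nonneg _) (Real.sqrt_nonneg _)
    -- The mixed derivatives of the weight and of the squared length, by the inequality between
    -- arithmetic and geometric mean.
    have e5 : 2 * (√(qf (G z') (w p)) * (√(qf (G z) (u p)) * √c)) ≤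
        qf (G z) (u p) + c * qf (G z') (w p) := by
      have h1 := Real.sq_sqrt (qf_nonneg hP (u p))
      have h2 := Real.sq_sqrt (hω0 p)
      have h3 := Real.sq_sqrt hc0
      have h4 := sq_nonneg (√(qf (G z) (u p)) - √(qf (G z') (w p)) * √c)
      have h5 : (√(qf (G z') (w p)) * √c) ^ 2 = c * qf (G z') (w p) := by rw [mul_pow, h2, h3, mul_comm]
      nlinarith
    rw [add_assoc (_ * _), e3, Complex.add_re, Complex.add_re, Complex.re_ofReal_mul,
      Complex.ofReal_re, Complex.re_ofReal_mul, (hF p).2.2, ← Complex.ofReal_mul, Complex.ofReal_re]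
    have e6 : 0 ≤ C * n ^ 2 * (2 * qf (G z') (w p) * c) + qf (G z) (u p) := by
      have := hω0 p; have := qf_nonneg hP (u p); positivity
    -- The weight is at most `2`, so `|u|²` occurs twice here and once in the mixed term. With `|u|²
    -- ≤ (4 (1 - s)² + c) |∂σ|²` this gives `12 (1 - s)²` and `3 c`; the mixed term and the Hessian
    -- of the weight add `c` each.
    have e7 : (1 + κ * qf 1 (z - e)) * (dz p (dzbar p H) 0).re ≤
        2 * (C * n ^ 2 * (2 * qf (G z') (w p) * c) + qf (G z) (u p)) := by
      have : 0 ≤ κ * qf 1 (z - e) := mul_nonneg hκ hψ0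
      nlinarith [hHpp p]
    have e8 : c * (κ * qf 1 (jac τ 0 p)) ≤ c * qf (G z') (w p) := by gcongr; exact hq1 p
    have e9 := hqu p
    nlinarith
  · rw [hFH, dz_mul (hF p).1 (hH p).1, hF0, hH0]
    refine (norm_add_le _ _).trans ?_
    rw [norm_mul, norm_mul, Complex.norm_real, Complex.norm_real, Real.norm_eq_abs, Real.norm_eq_abs,
      abs_of_nonneg hc0, abs_of_nonneg (by positivity)]
    have e1 : (1 + κ * qf 1 (z - e)) * ‖dz p H 0‖ ≤
        2 * (((2 * (1 - s) + √c) * √(qf (G z') (w p))) * √c) := by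
      gcongr
      · linarith
      · exact (hHp p).trans (by gcongr; exact hsq p)
    have e2 : c * ‖dz p F 0‖ ≤ c * √(qf (G z') (w p)) := by gcongr; exact hFp p
    have e3 : √c * √c = c := Real.mul_self_sqrt hc0
    have e4 : 0 ≤ c * √(qf (G z') (w p)) := mul_nonneg hc0 (Real.sqrt_nonneg _)
    calc _ ≤ 2 * (((2 * (1 - s) + √c) * √(qf (G z') (w p))) * √c) + c * √(qf (G z') (w p)) :=
          add_le_add e1 e2
      _ = (4 * (1 - s) * √c + 2 * (√c * √c) + c) * √(qf (G z') (w p)) := by ring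
      _ ≤ _ := by rw [e3]; nlinarith

end Step
end

noncomputable section

open Filter Topology

/-! ### The Riemannian distance of a Hermitian metric -/

section Distance

variable {n : ℕ} {X : Type*} [TopologicalSpace X] [ChartedSpace (CSpace n) X]

theorem isManifold_real [IsManifold 𝓘(ℂ, CSpace n) ω X] : IsManifold 𝓘(ℝ, CSpace n) ω X := by
  refine isManifold_of_contDiffOn _ _ _ fun e e' he he' => ?_
  have h := (contDiffGroupoid ω 𝓘(ℂ, CSpace n)).compatible he he'
  exact (mem_groupoid_of_pregroupoid.mp h).1.restrict_scalars ℝ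

theorem hasMFDerivAt_real {f : CSpace n → X} {z : CSpace n} {L : CSpace n →L[ℂ] CSpace n}
    (h : HasMFDerivAt 𝓘(ℂ, CSpace n) 𝓘(ℂ, CSpace n) f z L) :
    HasMFDerivAt 𝓘(ℝ, CSpace n) 𝓘(ℝ, CSpace n) f z (L.restrictScalars ℝ) :=
  ⟨h.1, h.2.restrictScalars ℝ⟩

namespace HermitianMetric

variable (g : HermitianMetric n X)

theorem enormSMulClass (x : X) :
    letI := g.tangentENorm
    ENormSMulClass ℝ (TangentSpace 𝓘(ℝ, CSpace n) x) := by
  let := g.tangentENorm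
  refine ⟨fun c v => ?_⟩
  have h : ∀ v : CSpace n, (g.inner x (c • v) (c • v)).re = c ^ 2 * (g.inner x v v).re := fun v => by
    have h1 : c • v = (c : ℂ) • v := rfl
    rw [h1, inner_smul_left, inner_smul_right, Complex.conj_ofReal, ← mul_assoc, ← Complex.ofReal_mul,
      Complex.re_ofReal_mul, sq]
  refine (congrArg (fun b => ENNReal.ofReal (√(2 * b))) (h v)).trans ?_
  change _ = ‖c‖ₑ * ENNReal.ofReal (√(2 * (g.inner x v v).re))
  rw [Real.enorm_eq_ofReal_abs, ← ENNReal.ofReal_mul (abs_nonneg _)]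
  congr 1
  rw [← mul_assoc, mul_comm 2, mul_assoc, Real.sqrt_mul (sq_nonneg _), Real.sqrt_sq_eq_abs]

theorem edist_triangle [IsManifold 𝓘(ℂ, CSpace n) ω X] (x y z : X) :
    g.edist x z ≤ g.edist x y + g.edist y z := by
  let := g.tangentENorm
  have : ∀ x : X, ENormSMulClass ℝ (TangentSpace 𝓘(ℝ, CSpace n) x) := g.enormSMulClass
  have : IsManifold 𝓘(ℝ, CSpace n) ω X := isManifold_real
  exact Manifold.riemannianEDist_triangle

theorem edist_self (x : X) : g.edist x x = 0 := by
  let := g.tangentENorm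
  have : ∀ x : X, ENormSMulClass ℝ (TangentSpace 𝓘(ℝ, CSpace n) x) := g.enormSMulClass
  exact Manifold.riemannianEDist_self

/-- The straight segment in the chart is a competitor. The Riemannian length carries the factor `2`
in `2 Re g`, so its speed is at most `√(2 · 2c) = 2 √c`. -/
theorem edist_chart_le [IsManifold 𝓘(ℂ, CSpace n) ω X] {a : X} {z z' : CSpace n} {c : ℝ}
    (hz : ∀ s ∈ Icc (0 : ℝ) 1, z + s • (z' - z) ∈ (chartAt (CSpace n) a).target ∧
      qf (g.coord a (z + s • (z' - z))) (z' - z) ≤ 2 * c) :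
    g.edist ((chartAt (CSpace n) a).symm z) ((chartAt (CSpace n) a).symm z') ≤
      ENNReal.ofReal (2 * √c) := by
  let := g.tangentENorm
  have : ∀ x : X, ENormSMulClass ℝ (TangentSpace 𝓘(ℝ, CSpace n) x) := g.enormSMulClass
  have : IsManifold 𝓘(ℝ, CSpace n) ω X := isManifold_real
  set γ : ℝ → X := fun s => (chartAt (CSpace n) a).symm (z + s • (z' - z)) with hγ
  have hl : ∀ s : ℝ, HasFDerivAt (fun s : ℝ => z + s • (z' - z))
      ((ContinuousLinearMap.id ℝ ℝ).smulRight (z' - z)) s := fun s =>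
    ((hasFDerivAt_id s).smul_const (z' - z)).const_add z
  have hd : ∀ s ∈ Icc (0 : ℝ) 1, HasMFDerivAt 𝓘(ℝ, ℝ) 𝓘(ℝ, CSpace n) γ s
      (((chartDeriv a (z + s • (z' - z))).restrictScalars ℝ).comp
        ((ContinuousLinearMap.id ℝ ℝ).smulRight (z' - z))) := fun s hs => by
    have h1 := ((contMDiffAt_chart_symm (hz s hs).1).mdifferentiableAt (by simp)).hasMFDerivAt
    exact HasMFDerivAt.comp s (hasMFDerivAt_real h1) (hl s).hasMFDerivAt
  have hsm : ContMDiffOn 𝓘(ℝ, ℝ) 𝓘(ℝ, CSpace n) 1 γ (Icc 0 1) := by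
    have h2 : ContMDiffOn 𝓘(ℝ, CSpace n) 𝓘(ℝ, CSpace n) 1 (chartAt (CSpace n) a).symm
        (chartAt (CSpace n) a).target := (contMDiffOn_chart_symm (x := a) (n := ω)).of_le le_top
    refine h2.comp (ContDiff.contMDiff (by fun_prop)).contMDiffOn fun s hs => (hz s hs).1
  have h0 : γ 0 = (chartAt (CSpace n) a).symm z := by simp [hγ]
  have h1 : γ 1 = (chartAt (CSpace n) a).symm z' := by simp [hγ]
  refine (Manifold.riemannianEDist_le_pathELength hsm h0 h1 zero_le_one).trans ?_
  rw [Manifold.pathELength_eq_lintegral_mfderiv_Icc]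
  have h3 : ∀ s ∈ Icc (0 : ℝ) 1, ‖mfderiv 𝓘(ℝ, ℝ) 𝓘(ℝ, CSpace n) γ s 1‖ₑ ≤
      ENNReal.ofReal (2 * √c) := fun s hs => by
    rw [(hd s hs).mfderiv]
    have h4 : (2 * √c) = √(2 * (2 * c)) := by
      rw [← mul_assoc, show (2 : ℝ) * 2 = 2 ^ 2 by norm_num, Real.sqrt_mul (by norm_num),
        Real.sqrt_sq (by norm_num)]
    rw [h4]
    refine ENNReal.ofReal_le_ofReal (Real.sqrt_le_sqrt ?_)
    have h5 := (hz s hs).2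
    have h6 := g.sf_coord a (z + s • (z' - z)) (z' - z) (z' - z)
    have h7 : (chartDeriv a (z + s • (z' - z))).restrictScalars ℝ
        ((ContinuousLinearMap.id ℝ ℝ).smulRight (z' - z) 1) =
          chartDeriv a (z + s • (z' - z)) (z' - z) := by simp
    have h8 : (g.inner (γ s) (chartDeriv a (z + s • (z' - z)) (z' - z))
        (chartDeriv a (z + s • (z' - z)) (z' - z))).re ≤ 2 * c :=
      (congrArg Complex.re h6).symm.trans_le h5
    rw [← h7] at h8
    exact mul_le_mul_of_nonneg_left h8 zero_le_two
  calc _ ≤ ∫⁻ s in Icc (0 : ℝ) 1, ENNReal.ofReal (2 * √c) :=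
        MeasureTheory.setLIntegral_mono measurable_const h3
    _ = _ := by simp

end HermitianMetric

end Distance
end

noncomputable section

open Filter Topology

/-! ### Chains of short steps in charts -/

section Chains

variable {n : ℕ} {X : Type*} [TopologicalSpace X] [ChartedSpace (CSpace n) X]

open scoped ComplexOrder

theorem qf_one_eq (v : CSpace n) : qf 1 v = ‖v‖ ^ 2 := by
  rw [qf_one, EuclideanSpace.norm_sq_eq]

/-- Cauchy–Schwarz, in the form needed to pass from sums of squared lengths to lengths one step at a
time. -/
theorem add_sqrt_le {c D : ℝ} (hc : 0 ≤ c) (hD : 0 ≤ D) (k : ℕ) :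
    √(k * D) + √c ≤ √(((k : ℝ) + 1) * (D + c)) := by
  refine Real.le_sqrt_of_sq_le ?_
  have h1 : (0 : ℝ) ≤ k := k.cast_nonneg
  have h2 := Real.sq_sqrt (mul_nonneg h1 hD)
  have h3 := Real.sq_sqrt hc
  rw [Real.sqrt_mul h1] at h2 ⊢
  have h4 := sq_nonneg (√k * √c - √D)
  have h5 := Real.sq_sqrt h1
  have h6 := Real.sq_sqrt hD
  nlinarith

namespace ChartEstimate

variable {G : CSpace n → Matrix (Fin n) (Fin n) ℂ} {L L' : ℝ} {z z' : CSpace n}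

theorem posDef (h : ChartEstimate G L z z') : (G z).PosDef :=
  posDef_of_qf_pos h.metric.herm.self_of_nhds h.metric.pos

theorem mono (h : ChartEstimate G L z z') (hL : L ≤ L') : ChartEstimate G L' z z' where
  metric := h.metric
  le w := (h.le w).trans (by gcongr)
  norm_le w := (h.norm_le w).trans (by have := qf_nonneg h.posDef w; gcongr)
  christoffel a b := (h.christoffel a b).trans (by gcongr)
  compare := h.compare
  transport w := (h.transport w).trans (by
    have h1 : 0 ≤ qf (G z') w := by have := qf_nonneg h.posDef w; have := h.compare w; linarith
    gcongr)

theorem norm_sq_le (h : ChartEstimate G L z z') : ‖z' - z‖ ^ 2 ≤ n * L * qf (G z) (z' - z) := by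
  rw [mul_assoc]
  exact (norm_sq_le_ofLp (z' - z)).trans (by gcongr; exact h.norm_le _)

end ChartEstimate

/-- A finite family of charts around the points of `A`, with balls of radius `ρ`, in which `g` and
the step costs are controlled. -/
structure ChainCharts (g : HermitianMetric n X) (K : Set X) (A : Finset X) (ρ : X → ℝ)
    (L η δ : ℝ) : Prop where
  one_le : 1 ≤ L
  η_pos : 0 < η
  η_le : η ≤ 1
  δ_pos : 0 < δ
  ρ_pos : ∀ a ∈ A, 0 < ρ a
  δ_le : ∀ a ∈ A, δ ≤ ρ a
  target : ∀ a ∈ A, Metric.closedBall (chartAt (CSpace n) a a) (2 * ρ a) ⊆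
    (chartAt (CSpace n) a).target
  estimate : ∀ a ∈ A, ∀ z ∈ Metric.closedBall (chartAt (CSpace n) a a) (2 * ρ a),
    ∀ z' ∈ Metric.closedBall (chartAt (CSpace n) a a) (2 * ρ a), ChartEstimate (g.coord a) L z z'
  -- The weight of the step cost varies so slowly that its own Hessian is harmless in `exists_step`.
  weight : ∀ a ∈ A, 2 * n * L * (η / ρ a ^ 2) ≤ 1
  cover : ∀ y ∈ K, ∃ a ∈ A, y ∈ (chartAt (CSpace n) a).source ∧
    ‖chartAt (CSpace n) a y - chartAt (CSpace n) a a‖ < ρ a / 2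
  -- The same step read in another chart. Squared lengths in two charts agree up to a factor `1 + η
  -- / 8`, which is smaller than the gain of the weight when passing from the boundary of one ball
  -- to the inner half of another.
  relabel : ∀ a ∈ A, ∀ b ∈ A, ∀ z z', ‖z - chartAt (CSpace n) a a‖ ≤ ρ a →
    (chartAt (CSpace n) a).symm z ∈ (chartAt (CSpace n) b).source →
    ‖transition b a z - chartAt (CSpace n) b b‖ < ρ b / 2 → ‖z' - z‖ ≤ δ →
    (chartAt (CSpace n) a).symm z' ∈ (chartAt (CSpace n) b).source ∧
      transition b a z' ∈ Metric.closedBall (chartAt (CSpace n) b b) (2 * ρ b) ∧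
      qf (g.coord b (transition b a z)) (transition b a z' - transition b a z) ≤
        (1 + η / 8) * qf (g.coord a z) (z' - z)

/-- The cost of a step in the chart at `a`. -/
def chartCost (g : HermitianMetric n X) (ρ : X → ℝ) (η : ℝ) (a : X) (z z' : CSpace n) : ℝ :=
  stepCost (g.coord a) (η / ρ a ^ 2) (chartAt (CSpace n) a a) z z'

/-- The pairs of an end point and the cost of a chain of `k` steps that starts at `o`. -/
def chainSet (g : HermitianMetric n X) (A : Finset X) (ρ : X → ℝ) (η δ : ℝ) (o : X) :
    ℕ → Set (X × ℝ)
  | 0 => {(o, 0)}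
  | k + 1 => {q | ∃ a ∈ A, ∃ z z' : CSpace n, ∃ D : ℝ,
      ‖z - chartAt (CSpace n) a a‖ ≤ ρ a ∧ ‖z' - z‖ ≤ δ ∧
      ((chartAt (CSpace n) a).symm z, D) ∈ chainSet g A ρ η δ o k ∧
      q = ((chartAt (CSpace n) a).symm z', D + chartCost g ρ η a z z')}

namespace ChainCharts

variable {g : HermitianMetric n X} {K : Set X} {A : Finset X} {ρ : X → ℝ} {L η δ : ℝ}
  (h : ChainCharts g K A ρ L η δ) {o : X}

include h

theorem mem_closedBall {a : X} (ha : a ∈ A) {z : CSpace n}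
    (hz : ‖z - chartAt (CSpace n) a a‖ ≤ ρ a) :
    z ∈ Metric.closedBall (chartAt (CSpace n) a a) (2 * ρ a) := by
  rw [mem_closedBall_iff_norm]; linarith [h.ρ_pos a ha]

theorem mem_closedBall' {a : X} (ha : a ∈ A) {z z' : CSpace n}
    (hz : ‖z - chartAt (CSpace n) a a‖ ≤ ρ a) (hz' : ‖z' - z‖ ≤ δ) :
    z' ∈ Metric.closedBall (chartAt (CSpace n) a a) (2 * ρ a) := by
  rw [mem_closedBall_iff_norm]
  have h1 : z' - chartAt (CSpace n) a a = (z' - z) + (z - chartAt (CSpace n) a a) := by abel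
  rw [h1]
  linarith [norm_add_le (z' - z) (z - chartAt (CSpace n) a a), h.δ_le a ha]

theorem qf_le_chartCost {a : X} (ha : a ∈ A) {z z' : CSpace n}
    (hz : ‖z - chartAt (CSpace n) a a‖ ≤ ρ a) :
    qf (g.coord a z) (z' - z) ≤ chartCost g ρ η a z z' := by
  have h1 := h.estimate a ha z (h.mem_closedBall ha hz) z (h.mem_closedBall ha hz)
  have h2 := qf_nonneg h1.posDef (z' - z)
  have h3 := h.η_pos
  have h4 : 0 ≤ qf 1 (z - chartAt (CSpace n) a a) := qf_nonneg Matrix.PosDef.one _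
  refine le_mul_of_one_le_left h2 (le_add_of_nonneg_right (by positivity))

theorem qf_coord_nonneg {a : X} (ha : a ∈ A) {z : CSpace n}
    (hz : ‖z - chartAt (CSpace n) a a‖ ≤ ρ a) (w : Fin n → ℂ) : 0 ≤ qf (g.coord a z) w :=
  qf_nonneg (h.estimate a ha z (h.mem_closedBall ha hz) z (h.mem_closedBall ha hz)).posDef w

omit h in
theorem continuousOn_qf {U : Set (CSpace n)} {a : X}
    (hU : ∀ i j, ContinuousOn (fun z => g.coord a z i j) U) {Y : Type*} [TopologicalSpace Y]
    {s : Set Y} {τ : Y → CSpace n} {v : Y → CSpace n} (hτ : ContinuousOn τ s)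
    (hv : ContinuousOn v s) (hs : MapsTo τ s U) :
    ContinuousOn (fun y => qf (g.coord a (τ y)) (v y)) s := by
  have hvi : ∀ i, ContinuousOn (fun y => v y i) s := fun i =>
    (EuclideanSpace.proj i : CSpace n →L[ℂ] ℂ).continuous.comp_continuousOn hv
  refine Complex.continuous_re.comp_continuousOn ?_
  refine continuousOn_finsetSum _ fun i _ => continuousOn_finsetSum _ fun j _ => ?_
  exact ((hvi i).mul ((hU i j).comp hτ hs)).mul (Complex.continuous_conj.comp_continuousOn (hvi j))

theorem continuousOn_coord {a : X} (ha : a ∈ A) (i j : Fin n) :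
    ContinuousOn (fun z => g.coord a z i j) (Metric.closedBall (chartAt (CSpace n) a a) (2 * ρ a)) :=
  fun z hz => ((h.estimate a ha z hz z hz).metric.smooth i j).continuousAt.continuousWithinAt

/-- All conditions on a step are closed and the number of charts is finite, so each step is a finite
union of continuous images of compact sets. This provides the maximum in the maximum principle, and
is the reason for the non-strict inequalities in `chainSet`. -/
theorem isCompact_chainSet [T2Space X] (k : ℕ) : IsCompact (chainSet g A ρ η δ o k) := by
  induction k with
  | zero => exact isCompact_singleton
  | succ k ih =>
    set S := chainSet g A ρ η δ o k with hS
    set Q : X → Set (ℝ × CSpace n × CSpace n) := fun a =>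
      (Prod.snd '' S) ×ˢ (Metric.closedBall (chartAt (CSpace n) a a) (ρ a) ×ˢ
        Metric.closedBall (chartAt (CSpace n) a a) (2 * ρ a)) with hQ
    set R : X → Set (ℝ × CSpace n × CSpace n) := fun a => {x | x ∈ Q a ∧
      ‖x.2.2 - x.2.1‖ ≤ δ ∧ ((chartAt (CSpace n) a).symm x.2.1, x.1) ∈ S} with hR
    have hQc : ∀ a, IsCompact (Q a) := fun a =>
      (ih.image continuous_snd).prod ((isCompact_closedBall _ _).prod (isCompact_closedBall _ _))
    have hsub : ∀ a ∈ A, ∀ x ∈ Q a, x.2.1 ∈ (chartAt (CSpace n) a).target ∧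
        x.2.2 ∈ (chartAt (CSpace n) a).target := fun a ha x hx =>
      ⟨h.target a ha (h.mem_closedBall ha (mem_closedBall_iff_norm.mp hx.2.1)),
        h.target a ha hx.2.2⟩
    have hRc : ∀ a ∈ A, IsCompact (R a) := fun a ha => by
      have h1 : ContinuousOn (fun x : ℝ × CSpace n × CSpace n =>
          (((chartAt (CSpace n) a).symm x.2.1, x.1) : X × ℝ)) (Q a) :=
        (((chartAt (CSpace n) a).continuousOn_symm.comp (by fun_prop)
          fun x hx => (hsub a ha x hx).1)).prodMk (by fun_prop)
      have h2 : IsClosed (Q a ∩ (fun x : ℝ × CSpace n × CSpace n =>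
          (((chartAt (CSpace n) a).symm x.2.1, x.1) : X × ℝ)) ⁻¹' S) :=
        h1.preimage_isClosed_of_isClosed (hQc a).isClosed ih.isClosed
      have h3 : IsClosed {x : ℝ × CSpace n × CSpace n | ‖x.2.2 - x.2.1‖ ≤ δ} :=
        isClosed_le (by fun_prop) continuous_const
      have h4 : R a = Q a ∩ ((Q a ∩ (fun x : ℝ × CSpace n × CSpace n =>
          (((chartAt (CSpace n) a).symm x.2.1, x.1) : X × ℝ)) ⁻¹' S) ∩
            {x : ℝ × CSpace n × CSpace n | ‖x.2.2 - x.2.1‖ ≤ δ}) := by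
        ext x
        simp only [hR, mem_ofPred_eq, mem_inter_iff, mem_preimage]
        tauto
      rw [h4]
      exact (hQc a).inter_right (h2.inter h3)
    have himg : chainSet g A ρ η δ o (k + 1) = ⋃ a ∈ A, (fun x : ℝ × CSpace n × CSpace n =>
        (((chartAt (CSpace n) a).symm x.2.2, x.1 + chartCost g ρ η a x.2.1 x.2.2) : X × ℝ)) ''
          R a := by
      ext q
      simp only [chainSet, mem_ofPred_eq, mem_iUnion, mem_image, exists_prop]
      refine exists_congr fun a => and_congr_right fun ha => ⟨?_, ?_⟩
      · rintro ⟨z, z', D, hz, hz', hD, rfl⟩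
        exact ⟨(D, z, z'), ⟨⟨⟨_, hD, rfl⟩, mem_closedBall_iff_norm.mpr hz,
          h.mem_closedBall' ha hz hz'⟩, hz', hD⟩, rfl⟩
      · rintro ⟨⟨D, z, z'⟩, ⟨⟨-, hz, -⟩, hz', hD⟩, rfl⟩
        exact ⟨z, z', D, mem_closedBall_iff_norm.mp hz, hz', hD, rfl⟩
    rw [himg]
    refine A.isCompact_biUnion fun a ha => (hRc a ha).image_of_continuousOn ?_
    have h1 : ContinuousOn (fun x : ℝ × CSpace n × CSpace n => qf (g.coord a x.2.1) (x.2.2 - x.2.1))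
        (R a) := continuousOn_qf (h.continuousOn_coord ha) (τ := fun x => x.2.1)
      (v := fun x : ℝ × CSpace n × CSpace n => x.2.2 - x.2.1) (by fun_prop) (by fun_prop)
      fun x hx => h.mem_closedBall ha (mem_closedBall_iff_norm.mp hx.1.2.1)
    have h2 : ContinuousOn (fun x : ℝ × CSpace n × CSpace n =>
        1 + η / ρ a ^ 2 * qf 1 (x.2.1 - chartAt (CSpace n) a a)) (R a) := by
      have : (fun x : ℝ × CSpace n × CSpace n =>
          1 + η / ρ a ^ 2 * qf 1 (x.2.1 - chartAt (CSpace n) a a)) = fun x =>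
          1 + η / ρ a ^ 2 * ‖x.2.1 - chartAt (CSpace n) a a‖ ^ 2 := by
        ext x; rw [← qf_one_eq]
      rw [this]
      fun_prop
    refine ((chartAt (CSpace n) a).continuousOn_symm.comp (by fun_prop)
      fun x hx => (hsub a ha x hx.1).2).prodMk ?_
    exact continuousOn_fst.add (h2.mul h1)

theorem base_mem_chainSet (ho : o ∈ K) (k : ℕ) : (o, 0) ∈ chainSet g A ρ η δ o k := by
  induction k with
  | zero => exact rfl
  | succ k ih =>
    obtain ⟨a, ha, hs, hρ⟩ := h.cover o ho
    have h1 : (chartAt (CSpace n) a).symm (chartAt (CSpace n) a o) = o :=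
      (chartAt (CSpace n) a).left_inv hs
    refine ⟨a, ha, chartAt (CSpace n) a o, chartAt (CSpace n) a o, 0,
      by linarith [h.ρ_pos a ha], by simpa using h.δ_pos.le, by rwa [h1], ?_⟩
    rw [h1, chartCost, stepCost, sub_self, qf_zero, mul_zero, add_zero]

/-- The cost bounds the sum of squared lengths, so by Cauchy–Schwarz `k` times the cost bounds the
squared length of the chain. Chains of small cost therefore do not leave the ball. -/
theorem edist_le_of_mem_chainSet [IsManifold 𝓘(ℂ, CSpace n) ω X] {k : ℕ} {y : X} {D : ℝ}
    (hy : (y, D) ∈ chainSet g A ρ η δ o k) :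
    0 ≤ D ∧ g.edist o y ≤ ENNReal.ofReal (2 * √(k * D)) := by
  induction k generalizing y D with
  | zero =>
    obtain ⟨rfl, rfl⟩ := (Prod.mk.injEq _ _ _ _).mp (mem_singleton_iff.mp hy)
    simp [HermitianMetric.edist_self]
  | succ k ih =>
    obtain ⟨a, ha, z, z', D', hz, hz', hD, hq⟩ := hy
    obtain ⟨rfl, rfl⟩ := (Prod.mk.injEq _ _ _ _).mp hq
    obtain ⟨h0, h1⟩ := ih hD
    have hzb := h.mem_closedBall ha hz
    have hzb' := h.mem_closedBall' ha hz hz'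
    have hc := h.qf_le_chartCost ha hz (z' := z')
    have hc0 := h.qf_coord_nonneg ha hz (z' - z)
    set c := qf (g.coord a z) (z' - z) with hcdef
    have h2 : g.edist ((chartAt (CSpace n) a).symm z) ((chartAt (CSpace n) a).symm z') ≤
        ENNReal.ofReal (2 * √c) := by
      refine g.edist_chart_le fun s hs => ?_
      have h3 : z + s • (z' - z) ∈ Metric.closedBall (chartAt (CSpace n) a a) (2 * ρ a) :=
        (convex_closedBall _ _).add_smul_sub_mem hzb hzb' hs
      exact ⟨h.target a ha h3, (h.estimate a ha _ h3 z hzb).compare _⟩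
    refine ⟨by linarith, (g.edist_triangle _ _ _).trans ((add_le_add h1 h2).trans ?_)⟩
    rw [← ENNReal.ofReal_add (by positivity) (by positivity)]
    refine ENNReal.ofReal_le_ofReal ?_
    rw [← mul_add]
    refine mul_le_mul_of_nonneg_left ?_ zero_le_two
    refine (add_sqrt_le hc0 h0 k).trans (Real.sqrt_le_sqrt ?_)
    push_cast
    gcongr

end ChainCharts

end Chains
end

noncomputable section

open Filter Topology

/-! ### Barriers for the cost of chains -/

section Barrier

variable {n : ℕ} {X : Type*} [TopologicalSpace X] [ChartedSpace (CSpace n) X]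

open scoped ComplexOrder

/-- The value `s = k / (k + 1)` balances the Hessian of the first `k` steps against that of the new
one; the recursion then reproduces the bound `12 / k`, as for a variation field that grows linearly
along a geodesic. -/
theorem split_sq (k : ℕ) : ((k : ℝ) / (k + 1)) ^ 2 * (12 / k) + 12 * (1 - (k : ℝ) / (k + 1)) ^ 2 =
    12 / (k + 1) := by
  have h : (k : ℝ) + 1 ≠ 0 := by positivity
  rcases eq_or_ne (k : ℝ) 0 with hk | hk
  · simp [hk]
  · field_simp
    ring

/-- The analogue for first derivatives, with the same `s`. -/
theorem split_sqrt {c D : ℝ} (hc : 0 ≤ c) (hD : 0 ≤ D) (k : ℕ) :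
    (k : ℝ) / (k + 1) * √(D / k) + (1 - (k : ℝ) / (k + 1)) * √c ≤ √((D + c) / (k + 1)) := by
  have hk : (0 : ℝ) < k + 1 := by positivity
  have h1 : (k : ℝ) * √(D / k) = √(k * D) := by
    rcases eq_or_ne (k : ℝ) 0 with h0 | h0
    · simp [h0]
    · have h2 : (0 : ℝ) ≤ k := k.cast_nonneg
      rw [← Real.sqrt_sq h2, ← Real.sqrt_mul (sq_nonneg _), Real.sqrt_sq h2]
      congr 1
      field_simp
  have h3 : √((D + c) / (k + 1)) = √((k + 1) * (D + c)) / (k + 1) := by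
    rw [eq_div_iff hk.ne']
    conv_lhs => rw [← Real.sqrt_sq hk.le]
    rw [← Real.sqrt_mul (by positivity), Real.sqrt_sq hk.le]
    congr 1
    field_simp
  have h4 : (k : ℝ) / (k + 1) * √(D / k) + (1 - (k : ℝ) / (k + 1)) * √c =
      (k * √(D / k) + √c) / (k + 1) := by field_simp; ring
  rw [h4, h1, h3]
  gcongr
  exact add_sqrt_le hc hD k

/-- Along every holomorphic map through `x` there is a smooth function that bounds the cost of a
chain from above, touches it at `x` and has controlled derivatives. -/
def HasBarrier (g : HermitianMetric n X) (S : Set (X × ℝ)) (k : ℕ) (L B : ℝ) (x : X) (D : ℝ) :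
    Prop :=
  ∀ (b : X) (σ : CSpace n → CSpace n), AnalyticAt ℂ σ 0 → σ 0 ∈ (chartAt (CSpace n) b).target →
    -- A chain without steps cannot move its end point, so for `k = 0` only constant maps are
    -- admitted.
    (chartAt (CSpace n) b).symm (σ 0) = x → (k = 0 → ∀ ζ, σ ζ = σ 0) →
    ∃ β : CSpace n → ℝ, ContDiffAt ℝ ∞ (fun ζ => (β ζ : ℂ)) 0 ∧ β 0 = D ∧
      (∀ᶠ ζ in 𝓝 0, ((chartAt (CSpace n) b).symm (σ ζ), β ζ) ∈ S) ∧
      ∀ p, (dz p (dzbar p fun ζ => (β ζ : ℂ)) 0).re ≤ (12 / k + B * D) * Real.exp (L ^ 2 * D) *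
          qf (g.coord b (σ 0)) (jac σ 0 p) ∧
        ‖dz p (fun ζ => (β ζ : ℂ)) 0‖ ≤ (4 * √(D / k) + 4 * D) * Real.exp (L ^ 2 * D / 2) *
          √(qf (g.coord b (σ 0)) (jac σ 0 p))

theorem jac_comp {τ σ : CSpace n → CSpace n} {z : CSpace n} (hτ : DifferentiableAt ℂ τ (σ z))
    (hσ : DifferentiableAt ℂ σ z) (p : Fin n) :
    jac (τ ∘ σ) z p = fderiv ℂ τ (σ z) (WithLp.toLp 2 (jac σ z p)) := by
  ext c
  rw [jac, Matrix.of_apply, fderiv_comp z hτ hσ]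
  rfl

namespace ChainCharts

variable {g : HermitianMetric n X} {K : Set X} {A : Finset X} {ρ : X → ℝ} {L η δ : ℝ}
  (h : ChainCharts g K A ρ L η δ) {o : X} [IsManifold 𝓘(ℂ, CSpace n) ω X]

include h

/-- A minimal step may be taken away from the boundary of the chart. -/
theorem exists_interior_step {k : ℕ} {x : X} {D Θ : ℝ}
    (hx : (x, D) ∈ chainSet g A ρ η δ o (k + 1))
    (hmin : ∀ D', (x, D') ∈ chainSet g A ρ η δ o (k + 1) → D ≤ D') (hD : D ≤ Θ)
    (hK : ∀ q ∈ chainSet g A ρ η δ o k, q.2 ≤ Θ → q.1 ∈ K) (hδ : 2 * (n * L * Θ) < δ ^ 2) :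
    ∃ a ∈ A, ∃ z z' : CSpace n, ∃ D' : ℝ, ‖z - chartAt (CSpace n) a a‖ < ρ a ∧ ‖z' - z‖ < δ ∧
      ((chartAt (CSpace n) a).symm z, D') ∈ chainSet g A ρ η δ o k ∧
      (chartAt (CSpace n) a).symm z' = x ∧ D = D' + chartCost g ρ η a z z' := by
  obtain ⟨a, ha, z, z', D', hz, hz', hy, hq⟩ := hx
  obtain ⟨rfl, hDD⟩ := (Prod.mk.injEq _ _ _ _).mp hq
  have hD'0 := (h.edist_le_of_mem_chainSet hy).1
  have hzb := h.mem_closedBall ha hz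
  have hc := h.qf_le_chartCost ha hz (z' := z')
  have hc0 := h.qf_coord_nonneg ha hz (z' - z)
  have hL := h.one_le
  have hnL : 0 ≤ n * L := by positivity
  have hΘ : 0 ≤ Θ := by linarith
  have hδ0 := h.δ_pos
  rcases hz.lt_or_eq with hlt | heq
  · refine ⟨a, ha, z, z', D', hlt, ?_, hy, rfl, hDD⟩
    have h1 := (h.estimate a ha z hzb z' (h.mem_closedBall' ha hz hz')).norm_sq_le
    have h2 : n * L * qf (g.coord a z) (z' - z) ≤ n * L * Θ := by gcongr; linarith
    exact lt_of_pow_lt_pow_left₀ 2 hδ0.le (by nlinarith)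
  -- If the step starts on the boundary of its ball, it is read in a chart that contains the
  -- starting point in the inner half of its ball.
  · have hyK : (chartAt (CSpace n) a).symm z ∈ K := hK _ hy (by simp only; linarith)
    obtain ⟨b, hb, hsb, hρb⟩ := h.cover _ hyK
    obtain ⟨hs', hb', hle⟩ := h.relabel a ha b hb z z' hz hsb hρb hz'
    set w := transition b a z with hw
    set w' := transition b a z' with hw'
    have hsw : (chartAt (CSpace n) b).symm w = (chartAt (CSpace n) a).symm z := symm_transition hsb
    have hsw' : (chartAt (CSpace n) b).symm w' = (chartAt (CSpace n) a).symm z' :=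
      symm_transition hs'
    have hρb0 := h.ρ_pos b hb
    have hwρ : ‖w - chartAt (CSpace n) b b‖ < ρ b := by
      refine lt_trans hρb ?_; linarith
    have hη := h.η_pos
    have hη1 := h.η_le
    have hca : chartCost g ρ η a z z' = (1 + η) * qf (g.coord a z) (z' - z) := by
      have hρ0 := h.ρ_pos a ha
      have h2 : qf 1 (z - chartAt (CSpace n) a a) = ρ a ^ 2 := by rw [← heq, ← qf_one_eq]
      rw [chartCost, stepCost, h2]
      congr 2
      field_simp
    have hcb : chartCost g ρ η b w w' ≤ (1 + η / 4) * qf (g.coord b w) (w' - w) := by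
      rw [chartCost, stepCost]
      have h2 : qf 1 (w - chartAt (CSpace n) b b) = ‖w - chartAt (CSpace n) b b‖ ^ 2 := by
        rw [← qf_one_eq]
      have h3 := h.qf_coord_nonneg hb hwρ.le (w' - w)
      have h4 : η / ρ b ^ 2 * qf 1 (w - chartAt (CSpace n) b b) ≤ η / 4 := by
        rw [h2]
        calc _ ≤ η / ρ b ^ 2 * (ρ b / 2) ^ 2 := by gcongr; exact hρb.le
          _ = η / 4 := by field_simp; ring
      exact mul_le_mul_of_nonneg_right (by linarith) h3
    -- On the boundary the weight is exactly `1 + η`; in the new chart it is at most `1 + η / 4`.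
    -- Since `(1 + η / 4)(1 + η / 8) ≤ 1 + η` for `η ≤ 1`, the relabelled step does not cost more,
    -- so by minimality the new chain has the same cost.
    have hcba : chartCost g ρ η b w w' ≤ chartCost g ρ η a z z' := by
      rw [hca]
      refine hcb.trans ((mul_le_mul_of_nonneg_left hle (by positivity)).trans ?_)
      rw [← mul_assoc]
      gcongr
      nlinarith
    have hww : ‖w' - w‖ < δ := by
      have h1 := (h.estimate b hb w (h.mem_closedBall hb hwρ.le) w' hb').norm_sq_le
      have h2 : qf (g.coord b w) (w' - w) ≤ 2 * Θ := by
        refine hle.trans ?_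
        have : qf (g.coord a z) (z' - z) ≤ Θ := by linarith
        nlinarith
      have h3 : n * L * qf (g.coord b w) (w' - w) ≤ n * L * (2 * Θ) := by gcongr
      exact lt_of_pow_lt_pow_left₀ 2 hδ0.le (by nlinarith)
    have hmem : ((chartAt (CSpace n) a).symm z', D' + chartCost g ρ η b w w') ∈
        chainSet g A ρ η δ o (k + 1) :=
      ⟨b, hb, w, w', D', hwρ.le, hww.le, by rwa [hsw], by rw [hsw']⟩
    have := hmin _ hmem
    exact ⟨b, hb, w, w', D', hwρ, hww, by rwa [hsw], hsw', by linarith⟩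

-- Induction on the number of steps. The last step of a minimal chain may be assumed to lie in the
-- interior of its constraints, so it can be varied by `exists_step`, and the rest of the chain
-- follows its starting point by the induction hypothesis. The sum of the two costs is the barrier.
-- The term `12 / k` is reproduced by `split_sq`, the curvature terms add up to a multiple of `D`,
-- and the transport errors multiply to `exp (L² D)`.
set_option maxHeartbeats 1000000 in
theorem hasBarrier {C Θ : ℝ} (hC : 0 ≤ C)
    (hRm : ∀ a ∈ A, ∀ z ∈ (chartAt (CSpace n) a).target, (chartAt (CSpace n) a).symm z ∈ K →
      (rmSqAt (g.coord a) z).re ≤ C ^ 2)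
    (hδ : 2 * (n * L * Θ) < δ ^ 2) (hsmall : 4 * L ^ 8 * Θ ≤ 1) {k : ℕ}
    (hK : ∀ j < k, ∀ q ∈ chainSet g A ρ η δ o j, q.2 ≤ Θ → q.1 ∈ K) {x : X} {D : ℝ}
    (hx : (x, D) ∈ chainSet g A ρ η δ o k)
    (hmin : ∀ D', (x, D') ∈ chainSet g A ρ η δ o k → D ≤ D') (hD : D ≤ Θ) :
    HasBarrier g (chainSet g A ρ η δ o k) k L (4 * C * n ^ 2 + 5) x D := by
  induction k generalizing x D with
  | zero =>
    intro b σ hσ hσ0 hσx hconst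
    refine ⟨fun _ => D, contDiffAt_const, rfl, Eventually.of_forall fun ζ => ?_, fun p => ?_⟩
    · rw [hconst rfl ζ, hσx]; exact hx
    · have h1 : jac σ 0 p = 0 := by
        have : σ = fun _ => σ 0 := funext (hconst rfl)
        rw [this, jac_const]
      have h2 : dzbar p (fun _ : CSpace n => (D : ℂ)) = fun _ => 0 :=
        funext fun z => dzbar_const _ z p
      rw [h1, qf_zero, h2, dz_const, dz_const]
      simp
  | succ k ih =>
    intro b₀ σ hσ hσ0 hσx _
    obtain ⟨a, ha, z, z', D', hz, hz', hy, hzx, hDD⟩ :=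
      h.exists_interior_step hx hmin hD (hK k k.lt_succ_self) hδ
    have hL := h.one_le
    have hη := h.η_pos
    have hρ := h.ρ_pos a ha
    have hD'0 := (h.edist_le_of_mem_chainSet hy).1
    have hzb := h.mem_closedBall ha hz.le
    have hzb' := h.mem_closedBall' ha hz.le hz'.le
    have hc := h.qf_le_chartCost ha hz.le (z' := z')
    have hc0 := h.qf_coord_nonneg ha hz.le (z' - z)
    set c := qf (g.coord a z) (z' - z) with hcdef
    have hE := h.estimate a ha z hzb z' hzb'
    have hE' := (h.estimate a ha z' hzb' z hzb).posDef
    have hyK : (chartAt (CSpace n) a).symm z ∈ K := hK k k.lt_succ_self _ hy (by simp only; linarith)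
    -- The first `k` steps form a minimal chain to their end point, for otherwise the whole chain
    -- could be shortened.
    have hbar := ih (fun j hj => hK j (hj.trans k.lt_succ_self)) hy (fun D'' hD'' => by
      have := hmin _ ⟨a, ha, z, z', D'', hz.le, hz'.le, hD'', by rw [hzx]⟩
      linarith) (by linarith)
    have hsrc : (chartAt (CSpace n) b₀).symm (σ 0) ∈ (chartAt (CSpace n) a).source := by
      rw [hσx, ← hzx]; exact (chartAt (CSpace n) a).map_target (h.target a ha hzb')
    have htr := analyticAt_transition hσ0 hsrc
    set σ' := transition a b₀ ∘ σ with hσ'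
    have hσ'a : AnalyticAt ℂ σ' 0 := htr.comp hσ
    have hσ'0 : σ' 0 = z' := by
      simp only [hσ', Function.comp, transition, hσx, ← hzx]
      exact (chartAt (CSpace n) a).right_inv (h.target a ha hzb')
    have hω : ∀ p, qf (g.coord b₀ (σ 0)) (jac σ 0 p) = qf (g.coord a z') (jac σ' 0 p) := fun p => by
      rw [hσ', jac_comp htr.differentiableAt hσ.differentiableAt]
      have h1 := g.sf_transition hσ0 hsrc (WithLp.toLp 2 (jac σ 0 p)) (WithLp.toLp 2 (jac σ 0 p))
      rw [qf, qf, ← hσ'0]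
      exact congrArg Complex.re h1
    have hσs : ∀ᶠ ζ in 𝓝 0, (chartAt (CSpace n) a).symm (σ' ζ) =
        (chartAt (CSpace n) b₀).symm (σ ζ) := by
      have h1 : ContinuousAt (fun ζ => (chartAt (CSpace n) b₀).symm (σ ζ)) 0 :=
        ((chartAt (CSpace n) b₀).continuousAt_symm hσ0).comp hσ.continuousAt
      filter_upwards [h1.eventually ((chartAt (CSpace n) a).open_source.mem_nhds hsrc)] with ζ hζ
      exact symm_transition hζ
    have hκ1 : η / ρ a ^ 2 * qf 1 (z - chartAt (CSpace n) a a) ≤ 1 := by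
      have h2 : qf 1 (z - chartAt (CSpace n) a a) = ‖z - chartAt (CSpace n) a a‖ ^ 2 := by
        rw [← qf_one_eq]
      rw [h2]
      calc _ ≤ η / ρ a ^ 2 * ρ a ^ 2 := by gcongr
        _ = η := by field_simp
        _ ≤ 1 := h.η_le
    have hs0 : (0 : ℝ) ≤ (k : ℝ) / (k + 1) := by positivity
    have hs1 : (k : ℝ) / (k + 1) ≤ 1 := by
      rw [div_le_one (by positivity)]; linarith
    -- The speed of the starting point is the fraction `k / (k + 1)` of that of the end point.
    obtain ⟨τ, hτ, hτ0, hτs, hcd, hτj, hlevi, hgrad⟩ := exists_step (s := (k : ℝ) / (k + 1))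
      (g.isHermitian_coord a) hE hE' hL hC (hRm a ha z (h.target a ha hzb) hyK) hσ'a hσ'0
      (by positivity) hκ1 (h.weight a ha) hs0 hs1 hcdef
      (le_trans (by have : c ≤ Θ := by linarith
                    gcongr) hsmall)
    -- For `k = 0` this fraction is zero and `τ` is constant, as the barrier of a chain without
    -- steps requires.
    obtain ⟨β, hβ, hβ0, hβS, hβp⟩ := hbar a τ hτ (by rw [hτ0]; exact h.target a ha hzb) (by rw [hτ0])
      (fun hk0 ζ => by rw [hτs (by simp [hk0]), hτ0])
    rw [hτ0] at hβp
    replace hcd : ContDiffAt ℝ ∞ (fun ζ => (chartCost g ρ η a (τ ζ) (σ' ζ) : ℂ)) 0 := hcd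
    refine ⟨fun ζ => β ζ + chartCost g ρ η a (τ ζ) (σ' ζ), ?_, ?_, ?_, fun p => ?_⟩
    · have : (fun ζ => ((β ζ + chartCost g ρ η a (τ ζ) (σ' ζ) : ℝ) : ℂ)) =
        fun ζ => (β ζ : ℂ) + (chartCost g ρ η a (τ ζ) (σ' ζ) : ℂ) := by ext; push_cast; rfl
      rw [this]
      exact hβ.add hcd
    · change β 0 + chartCost g ρ η a (τ 0) (σ' 0) = D
      rw [hβ0, hτ0, hσ'0, hDD]
    · have h1 : ∀ᶠ ζ in 𝓝 0, ‖τ ζ - chartAt (CSpace n) a a‖ < ρ a := by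
        refine (hτ.continuousAt.sub continuousAt_const).norm.eventually_lt_const ?_
        change ‖τ 0 - _‖ < _
        rw [hτ0]; exact hz
      have h2 : ∀ᶠ ζ in 𝓝 0, ‖σ' ζ - τ ζ‖ < δ := by
        refine (hσ'a.continuousAt.sub hτ.continuousAt).norm.eventually_lt_const ?_
        change ‖σ' 0 - τ 0‖ < _
        rw [hτ0, hσ'0]; exact hz'
      filter_upwards [h1, h2, hβS, hσs] with ζ e1 e2 e3 e4
      exact ⟨a, ha, τ ζ, σ' ζ, β ζ, e1.le, e2.le, e3, by rw [e4]⟩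
    · have hsum : (fun ζ => ((β ζ + chartCost g ρ η a (τ ζ) (σ' ζ) : ℝ) : ℂ)) =
        fun ζ => (β ζ : ℂ) + (chartCost g ρ η a (τ ζ) (σ' ζ) : ℂ) := by ext; push_cast; rfl
      -- The transport factors of the individual steps turn into an exponential of the total cost,
      -- which stays below `2` once `L² D ≤ log 2`.
      have hexp : 1 + L ^ 2 * c ≤ Real.exp (L ^ 2 * c) := by
        rw [add_comm]; exact Real.add_one_le_exp _
      rw [hω p, hsum]
      set Ω := qf (g.coord a z') (jac σ' 0 p) with hΩ
      have hΩ0 : 0 ≤ Ω := qf_nonneg hE' _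
      have hP : qf (g.coord a z) (jac τ 0 p) ≤
          ((k : ℝ) / (k + 1)) ^ 2 * (Real.exp (L ^ 2 * c) * Ω) := by
        refine (hτj p).trans ?_
        rw [mul_assoc]
        gcongr
      have hDc : D' + c ≤ D := by linarith
      have hB : (0 : ℝ) ≤ 4 * C * n ^ 2 + 5 := by positivity
      have hD0 : 0 ≤ D := by linarith
      have hE1 : 1 ≤ Real.exp (L ^ 2 * D) := Real.one_le_exp (by positivity)
      have hE2 : Real.exp (L ^ 2 * D') * Real.exp (L ^ 2 * c) ≤ Real.exp (L ^ 2 * D) := by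
        rw [← Real.exp_add, ← mul_add]
        gcongr
      constructor
      · rw [dz_dzbar_add hβ hcd, Complex.add_re]
        refine (add_le_add (hβp p).1 (hlevi p)).trans ?_
        set s := (k : ℝ) / (k + 1) with hs
        have h1 : (12 / k + (4 * C * n ^ 2 + 5) * D') * Real.exp (L ^ 2 * D') *
            qf (g.coord a z) (jac τ 0 p) ≤ (s ^ 2 * (12 / k) + (4 * C * n ^ 2 + 5) * D') *
              Real.exp (L ^ 2 * D) * Ω := by
          calc _ ≤ (12 / k + (4 * C * n ^ 2 + 5) * D') * Real.exp (L ^ 2 * D') *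
                (s ^ 2 * (Real.exp (L ^ 2 * c) * Ω)) := by gcongr
            _ = (s ^ 2 * (12 / k) + (4 * C * n ^ 2 + 5) * (s ^ 2 * D')) *
                (Real.exp (L ^ 2 * D') * Real.exp (L ^ 2 * c)) * Ω := by ring
            _ ≤ _ := by
                have : s ^ 2 * D' ≤ D' := mul_le_of_le_one_left hD'0 (pow_le_one₀ hs0 hs1)
                gcongr
        have h2 : (12 * (1 - s) ^ 2 + (4 * C * n ^ 2 + 5) * c) * Ω ≤
            (12 * (1 - s) ^ 2 + (4 * C * n ^ 2 + 5) * c) * Real.exp (L ^ 2 * D) * Ω := by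
          gcongr
          exact le_mul_of_one_le_right (by positivity) hE1
        refine (add_le_add h1 h2).trans ?_
        rw [← add_mul, ← add_mul]
        gcongr ?_ * _ * _
        have h3 := split_sq k
        push_cast
        nlinarith
      · rw [dz_add (hβ.differentiableAt (by simp)) (hcd.differentiableAt (by simp))]
        refine (norm_add_le _ _).trans ((add_le_add (hβp p).2 (hgrad p)).trans ?_)
        set s := (k : ℝ) / (k + 1) with hs
        have hF1 : 1 ≤ Real.exp (L ^ 2 * D / 2) := Real.one_le_exp (by positivity)
        have hF2 : Real.exp (L ^ 2 * D' / 2) * Real.exp (L ^ 2 * c / 2) ≤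
            Real.exp (L ^ 2 * D / 2) := by
          rw [← Real.exp_add, ← add_div, ← mul_add]
          gcongr
        have h0 : √(qf (g.coord a z) (jac τ 0 p)) ≤ s * (Real.exp (L ^ 2 * c / 2) * √Ω) := by
          refine (Real.sqrt_le_sqrt hP).trans_eq ?_
          rw [Real.sqrt_mul (sq_nonneg _), Real.sqrt_sq hs0, Real.sqrt_mul (Real.exp_pos _).le,
            Real.exp_half]
        have h1 : (4 * √(D' / k) + 4 * D') * Real.exp (L ^ 2 * D' / 2) *
            √(qf (g.coord a z) (jac τ 0 p)) ≤ (4 * (s * √(D' / k)) + 4 * D') *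
              Real.exp (L ^ 2 * D / 2) * √Ω := by
          calc _ ≤ (4 * √(D' / k) + 4 * D') * Real.exp (L ^ 2 * D' / 2) *
                (s * (Real.exp (L ^ 2 * c / 2) * √Ω)) := by gcongr
            _ = (4 * (s * √(D' / k)) + 4 * (s * D')) *
                (Real.exp (L ^ 2 * D' / 2) * Real.exp (L ^ 2 * c / 2)) * √Ω := by ring
            _ ≤ _ := by
                have : s * D' ≤ D' := mul_le_of_le_one_left hD'0 hs1
                gcongr
        have h2 : (4 * (1 - s) * √c + 4 * c) * √Ω ≤
            (4 * (1 - s) * √c + 4 * c) * Real.exp (L ^ 2 * D / 2) * √Ω := by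
          gcongr
          have : 0 ≤ 1 - s := by linarith
          exact le_mul_of_one_le_right (by positivity) hF1
        refine (add_le_add h1 h2).trans ?_
        rw [← add_mul, ← add_mul]
        gcongr ?_ * _ * _
        have h3 := split_sqrt hc0 hD'0 k
        have h4 : √((D' + c) / (k + 1)) ≤ √(D / ((k + 1 : ℕ) : ℝ)) := by push_cast; gcongr
        linarith

end ChainCharts

end Barrier
end

noncomputable section

open Filter Topology

/-! ### Finite families of charts around a compact set -/

section ExistsCharts

variable {n : ℕ} {X : Type*} [TopologicalSpace X] [ChartedSpace (CSpace n) X]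

open scoped ComplexOrder

theorem qf_add_le_mul {P : Matrix (Fin n) (Fin n) ℂ} (hP : P.PosDef) {t : ℝ} (ht : 0 < t)
    (u v : Fin n → ℂ) : qf P (u + v) ≤ (1 + t) * qf P u + (1 + t⁻¹) * qf P v := by
  rw [qf_add hP.1]
  have h1 := (Complex.re_le_norm _).trans (norm_sf_le_sqrt hP u v)
  have h2 := Real.sq_sqrt (qf_nonneg hP u)
  have h3 := Real.sq_sqrt (qf_nonneg hP v)
  have h4 : t * (√(qf P u)) ^ 2 + t⁻¹ * (√(qf P v)) ^ 2 - 2 * (√(qf P u) * √(qf P v)) =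
      t * (√(qf P u) - t⁻¹ * √(qf P v)) ^ 2 := by field_simp; ring
  have h5 : 0 ≤ t * (√(qf P u) - t⁻¹ * √(qf P v)) ^ 2 := by positivity
  rw [h2, h3] at h4
  linarith

variable [IsManifold 𝓘(ℂ, CSpace n) ω X] {g : HermitianMetric n X}

theorem HermitianMetric.localMetric {a : X} {z : CSpace n} (hz : z ∈ (chartAt (CSpace n) a).target)
    (hsm : ∀ i j, ContDiffAt ℝ ∞ (fun w => g.coord a w i j) z) : LocalMetric (g.coord a) z :=
  ⟨hsm, Eventually.of_forall fun w => g.isHermitian_coord a w, fun v hv => g.qf_coord_pos hz v hv⟩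

/-- Around every point there is a ball of a chart with uniform estimates. -/
theorem exists_chart_ball (hsm : ∀ a : X, ∀ z ∈ (chartAt (CSpace n) a).target, ∀ i j,
      ContDiffAt ℝ ∞ (fun w => g.coord a w i j) z) (hK : g.IsKahler) (a : X) :
    ∃ L ρ : ℝ, 1 ≤ L ∧ 0 < ρ ∧ Metric.closedBall (chartAt (CSpace n) a a) (2 * ρ) ⊆
      (chartAt (CSpace n) a).target ∧
      ∀ z ∈ Metric.closedBall (chartAt (CSpace n) a a) (2 * ρ),
      ∀ z' ∈ Metric.closedBall (chartAt (CSpace n) a a) (2 * ρ), ChartEstimate (g.coord a) L z z' := by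
  have ht : (chartAt (CSpace n) a).target ∈ 𝓝 (chartAt (CSpace n) a a) :=
    (chartAt (CSpace n) a).open_target.mem_nhds (mem_chart_target _ a)
  obtain ⟨L, hL, hE⟩ := exists_chartEstimate (G := g.coord a)
    (HermitianMetric.localMetric (mem_chart_target _ a) (hsm a _ (mem_chart_target _ a)))
    (by filter_upwards [ht] with z hz using hsm a z hz)
    (by filter_upwards [ht] with z hz using hK a z hz)
  obtain ⟨ε, hε, hball⟩ := Metric.mem_nhds_iff.mp (hE.and ((prod_mem_nhds ht ht) :
    ∀ᶠ q in 𝓝 (chartAt (CSpace n) a a, chartAt (CSpace n) a a),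
      q ∈ (chartAt (CSpace n) a).target ×ˢ (chartAt (CSpace n) a).target))
  have hsub : ∀ z ∈ Metric.closedBall (chartAt (CSpace n) a a) (2 * (ε / 4)),
      ∀ z' ∈ Metric.closedBall (chartAt (CSpace n) a a) (2 * (ε / 4)),
        (z, z') ∈ Metric.ball (chartAt (CSpace n) a a, chartAt (CSpace n) a a) ε := by
    intro z hz z' hz'
    rw [Metric.mem_closedBall] at hz hz'
    rw [Metric.mem_ball, Prod.dist_eq, max_lt_iff]
    constructor <;> simp only <;> linarith
  exact ⟨L, ε / 4, hL, by positivity, fun z hz => (hball (hsub z hz z hz)).2.1,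
    fun z hz z' hz' => (hball (hsub z hz z' hz')).1⟩

/-- Close to the diagonal, the step costs in two charts almost coincide. -/
theorem eventually_relabel [T2Space X] {a b : X} {ρa ρb L : ℝ} (hL : 1 ≤ L) (hρb : 0 < ρb)
    (hta : Metric.closedBall (chartAt (CSpace n) a a) (2 * ρa) ⊆ (chartAt (CSpace n) a).target)
    (htb : Metric.closedBall (chartAt (CSpace n) b b) (2 * ρb) ⊆ (chartAt (CSpace n) b).target)
    (hρa : 0 < ρa)
    (hEa : ∀ z ∈ Metric.closedBall (chartAt (CSpace n) a a) (2 * ρa),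
      ∀ z' ∈ Metric.closedBall (chartAt (CSpace n) a a) (2 * ρa), ChartEstimate (g.coord a) L z z')
    (hEb : ∀ z ∈ Metric.closedBall (chartAt (CSpace n) b b) (2 * ρb),
      ∀ z' ∈ Metric.closedBall (chartAt (CSpace n) b b) (2 * ρb), ChartEstimate (g.coord b) L z z')
    {η : ℝ} (hη : 0 < η) :
    ∀ᶠ v in 𝓝 (0 : CSpace n), ∀ z, ‖z - chartAt (CSpace n) a a‖ ≤ ρa →
      (chartAt (CSpace n) a).symm z ∈ (chartAt (CSpace n) b).source →
      ‖transition b a z - chartAt (CSpace n) b b‖ < ρb / 2 →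
      (chartAt (CSpace n) a).symm (z + v) ∈ (chartAt (CSpace n) b).source ∧
      transition b a (z + v) ∈ Metric.closedBall (chartAt (CSpace n) b b) (2 * ρb) ∧
      qf (g.coord b (transition b a z)) (transition b a (z + v) - transition b a z) ≤
        (1 + η / 8) * qf (g.coord a z) v := by
  -- A compact set that contains all starting points `z` to be considered; the claim is local around
  -- each of its points.
  set Q : Set (CSpace n) := Metric.closedBall (chartAt (CSpace n) a a) ρa ∩
    (chartAt (CSpace n) a).symm ⁻¹' ((chartAt (CSpace n) b).symm ''
      Metric.closedBall (chartAt (CSpace n) b b) (ρb / 2)) with hQ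
  have hsub : Metric.closedBall (chartAt (CSpace n) a a) ρa ⊆
      Metric.closedBall (chartAt (CSpace n) a a) (2 * ρa) :=
    Metric.closedBall_subset_closedBall (by linarith)
  have hsubb : Metric.closedBall (chartAt (CSpace n) b b) (ρb / 2) ⊆
      Metric.closedBall (chartAt (CSpace n) b b) (2 * ρb) :=
    Metric.closedBall_subset_closedBall (by linarith)
  have hQc : IsCompact Q := by
    have h1 : IsCompact ((chartAt (CSpace n) b).symm ''
        Metric.closedBall (chartAt (CSpace n) b b) (ρb / 2)) :=
      (isCompact_closedBall _ _).image_of_continuousOn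
        ((chartAt (CSpace n) b).continuousOn_symm.mono (hsubb.trans htb))
    have h2 : IsClosed Q := ((chartAt (CSpace n) a).continuousOn_symm.mono
      (hsub.trans hta)).preimage_isClosed_of_isClosed Metric.isClosed_closedBall h1.isClosed
    exact (isCompact_closedBall (chartAt (CSpace n) a a) ρa).of_isClosed_subset h2 inter_subset_left
  have key : ∀ᶠ v in 𝓝 (0 : CSpace n), ∀ z ∈ Q,
      (chartAt (CSpace n) a).symm (z + v) ∈ (chartAt (CSpace n) b).source ∧
      transition b a (z + v) ∈ Metric.closedBall (chartAt (CSpace n) b b) (2 * ρb) ∧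
      -- The compactness argument asks for a statement about all `z` near a point of `Q`, but the
      -- comparison of the squared lengths is established at points of `Q` only.
      (z ∈ Q → qf (g.coord b (transition b a z)) (transition b a (z + v) - transition b a z) ≤
        (1 + η / 8) * qf (g.coord a z) v) := by
    refine hQc.eventually_forall_of_forall_eventually fun z₀ hz₀ => ?_
    have hz₀t : z₀ ∈ (chartAt (CSpace n) a).target := hta (hsub hz₀.1)
    have hsrc : ∀ z ∈ Q, (chartAt (CSpace n) a).symm z ∈ (chartAt (CSpace n) b).source ∧
        transition b a z ∈ Metric.closedBall (chartAt (CSpace n) b b) (ρb / 2) := by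
      rintro z ⟨-, w, hw, hwz⟩
      have hwt := htb (hsubb hw)
      refine ⟨?_, ?_⟩
      · rw [← hwz]; exact (chartAt (CSpace n) b).map_target hwt
      · rw [transition, ← hwz, (chartAt (CSpace n) b).right_inv hwt]; exact hw
    have han := analyticAt_transition hz₀t (hsrc z₀ hz₀).1
    have hadd : Tendsto (fun q : CSpace n × CSpace n => q.2 + q.1) (𝓝 (0, z₀)) (𝓝 z₀) := by
      have : Continuous fun q : CSpace n × CSpace n => q.2 + q.1 := by fun_prop
      simpa using this.tendsto (0, z₀)
    have hsnd : Tendsto (fun q : CSpace n × CSpace n => q.2) (𝓝 (0, z₀)) (𝓝 z₀) :=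
      continuous_snd.tendsto (0, z₀)
    have h1 : ∀ᶠ q : CSpace n × CSpace n in 𝓝 (0, z₀),
        (chartAt (CSpace n) a).symm (q.2 + q.1) ∈ (chartAt (CSpace n) b).source :=
      hadd.eventually (((chartAt (CSpace n) a).continuousAt_symm hz₀t).eventually
        ((chartAt (CSpace n) b).open_source.mem_nhds (hsrc z₀ hz₀).1))
    have h2 : ∀ᶠ q : CSpace n × CSpace n in 𝓝 (0, z₀),
        transition b a (q.2 + q.1) ∈ Metric.closedBall (chartAt (CSpace n) b b) (2 * ρb) := by
      refine hadd.eventually (han.continuousAt.eventually ?_)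
      refine mem_of_superset (Metric.ball_mem_nhds _ hρb) fun w hw => ?_
      have h3 := Metric.mem_closedBall.mp (hsrc z₀ hz₀).2
      have h4 := Metric.mem_ball.mp hw
      change dist w (chartAt (CSpace n) b b) ≤ 2 * ρb
      linarith [dist_triangle w (transition b a z₀) (chartAt (CSpace n) b b)]
    obtain ⟨M, hM0, hM⟩ := exists_taylor ((han.contDiffAt (n := ∞)).restrict_scalars ℝ)
    have h3 := (hsnd.prodMk_nhds hadd).eventually hM
    -- The derivative of the transition map preserves the form. Its second-order remainder is
    -- absorbed in `η / 16`, and separating it by `qf_add_le_mul` with `t = η / 16` costs the other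
    -- half of `η / 8`.
    have h4 : ∀ᶠ q : CSpace n × CSpace n in 𝓝 (0, z₀),
        (1 + (η / 16)⁻¹) * (L * (M ^ 2 * (n * L))) * ‖q.1‖ ^ 2 < η / 16 := by
      have : Continuous fun q : CSpace n × CSpace n =>
        (1 + (η / 16)⁻¹) * (L * (M ^ 2 * (n * L))) * ‖q.1‖ ^ 2 := by fun_prop
      refine this.continuousAt.eventually_lt_const ?_
      simpa using hη
    filter_upwards [h1, h2, h3, h4] with ⟨v, z⟩ e1 e2 e3 e4
    refine ⟨e1, e2, fun hz => ?_⟩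
    obtain ⟨hs, hb⟩ := hsrc z hz
    have hzt : z ∈ (chartAt (CSpace n) a).target := hta (hsub hz.1)
    have hanz := analyticAt_transition hzt hs
    have hEz := hEa z (hsub hz.1) z (hsub hz.1)
    have hEw := hEb _ (hsubb hb) _ (hsubb hb)
    simp only at e3 e4
    have e5 : fderiv ℝ (transition b a) z (z + v - z) = fderiv ℂ (transition b a) z v := by
      rw [add_sub_cancel_left, hanz.differentiableAt.fderiv_restrictScalars ℝ]
      rfl
    rw [e5, add_sub_cancel_left] at e3
    set T := fderiv ℂ (transition b a) z v with hT
    set r := transition b a (z + v) - transition b a z - T with hr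
    have e6 : transition b a (z + v) - transition b a z = T + r := by rw [hr]; abel
    have e7 : qf (g.coord b (transition b a z)) T = qf (g.coord a z) v :=
      (congrArg Complex.re (g.sf_transition hzt hs v v)).symm
    have e8 : ((transition b a (z + v) : Fin n → ℂ) - transition b a z) =
        (T : Fin n → ℂ) + (r : Fin n → ℂ) := congrArg (fun w : CSpace n => (w : Fin n → ℂ)) e6
    have hv0 : 0 ≤ qf (g.coord a z) v := qf_nonneg hEz.posDef _
    have hvn : ‖v‖ ^ 2 ≤ n * L * qf (g.coord a z) v := by
      rw [mul_assoc]
      exact (norm_sq_le_ofLp v).trans (by gcongr; exact hEz.norm_le _)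
    have e9 : qf (g.coord b (transition b a z)) r ≤ L * (M * ‖v‖ ^ 2) ^ 2 :=
      (hEw.le _).trans (by gcongr; exact (norm_ofLp_le r).trans e3)
    rw [e8]
    refine (qf_add_le_mul hEw.posDef (t := η / 16) (by positivity) _ _).trans ?_
    rw [e7]
    have e10 : (1 + (η / 16)⁻¹) * qf (g.coord b (transition b a z)) r ≤
        η / 16 * qf (g.coord a z) v := by
      calc _ ≤ (1 + (η / 16)⁻¹) * (L * (M * ‖v‖ ^ 2) ^ 2) := by gcongr
        _ = (1 + (η / 16)⁻¹) * (L * M ^ 2) * ‖v‖ ^ 2 * ‖v‖ ^ 2 := by ring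
        _ ≤ (1 + (η / 16)⁻¹) * (L * M ^ 2) * ‖v‖ ^ 2 * (n * L * qf (g.coord a z) v) := by gcongr
        _ = (1 + (η / 16)⁻¹) * (L * (M ^ 2 * (n * L))) * ‖v‖ ^ 2 * qf (g.coord a z) v := by ring
        _ ≤ _ := by gcongr
    linarith
  filter_upwards [key] with v hv z hz hs hb
  have hzQ : z ∈ Q := ⟨mem_closedBall_iff_norm.mpr hz, transition b a z,
    mem_closedBall_iff_norm.mpr hb.le, symm_transition hs⟩
  exact ⟨(hv z hzQ).1, (hv z hzQ).2.1, (hv z hzQ).2.2 hzQ⟩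

/-- The constants are chosen successively: a finite subcover, a common `L`, then `η` in terms of `L`
and the radii, then `δ` in terms of all of them. -/
theorem exists_chainCharts [T2Space X] {K : Set X} (hK : IsCompact K)
    (hsm : ∀ a : X, ∀ z ∈ (chartAt (CSpace n) a).target, ∀ i j,
      ContDiffAt ℝ ∞ (fun w => g.coord a w i j) z) (hg : g.IsKahler) :
    ∃ A ρ L η δ, ChainCharts g K A ρ L η δ := by
  choose L ρ hL hρ ht hE using exists_chart_ball hsm hg
  have hU : ∀ y ∈ K, {x | x ∈ (chartAt (CSpace n) y).source ∧
      ‖chartAt (CSpace n) y x - chartAt (CSpace n) y y‖ < ρ y / 2} ∈ 𝓝 y := fun y _ => by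
    have h1 : ContinuousAt (chartAt (CSpace n) y) y :=
      (chartAt (CSpace n) y).continuousAt (mem_chart_source _ y)
    filter_upwards [(chartAt (CSpace n) y).open_source.mem_nhds (mem_chart_source _ y),
      h1.eventually (Metric.ball_mem_nhds _ (half_pos (hρ y)))] with x hx hx'
    exact ⟨hx, mem_ball_iff_norm.mp hx'⟩
  obtain ⟨A, -, hA⟩ := hK.elim_nhds_subcover _ hU
  obtain ⟨L', hL', hLL'⟩ : ∃ L' : ℝ, 1 ≤ L' ∧ ∀ a ∈ A, L a ≤ L' := by
    refine ⟨1 + ∑ a ∈ A, |L a|, le_add_of_nonneg_right (by positivity), fun a ha => ?_⟩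
    have := Finset.single_le_sum (f := fun a => |L a|) (fun _ _ => abs_nonneg _) ha
    linarith [le_abs_self (L a)]
  have hE' : ∀ a ∈ A, ∀ z ∈ Metric.closedBall (chartAt (CSpace n) a a) (2 * ρ a),
      ∀ z' ∈ Metric.closedBall (chartAt (CSpace n) a a) (2 * ρ a),
        ChartEstimate (g.coord a) L' z z' := fun a ha z hz z' hz' =>
    (hE a z hz z' hz').mono (hLL' a ha)
  obtain ⟨η, ⟨hη1, hη2⟩, hη0⟩ : ∃ η : ℝ, (η ≤ 1 ∧ ∀ a ∈ A, 2 * n * L' * (η / ρ a ^ 2) ≤ 1) ∧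
      0 < η := by
    have h1 : ∀ᶠ η in 𝓝[>] (0 : ℝ), ∀ a ∈ A, 2 * n * L' * (η / ρ a ^ 2) ≤ 1 := by
      rw [eventually_all_finset]
      intro a _
      have h2 : Continuous fun η : ℝ => 2 * n * L' * (η / ρ a ^ 2) := by fun_prop
      exact ((h2.continuousAt (x := 0)).eventually_lt_const (by simp)).filter_mono
        nhdsWithin_le_nhds |>.mono fun _ h => le_of_lt h
    have h2 : ∀ᶠ η in 𝓝[>] (0 : ℝ), η ≤ 1 := nhdsWithin_le_nhds (Iic_mem_nhds zero_lt_one)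
    exact ((h2.and h1).and self_mem_nhdsWithin).exists
  obtain ⟨δ, ⟨hδ1, hδ2⟩, hδ0⟩ : ∃ δ : ℝ, ((∀ a ∈ A, δ ≤ ρ a) ∧ ∀ a ∈ A, ∀ b ∈ A,
      ∀ v : CSpace n, ‖v‖ ≤ δ → ∀ z, ‖z - chartAt (CSpace n) a a‖ ≤ ρ a →
      (chartAt (CSpace n) a).symm z ∈ (chartAt (CSpace n) b).source →
      ‖transition b a z - chartAt (CSpace n) b b‖ < ρ b / 2 →
      (chartAt (CSpace n) a).symm (z + v) ∈ (chartAt (CSpace n) b).source ∧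
      transition b a (z + v) ∈ Metric.closedBall (chartAt (CSpace n) b b) (2 * ρ b) ∧
      qf (g.coord b (transition b a z)) (transition b a (z + v) - transition b a z) ≤
        (1 + η / 8) * qf (g.coord a z) v) ∧ 0 < δ := by
    have h1 : ∀ᶠ δ in 𝓝[>] (0 : ℝ), ∀ a ∈ A, δ ≤ ρ a := by
      rw [eventually_all_finset]
      exact fun a _ => nhdsWithin_le_nhds (Iic_mem_nhds (hρ a))
    refine ((h1.and ?_).and self_mem_nhdsWithin).exists
    rw [eventually_all_finset]
    intro a ha
    rw [eventually_all_finset]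
    intro b hb
    obtain ⟨ε, hε, h2⟩ := Metric.eventually_nhds_iff.mp
      (eventually_relabel hL' (hρ b) (ht a) (ht b) (hρ a) (hE' a ha) (hE' b hb) hη0)
    filter_upwards [nhdsWithin_le_nhds (Iio_mem_nhds hε)] with δ hδ v hv
    exact h2 (by rw [dist_zero_right]; exact hv.trans_lt hδ)
  refine ⟨A, ρ, L', η, δ, hL', hη0, hη1, hδ0, fun a _ => hρ a, hδ1, fun a _ => ht a, hE', hη2,
    fun y hy => ?_, fun a ha b hb z z' hz hs hb' hv => ?_⟩
  · obtain ⟨a, ha, hya⟩ := mem_iUnion₂.mp (hA hy)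
    exact ⟨a, ha, hya⟩
  · have := hδ2 a ha b hb (z' - z) hv z hz hs hb'
    rw [add_sub_cancel] at this
    exact this

end ExistsCharts
end

noncomputable section

open Filter Topology

/-! ### The second derivative test -/

section SecondDerivative

variable {n : ℕ}

/-- If the second derivative were positive, the point would be a local minimum as well, so the
function would be locally constant and the second derivative zero. -/
theorem deriv_deriv_nonpos_of_isLocalMax {f : ℝ → ℝ} {a : ℝ} (hf : ContinuousAt f a)
    (h : IsLocalMax f a) : deriv (deriv f) a ≤ 0 := by
  by_contra! hpos
  have h1 := isLocalMin_of_deriv_deriv_pos hpos h.deriv_eq_zero hf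
  have h2 : f =ᶠ[𝓝 a] fun _ => f a := by
    filter_upwards [h, h1] with x hx hx'
    exact le_antisymm hx hx'
  have h3 : deriv f =ᶠ[𝓝 a] fun _ => 0 := by
    filter_upwards [h2.eventually_nhds] with x hx
    rw [EventuallyEq.deriv_eq hx, deriv_const]
  rw [h3.deriv_eq, deriv_const] at hpos
  exact lt_irrefl _ hpos

theorem fderiv_fderiv_nonpos_of_isLocalMax {f : CSpace n → ℝ} {z : CSpace n}
    (hf : ContDiffAt ℝ ∞ f z) (h : IsLocalMax f z) (v : CSpace n) :
    fderiv ℝ (fun y => fderiv ℝ f y v) z v ≤ 0 := by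
  have hl : ∀ s : ℝ, HasDerivAt (fun s : ℝ => z + s • v) v s := fun s => by
    simpa using ((hasDerivAt_id s).smul_const v).const_add z
  have hcont : Tendsto (fun s : ℝ => z + s • v) (𝓝 0) (𝓝 z) := by
    have : Continuous fun s : ℝ => z + s • v := by fun_prop
    simpa using this.tendsto 0
  have h0 : z + (0 : ℝ) • v = z := by simp
  have hd : ∀ᶠ y in 𝓝 z, DifferentiableAt ℝ f y :=
    ((hf.of_le (m := 1) (by norm_cast)).eventually (by simp)).mono fun y hy =>
      hy.differentiableAt one_ne_zero
  have h1 : deriv (fun s : ℝ => f (z + s • v)) =ᶠ[𝓝 0] fun s => fderiv ℝ f (z + s • v) v := by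
    filter_upwards [hcont.eventually hd] with s hs
    exact (hs.hasFDerivAt.comp_hasDerivAt s (hl s)).deriv
  have h2 : DifferentiableAt ℝ (fun y => fderiv ℝ f y v) z :=
    ((hf.fderiv_right (m := 1) (by norm_cast)).differentiableAt one_ne_zero).clm_apply
      (differentiableAt_const v)
  have h3 : deriv (fun s : ℝ => fderiv ℝ f (z + s • v) v) 0 =
      fderiv ℝ (fun y => fderiv ℝ f y v) z v := by
    have h4 : HasFDerivAt (fun y => fderiv ℝ f y v) (fderiv ℝ (fun y => fderiv ℝ f y v) z)
        (z + (0 : ℝ) • v) := by rw [h0]; exact h2.hasFDerivAt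
    exact (h4.comp_hasDerivAt 0 (hl 0)).deriv
  rw [← h3, ← h1.deriv_eq]
  refine deriv_deriv_nonpos_of_isLocalMax ?_ ?_
  · exact ContinuousAt.comp (g := f) (by rw [h0]; exact hf.continuousAt) (hl 0).continuousAt
  · have h5 := hcont.eventually h
    filter_upwards [h5] with s hs
    rwa [h0]

theorem fderiv_ofReal {f : CSpace n → ℝ} {z : CSpace n} (hf : DifferentiableAt ℝ f z) (v : CSpace n) :
    fderiv ℝ (fun y => (f y : ℂ)) z v = (fderiv ℝ f z v : ℂ) := by
  have h := (Complex.ofRealCLM.hasFDerivAt (x := f z)).comp z hf.hasFDerivAt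
  exact DFunLike.congr_fun h.fderiv v

theorem contDiffAt_of_ofReal {f : CSpace n → ℝ} {z : CSpace n}
    (hf : ContDiffAt ℝ ∞ (fun y => (f y : ℂ)) z) : ContDiffAt ℝ ∞ f z :=
  Complex.reCLM.contDiff.contDiffAt.comp z hf

/-- The complex second derivative test. -/
theorem dz_dzbar_nonpos_of_isLocalMax {f : CSpace n → ℝ} {z : CSpace n}
    (hf : ContDiffAt ℝ ∞ (fun y => (f y : ℂ)) z) (h : IsLocalMax f z) (p : Fin n) :
    dz p (fun y => (f y : ℂ)) z = 0 ∧ (dz p (dzbar p fun y => (f y : ℂ)) z).re ≤ 0 := by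
  have hr := contDiffAt_of_ofReal hf
  constructor
  · rw [dz, fderiv_ofReal (hr.differentiableAt (by simp)), fderiv_ofReal (hr.differentiableAt (by simp)),
      h.fderiv_eq_zero]
    simp
  set e : CSpace n := EuclideanSpace.single p 1 with he
  set e' : CSpace n := EuclideanSpace.single p Complex.I with he'
  have hd : ∀ᶠ y in 𝓝 z, DifferentiableAt ℝ f y :=
    ((hr.of_le (m := 1) (by norm_cast)).eventually (by simp)).mono fun y hy =>
      hy.differentiableAt one_ne_zero
  have h1 : dzbar p (fun y => (f y : ℂ)) =ᶠ[𝓝 z]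
      fun y => ((fderiv ℝ f y e : ℂ) + Complex.I * (fderiv ℝ f y e' : ℂ)) / 2 := by
    filter_upwards [hd] with y hy
    rw [dzbar, fderiv_ofReal hy, fderiv_ofReal hy]
  have h2 : ∀ v : CSpace n, DifferentiableAt ℝ (fun y => fderiv ℝ f y v) z := fun v =>
    ((hr.fderiv_right (m := 1) (by norm_cast)).differentiableAt one_ne_zero).clm_apply
      (differentiableAt_const v)
  have h3 : ∀ v : CSpace n, HasFDerivAt (fun y => (fderiv ℝ f y v : ℂ))
      (Complex.ofRealCLM.comp (fderiv ℝ (fun y => fderiv ℝ f y v) z)) z := fun v =>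
    Complex.ofRealCLM.hasFDerivAt.comp z (h2 v).hasFDerivAt
  have h4 : HasFDerivAt (fun y => ((fderiv ℝ f y e : ℂ) + Complex.I * (fderiv ℝ f y e' : ℂ)) / 2) _ z :=
    ((h3 e).add ((h3 e').const_mul Complex.I)).mul_const (2⁻¹ : ℂ)
  have h5 := fderiv_fderiv_nonpos_of_isLocalMax hr h e
  have h6 := fderiv_fderiv_nonpos_of_isLocalMax hr h e'
  rw [dz, h1.fderiv_eq, h4.fderiv]
  simp
  linarith

/-- The consequence of the second derivative test for a product with a squared cutoff. -/
theorem dz_dzbar_le_of_isLocalMax {F β : CSpace n → ℝ} {θ : ℝ}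
    (hF : ContDiffAt ℝ ∞ (fun y => (F y : ℂ)) 0) (hβ : ContDiffAt ℝ ∞ (fun y => (β y : ℂ)) 0)
    (h : IsLocalMax (fun y => (θ - β y) ^ 2 * F y) 0) (hθ : 0 < θ - β 0) (p : Fin n) :
    (dz p (dzbar p fun y => (F y : ℂ)) 0).re ≤ F 0 * (6 * ‖dz p (fun y => (β y : ℂ)) 0‖ ^ 2 /
      (θ - β 0) ^ 2 + 2 * (dz p (dzbar p fun y => (β y : ℂ)) 0).re / (θ - β 0)) := by
  set f : CSpace n → ℂ := fun y => (F y : ℂ) with hf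
  set b : CSpace n → ℂ := fun y => (β y : ℂ) with hb
  set E : CSpace n → ℂ := fun y => (θ : ℂ) + (-1) * b y with hE
  have hEs : ContDiffAt ℝ ∞ E 0 := contDiffAt_const.add (contDiffAt_const.mul hβ)
  have hprod : (fun y => (((θ - β y) ^ 2 * F y : ℝ) : ℂ)) = fun y => (E y * E y) * f y := by
    ext y; simp only [hE, hb, hf]; push_cast; ring
  have hEE : ContDiffAt ℝ ∞ (fun y => E y * E y) 0 := hEs.mul hEs
  obtain ⟨h1, h2⟩ := dz_dzbar_nonpos_of_isLocalMax (f := fun y => (θ - β y) ^ 2 * F y)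
    (by rw [hprod]; exact hEE.mul hF) h p
  rw [hprod] at h1 h2
  set ε : ℝ := θ - β 0 with hε
  set q : ℝ := F 0 with hq
  have hE0 : E 0 = (ε : ℂ) := by simp only [hE, hb, hε]; push_cast; ring
  have hf0 : f 0 = (q : ℂ) := rfl
  have hc0 : ∀ c : ℂ, dzbar p (fun _ : CSpace n => c) = fun _ => 0 := fun c =>
    funext fun z => dzbar_const c z p
  have hbs : ContDiffAt ℝ ∞ (fun y => (-1 : ℂ) * b y) 0 := contDiffAt_const.mul hβ
  have hdE : dz p E 0 = -dz p b 0 := by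
    rw [hE, dz_add (differentiableAt_const _) (hbs.differentiableAt (by simp)), dz_const,
      dz_mul contDiffAt_const hβ, dz_const]
    ring
  have hdbE : dzbar p E 0 = conj (dz p E 0) := by
    refine dzbar_eq_conj_dz (Eventually.of_forall fun y => ?_) p
    simp [hE, hb]
  have hdbf : dzbar p f 0 = conj (dz p f 0) := dzbar_ofReal p
  have hddE : dz p (dzbar p E) 0 = -dz p (dzbar p b) 0 := by
    rw [hE, dz_dzbar_add contDiffAt_const hbs, hc0, dz_const, dz_dzbar_mul contDiffAt_const hβ, hc0,
      dz_const, dz_const]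
    ring
  have hdEE : dz p (fun y => E y * E y) 0 = -(2 * ε) * dz p b 0 := by
    rw [dz_mul hEs hEs, hE0, hdE]; ring
  have hdbEE : dzbar p (fun y => E y * E y) 0 = -(2 * ε) * conj (dz p b 0) := by
    have h3 : dzbar p (fun y => E y * E y) 0 = conj (dz p (fun y => E y * E y) 0) := by
      refine dzbar_eq_conj_dz (Eventually.of_forall fun y => ?_) p
      simp [hE, hb]
    rw [h3, hdEE]
    simp [Complex.conj_ofNat]
  have hddEE : dz p (dzbar p fun y => E y * E y) 0 =
      2 * (dz p b 0 * conj (dz p b 0)) - 2 * ε * dz p (dzbar p b) 0 := by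
    rw [dz_dzbar_mul hEs hEs, hE0, hddE, hdbE, hdE, map_neg]; ring
  rw [dz_mul hEE hF, hE0, hdEE, hf0] at h1
  have hεc : (ε : ℂ) ≠ 0 := by exact_mod_cast hθ.ne'
  -- The first-order condition at the maximum expresses the gradient of `F` by that of the barrier.
  have hdf : dz p f 0 = (2 * q / ε : ℝ) * dz p b 0 := by
    push_cast
    field_simp
    have h3 : (ε : ℂ) * (ε * dz p f 0 - 2 * q * dz p b 0) = 0 := by linear_combination h1
    have h4 := (mul_eq_zero.mp h3).resolve_left hεc
    linear_combination h4
  rw [dz_dzbar_mul hEE hF, hddEE, hdEE, hdbEE, hdbf, hdf, hE0, hf0] at h2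
  have hn : dz p b 0 * conj (dz p b 0) = ((‖dz p b 0‖ ^ 2 : ℝ) : ℂ) := by
    rw [Complex.mul_conj, Complex.normSq_eq_norm_sq]
  -- With the first-order condition inserted, the two mixed terms contribute `-4` each and the
  -- Hessian of the squared cutoff `+2`, which makes the coefficient `6` of the squared gradient.
  have e1 : (ε : ℂ) * ε * dz p (dzbar p f) 0 +
      -(2 * ε) * dz p b 0 * conj ((2 * q / ε : ℝ) * dz p b 0) +
      (2 * q / ε : ℝ) * dz p b 0 * (-(2 * ε) * conj (dz p b 0)) +
      q * (2 * (dz p b 0 * conj (dz p b 0)) - 2 * ε * dz p (dzbar p b) 0) =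
      ((ε ^ 2 : ℝ) : ℂ) * dz p (dzbar p f) 0 - ((6 * q * ‖dz p b 0‖ ^ 2 : ℝ) : ℂ) -
        ((2 * q * ε : ℝ) : ℂ) * dz p (dzbar p b) 0 := by
    have e2 : conj ((2 * q / ε : ℝ) * dz p b 0) = (2 * q / ε : ℝ) * conj (dz p b 0) := by
      rw [map_mul, Complex.conj_ofReal]
    rw [e2]
    have e3 : (((2 * q / ε : ℝ)) : ℂ) * ε = 2 * q := by push_cast; field_simp
    have e4 : ((6 * q * ‖dz p b 0‖ ^ 2 : ℝ) : ℂ) = 6 * q * (dz p b 0 * conj (dz p b 0)) := by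
      rw [hn]; push_cast; ring
    rw [e4]
    push_cast at e3 ⊢
    linear_combination (-4 * (dz p b 0 * conj (dz p b 0))) * e3
  rw [e1, Complex.sub_re, Complex.sub_re, Complex.re_ofReal_mul, Complex.re_ofReal_mul,
    Complex.ofReal_re] at h2
  have e5 : q * (6 * ‖dz p b 0‖ ^ 2 / ε ^ 2 + 2 * (dz p (dzbar p b) 0).re / ε) =
      (6 * q * ‖dz p b 0‖ ^ 2 + 2 * q * ε * (dz p (dzbar p b) 0).re) / ε ^ 2 := by
    field_simp
  rw [e5, le_div_iff₀ (by positivity)]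
  linarith

end SecondDerivative
end

noncomputable section

open Filter Topology

/-! ### A local maximum principle -/

section MaximumPrinciple

variable {n : ℕ} {X : Type*} [TopologicalSpace X] [ChartedSpace (CSpace n) X]

theorem ChainCharts.mono {g : HermitianMetric n X} {K K' : Set X} {A : Finset X} {ρ : X → ℝ}
    {L η δ : ℝ} (h : ChainCharts g K A ρ L η δ) (hK : K' ⊆ K) : ChainCharts g K' A ρ L η δ :=
  { h with cover := fun y hy => h.cover y (hK hy) }

theorem le_of_quadratic_le {a b c m : ℝ} (ha : 0 ≤ a) (hb : 0 ≤ b) (hc : 0 < c)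
    (h : c * m ^ 2 ≤ a + b * m) : m ≤ (a + b) / c + 1 := by
  have h0 : 0 ≤ (a + b) / c := by positivity
  rcases le_total m 1 with hm | hm
  · linarith
  · have : m ≤ (a + b) / c := by
      rw [le_div_iff₀ hc]
      by_contra! h1
      nlinarith
    linarith

/-- Only earlier times are compared, so the slopes from the left decide; no information beyond time
`t` is needed. -/
theorem nonneg_of_hasDerivAt_of_le {f : ℝ → ℝ} {d t : ℝ} (ht : 0 < t) (hf : HasDerivAt f d t)
    (h : ∀ s ∈ Icc 0 t, f s ≤ f t) : 0 ≤ d := by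
  by_contra! hd
  have h1 := (hasDerivWithinAt_iff_tendsto_slope' (s := Iio t) (by simp)).mp hf.hasDerivWithinAt
  have h2 : ∀ᶠ s in 𝓝[<] t, slope f t s < 0 := h1.eventually (gt_mem_nhds hd)
  have h3 : ∀ᶠ s in 𝓝[<] t, s ∈ Ioo 0 t := Ioo_mem_nhdsLT ht
  obtain ⟨s, hs, hs'⟩ := (h2.and h3).exists
  rw [slope_def_field, div_neg_iff] at hs
  rcases hs with hs | hs
  · linarith [h s ⟨hs'.1.le, hs'.2.le⟩]
  · linarith [hs'.2]

/-- The function `Q` satisfies `∂Q/∂t ≤ ΔQ - c Q² + D` at `(t, x)` for a Laplace operator that is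
bounded by `C` times that of `g`. -/
def HeatBoundAt (g : HermitianMetric n X) (T : ℝ) (Q : ℝ → X → ℝ) (C c D t : ℝ) (x : X) : Prop :=
  ∃ (b : X) (σ : CSpace n → CSpace n) (F : ℝ → CSpace n → ℂ), AnalyticAt ℂ σ 0 ∧
    σ 0 ∈ (chartAt (CSpace n) b).target ∧ (chartAt (CSpace n) b).symm (σ 0) = x ∧
    (∀ p, qf (g.coord b (σ 0)) (jac σ 0 p) ≤ C) ∧
    (∀ s ∈ Icc 0 T, ∀ᶠ ζ in 𝓝 0, F s ζ = (Q s ((chartAt (CSpace n) b).symm (σ ζ)) : ℂ)) ∧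
    HeatBound F t c D

/-- A differential inequality at an interior maximum of `(θ - D)² Q` over chains of `N` steps. -/
theorem HasBarrier.le_of_isMaxOn {g : HermitianMetric n X} {S : Set (X × ℝ)} {N : ℕ} (hN : N ≠ 0)
    {L B C c D₀ T t D θ : ℝ} {x : X} {Q : ℝ → X → ℝ} (hS : HasBarrier g S N L B x D)
    (hB : 0 ≤ B) (hC : 0 ≤ C) (hQ : HeatBoundAt g T Q C c D₀ t x) (ht : t ∈ Ioo 0 T) (hD : 0 ≤ D)
    (hDθ : D < θ / N) (hL : L ^ 2 * D ≤ Real.log 2) (hpos : 0 < Q t x)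
    (htime : ∀ s ∈ Icc 0 t, Q s x ≤ Q t x)
    (hmax : ∀ q ∈ S, q.2 ≤ θ / N → (θ / N - q.2) ^ 2 * Q t q.1 ≤ (θ / N - D) ^ 2 * Q t x) :
    c * ((θ - N * D) ^ 2 * Q t x) ^ 2 ≤ |D₀| * θ ^ 4 +
      n * (384 * (√θ + θ) ^ 2 * C + 4 * (12 + B * θ) * C * θ) * ((θ - N * D) ^ 2 * Q t x) := by
  obtain ⟨b, σ, F, hσ, hσ0, hσx, hqf, hF, d, hd, hFs, hle⟩ := hQ
  obtain ⟨β, hβ, hβ0, hβS, hβp⟩ := hS b σ hσ hσ0 hσx fun h => absurd h hN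
  have hN0 : (0 : ℝ) < N := by positivity
  have htT : t ∈ Icc 0 T := ⟨ht.1.le, ht.2.le⟩
  have hθ0 : 0 < θ := by
    have := hD.trans_lt hDθ
    rwa [div_pos_iff_of_pos_right hN0] at this
  have hd0 : 0 ≤ d := by
    have h1 : ∀ s ∈ Icc 0 T, (F s 0).re = Q s x := fun s hs => by
      rw [(hF s hs).self_of_nhds, hσx, Complex.ofReal_re]
    refine nonneg_of_hasDerivAt_of_le ht.1 hd fun s hs => ?_
    rw [h1 s ⟨hs.1, hs.2.trans ht.2.le⟩, h1 t htT]
    exact htime s hs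
  set f : CSpace n → ℝ := fun ζ => Q t ((chartAt (CSpace n) b).symm (σ ζ)) with hf
  have hFf : F t =ᶠ[𝓝 0] fun ζ => (f ζ : ℂ) := hF t htT
  have hf0 : f 0 = Q t x := by simp only [hf, hσx]
  have hlevi : ∀ p, dz p (dzbar p (F t)) 0 = dz p (dzbar p fun ζ => (f ζ : ℂ)) 0 := fun p => by
    have h1 : dzbar p (F t) =ᶠ[𝓝 0] dzbar p fun ζ => (f ζ : ℂ) :=
      hFf.eventuallyEq_nhds.mono fun z hz => by rw [dzbar, dzbar, hz.fderiv_eq]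
    rw [dz, dz, h1.fderiv_eq]
  have hβc : ContinuousAt β 0 := by
    have := Complex.continuous_re.continuousAt.comp hβ.continuousAt
    exact this
  -- Near the origin the pair of the moving point and the barrier belongs to `S`, so it competes in
  -- the maximum; at the origin the two sides agree. This is all that is used of the barrier, and
  -- the minimal cost itself need not be differentiable.
  have hlm : IsLocalMax (fun y => (θ / N - β y) ^ 2 * f y) 0 := by
    filter_upwards [hβS, hβc.eventually (gt_mem_nhds (hβ0.symm ▸ hDθ))] with ζ hζ hζ'
    change _ ≤ (θ / N - β 0) ^ 2 * f 0
    rw [hf0, hβ0]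
    exact hmax _ hζ hζ'.le
  have hε : 0 < θ / N - β 0 := by rw [hβ0]; linarith
  have hkey := fun p => dz_dzbar_le_of_isLocalMax (hFs.congr_of_eventuallyEq hFf.symm) hβ hlm hε p
  rw [hβ0, hf0] at hkey
  rw [hβ0] at hε
  set q := Q t x with hq
  set ε := θ - N * D with hεd
  -- The natural quantities are `N D` and `ε = θ - N D`. Since `D ≤ θ / N`, the derivatives of `N β`
  -- are bounded independently of `N`, and all powers of `N` cancel below.
  have hεN : θ / N - D = ε / N := by rw [hεd]; field_simp
  rw [hεN] at hkey hε
  have hε0 : 0 < ε := by rwa [div_pos_iff_of_pos_right hN0] at hε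
  have hεθ : ε ≤ θ := by rw [hεd]; nlinarith
  have hexp : Real.exp (L ^ 2 * D) ≤ 2 := by
    rw [← Real.exp_log zero_lt_two]; exact Real.exp_le_exp.mpr hL
  have hexp' : Real.exp (L ^ 2 * D / 2) ≤ 2 := by
    refine (Real.exp_le_exp.mpr ?_).trans hexp
    have : 0 ≤ L ^ 2 * D := by positivity
    linarith
  have hlev : ∀ p, (dz p (dzbar p fun ζ => (β ζ : ℂ)) 0).re ≤ 2 * (12 + B * θ) * C / N :=
      fun p => by
    have h0 : 0 ≤ qf (g.coord b (σ 0)) (jac σ 0 p) ∨ qf (g.coord b (σ 0)) (jac σ 0 p) < 0 :=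
      le_or_gt _ _
    have hA : 12 / N + B * D ≤ (12 + B * θ) / N := by
      rw [add_div, mul_div_assoc]; gcongr
    have hA0 : 0 ≤ 12 / (N : ℝ) + B * D := by positivity
    calc _ ≤ (12 / N + B * D) * Real.exp (L ^ 2 * D) * qf (g.coord b (σ 0)) (jac σ 0 p) := (hβp p).1
      _ ≤ (12 / N + B * D) * Real.exp (L ^ 2 * D) * C := by
        have := hqf p; gcongr
      _ ≤ (12 + B * θ) / N * 2 * C := by gcongr
      _ = _ := by ring
  have hgrad : ∀ p, ‖dz p (fun ζ => (β ζ : ℂ)) 0‖ ^ 2 ≤ 64 * (√θ + θ) ^ 2 * C / N ^ 2 := fun p => by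
    have h1 : √(D / N) ≤ √θ / N := by
      rw [Real.sqrt_le_left (by positivity), div_pow, Real.sq_sqrt hθ0.le, sq, ← div_div]
      gcongr
    have h2 : ‖dz p (fun ζ => (β ζ : ℂ)) 0‖ ≤ (4 * (√θ / N) + 4 * (θ / N)) * 2 * √C := by
      refine (hβp p).2.trans ?_
      have := hqf p
      gcongr
    calc _ ≤ ((4 * (√θ / N) + 4 * (θ / N)) * 2 * √C) ^ 2 := by gcongr
      _ = 64 * (√θ + θ) ^ 2 * (√C ^ 2) / N ^ 2 := by field_simp; ring
      _ = _ := by rw [Real.sq_sqrt hC]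
  have hsum : ∑ p, (dz p (dzbar p (F t)) 0).re ≤
      n * (q * (384 * (√θ + θ) ^ 2 * C / ε ^ 2 + 4 * (12 + B * θ) * C / ε)) := by
    have h1 : ∀ p ∈ Finset.univ, (dz p (dzbar p (F t)) 0).re ≤
        q * (384 * (√θ + θ) ^ 2 * C / ε ^ 2 + 4 * (12 + B * θ) * C / ε) := fun p _ => by
      rw [hlevi]
      refine (hkey p).trans (mul_le_mul_of_nonneg_left ?_ hpos.le)
      refine add_le_add ?_ ?_
      · rw [div_pow, div_le_div_iff₀ (by positivity) (by positivity)]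
        have := hgrad p
        rw [le_div_iff₀ (by positivity)] at this
        rw [mul_div_assoc', le_div_iff₀ (by positivity)]
        nlinarith [sq_nonneg ε, mul_le_mul_of_nonneg_right this (sq_nonneg ε)]
      · rw [div_le_div_iff₀ hε hε0, mul_div_assoc', le_div_iff₀ hN0]
        have := hlev p
        rw [le_div_iff₀ hN0] at this
        nlinarith [mul_le_mul_of_nonneg_right this hε0.le]
    simpa using Finset.sum_le_card_nsmul _ _ _ h1
  have hre : (F t 0).re = q := by rw [hFf.self_of_nhds, Complex.ofReal_re, hf0]
  rw [hre] at hle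
  have hfin : c * q ^ 2 ≤ |D₀| +
      n * (q * (384 * (√θ + θ) ^ 2 * C / ε ^ 2 + 4 * (12 + B * θ) * C / ε)) := by
    linarith [le_abs_self D₀]
  -- Multiplication by `ε⁴` removes the singular terms of the cutoff and leaves a quadratic
  -- inequality for `ε² q`.
  have h1 := mul_le_mul_of_nonneg_right hfin (pow_nonneg hε0.le 4)
  have h2 : c * (ε ^ 2 * q) ^ 2 = c * q ^ 2 * ε ^ 4 := by ring
  rw [h2]
  refine h1.trans ?_
  rw [add_mul]
  refine add_le_add (by gcongr) ?_
  have h3 : n * (q * (384 * (√θ + θ) ^ 2 * C / ε ^ 2 + 4 * (12 + B * θ) * C / ε)) * ε ^ 4 =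
      n * (384 * (√θ + θ) ^ 2 * C + 4 * (12 + B * θ) * C * ε) * (ε ^ 2 * q) := by
    field_simp
  rw [h3]
  gcongr

-- The quantity `(θ / N - D)² Q` is maximised over times and chains with at most the cost `θ / N`.
-- At the initial time the maximum is bounded by `Q₀`, and otherwise the barrier argument applies.
-- The constant `M` is fixed before the charts; their constants influence only how large `N` has to
-- be.
set_option maxHeartbeats 400000 in
theorem exists_maximum_principle (n : ℕ) {C R c : ℝ} (hC : 0 ≤ C) (hR : 0 < R) (hc : 0 < c)
    (D₀ Q₀ : ℝ) : ∃ M : ℝ, ∀ (X : Type*) [TopologicalSpace X] [T2Space X]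
      [ChartedSpace (CSpace n) X] [IsManifold 𝓘(ℂ, CSpace n) ω X] (g : HermitianMetric n X) (o : X)
      (A : Finset X) (ρ : X → ℝ) (L η δ T : ℝ) (Q : ℝ → X → ℝ),
      ChainCharts g (g.ball o R) A ρ L η δ →
      (∀ a ∈ A, ∀ z ∈ (chartAt (CSpace n) a).target,
        (chartAt (CSpace n) a).symm z ∈ g.ball o R → (rmSqAt (g.coord a) z).re ≤ C ^ 2) →
      ContinuousOn (Function.uncurry Q) (Icc 0 T ×ˢ g.ball o R) →
      (∀ x ∈ g.ball o R, Q 0 x ≤ Q₀) →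
      (∀ t ∈ Ioo 0 T, ∀ x ∈ g.ball o R, HeatBoundAt g T Q C c D₀ t x) →
      ∀ t ∈ Ico 0 T, Q t o ≤ M := by
  -- Chains with `N D ≤ θ` have length at most `2 √θ = R / 2` and remain in the ball.
  set θ : ℝ := R ^ 2 / 16 with hθ
  have hθ0 : 0 < θ := by positivity
  set B : ℝ := 4 * C * n ^ 2 + 5 with hBd
  have hB : 0 ≤ B := by positivity
  set b : ℝ := n * (384 * (√θ + θ) ^ 2 * C + 4 * (12 + B * θ) * C * θ) with hb
  have hb0 : 0 ≤ b := by positivity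
  refine ⟨(θ ^ 2)⁻¹ * (((|D₀| * θ ^ 4 + b) / c + 1) + θ ^ 2 * |Q₀|), ?_⟩
  intro X _ _ _ _ g o A ρ L η δ T Q h hRm hQ hQ0 hheat t ht
  have hL := h.one_le
  have hδ := h.δ_pos
  have hM : 0 ≤ (|D₀| * θ ^ 4 + b) / c + 1 := by positivity
  rcases le_or_gt (Q t o) 0 with hneg | hpos
  · exact hneg.trans (by positivity)
  rw [le_inv_mul_iff₀ (by positivity)]
  -- The summands ensure in turn that `N` is positive, that minimal steps are shorter than `δ`, that
  -- the Christoffel errors in `exists_step` are absorbed, and that the accumulated transport factor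
  -- is at most `2`.
  obtain ⟨N, hN⟩ : ∃ N : ℕ, 1 + 2 * (n * L * θ) / δ ^ 2 + 4 * L ^ 8 * θ +
      L ^ 2 * θ / Real.log 2 ≤ N := exists_nat_ge _
  have hlog : 0 < Real.log 2 := Real.log_pos one_lt_two
  have hp1 : 0 ≤ 2 * (n * L * θ) / δ ^ 2 := by positivity
  have hp2 : 0 ≤ 4 * L ^ 8 * θ := by positivity
  have hp3 : 0 ≤ L ^ 2 * θ / Real.log 2 := by positivity
  have hN0 : (0 : ℝ) < N := by linarith
  have hδ' : 2 * (n * L * (θ / N)) < δ ^ 2 := by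
    have h1 : 2 * (n * L * θ) / δ ^ 2 < N := by linarith
    rw [div_lt_iff₀ (by positivity)] at h1
    have : 2 * (n * L * (θ / N)) = 2 * (n * L * θ) / N := by ring
    rw [this, div_lt_iff₀ hN0]; linarith
  have hsmall : 4 * L ^ 8 * (θ / N) ≤ 1 := by
    rw [mul_div_assoc', div_le_one hN0]; linarith
  have hlog' : L ^ 2 * (θ / N) ≤ Real.log 2 := by
    have h1 : L ^ 2 * θ / Real.log 2 ≤ N := by linarith
    rw [div_le_iff₀ hlog] at h1
    rw [mul_div_assoc', div_le_iff₀ hN0]; linarith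
  have hball : ∀ j ≤ N, ∀ q ∈ chainSet g A ρ η δ o j, q.2 ≤ θ / N → q.1 ∈ g.ball o R := by
    intro j hj q hq hqθ
    obtain ⟨h1, h2⟩ := ChainCharts.edist_le_of_mem_chainSet h (y := q.1) (D := q.2) hq
    refine h2.trans_lt ((ENNReal.ofReal_lt_ofReal_iff hR).mpr ?_)
    have h3 : (j : ℝ) * q.2 ≤ (R / 4) ^ 2 := by
      calc (j : ℝ) * q.2 ≤ N * (θ / N) := by gcongr
        _ = _ := by rw [mul_div_cancel₀ _ hN0.ne', hθ]; ring
    have h4 := Real.sqrt_le_sqrt h3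
    rw [Real.sqrt_sq (by positivity)] at h4
    linarith
  have ho : o ∈ g.ball o R := by
    change g.edist o o < _
    rw [HermitianMetric.edist_self]; simpa using hR
  set S := chainSet g A ρ η δ o N with hS
  have hcpt : IsCompact (Icc 0 t ×ˢ (S ∩ {q | q.2 ≤ θ / N})) :=
    isCompact_Icc.prod ((h.isCompact_chainSet N).inter_right
      (isClosed_le continuous_snd continuous_const))
  have hoS : (t, (o, (0 : ℝ))) ∈ Icc 0 t ×ˢ (S ∩ {q : X × ℝ | q.2 ≤ θ / N}) :=
    ⟨⟨ht.1, le_rfl⟩, h.base_mem_chainSet ho N, by change (0 : ℝ) ≤ θ / N; positivity⟩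
  have hcont : ContinuousOn (fun y : ℝ × (X × ℝ) => (θ / N - y.2.2) ^ 2 * Q y.1 y.2.1)
      (Icc 0 t ×ˢ (S ∩ {q | q.2 ≤ θ / N})) := by
    refine ContinuousOn.mul (by fun_prop) ?_
    refine hQ.comp (f := fun y : ℝ × (X × ℝ) => (y.1, y.2.1)) (by fun_prop) fun y hy => ?_
    exact ⟨⟨hy.1.1, hy.1.2.trans ht.2.le⟩, hball N le_rfl _ hy.2.1 hy.2.2⟩
  obtain ⟨⟨s, x, D⟩, ⟨hs, hxS, hDθ⟩, hmax⟩ := hcpt.exists_isMaxOn ⟨_, hoS⟩ hcont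
  have hmax' : ∀ s' ∈ Icc 0 t, ∀ q ∈ S, q.2 ≤ θ / N →
      (θ / N - q.2) ^ 2 * Q s' q.1 ≤ (θ / N - D) ^ 2 * Q s x := fun s' hs' q hq hq' =>
    hmax (show (s', q) ∈ Icc 0 t ×ˢ (S ∩ {q : X × ℝ | q.2 ≤ θ / N}) from ⟨hs', hq, hq'⟩)
  change D ≤ θ / N at hDθ
  have hxB : x ∈ g.ball o R := hball N le_rfl _ hxS hDθ
  have hD0 : 0 ≤ D := (ChainCharts.edist_le_of_mem_chainSet h hxS).1
  have hoM := hmax' t ⟨ht.1, le_rfl⟩ _ (h.base_mem_chainSet ho N) (by positivity)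
  -- The constant chain at `o` at time `t` is a competitor of zero cost with `Q > 0`. So the maximum
  -- is positive, which forces `Q > 0` and `D < θ / N` at the maximum.
  have hop : 0 < (θ / N - D) ^ 2 * Q s x := by
    refine lt_of_lt_of_le ?_ hoM
    simp only [sub_zero]
    positivity
  have hqpos : 0 < Q s x := by
    by_contra! hq
    nlinarith [sq_nonneg (θ / N - D)]
  have hDlt : D < θ / N := by
    refine lt_of_le_of_ne hDθ fun he => ?_
    rw [he] at hop; simp at hop
  -- The cutoff decreases in the cost, so the maximising chain is automatically a cheapest one to
  -- its end point, as `hasBarrier` demands.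
  have hmin : ∀ D', (x, D') ∈ S → D ≤ D' := fun D' hD' => by
    by_contra! hlt
    have h1 := hmax' s hs (x, D') hD' (hlt.le.trans hDθ)
    have h2 := le_of_mul_le_mul_right h1 hqpos
    exact absurd h2 (not_le.mpr (pow_lt_pow_left₀ (sub_lt_sub_left hlt _) (sub_pos.mpr hDlt).le two_ne_zero))
  have hscale : θ ^ 2 * Q t o ≤ (θ - N * D) ^ 2 * Q s x := by
    have h1 := mul_le_mul_of_nonneg_left hoM (sq_nonneg (N : ℝ))
    have h2 : (N : ℝ) ^ 2 * ((θ / N - 0) ^ 2 * Q t o) = θ ^ 2 * Q t o := by field_simp; ring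
    have h3 : (N : ℝ) ^ 2 * ((θ / N - D) ^ 2 * Q s x) = (θ - N * D) ^ 2 * Q s x := by field_simp
    simp only at h1
    rwa [h2, h3] at h1
  refine hscale.trans ?_
  have hε : θ - N * D ≤ θ := sub_le_self _ (by positivity)
  have hε' : 0 ≤ θ - N * D := by
    rw [lt_div_iff₀ hN0] at hDlt; linarith
  rcases hs.1.eq_or_lt with hs0 | hs0
  · have h1 : Q s x ≤ |Q₀| := by
      have h0 : 0 = s := hs0
      rw [← h0]; exact (hQ0 x hxB).trans (le_abs_self _)
    have : (θ - N * D) ^ 2 * Q s x ≤ θ ^ 2 * |Q₀| := by gcongr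
    linarith
  · have hbar : HasBarrier g S N L B x D :=
      h.hasBarrier hC hRm hδ' hsmall (fun j hj => hball j hj.le) hxS hmin hDθ
    have hst : s < T := hs.2.trans_lt ht.2
    have h1 := hbar.le_of_isMaxOn (θ := θ) (by rintro rfl; simp at hN0) hB hC
      (hheat s ⟨hs0, hst⟩ x hxB) ⟨hs0, hst⟩ hD0 hDlt
      ((mul_le_mul_of_nonneg_left hDθ (sq_nonneg L)).trans hlog') hqpos
      (fun s' hs' => le_of_mul_le_mul_left
        (hmax' s' ⟨hs'.1, hs'.2.trans hs.2⟩ (x, D) hxS hDθ) (pow_pos (sub_pos.mpr hDlt) 2))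
      (hmax' s hs)
    have h2 := le_of_quadratic_le (by positivity) hb0 hc h1
    have : 0 ≤ θ ^ 2 * |Q₀| := by positivity
    linarith

end MaximumPrinciple
end

noncomputable section

open Filter Topology

/-! ### Scalar invariants of a pair of metrics -/

section Invariants

variable {n : ℕ}

/-- A pointwise expression in the components of two metrics that is real, invariant under
holomorphic changes of coordinates, and smooth for smooth families. -/
structure IsMetricScalar (Φ : (CSpace n → Matrix (Fin n) (Fin n) ℂ) →
    (CSpace n → Matrix (Fin n) (Fin n) ℂ) → CSpace n → ℂ) : Prop where
  pullback : ∀ {τ z G G' G₀ G₀'}, IsPullback τ z G G' → IsPullback τ z G₀ G₀' →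
    Φ G' G₀' z = Φ G G₀ (τ z)
  real : ∀ {G G₀ z}, (G z).IsHermitian → (G₀ z).IsHermitian → conj (Φ G G₀ z) = Φ G G₀ z
  smooth : ∀ {T U} {G G₀ : ℝ → CSpace n → Matrix (Fin n) (Fin n) ℂ}, 0 < T → IsOpen U →
    (∀ i j, SmoothFam T U fun t z => G t z i j) → (∀ i j, SmoothFam T U fun t z => (G t z)⁻¹ i j) →
    (∀ i j, SmoothFam T U fun t z => G₀ t z i j) →
    (∀ i j, SmoothFam T U fun t z => (G₀ t z)⁻¹ i j) → SmoothFam T U fun t z => Φ (G t) (G₀ t) z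

theorem conj_hermSq {κ : Type*} [Fintype κ] {w : κ → κ → ℂ} (hw : ∀ x y, conj (w x y) = w y x)
    (T : κ → ℂ) : conj (hermSq (starRingEnd ℂ) w T) = hermSq (starRingEnd ℂ) w T := by
  simp only [hermSq, map_sum, map_mul, hw, Complex.conj_conj]
  rw [Finset.sum_comm]
  exact Finset.sum_congr rfl fun x _ => Finset.sum_congr rfl fun y _ => by ring

variable {G G₀ : CSpace n → Matrix (Fin n) (Fin n) ℂ} {z : CSpace n}

theorem conj_rmSqAt (h : (G z).IsHermitian) : conj (rmSqAt G z) = rmSqAt G z := by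
  have h1 : ∀ i j, conj ((G z)⁻¹ i j) = (G z)⁻¹ j i := fun i j => h.inv.apply _ _
  refine conj_hermSq (fun x y => ?_) _
  simp only [weight4, map_mul, h1]

theorem conj_connDiffSqAt (h : (G z).IsHermitian) :
    conj (connDiffSqAt G G₀ z) = connDiffSqAt G G₀ z := by
  have h1 : ∀ i j, conj ((G z)⁻¹ i j) = (G z)⁻¹ j i := fun i j => h.inv.apply _ _
  have h2 : ∀ i j, conj (G z i j) = G z j i := fun i j => h.apply _ _
  refine conj_hermSq (fun x y => ?_) _
  simp only [weight3, map_mul, h1, h2]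

theorem isMetricScalar_rmSqAt : IsMetricScalar fun G (_ : CSpace n → Matrix (Fin n) (Fin n) ℂ) => rmSqAt G :=
  ⟨fun h _ => h.rmSqAt_eq, fun h _ => conj_rmSqAt h,
    fun hT hU h h' _ _ => SmoothFam.rmSqAt hT hU h h'⟩

theorem isMetricScalar_connTestAt (K : ℝ) : IsMetricScalar (n := n) (connTestAt K) where
  pullback h h₀ := h.connTestAt_eq h₀ K
  real {G G₀ z} h h₀ := by
    have h1 : ∀ i j, conj ((G z)⁻¹ i j) = (G z)⁻¹ j i := fun i j => h.inv.apply _ _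
    have h2 : ∀ i j, conj (G₀ z i j) = G₀ z j i := fun i j => h₀.apply _ _
    rw [connTestAt, map_mul, map_add, conj_connDiffSqAt h, Complex.conj_ofReal]
    congr 2
    simp only [Wirtinger.relTrace, map_sum, map_mul, h1, h2]
    exact Finset.sum_comm
  smooth hT hU h h' h₀ h₀' := SmoothFam.connTestAt hT hU h h' h₀ h₀' K

theorem isMetricScalar_curvTestAt (K : ℝ) : IsMetricScalar (n := n) (curvTestAt K) where
  pullback h h₀ := h.curvTestAt_eq h₀ K
  real h _ := by
    rw [curvTestAt, map_mul, map_add, conj_connDiffSqAt h, conj_rmSqAt h, Complex.conj_ofReal]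
  smooth hT hU h h' h₀ h₀' := SmoothFam.curvTestAt hT hU h h' h₀ h₀' K

theorem connDiffSqAt_self (G : CSpace n → Matrix (Fin n) (Fin n) ℂ) (z : CSpace n) :
    connDiffSqAt G G z = 0 := by
  simp [connDiffSqAt, hermSq]

end Invariants

section InvariantsOnManifold

variable {n : ℕ} {X : Type*} [TopologicalSpace X] [ChartedSpace (CSpace n) X]
  {Φ : (CSpace n → Matrix (Fin n) (Fin n) ℂ) →
    (CSpace n → Matrix (Fin n) (Fin n) ℂ) → CSpace n → ℂ}

/-- The components in all charts are smooth. -/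
def HermitianMetric.IsSmooth (g : HermitianMetric n X) : Prop :=
  ∀ a : X, ∀ z ∈ (chartAt (CSpace n) a).target, ∀ i j,
    ContDiffAt ℝ ∞ (fun w => g.coord a w i j) z

/-- The value at `x` of an expression in the components of two metrics, in the preferred chart. -/
def invariantAt (Φ : (CSpace n → Matrix (Fin n) (Fin n) ℂ) →
    (CSpace n → Matrix (Fin n) (Fin n) ℂ) → CSpace n → ℂ) (g g₀ : HermitianMetric n X) (x : X) : ℂ :=
  Φ (g.coord x) (g₀.coord x) (chartAt (CSpace n) x x)

theorem HermitianMetric.IsSmooth.isPullback [IsManifold 𝓘(ℂ, CSpace n) ω X]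
    {g : HermitianMetric n X} (hg : g.IsSmooth) {a b : X} {z : CSpace n}
    (hz : z ∈ (chartAt (CSpace n) a).target)
    (h : (chartAt (CSpace n) a).symm z ∈ (chartAt (CSpace n) b).source) :
    IsPullback (transition b a) z (g.coord b) (g.coord a) := by
  have h1 : transition b a z ∈ (chartAt (CSpace n) b).target := (chartAt (CSpace n) b).map_source h
  refine ⟨analyticAt_transition hz h, det_jac_transition_ne hz h, hg b _ h1,
    (g.localMetric h1 (hg b _ h1)).det_ne, ?_⟩
  have h2 : ContinuousAt (chartAt (CSpace n) a).symm z := (chartAt (CSpace n) a).symm.continuousAt hz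
  filter_upwards [(chartAt (CSpace n) a).open_target.mem_nhds hz,
    h2.eventually ((chartAt (CSpace n) b).open_source.mem_nhds h)] with w hw hw'
  exact g.coord_transition hw hw'

/-- The definition uses the preferred chart at each point, which may jump from point to point. By
invariance a fixed chart computes the same values, and this gives access to smoothness. -/
theorem IsMetricScalar.invariantAt_symm [IsManifold 𝓘(ℂ, CSpace n) ω X] (hΦ : IsMetricScalar Φ)
    {g g₀ : HermitianMetric n X} (hg : g.IsSmooth) (hg₀ : g₀.IsSmooth) {a : X} {z : CSpace n}
    (hz : z ∈ (chartAt (CSpace n) a).target) :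
    invariantAt Φ g g₀ ((chartAt (CSpace n) a).symm z) = Φ (g.coord a) (g₀.coord a) z := by
  have h := mem_chart_source (CSpace n) ((chartAt (CSpace n) a).symm z)
  exact (hΦ.pullback (hg.isPullback hz h) (hg₀.isPullback hz h)).symm

theorem IsMetricScalar.ofReal_re (hΦ : IsMetricScalar Φ) (g g₀ : HermitianMetric n X) (x : X) :
    ((invariantAt Φ g g₀ x).re : ℂ) = invariantAt Φ g g₀ x :=
  Complex.conj_eq_iff_re.mp (hΦ.real (g.isHermitian_coord x _) (g₀.isHermitian_coord x _))

theorem mul_sqrt_sq_le {a b : ℝ} (hb : 0 ≤ b) (h : √a ≤ b) : a ≤ b ^ 2 :=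
  (Real.sqrt_le_left hb).mp h

end InvariantsOnManifold

/-! ### Scalar invariants along a Kähler–Ricci flow -/

section Flow

variable {n : ℕ} {X : Type*} [TopologicalSpace X] [ChartedSpace (CSpace n) X]
  [IsManifold 𝓘(ℂ, CSpace n) ω X] {g : ℝ → HermitianMetric n X} {T : ℝ}

namespace IsKahlerRicciFlow

theorem isSmooth (hg : IsKahlerRicciFlow g T) {t : ℝ} (ht : t ∈ Icc 0 T) : (g t).IsSmooth := by
  intro a z hz i j
  have h1 : ContDiffOn ℝ ∞ (fun w => (g t).coord a w i j) (chartAt (CSpace n) a).target :=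
    (hg.smooth a i j).comp (f := fun w : CSpace n => (t, w)) (by fun_prop) fun w hw => ⟨ht, hw⟩
  exact h1.contDiffAt ((chartAt (CSpace n) a).open_target.mem_nhds hz)

theorem smoothFam_invariant (hg : IsKahlerRicciFlow g T) (hT : 0 < T)
    {Φ : (CSpace n → Matrix (Fin n) (Fin n) ℂ) →
      (CSpace n → Matrix (Fin n) (Fin n) ℂ) → CSpace n → ℂ}
      (hΦ : IsMetricScalar Φ) (a : X) :
    SmoothFam T (chartAt (CSpace n) a).target fun t z => Φ ((g t).coord a) ((g 0).coord a) z := by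
  have h0 : (0 : ℝ) ∈ Icc 0 T := ⟨le_rfl, hT.le⟩
  have h1 : ∀ i j, SmoothFam T (chartAt (CSpace n) a).target fun _ z => (g 0).coord a z i j :=
    fun i j => (hg.smooth a i j).comp (f := fun x : ℝ × CSpace n => ((0 : ℝ), x.2)) (by fun_prop)
      fun x hx => ⟨h0, hx.2⟩
  have hdet : ∀ t ∈ Icc 0 T, ∀ z ∈ (chartAt (CSpace n) a).target, ((g t).coord a z).det ≠ 0 :=
    fun t ht z hz => ((g t).localMetric hz (hg.isSmooth ht a z hz)).det_ne
  exact hΦ.smooth hT (chartAt (CSpace n) a).open_target (hg.smooth a)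
    (SmoothFam.inv (hg.smooth a) hdet) h1 (SmoothFam.inv h1 fun _ _ => hdet 0 h0)

/-- Near each point a single chart computes the invariant, and there it is a smooth family on the
closed time interval. -/
theorem continuousOn_invariant (hg : IsKahlerRicciFlow g T)
    (hT : 0 < T) {Φ : (CSpace n → Matrix (Fin n) (Fin n) ℂ) →
      (CSpace n → Matrix (Fin n) (Fin n) ℂ) → CSpace n → ℂ} (hΦ : IsMetricScalar Φ) (B : Set X) :
    ContinuousOn (Function.uncurry fun t x => (invariantAt Φ (g t) (g 0) x).re) (Icc 0 T ×ˢ B) := by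
  have h0 : (0 : ℝ) ∈ Icc 0 T := ⟨le_rfl, hT.le⟩
  refine Complex.continuous_re.comp_continuousOn
    (f := fun y : ℝ × X => invariantAt Φ (g y.1) (g 0) y.2) ?_
  rintro ⟨t, x⟩ ⟨ht, -⟩
  have hsrc := (chartAt (CSpace n) x).open_source.mem_nhds (mem_chart_source (CSpace n) x)
  have h1 := (hg.smoothFam_invariant hT hΦ x).continuousOn
  have h2 : ContinuousOn (fun y : ℝ × X => Φ ((g y.1).coord x) ((g 0).coord x)
      (chartAt (CSpace n) x y.2)) (Icc 0 T ×ˢ (chartAt (CSpace n) x).source) := by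
    refine h1.comp (f := fun y : ℝ × X => (y.1, chartAt (CSpace n) x y.2))
      (continuousOn_fst.prodMk ((chartAt (CSpace n) x).continuousOn.comp continuousOn_snd
        fun y hy => hy.2)) fun y hy => ⟨hy.1, (chartAt (CSpace n) x).map_source hy.2⟩
  have h3 : ContinuousOn (fun y : ℝ × X => invariantAt Φ (g y.1) (g 0) y.2)
      (Icc 0 T ×ˢ (chartAt (CSpace n) x).source) := h2.congr fun y hy => by
    have := hΦ.invariantAt_symm (hg.isSmooth hy.1) (hg.isSmooth h0)
      ((chartAt (CSpace n) x).map_source hy.2)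
    rwa [(chartAt (CSpace n) x).left_inv hy.2] at this
  have h4 := h3 (t, x) ⟨ht, mem_chart_source _ x⟩
  refine h4.mono_of_mem_nhdsWithin ?_
  rw [nhdsWithin_prod_eq]
  refine mem_of_superset (prod_mem_prod self_mem_nhdsWithin (mem_nhdsWithin_of_mem_nhds hsrc))
    subset_rfl

/-- Interior times only: at the ends of the interval just the one-sided time derivatives are given.
-/
theorem localFlow (hg : IsKahlerRicciFlow g T) {t : ℝ} (ht : t ∈ Ioo 0 T) {a : X} {z : CSpace n}
    (hz : z ∈ (chartAt (CSpace n) a).target) : LocalFlow (fun s => (g s).coord a) t z := by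
  have h1 : Ioo 0 T ×ˢ (chartAt (CSpace n) a).target ∈ 𝓝 (t, z) :=
    prod_mem_nhds (Ioo_mem_nhds ht.1 ht.2) ((chartAt (CSpace n) a).open_target.mem_nhds hz)
  refine ⟨fun i j => (hg.smooth a i j).contDiffAt (mem_of_superset h1 ?_),
    Eventually.of_forall fun x => (g x.1).isHermitian_coord a x.2, (g t).qf_coord_pos hz, ?_, ?_⟩
  · exact prod_mono Ioo_subset_Icc_self subset_rfl
  · filter_upwards [h1] with x hx
    exact hg.kahler x.1 (Ioo_subset_Icc_self hx.1) a x.2 hx.2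
  · filter_upwards [h1] with x hx i j
    exact (hg.flow x.1 (Ioo_subset_Icc_self hx.1) a x.2 hx.2 i j).hasDerivAt
      (Icc_mem_nhds hx.1.1 hx.1.2)

end IsKahlerRicciFlow

/-- A Kähler-Ricci flow on `X` that is comparable with its initial metric on `B`, with bounds of
the initial curvature. -/
structure ControlledFlow (g : ℝ → HermitianMetric n X) (T : ℝ) (B : Set X) (C : ℝ) : Prop where
  flow : IsKahlerRicciFlow g T
  pos : 0 < T
  one_le : 1 ≤ C
  rm : ∀ x ∈ B, (g 0).normRm x ≤ C
  cov : ∀ x ∈ B, (g 0).normCovRm x ≤ C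
  le : ∀ t ∈ Icc 0 T, ∀ x ∈ B, ∀ v : CSpace n,
    ((g 0).inner x v v).re ≤ C * ((g t).inner x v v).re
  ge : ∀ t ∈ Icc 0 T, ∀ x ∈ B, ∀ v : CSpace n,
    ((g t).inner x v v).re ≤ C * ((g 0).inner x v v).re

namespace ControlledFlow

variable {B : Set X} {C : ℝ} (h : ControlledFlow g T B C)
include h

theorem mono {B' : Set X} (hB : B' ⊆ B) : ControlledFlow g T B' C :=
  ⟨h.flow, h.pos, h.one_le, fun x hx => h.rm x (hB hx), fun x hx => h.cov x (hB hx),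
    fun t ht x hx => h.le t ht x (hB hx), fun t ht x hx => h.ge t ht x (hB hx)⟩

theorem zero_mem : (0 : ℝ) ∈ Icc 0 T := ⟨le_rfl, h.pos.le⟩

theorem rmSq_le {x : X} (hx : x ∈ B) :
    (rmSqAt ((g 0).coord x) (chartAt (CSpace n) x x)).re ≤ C ^ 2 := by
  rw [← curvatureNormSq_eq]
  exact mul_sqrt_sq_le (zero_le_one.trans h.one_le) (h.rm x hx)

theorem comparableFlow {t : ℝ} (ht : t ∈ Ioo 0 T) {x : X} (hx : x ∈ B) :
    ComparableFlow (fun s => (g s).coord x) ((g 0).coord x) C t (chartAt (CSpace n) x x) := by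
  have hz := mem_chart_target (CSpace n) x
  have hxx := (chartAt (CSpace n) x).left_inv (mem_chart_source (CSpace n) x)
  have hqf : ∀ s (v : Fin n → ℂ), qf ((g s).coord x (chartAt (CSpace n) x x)) v =
      ((g s).inner x (chartDeriv x (chartAt (CSpace n) x x) (WithLp.toLp 2 v))
        (chartDeriv x (chartAt (CSpace n) x x) (WithLp.toLp 2 v))).re := fun s v => by
    have h1 := (g s).sf_coord x (chartAt (CSpace n) x x) (WithLp.toLp 2 v) (WithLp.toLp 2 v)
    rw [hxx] at h1
    exact congrArg Complex.re h1
  refine ⟨h.flow.localFlow ht hz, (g 0).localMetric hz (h.flow.isSmooth h.zero_mem x _ hz),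
    fun v => ?_, fun v => ?_, h.rmSq_le hx, ?_⟩
  · rw [hqf, hqf]; exact h.le t (Ioo_subset_Icc_self ht) x hx _
  · rw [hqf, hqf]; exact h.ge t (Ioo_subset_Icc_self ht) x hx _
  · rw [← covCurvatureNormSq_eq]
    exact mul_sqrt_sq_le (zero_le_one.trans h.one_le) (h.cov x hx)

theorem heatBoundAt
    {Φ : (CSpace n → Matrix (Fin n) (Fin n) ℂ) →
      (CSpace n → Matrix (Fin n) (Fin n) ℂ) → CSpace n → ℂ} (hΦ : IsMetricScalar Φ) {c D t : ℝ} {x : X}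
    (hheat : ∃ τ : CSpace n → CSpace n, AnalyticAt ℂ τ 0 ∧ τ 0 = chartAt (CSpace n) x x ∧
      (∀ p, qf ((g 0).coord x (chartAt (CSpace n) x x)) (jac τ 0 p) ≤ C) ∧
      HeatBound (fun s z => Φ ((g s).coord x) ((g 0).coord x) (τ z)) t c D) :
    HeatBoundAt (g 0) T (fun s y => (invariantAt Φ (g s) (g 0) y).re) C c D t x := by
  obtain ⟨τ, hτ, hτ0, hqf, hb⟩ := hheat
  have hz := mem_chart_target (CSpace n) x
  refine ⟨x, τ, _, hτ, hτ0 ▸ hz, ?_, by rwa [hτ0], fun s hs => ?_, hb⟩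
  · rw [hτ0]; exact (chartAt (CSpace n) x).left_inv (mem_chart_source (CSpace n) x)
  · filter_upwards [hτ.continuousAt.eventually
      ((chartAt (CSpace n) x).open_target.mem_nhds (hτ0.symm ▸ hz))] with ζ hζ
    rw [hΦ.ofReal_re]
    exact (hΦ.invariantAt_symm (h.flow.isSmooth hs) (h.flow.isSmooth h.zero_mem) hζ).symm

end ControlledFlow

/-- Transfers the maximum principle to invariants of the flow. The initial metric serves as the
background for the chains, so the assumed bound of its curvature is the one that controls the
barriers. -/
theorem exists_invariant_bound (n : ℕ) {C R c : ℝ} (hC : 0 ≤ C) (hR : 0 < R) (hc : 0 < c)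
    (D₀ Q₀ : ℝ) : ∃ M : ℝ, 0 ≤ M ∧ ∀ (X : Type*) [TopologicalSpace X] [T2Space X]
      [ChartedSpace (CSpace n) X] [IsManifold 𝓘(ℂ, CSpace n) ω X] (g : ℝ → HermitianMetric n X)
      (o : X) (T : ℝ) (Φ : (CSpace n → Matrix (Fin n) (Fin n) ℂ) →
        (CSpace n → Matrix (Fin n) (Fin n) ℂ) → CSpace n → ℂ),
      IsMetricScalar Φ → ControlledFlow g T ((g 0).ball o R) C →
      IsCompact (closure ((g 0).ball o R)) →
      (∀ x ∈ (g 0).ball o R, (invariantAt Φ (g 0) (g 0) x).re ≤ Q₀) →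
      (∀ t ∈ Ioo 0 T, ∀ x ∈ (g 0).ball o R,
        ∃ τ : CSpace n → CSpace n, AnalyticAt ℂ τ 0 ∧ τ 0 = chartAt (CSpace n) x x ∧
        (∀ p, qf ((g 0).coord x (chartAt (CSpace n) x x)) (jac τ 0 p) ≤ C) ∧
        HeatBound (fun s z => Φ ((g s).coord x) ((g 0).coord x) (τ z)) t c D₀) →
      ∀ t ∈ Ioo 0 T, (invariantAt Φ (g t) (g 0) o).re ≤ M := by
  obtain ⟨M, hM⟩ := exists_maximum_principle n hC hR hc D₀ Q₀
  refine ⟨max M 0, le_max_right _ _, fun X _ _ _ _ g o T Φ hΦ h hcpt hQ0 hheat t ht => ?_⟩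
  have hsm := h.flow.isSmooth h.zero_mem
  obtain ⟨A, ρ, L, η, δ, hch⟩ := exists_chainCharts hcpt hsm (h.flow.kahler 0 h.zero_mem)
  refine (hM X (g 0) o A ρ L η δ T (fun s y => (invariantAt Φ (g s) (g 0) y).re)
    (hch.mono subset_closure) (fun a _ z hz hB => ?_) (h.flow.continuousOn_invariant h.pos hΦ _) hQ0
    (fun s hs x hx => h.heatBoundAt hΦ (hheat s hs x hx)) t ⟨ht.1.le, ht.2⟩).trans (le_max_left _ _)
  have h1 := (isMetricScalar_rmSqAt (n := n)).invariantAt_symm hsm hsm hz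
  rw [← h1]
  exact h.rmSq_le hB

end Flow
end

noncomputable section

open Filter Topology

/-! ### Scaling of metrics -/

section ScalingLocal

variable {n : ℕ} (c : ℂ) (G : CSpace n → Matrix (Fin n) (Fin n) ℂ)

theorem fderiv_mul_left_const (f : CSpace n → ℂ) (z v : CSpace n) :
    fderiv ℝ (fun w => c * f w) z v = c * fderiv ℝ f z v :=
  congrArg (fun L : CSpace n →L[ℝ] ℂ => L v)
    (congrFun (fderiv_const_smul_field (𝕜 := ℝ) (f := f) c) z)

theorem dz_const_mul (i : Fin n) (f : CSpace n → ℂ) (z : CSpace n) :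
    dz i (fun w => c * f w) z = c * dz i f z := by
  rw [dz, dz, fderiv_mul_left_const, fderiv_mul_left_const]
  ring

theorem dzbar_const_mul (i : Fin n) (f : CSpace n → ℂ) (z : CSpace n) :
    dzbar i (fun w => c * f w) z = c * dzbar i f z := by
  rw [dzbar, dzbar, fderiv_mul_left_const, fderiv_mul_left_const]
  ring

variable {c} (hc : c ≠ 0)
include hc

theorem inv_smul_apply_of_ne (M : Matrix (Fin n) (Fin n) ℂ) (i j : Fin n) :
    (c • M)⁻¹ i j = c⁻¹ * M⁻¹ i j := by
  by_cases h : IsUnit M.det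
  · have := invertibleOfNonzero hc
    exact (congrFun₂ (Matrix.inv_smul M c h) i j).trans (by rw [invOf_eq_inv]; rfl)
  · have h' : ¬IsUnit (c • M).det := by
      rw [isUnit_iff_ne_zero, not_not] at h ⊢
      rw [Matrix.det_smul, h, mul_zero]
    rw [Matrix.nonsing_inv_apply_not_isUnit _ h, Matrix.nonsing_inv_apply_not_isUnit _ h']
    simp

theorem christoffel_smul (p m i : Fin n) (z : CSpace n) :
    christoffel (fun w => c • G w) p m i z = christoffel G p m i z := by
  simp only [christoffel, inv_smul_apply_of_ne hc, Matrix.smul_apply, smul_eq_mul, dz_const_mul]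
  exact Finset.sum_congr rfl fun q _ => by field_simp

theorem curvature_smul (i j k l : Fin n) :
    curvature (fun w => c • G w) i j k l = fun z => c * curvature G i j k l z := by
  ext z
  simp only [curvature, inv_smul_apply_of_ne hc, Matrix.smul_apply, smul_eq_mul, dz_const_mul,
    dzbar_const_mul, mul_add, Finset.mul_sum, mul_neg]
  congr 1
  exact Finset.sum_congr rfl fun p _ => Finset.sum_congr rfl fun q _ => by field_simp

theorem ricci_smul (i j : Fin n) (z : CSpace n) :
    ricci (fun w => c • G w) i j z = ricci G i j z := by
  simp only [ricci, inv_smul_apply_of_ne hc, curvature_smul G hc]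
  exact Finset.sum_congr rfl fun k _ => Finset.sum_congr rfl fun l _ => by field_simp

theorem covCurvature_smul (m i j k l : Fin n) (z : CSpace n) :
    covCurvature (fun w => c • G w) m i j k l z = c * covCurvature G m i j k l z := by
  simp only [covCurvature, christoffel_smul G hc, curvature_smul G hc, dz_const_mul, mul_sub,
    Finset.mul_sum]
  congr 1
  · congr 1
    exact Finset.sum_congr rfl fun p _ => by ring
  · exact Finset.sum_congr rfl fun p _ => by ring

omit hc in
theorem hermSq_eq_mul {κ : Type*} [Fintype κ] {w w' : κ → κ → ℂ} {T T' : κ → ℂ} {a b : ℝ}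
    (hw : ∀ x y, w' x y = a * w x y) (hT : ∀ x, T' x = b * T x) :
    (hermSq (starRingEnd ℂ) w' T').re = a * b ^ 2 * (hermSq (starRingEnd ℂ) w T).re := by
  rw [← Complex.re_ofReal_mul]
  congr 1
  simp only [hermSq, Finset.mul_sum, hw, hT, map_mul, Complex.conj_ofReal]
  exact Finset.sum_congr rfl fun x _ => Finset.sum_congr rfl fun y _ => by push_cast; ring

omit hc in
theorem curvatureNormSq_smul {r : ℝ} (hr : r ≠ 0) (z : CSpace n) :
    curvatureNormSq (fun w => (((r ^ 2)⁻¹ : ℝ) : ℂ) • G w) z = (r ^ 2) ^ 2 * curvatureNormSq G z := by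
  have hc : (((r ^ 2)⁻¹ : ℝ) : ℂ) ≠ 0 := by
    rw [Complex.ofReal_ne_zero]; positivity
  -- Each of the four inverse metrics contributes `r²`, and each of the two curvature factors `r⁻²`.
  rw [curvatureNormSq_eq, curvatureNormSq_eq, rmSqAt, hermSq_eq_mul (a := (r ^ 2) ^ 4)
    (b := (r ^ 2)⁻¹) (w := weight4 (G z)⁻¹) (T := fun x => curvature G x.1.1 x.1.2 x.2.1 x.2.2 z)]
  · congr 1; field_simp
  · intro x y
    simp only [weight4, inv_smul_apply_of_ne hc]
    simp only [Complex.ofReal_inv, inv_inv]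
    push_cast; ring
  · intro x; rw [curvature_smul G hc]

omit hc in
theorem covCurvatureNormSq_smul {r : ℝ} (hr : r ≠ 0) (z : CSpace n) :
    covCurvatureNormSq (fun w => (((r ^ 2)⁻¹ : ℝ) : ℂ) • G w) z =
      (r ^ 3) ^ 2 * covCurvatureNormSq G z := by
  have hc : (((r ^ 2)⁻¹ : ℝ) : ℂ) ≠ 0 := by
    rw [Complex.ofReal_ne_zero]; positivity
  rw [covCurvatureNormSq_eq, covCurvatureNormSq_eq, covCurvSqAt]
  refine (hermSq_eq_mul (a := (r ^ 2) ^ 5) (b := (r ^ 2)⁻¹) (w := weight5 (G z)⁻¹)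
    (T := fun x => covCurvature G x.1 x.2.1.1 x.2.1.2 x.2.2.1 x.2.2.2 z) ?_ ?_).trans ?_
  rotate_left 2
  · rw [covCurvSqAt]; congr 1; field_simp
  · intro x y
    have h5 : ∀ H : Matrix (Fin n) (Fin n) ℂ, weight5 H x y = H y.1 x.1 * weight4 H x.2 y.2 :=
      fun _ => rfl
    simp only [h5, weight4, inv_smul_apply_of_ne hc]
    simp only [Complex.ofReal_inv, inv_inv]
    push_cast; ring
  · intro x; rw [covCurvature_smul G hc]

end ScalingLocal

section Scaling

variable {n : ℕ} {X : Type*} [TopologicalSpace X] [ChartedSpace (CSpace n) X]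

namespace HermitianMetric

/-- The metric `c g`. -/
def scale (g : HermitianMetric n X) {c : ℝ} (hc : 0 < c) : HermitianMetric n X where
  form x := (c : ℂ) • g.form x
  conj_symm x v w := by
    change conj ((c : ℂ) * g.form x v w) = (c : ℂ) * g.form x w v
    rw [map_mul, g.conj_symm, Complex.conj_ofReal]
  pos x v hv := by
    change 0 < ((c : ℂ) * g.form x v v).re
    rw [Complex.re_ofReal_mul]
    exact mul_pos hc (g.pos x v hv)

variable (g : HermitianMetric n X) {c : ℝ} (hc : 0 < c)

theorem inner_scale (x : X) (v w : CSpace n) :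
    (g.scale hc).inner x v w = (c : ℂ) * g.inner x v w := rfl

theorem coord_scale (a : X) : (g.scale hc).coord a = fun z => (c : ℂ) • g.coord a z := rfl

theorem edist_scale (x y : X) :
    (g.scale hc).edist x y = ENNReal.ofReal (√c) * g.edist x y := by
  have h0 : ENNReal.ofReal (√c) ≠ 0 := by simpa using Real.sqrt_pos.mpr hc
  have h1 : ∀ (z : X) (v : CSpace n), ENNReal.ofReal (√(2 * ((g.scale hc).inner z v v).re)) =
      ENNReal.ofReal (√c) * ENNReal.ofReal (√(2 * (g.inner z v v).re)) := fun z v => by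
    rw [← ENNReal.ofReal_mul (Real.sqrt_nonneg _), ← Real.sqrt_mul hc.le, inner_scale,
      Complex.re_ofReal_mul]
    congr 2
    ring
  unfold edist
  rw [Manifold.riemannianEDist, Manifold.riemannianEDist, ENNReal.mul_iInf_of_ne h0 ENNReal.ofReal_ne_top]
  refine iInf_congr fun γ => ?_
  rw [ENNReal.mul_iInf_of_ne h0 ENNReal.ofReal_ne_top]
  refine iInf_congr fun _ => ?_
  rw [← MeasureTheory.lintegral_const_mul' _ _ ENNReal.ofReal_ne_top]
  exact MeasureTheory.lintegral_congr fun s => h1 _ _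

theorem ball_scale {r : ℝ} (hr : 0 < r) (p : X) (ρ : ℝ) :
    (g.scale (c := (r ^ 2)⁻¹) (by positivity)).ball p ρ = g.ball p (r * ρ) := by
  ext x
  have h1 : √((r ^ 2)⁻¹) = r⁻¹ := by rw [Real.sqrt_inv, Real.sqrt_sq hr.le]
  have h2 : ENNReal.ofReal r⁻¹ = (ENNReal.ofReal r)⁻¹ := ENNReal.ofReal_inv_of_pos hr
  change (g.scale _).edist p x < ENNReal.ofReal ρ ↔ g.edist p x < ENNReal.ofReal (r * ρ)
  rw [edist_scale, h1, h2, ENNReal.ofReal_mul hr.le, ← ENNReal.div_eq_inv_mul,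
    ENNReal.div_lt_iff (by simp [hr]) (by simp), mul_comm]

theorem normRm_scale {r : ℝ} (hr : 0 < r) (x : X) :
    (g.scale (c := (r ^ 2)⁻¹) (by positivity)).normRm x = r ^ 2 * g.normRm x := by
  rw [normRm, normRm, coord_scale, curvatureNormSq_smul _ hr.ne', Real.sqrt_mul (by positivity),
    Real.sqrt_sq (by positivity)]

theorem normCovRm_scale {r : ℝ} (hr : 0 < r) (x : X) :
    (g.scale (c := (r ^ 2)⁻¹) (by positivity)).normCovRm x = r ^ 3 * g.normCovRm x := by
  rw [normCovRm, normCovRm, coord_scale, covCurvatureNormSq_smul _ hr.ne',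
    Real.sqrt_mul (by positivity), Real.sqrt_sq (by positivity)]

theorem IsKahler.scale {g : HermitianMetric n X} (hg : g.IsKahler) : (g.scale hc).IsKahler := by
  intro a z hz i j k
  simp only [coord_scale, Matrix.smul_apply, smul_eq_mul, dz_const_mul, hg a z hz i j k]

end HermitianMetric

/-- Parabolic rescaling of a Kähler-Ricci flow. -/
theorem IsKahlerRicciFlow.scale {g : ℝ → HermitianMetric n X} {T : ℝ} (hg : IsKahlerRicciFlow g T)
    {c : ℝ} (hc : 0 < c) :
    IsKahlerRicciFlow (fun s => (g (c⁻¹ * s)).scale hc) (c * T) := by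
  have hmem : ∀ s ∈ Icc 0 (c * T), c⁻¹ * s ∈ Icc 0 T := fun s hs =>
    ⟨mul_nonneg (by positivity) hs.1, by rw [inv_mul_le_iff₀ hc]; exact hs.2⟩
  have hc' : (c : ℂ) ≠ 0 := by exact_mod_cast hc.ne'
  refine ⟨fun a i j => ?_, fun t ht => (hg.kahler _ (hmem t ht)).scale hc, fun t ht a z hz i j => ?_⟩
  · have h1 := (hg.smooth a i j).comp (f := fun q : ℝ × CSpace n => (c⁻¹ * q.1, q.2))
      (s := Icc 0 (c * T) ×ˢ (chartAt (CSpace n) a).target) (by fun_prop)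
      fun q hq => ⟨hmem _ hq.1, hq.2⟩
    exact contDiffOn_const.mul h1
  · have h1 := (hg.flow _ (hmem t ht) a z hz i j).scomp t (h := fun s => c⁻¹ * s)
      ((hasDerivWithinAt_id t _).const_mul c⁻¹) hmem
    have h2 := h1.const_mul (c : ℂ)
    refine h2.congr_deriv ?_
    rw [HermitianMetric.coord_scale, ricci_smul _ hc', Complex.real_smul]
    push_cast
    field_simp

end Scaling

/-! ### The curvature bound -/

section Main

variable {n : ℕ} {X : Type*} [TopologicalSpace X] [ChartedSpace (CSpace n) X]
  [IsManifold 𝓘(ℂ, CSpace n) ω X]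

theorem HermitianMetric.ball_subset_ball (g : HermitianMetric n X) {p o : X} {a b c : ℝ}
    (ho : o ∈ g.ball p a) (ha : 0 ≤ a) (hb : 0 ≤ b) (h : a + b ≤ c) : g.ball o b ⊆ g.ball p c := by
  intro y hy
  refine (g.edist_triangle p o y).trans_lt ((ENNReal.add_lt_add ho hy).trans_le ?_)
  rw [← ENNReal.ofReal_add ha hb]
  exact ENNReal.ofReal_le_ofReal h

end Main

/-- The curvature bound on a ball of radius one. -/
theorem exists_normRm_bound (n : ℕ) {C : ℝ} (hC : 1 ≤ C) :
    ∃ M : ℝ, ∀ (X : Type*) [TopologicalSpace X] [T2Space X]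
      [ChartedSpace (CSpace n) X] [IsManifold 𝓘(ℂ, CSpace n) ω X] (g : ℝ → HermitianMetric n X)
      (p : X) (T : ℝ), ControlledFlow g T ((g 0).ball p 1) C →
      IsCompact (closure ((g 0).ball p 1)) →
      ∀ x ∈ (g 0).ball p (1 / 4), ∀ t ∈ Icc 0 T, (g t).normRm x ≤ M := by
  have hC0 := zero_le_one.trans hC
  obtain ⟨K, c, D, hK, hc, hD, H⟩ := exists_connTest_heat n hC
  -- The connection is bounded at points of `B(p, 1/2)`, by the maximum principle on balls of radius
  -- `1/2` around them, which lie in `B(p, 1)`. At time zero the test function vanishes because both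
  -- connections coincide.
  obtain ⟨S, hS, HS⟩ := exists_invariant_bound n (R := 1 / 2) hC0 (by norm_num) hc D 0
  obtain ⟨K', c', D', hK', hc', hD', H'⟩ := exists_curvTest_heat n hC hS
  -- The curvature is bounded at points of `B(p, 1/4)`, using balls of radius `1/4` around them;
  -- these lie in `B(p, 1/2)`, where `S` is available. At time zero the test function is `K' |Rm₀|²
  -- ≤ C² K'`.
  obtain ⟨M, hM, HM⟩ := exists_invariant_bound n (R := 1 / 4) hC0 (by norm_num) hc' D' (C ^ 2 * K')
  refine ⟨√M, fun X _ _ _ _ g p T h hcpt x hx t ht => ?_⟩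
  have hconn : ∀ o ∈ (g 0).ball p (1 / 2), ∀ s ∈ Ioo 0 T,
      (connDiffSqAt ((g s).coord o) ((g 0).coord o) (chartAt (CSpace n) o o)).re ≤ S :=
      fun o ho s hs => by
    have hsub := (g 0).ball_subset_ball (b := 1 / 2) (c := 1) ho (by norm_num) (by norm_num)
      (by norm_num)
    have h0 := h.mono hsub
    have hmem : o ∈ (g 0).ball p 1 := lt_of_lt_of_le ho (ENNReal.ofReal_le_ofReal (by norm_num))
    refine (H _ _ s _ (h.comparableFlow hs hmem)).1.trans ?_
    refine HS X g o T _ (isMetricScalar_connTestAt K) h0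
      (hcpt.of_isClosed_subset isClosed_closure (closure_mono hsub)) (fun y _ => ?_)
      (fun s hs y hy => (H _ _ s _ (h0.comparableFlow hs hy)).2) s hs
    rw [invariantAt, connTestAt, connDiffSqAt_self]
    simp
  have hcurv : ∀ s ∈ Ioo 0 T,
      (invariantAt (fun G _ => rmSqAt G) (g s) (g 0) x).re ≤ M := fun s hs => by
    have hsub := (g 0).ball_subset_ball (b := 1 / 4) (c := 1 / 2) hx (by norm_num) (by norm_num)
      (by norm_num)
    have hsub' : (g 0).ball p (1 / 2) ⊆ (g 0).ball p 1 := fun y hy =>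
      lt_of_lt_of_le hy (ENNReal.ofReal_le_ofReal (by norm_num))
    have h0 := h.mono (hsub.trans hsub')
    have hx2 : x ∈ (g 0).ball p (1 / 2) :=
      lt_of_lt_of_le hx (ENNReal.ofReal_le_ofReal (by norm_num))
    refine (H' _ _ s _ (h.comparableFlow hs (hsub' hx2)) (hconn x hx2 s hs)).1.trans ?_
    refine HM X g x T _ (isMetricScalar_curvTestAt K') h0
      (hcpt.of_isClosed_subset isClosed_closure (closure_mono (hsub.trans hsub'))) (fun y hy => ?_)
      (fun s hs y hy => (H' _ _ s _ (h0.comparableFlow hs hy) (hconn y (hsub hy) s hs)).2) s hs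
    rw [invariantAt, curvTestAt, connDiffSqAt_self, add_zero, mul_comm, Complex.re_ofReal_mul,
      mul_comm]
    exact mul_le_mul_of_nonneg_right (h0.rmSq_le hy) (by linarith)
  rw [HermitianMetric.normRm, curvatureNormSq_eq]
  refine Real.sqrt_le_sqrt ?_
  have hcont : ContinuousOn (fun s => (invariantAt (fun G _ => rmSqAt G) (g s) (g 0) x).re)
      (Icc 0 T) :=
    (h.flow.continuousOn_invariant h.pos isMetricScalar_rmSqAt univ).comp
      (f := fun s : ℝ => (s, x)) (by fun_prop) fun s hs => ⟨hs, mem_univ x⟩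
  -- The maximum principle covers the open time interval; the end points follow by continuity.
  rw [← closure_Ioo h.pos.ne] at hcont ht
  exact le_on_closure hcurv hcont continuousOn_const ht
end

theorem propositionA1 (n : ℕ) (C₁ : ℝ) (hC₁ : 0 < C₁) :
    ∃ C₂ : ℝ, ∀ (X : Type*) [TopologicalSpace X] [T2Space X] [ChartedSpace (CSpace n) X]
      [IsManifold 𝓘(ℂ, CSpace n) ω X] (T : ℝ) (_hT : 0 < T) (g : ℝ → HermitianMetric n X)
      (_hg : IsKahlerRicciFlow g T) (p : X) (r : ℝ) (_hr : 0 < r)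
      (_hcpt : IsCompact (closure ((g 0).ball p r)))
      (_hRm : ∀ x ∈ (g 0).ball p r, (g 0).normRm x ≤ C₁ * (r ^ 2)⁻¹)
      (_hCovRm : ∀ x ∈ (g 0).ball p r, (g 0).normCovRm x ≤ C₁ * (r ^ 3)⁻¹)
      (_hbiLip : ∀ t ∈ Set.Icc 0 T, ∀ x ∈ (g 0).ball p r,
        ∀ v : TangentSpace 𝓘(ℂ, CSpace n) x,
          C₁⁻¹ * ((g 0).form x v v).re ≤ ((g t).form x v v).re ∧
          ((g t).form x v v).re ≤ C₁ * ((g 0).form x v v).re),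
      ∀ x ∈ (g 0).ball p (r / 4), ∀ t ∈ Set.Icc 0 T, (g t).normRm x ≤ C₂ * (r ^ 2)⁻¹ := by
  -- The estimates assume a constant that is at least one, and all hypotheses persist when the
  -- constant is enlarged.
  obtain ⟨M, hM⟩ := exists_normRm_bound n (le_max_right C₁ 1)
  refine ⟨M, fun X _ _ _ _ T hT g hg p r hr hcpt hRm hCovRm hbiLip x hx t ht => ?_⟩
  have hc : 0 < (r ^ 2)⁻¹ := by positivity
  -- Parabolic rescaling by `r⁻²` in the metric and in time turns the ball of radius `r` into a unit
  -- ball.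
  set g' : ℝ → HermitianMetric n X := fun s => (g ((r ^ 2)⁻¹⁻¹ * s)).scale hc with hg'
  have h0 : g' 0 = (g 0).scale hc := by simp only [hg', mul_zero]
  have hball : ∀ ρ, (g' 0).ball p ρ = (g 0).ball p (r * ρ) := fun ρ => by
    rw [h0]; exact (g 0).ball_scale hr p ρ
  have hball1 : (g' 0).ball p 1 = (g 0).ball p r := by rw [hball, mul_one]
  have hmem : ∀ s ∈ Icc 0 ((r ^ 2)⁻¹ * T), (r ^ 2)⁻¹⁻¹ * s ∈ Icc 0 T := fun s hs =>
    ⟨mul_nonneg (by positivity) hs.1, by rw [inv_mul_le_iff₀ hc]; exact hs.2⟩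
  have hnonneg : ∀ (g : HermitianMetric n X) (x : X) (v : CSpace n), 0 ≤ (g.inner x v v).re :=
      fun g x v => by
    rcases eq_or_ne v 0 with rfl | hv
    · have := g.inner_smul_left x 0 0 0
      rw [zero_smul, zero_mul] at this
      rw [this, Complex.zero_re]
    · exact (g.pos x v hv).le
  have hflow : ControlledFlow g' ((r ^ 2)⁻¹ * T) ((g' 0).ball p 1) (max C₁ 1) := by
    rw [hball1]
    refine ⟨hg.scale hc, by positivity, le_max_right _ _, fun y hy => ?_, fun y hy => ?_,
      fun s hs y hy v => ?_, fun s hs y hy v => ?_⟩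
    · have h1 := hRm y hy
      rw [← div_eq_mul_inv, le_div_iff₀' (by positivity)] at h1
      rw [h0, (g 0).normRm_scale hr]
      exact h1.trans (le_max_left _ _)
    · have h1 := hCovRm y hy
      rw [← div_eq_mul_inv, le_div_iff₀' (by positivity)] at h1
      rw [h0, (g 0).normCovRm_scale hr]
      exact h1.trans (le_max_left _ _)
    · have h1 : C₁⁻¹ * ((g 0).inner y v v).re ≤ ((g ((r ^ 2)⁻¹⁻¹ * s)).inner y v v).re :=
        (hbiLip _ (hmem s hs) y hy v).1
      rw [inv_mul_le_iff₀ hC₁] at h1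
      have h2 := h1.trans (mul_le_mul_of_nonneg_right (le_max_left C₁ 1) (hnonneg _ y v))
      rw [h0, HermitianMetric.inner_scale, HermitianMetric.inner_scale, Complex.re_ofReal_mul,
        Complex.re_ofReal_mul, mul_left_comm]
      exact mul_le_mul_of_nonneg_left h2 hc.le
    · have h1 : ((g ((r ^ 2)⁻¹⁻¹ * s)).inner y v v).re ≤ C₁ * ((g 0).inner y v v).re :=
        (hbiLip _ (hmem s hs) y hy v).2
      have h2 := h1.trans (mul_le_mul_of_nonneg_right (le_max_left C₁ 1) (hnonneg _ y v))
      rw [h0, HermitianMetric.inner_scale, HermitianMetric.inner_scale, Complex.re_ofReal_mul,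
        Complex.re_ofReal_mul, mul_left_comm]
      exact mul_le_mul_of_nonneg_left h2 hc.le
  have hx' : x ∈ (g' 0).ball p (1 / 4) := by rw [hball, mul_one_div]; exact hx
  have h1 := hM X g' p ((r ^ 2)⁻¹ * T) hflow (by rwa [hball1]) x hx' ((r ^ 2)⁻¹ * t)
    ⟨mul_nonneg hc.le ht.1, mul_le_mul_of_nonneg_left ht.2 hc.le⟩
  have h2 : g' ((r ^ 2)⁻¹ * t) = (g t).scale hc := by
    simp only [hg', inv_mul_cancel_left₀ hc.ne']
  rw [h2, (g t).normRm_scale hr] at h1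
  rwa [← div_eq_mul_inv, le_div_iff₀' (by positivity)]
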